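/- All factors are II$_1$ factors with separable predual, acting on a separable Hilbert space. **Bimodules and $\tilde\chi(A)$.** For a II$_1$ factor $A$ with trace $\operatorname{tr}$, let $\mathsf{Bim_{fgp}}(A)$ be the monoidal dagger category of $A$-$A$ bimodules $X$ with a right $A$-valued inner product $\langle\cdot|\cdot\rangle$ (linear in the second variable), a normal left action by adjointable operators and a finite basis ($x=\sum_i b_i\langle b_i|x\rangle$ for all $x\in X$), with adjointable bimodule maps as morphisms and the relative tensor product $\boxtimes=\boxtimes_A$. Put $\|x\|_2=\operatorname{tr}(\langle x|x\rangle)^{1/2}$. A bimodule $X$ is *centrally trivial* if $\|a_nx-xa_n\|_2\to0$ for every $x\in X$ and every bounded sequence $(a_n)$ in $A$ with $\|a_nb-ba_n\|_2\to 0$ for all $b\in A$. It is *approximately inner* if it has an approximately inner basis: finite families $\{b^{(n)}_i\}_{i}\subset X$ of bounded length with $\sup_{i,n}\|\langle b_i^{(n)}|b_i^{(n)}\rangle\|<\infty$, $\|x-\sum_i b^{(n)}_i\langle b^{(n)}_i|x\rangle\|_2\to0$ for all $x\in X$ and $\|ab_i^{(n)}-b_i^{(n)}a\|_2\to0$ for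 all $a\in A$. Let $\tilde\chi(A)\subseteq\mathsf{Bim_{fgp}}(A)$ be the full subcategory of the dualizable bimodules that are approximately inner and centrally trivial together with their dual. It is a unitary braided tensor category with the braiding $u_{X,Y}=\lim_n\sum_{i,j}|c_j\boxtimes b_i^{(n)}\rangle\langle b_i^{(n)}\boxtimes c_j|:X\boxtimes Y\to Y\boxtimes X$ (limit in $\|\cdot\|_2$ on each vector), for any approximately inner basis $\{b_i^{(n)}\}$ of $X$ and any finite basis $\{c_j\}$ of $Y$. **Q-systems and local modules.** A *Q-system* in $\mathsf{Bim_{fgp}}(A)$ is a unital associative algebra $(Q,m,i)$ that satisfies the Frobenius relations and $mm^\dagger=\mathrm{id}$. A Q-system $Q\in\tilde\chi(A)$ is *commutative* if $m\,u_{Q,Q}=m=m\,u_{Q,Q}^\dagger$. A *local* $Q$-module is an object $X\in\tilde\chi(A)$ with a unital associative right action $\rho:X\boxtimes Q\to X$ that satisfies the Frobenius relation $\rho^\dagger\rho=(\rho\boxtimes 1)(1\boxtimes m^\dagger)$, $\rho\rho^\dagger=\mathrm{id}$, and $\rho\,u_{Q,X}=\rho\,u_{X,Q}^\dagger$; this common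 map is its left action $\lambda:Q\boxtimes X\to X$. For $Q$ commutative, the category $\tilde\chi(A)_Q^{\rm loc}$ of local $Q$-modules and module maps is a unitary braided tensor category under $\otimes_Q$: the quotient map $\pi:X\boxtimes Y\to X\otimes_QY$ is a coisometry with $\pi^\dagger\pi=(\rho_X\boxtimes1)(1\boxtimes\lambda_Y^\dagger)$, the unit object is $Q$, and the right action, the coherence isomorphisms and the braiding are those induced along $\pi$ by those of $\tilde\chi(A)$. **Theorem.** Let $N\subseteq M$ be a finite index subfactor, with trace preserving conditional expectation $E:M\to N$, and let $Q=L^2M$ be its Q-system: the $N$-$N$ bimodule $M$ with $\langle x|y\rangle=[M:N]\,E(x^*y)$, with $m$ the multiplication and $i$ the inclusion $N\to M$. Assume that $Q\in\tilde\chi(N)$ and that $Q$ is commutative. Then realization $X\mapsto|X|$ is a braided unitary equivalence $$\tilde\chi(N)_Q^{\rm loc}\;\cong\;\tilde\chi(M).$$ Here $|X|$ is the space $X$ with right and left action of $M$ given by $x\cdot q=\rho(x\boxtimes q)$ and $q\cdot x=\lambda(q\boxtimes x)$ and with $M$-valued inner product $\langle x_1|x_2\rangle_M=(x_1^\dagger\boxtimes1)\rho^\dagger(x_2)$,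 where $x_1^\dagger\boxtimes 1:X\boxtimes Q\to Q$ sends $x\boxtimes q$ to $\langle x_1|x\rangle q$; the tensorator is $|x|\boxtimes_M|y|\mapsto|\pi(x\boxtimes y)|$, and $1_M\mapsto|1_M|\in|Q|$ on the unit. -/

import Mathlib

open CategoryTheory MonoidalCategory Filter Topology
open scoped ComplexOrder TensorProduct

universe u

namespace LocalExt

set_option linter.unusedSimpArgs false

/-! ## II₁ factors and subfactors -/

section Factors

variable (H : Type u) [NormedAddCommGroup H] [InnerProductSpace ℂ H] [CompleteSpace H]

/-- A II₁ factor acting on `H`: an infinite-dimensional von Neumann algebra with trivial centre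
and a faithful normal tracial state (which is then unique, so it is no extra structure). -/
structure IIOneFactor where
  alg : VonNeumannAlgebra H
  center_trivial : ∀ z ∈ alg, (∀ y ∈ alg, z * y = y * z) → ∃ c : ℂ, z = c • (1 : H →L[ℂ] H)
  infinite_dim : ¬ FiniteDimensional ℂ alg.toStarSubalgebra
  tr : alg.toStarSubalgebra →ₗ[ℂ] ℂ
  tr_one : tr 1 = 1
  tr_mul_comm : ∀ x y, tr (x * y) = tr (y * x)
  tr_nonneg : ∀ x, 0 ≤ tr (star x * x)
  tr_faithful : ∀ x, tr (star x * x) = 0 → x = 0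
  /-- Normality (ultraweak continuity) of the trace. -/
  tr_normal : ∃ ξ η : ℕ → H, Summable (fun k => ‖ξ k‖ ^ 2) ∧ Summable (fun k => ‖η k‖ ^ 2) ∧
    ∀ x : alg.toStarSubalgebra,
      HasSum (fun k => inner ℂ (ξ k) ((x : H →L[ℂ] H) (η k))) (tr x)

variable {H}

/-- The elements of a II₁ factor. -/
abbrev IIOneFactor.El (M : IIOneFactor H) : Type u := ↥M.alg.toStarSubalgebra

noncomputable instance (M : IIOneFactor H) : Ring M.El := inferInstance

noncomputable instance (M : IIOneFactor H) : AddCommGroup M.El := inferInstance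

noncomputable instance (M : IIOneFactor H) : AddCommMonoid M.El := inferInstance

noncomputable instance (M : IIOneFactor H) : Module ℂ M.El := inferInstance

noncomputable instance (M : IIOneFactor H) : Algebra ℂ M.El := inferInstance

/-- The `2`-norm `‖x‖₂ = tr(x* x)^{1/2}`. -/
noncomputable def IIOneFactor.norm2 (M : IIOneFactor H) (x : M.El) : ℝ :=
  Real.sqrt (M.tr (star x * x)).re

/-- Convergence to `0` of a sequence in the weak operator topology. -/
def WeakNull {M : IIOneFactor H} (a : ℕ → M.El) : Prop :=
  ∀ ξ η : H, Tendsto (fun n => inner ℂ ξ ((a n : H →L[ℂ] H) η)) atTop (𝓝 0)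

/-- A subfactor `N ⊆ M`: a unital von Neumann subalgebra of `M` that is itself a II₁ factor. -/
structure Subfactor (M : IIOneFactor H) where
  alg : VonNeumannAlgebra H
  le : alg ≤ M.alg
  center_trivial : ∀ z ∈ alg, (∀ y ∈ alg, z * y = y * z) → ∃ c : ℂ, z = c • (1 : H →L[ℂ] H)
  infinite_dim : ¬ FiniteDimensional ℂ alg.toStarSubalgebra

namespace Subfactor

variable {M : IIOneFactor H} (S : Subfactor M)

lemma le' : S.alg.toStarSubalgebra ≤ M.alg.toStarSubalgebra := fun _ hx => S.le hx

/-- The subfactor as a II₁ factor; its trace is the restriction of the trace of `M`. -/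
noncomputable def toFactor : IIOneFactor H where
  alg := S.alg
  center_trivial := S.center_trivial
  infinite_dim := S.infinite_dim
  tr := M.tr ∘ₗ (StarSubalgebra.inclusion S.le').toAlgHom.toLinearMap
  tr_one := by
    change M.tr (StarSubalgebra.inclusion S.le' 1) = 1
    rw [map_one, M.tr_one]
  tr_mul_comm x y := by
    change M.tr (StarSubalgebra.inclusion S.le' _) = M.tr (StarSubalgebra.inclusion S.le' _)
    rw [map_mul (StarSubalgebra.inclusion S.le'), map_mul (StarSubalgebra.inclusion S.le'),
      M.tr_mul_comm]
  tr_nonneg x := by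
    change 0 ≤ M.tr (StarSubalgebra.inclusion S.le' _)
    rw [map_mul (StarSubalgebra.inclusion S.le'), map_star]; exact M.tr_nonneg _
  tr_faithful x hx := by
    change M.tr (StarSubalgebra.inclusion S.le' _) = 0 at hx
    rw [map_mul (StarSubalgebra.inclusion S.le'), map_star] at hx
    exact StarSubalgebra.inclusion_injective S.le' ((M.tr_faithful _ hx).trans (map_zero _).symm)
  tr_normal := by
    obtain ⟨ξ, η, h1, h2, h3⟩ := M.tr_normal
    exact ⟨ξ, η, h1, h2, fun x => h3 (StarSubalgebra.inclusion S.le' x)⟩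

/-- The inclusion `N → M`. -/
noncomputable def incl : S.toFactor.El →⋆ₐ[ℂ] M.El := StarSubalgebra.inclusion S.le'

end Subfactor

end Factors

/-! ## The W*-tensor category of finitely generated projective bimodules -/

section Bimodules

variable {H : Type u} [NormedAddCommGroup H] [InnerProductSpace ℂ H] [CompleteSpace H]

/-- A finitely generated projective right W*-correspondence over a II₁ factor `A` (an object of
`Bim_fgp(A)`): an `A`-`A` bimodule with a right `A`-valued inner product, for which the left
action is by adjointable operators and normal, and which has a finite basis `{b_i}`, that is
`x = ∑ b_i ⟨b_i|x⟩` for all `x`.  Given the basis, `x ↦ (⟨b_i|x⟩)_i` is a unitary onto `p Aⁿ` for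
the projection `p = (⟨b_i|b_j⟩)_{ij}`, so that completeness, existence of the predual and weak*
continuity of the inner product are automatic. -/
structure Bim (A : IIOneFactor H) where
  carrier : Type u
  [grp : AddCommGroup carrier]
  [mod : Module ℂ carrier]
  /-- left action -/
  l : A.El →ₐ[ℂ] Module.End ℂ carrier
  /-- right action -/
  r : A.Elᵐᵒᵖ →ₐ[ℂ] Module.End ℂ carrier
  l_r : ∀ a b x, l a (r b x) = r b (l a x)
  /-- the `A`-valued inner product `⟨x|y⟩`, linear in `y` -/
  ip : carrier → carrier → A.El
  ip_add : ∀ x y z, ip x (y + z) = ip x y + ip x z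
  ip_r : ∀ x y a, ip x (r (MulOpposite.op a) y) = ip x y * a
  star_ip : ∀ x y, star (ip x y) = ip y x
  ip_pos : ∀ x, ((ip x x : A.El) : H →L[ℂ] H).IsPositive
  ip_def : ∀ x, ip x x = 0 → x = 0
  ip_l : ∀ a x y, ip (l a x) y = ip x (l (star a) y)
  exists_basis : ∃ (n : ℕ) (b : Fin n → carrier),
    ∀ x, ∑ i, r (MulOpposite.op (ip (b i) x)) (b i) = x
  /-- The left action is normal: as bounded sets are weakly metrizable on a separable Hilbert
  space, and weakly convergent sequences are bounded, it is enough to consider sequences. -/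
  l_normal : ∀ (x y : carrier) (a : ℕ → A.El), WeakNull a → WeakNull (fun n => ip x (l (a n) y))

attribute [instance] Bim.grp Bim.mod

namespace Bim

variable {A : IIOneFactor H}

instance : CoeSort (Bim A) (Type u) := ⟨Bim.carrier⟩

/-- The right action `x ◁ a`. -/
noncomputable def ra (X : Bim A) (x : X) (a : A.El) : X := X.r (MulOpposite.op a) x

section basic

variable (X : Bim A)

lemma ip_ra (x y : X) (a : A.El) : X.ip x (X.ra y a) = X.ip x y * a := X.ip_r x y a

lemma ip_add_left (x y z : X) : X.ip (x + y) z = X.ip x z + X.ip y z := by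
  rw [← X.star_ip, X.ip_add, star_add, X.star_ip, X.star_ip]

lemma ip_ra_left (x y : X) (a : A.El) : X.ip (X.ra x a) y = star a * X.ip x y := by
  rw [← X.star_ip, X.ip_ra, star_mul, X.star_ip]

lemma ra_smul_one (x : X) (c : ℂ) : X.ra x (c • (1 : A.El)) = c • x := by
  simp [ra, MulOpposite.op_smul]

lemma ip_smul (x y : X) (c : ℂ) : X.ip x (c • y) = c • X.ip x y := by
  rw [← X.ra_smul_one, X.ip_ra]; simp

lemma ip_smul_left (x y : X) (c : ℂ) : X.ip (c • x) y = (starRingEnd ℂ c) • X.ip x y := by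
  rw [← X.star_ip, X.ip_smul, star_smul, X.star_ip]; rfl

lemma ip_zero (x : X) : X.ip x 0 = 0 := by
  have := X.ip_smul x 0 0
  simpa using this

lemma ip_neg (x y : X) : X.ip x (-y) = - X.ip x y := by
  have := X.ip_smul x y (-1)
  simpa using this

lemma ip_sub (x y z : X) : X.ip x (y - z) = X.ip x y - X.ip x z := by
  rw [sub_eq_add_neg, X.ip_add, X.ip_neg, sub_eq_add_neg]

/-- `⟨x| · ⟩` as a linear map. -/
noncomputable def ipL (x : X) : X →ₗ[ℂ] A.El where
  toFun := X.ip x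
  map_add' := X.ip_add x
  map_smul' c y := X.ip_smul x y c

@[simp] lemma ipL_apply (x y : X) : X.ipL x y = X.ip x y := rfl

lemma ip_sum {ι : Type*} (s : Finset ι) (x : X) (f : ι → X) :
    X.ip x (∑ i ∈ s, f i) = ∑ i ∈ s, X.ip x (f i) := map_sum (X.ipL x) f s

lemma ip_sum_left {ι : Type*} (s : Finset ι) (f : ι → X) (x : X) :
    X.ip (∑ i ∈ s, f i) x = ∑ i ∈ s, X.ip (f i) x := by
  rw [← X.star_ip, X.ip_sum, star_sum]; simp only [X.star_ip]

/-- Vectors are separated by the inner product. -/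
lemma ext_ip {x y : X} (h : ∀ z, X.ip z x = X.ip z y) : x = y := by
  rw [← sub_eq_zero]
  apply X.ip_def
  rw [X.ip_sub, h, sub_self]

lemma ext_ip_left {x y : X} (h : ∀ z, X.ip x z = X.ip y z) : x = y :=
  X.ext_ip fun z => by rw [← X.star_ip, h, X.star_ip]

lemma ra_add (x y : X) (a : A.El) : X.ra (x + y) a = X.ra x a + X.ra y a := map_add _ _ _

lemma ra_mul (x : X) (a b : A.El) : X.ra x (a * b) = X.ra (X.ra x a) b := by
  simp [ra]

lemma l_mul (a b : A.El) (x : X) : X.l (a * b) x = X.l a (X.l b x) := by simp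

lemma l_one (x : X) : X.l 1 x = x := by simp

lemma l_ra (a b : A.El) (x : X) : X.l a (X.ra x b) = X.ra (X.l a x) b := X.l_r _ _ _

lemma ra_one (x : X) : X.ra x 1 = x := by simp [ra]

/-- A finite basis of the right module `X`. -/
def IsBasis {n : ℕ} (b : Fin n → X) : Prop := ∀ x, ∑ i, X.ra (b i) (X.ip (b i) x) = x

end basic

/-- Morphisms of `Bim_fgp(A)`: the bimodule maps with an adjoint.  (The adjoint is unique.) -/
structure Hom (X Y : Bim A) where
  toFun : X →ₗ[ℂ] Y
  adj : Y →ₗ[ℂ] X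
  map_l : ∀ a x, toFun (X.l a x) = Y.l a (toFun x)
  map_ra : ∀ x a, toFun (X.ra x a) = Y.ra (toFun x) a
  adj_spec : ∀ x y, Y.ip (toFun x) y = X.ip x (adj y)

lemma Hom.ext' {X Y : Bim A} {f g : Hom X Y} (h : ∀ x, f.toFun x = g.toFun x) : f = g := by
  have h1 : f.toFun = g.toFun := LinearMap.ext h
  have h2 : f.adj = g.adj := LinearMap.ext fun y => X.ext_ip fun z => by
    rw [← f.adj_spec, ← g.adj_spec, h1]
  cases f; cases g; cases h1; cases h2; rfl

lemma Hom.adj_spec' {X Y : Bim A} (f : Hom X Y) (x : X) (y : Y) :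
    X.ip (f.adj y) x = Y.ip y (f.toFun x) := by
  rw [← X.star_ip, ← f.adj_spec, Y.star_ip]

instance : Category (Bim A) where
  Hom := Hom
  id X := ⟨LinearMap.id, LinearMap.id, fun _ _ => rfl, fun _ _ => rfl, fun _ _ => rfl⟩
  comp f g := ⟨g.toFun ∘ₗ f.toFun, f.adj ∘ₗ g.adj,
    fun a x => by simp [f.map_l, g.map_l], fun x a => by simp [f.map_ra, g.map_ra],
    fun x y => by simp [g.adj_spec, f.adj_spec]⟩

/-- The underlying linear map of a morphism. -/
def map {X Y : Bim A} (f : X ⟶ Y) : X →ₗ[ℂ] Y := Hom.toFun f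

lemma hom_ext {X Y : Bim A} {f g : X ⟶ Y} (h : ∀ x, map f x = map g x) : f = g := Hom.ext' h

@[simp] lemma map_id (X : Bim A) (x : X) : map (𝟙 X) x = x := rfl

@[simp] lemma map_comp {X Y Z : Bim A} (f : X ⟶ Y) (g : Y ⟶ Z) (x : X) :
    map (f ≫ g) x = map g (map f x) := rfl

lemma map_l {X Y : Bim A} (f : X ⟶ Y) (a : A.El) (x : X) : map f (X.l a x) = Y.l a (map f x) :=
  Hom.map_l f a x

lemma map_ra {X Y : Bim A} (f : X ⟶ Y) (x : X) (a : A.El) : map f (X.ra x a) = Y.ra (map f x) a :=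
  Hom.map_ra f x a

/-- The adjoint of a morphism. -/
def dagger {X Y : Bim A} (f : X ⟶ Y) : Y ⟶ X where
  toFun := Hom.adj f
  adj := Hom.toFun f
  map_l a y := X.ext_ip_left fun z => by
    rw [Hom.adj_spec', Y.ip_l, X.ip_l, Hom.adj_spec', Hom.map_l]
  map_ra y a := X.ext_ip_left fun z => by
    rw [Hom.adj_spec', Y.ip_ra_left, X.ip_ra_left, Hom.adj_spec']
  adj_spec x y := Hom.adj_spec' f y x

lemma ip_map {X Y : Bim A} (f : X ⟶ Y) (x : X) (y : Y) :
    Y.ip (map f x) y = X.ip x (map (dagger f) y) := Hom.adj_spec f x y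

noncomputable instance {X Y : Bim A} : Zero (X ⟶ Y) :=
  ⟨⟨0, 0, fun _ _ => by simp, fun _ _ => by simp [ra], fun x y => by
    rw [LinearMap.zero_apply, LinearMap.zero_apply, X.ip_zero, ← Y.star_ip, Y.ip_zero, star_zero]⟩⟩

/-- A bijective inner product preserving bimodule map is a (unitary) isomorphism. -/
def unitaryIso {X Y : Bim A} (f : X →ₗ[ℂ] Y) (g : Y →ₗ[ℂ] X)
    (fg : ∀ y, f (g y) = y) (gf : ∀ x, g (f x) = x)
    (hl : ∀ a x, f (X.l a x) = Y.l a (f x)) (hr : ∀ x a, f (X.ra x a) = Y.ra (f x) a)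
    (hip : ∀ x x', Y.ip (f x) (f x') = X.ip x x') : X ≅ Y where
  hom := ⟨f, g, hl, hr, fun x y => by rw [← hip x (g y), fg]⟩
  inv := dagger ⟨f, g, hl, hr, fun x y => by rw [← hip x (g y), fg]⟩
  hom_inv_id := hom_ext gf
  inv_hom_id := hom_ext fg


/-! ### The relative tensor product -/

section Tensor

variable (X Y Z W : Bim A)

/-- The relations `x a ⊗ y = x ⊗ a y`. -/
def relations : Submodule ℂ (X ⊗[ℂ] Y) :=
  Submodule.span ℂ {t | ∃ (x : X) (a : A.El) (y : Y), t = X.ra x a ⊗ₜ y - x ⊗ₜ Y.l a y}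

/-- The underlying space of `X ⊠_A Y`: the algebraic tensor product over `A`, which is already
complete, the bimodules being finitely generated projective. -/
abbrev Ten : Type u := (X ⊗[ℂ] Y) ⧸ relations X Y

variable {X Y Z W}

/-- The simple tensor `x ⊠ y`. -/
def Ten.mk (x : X) (y : Y) : Ten X Y := (relations X Y).mkQ (x ⊗ₜ y)

namespace Ten

lemma add_mk (x x' : X) (y : Y) : mk (x + x') y = mk x y + mk x' y := by
  simp [mk, TensorProduct.add_tmul]

lemma mk_add (x : X) (y y' : Y) : mk x (y + y') = mk x y + mk x y' := by
  simp [mk, TensorProduct.tmul_add]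

lemma smul_mk (c : ℂ) (x : X) (y : Y) : mk (c • x) y = c • mk x y := by
  rw [mk, mk, ← map_smul, TensorProduct.smul_tmul']

lemma mk_smul (c : ℂ) (x : X) (y : Y) : mk x (c • y) = c • mk x y := by
  simp [mk]

lemma ra_mk (x : X) (a : A.El) (y : Y) : mk (X.ra x a) y = mk x (Y.l a y) := by
  rw [← sub_eq_zero, mk, mk, ← map_sub, Submodule.mkQ_apply, Submodule.Quotient.mk_eq_zero]
  exact Submodule.subset_span ⟨x, a, y, rfl⟩

/-- `x ⊠ y` as a bilinear map. -/
def mkL : X →ₗ[ℂ] Y →ₗ[ℂ] Ten X Y := LinearMap.mk₂ ℂ mk add_mk smul_mk mk_add mk_smul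

@[simp] lemma mkL_apply (x : X) (y : Y) : mkL x y = mk x y := rfl

lemma sum_mk {ι : Type*} (s : Finset ι) (f : ι → X) (y : Y) :
    mk (∑ i ∈ s, f i) y = ∑ i ∈ s, mk (f i) y := by
  have h := map_sum (mkL (X := X) (Y := Y)) f s
  simpa only [mkL_apply, LinearMap.sum_apply] using LinearMap.congr_fun h y

lemma mk_sum {ι : Type*} (s : Finset ι) (x : X) (f : ι → Y) :
    mk x (∑ i ∈ s, f i) = ∑ i ∈ s, mk x (f i) := map_sum (mkL x) f s

/-- The universal property of `X ⊠_A Y`. -/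
def lift {V : Type*} [AddCommGroup V] [Module ℂ V] (f : X →ₗ[ℂ] Y →ₗ[ℂ] V)
    (hf : ∀ x a y, f (X.ra x a) y = f x (Y.l a y)) : Ten X Y →ₗ[ℂ] V :=
  (relations X Y).liftQ (TensorProduct.lift f) (by
    rw [relations, Submodule.span_le]
    rintro _ ⟨x, a, y, rfl⟩
    simp [hf])

@[simp] lemma lift_mk {V : Type*} [AddCommGroup V] [Module ℂ V] (f : X →ₗ[ℂ] Y →ₗ[ℂ] V) (hf)
    (x : X) (y : Y) : lift f hf (mk x y) = f x y := by
  simp [lift, mk]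

@[elab_as_elim]
lemma induction {p : Ten X Y → Prop} (z : Ten X Y) (h0 : p 0) (h1 : ∀ x y, p (mk x y))
    (h2 : ∀ z w, p z → p w → p (z + w)) : p z := by
  obtain ⟨t, rfl⟩ := (relations X Y).mkQ_surjective z
  induction t with
  | zero => simpa using h0
  | tmul x y => exact h1 x y
  | add s t hs ht => rw [map_add]; exact h2 _ _ hs ht

lemma ext {V : Type*} [AddCommGroup V] [Module ℂ V] {f g : Ten X Y →ₗ[ℂ] V}
    (h : ∀ x y, f (mk x y) = g (mk x y)) : f = g := by
  refine LinearMap.ext fun z => ?_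
  induction z using induction with
  | h0 => simp
  | h1 x y => exact h x y
  | h2 z w hz hw => simp [hz, hw]

/-- The left creation-annihilation map `z ⊠ y ↦ ⟨x|z⟩ y`, written `x† ⊠ 1`. -/
noncomputable def contract (x : X) : Ten X Y →ₗ[ℂ] Y :=
  lift (Y.l.toLinearMap ∘ₗ X.ipL x) (fun z a y => by simp [X.ip_ra])

@[simp] lemma contract_mk (x z : X) (y : Y) : contract x (mk z y) = Y.l (X.ip x z) y :=
  lift_mk _ _ _ _

/-- Functoriality for linear maps. -/
def lmap (f : X →ₗ[ℂ] Z) (g : Y →ₗ[ℂ] W) (hf : ∀ x a, f (X.ra x a) = Z.ra (f x) a)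
    (hg : ∀ a y, g (Y.l a y) = W.l a (g y)) : Ten X Y →ₗ[ℂ] Ten Z W :=
  lift (LinearMap.compl₁₂ mkL f g) (fun x a y => by simp [hf, hg, ra_mk])

@[simp] lemma lmap_mk (f : X →ₗ[ℂ] Z) (g : Y →ₗ[ℂ] W) (hf) (hg) (x : X) (y : Y) :
    lmap f g hf hg (mk x y) = mk (f x) (g y) := by
  simp [lmap]

/-- Left action on the tensor product. -/
noncomputable def l : A.El →ₐ[ℂ] Module.End ℂ (Ten X Y) :=
  AlgHom.ofLinearMap
    { toFun := fun a => lmap (X.l a) LinearMap.id (fun x b => X.l_ra a b x) (fun _ _ => rfl)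
      map_add' := fun a b => ext fun x y => by simp [add_mk]
      map_smul' := fun c a => ext fun x y => by simp [smul_mk] }
    (ext fun x y => by simp) (fun a b => ext fun x y => by simp)

@[simp] lemma l_mk (a : A.El) (x : X) (y : Y) : l a (mk x y) = mk (X.l a x) y := by
  simp [l]

/-- Right action on the tensor product. -/
noncomputable def r : A.Elᵐᵒᵖ →ₐ[ℂ] Module.End ℂ (Ten X Y) :=
  AlgHom.ofLinearMap
    { toFun := fun a => lmap LinearMap.id (Y.r a) (fun _ _ => rfl) (fun b y => (Y.l_r b a y).symm)
      map_add' := fun a b => ext fun x y => by simp [mk_add]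
      map_smul' := fun c a => ext fun x y => by simp [mk_smul] }
    (ext fun x y => by simp) (fun a b => ext fun x y => by simp)

@[simp] lemma r_mk (a : A.Elᵐᵒᵖ) (x : X) (y : Y) : r a (mk x y) = mk x (Y.r a y) := by
  simp [r]

/-- A basis of the right module `X`. -/
lemma basis_spec (X : Bim A) : X.IsBasis X.exists_basis.choose_spec.choose :=
  X.exists_basis.choose_spec.choose_spec

/-- The inner product of `X ⊠ Y`, written with a basis of `X`.  See `ip_mk` for the defining
formula `⟨x ⊠ y | x' ⊠ y'⟩ = ⟨y | ⟨x|x'⟩ y'⟩`. -/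
noncomputable def ip (z w : Ten X Y) : A.El :=
  ∑ i, Y.ip (contract (X.exists_basis.choose_spec.choose i) z)
    (contract (X.exists_basis.choose_spec.choose i) w)

lemma ip_mk (x x' : X) (y y' : Y) : ip (mk x y) (mk x' y') = Y.ip y (Y.l (X.ip x x') y') := by
  set b := X.exists_basis.choose_spec.choose with hb
  have h : X.ip x x' = ∑ i, X.ip x (b i) * X.ip (b i) x' := by
    conv_lhs => rw [← basis_spec X x']
    rw [X.ip_sum]; simp only [X.ip_ra]; rfl
  simp only [ip, contract_mk, ← hb, h, map_sum, LinearMap.sum_apply, Y.ip_sum]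
  refine Finset.sum_congr rfl fun i _ => ?_
  rw [Y.ip_l, X.star_ip, Y.l_mul]

lemma ip_add (x y z : Ten X Y) : ip x (y + z) = ip x y + ip x z := by
  simp [ip, Y.ip_add, Finset.sum_add_distrib]

lemma star_ip (x y : Ten X Y) : star (ip x y) = ip y x := by
  simp [ip, star_sum, Y.star_ip]

lemma ip_add_left (x y z : Ten X Y) : ip (x + y) z = ip x z + ip y z := by
  rw [← star_ip, ip_add, star_add, star_ip, star_ip]

lemma ip_zero (x : Ten X Y) : ip x 0 = 0 := by simp [ip, Y.ip_zero]

lemma ip_zero_left (x : Ten X Y) : ip 0 x = 0 := by rw [← star_ip, ip_zero, star_zero]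

/-- Expansion in a basis of `X`. -/
lemma expand {n : ℕ} {b : Fin n → X} (hb : X.IsBasis b) (z : Ten X Y) :
    ∑ i, mk (b i) (contract (b i) z) = z := by
  induction z using induction with
  | h0 => simp [← mkL_apply]
  | h1 x y =>
    simp only [contract_mk, ← ra_mk, ← sum_mk]
    rw [hb x]
  | h2 z w hz hw =>
    simp only [map_add, mk_add, Finset.sum_add_distrib, hz, hw]

lemma eq_zero_of_ip (z : Ten X Y) (h : ip z z = 0) : z = 0 := by
  set b := X.exists_basis.choose_spec.choose with hb
  have hp : ∀ i, ((Y.ip (contract (b i) z) (contract (b i) z) : A.El) : H →L[ℂ] H).IsPositive :=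
    fun i => Y.ip_pos _
  have hs : ∑ i, ((Y.ip (contract (b i) z) (contract (b i) z) : A.El) : H →L[ℂ] H) = 0 := by
    have := congrArg (fun a : A.El => (a : H →L[ℂ] H)) h
    simpa [ip, ← hb] using this
  have hz : ∀ i, contract (b i) z = 0 := fun i => by
    apply Y.ip_def
    apply Subtype.ext
    simp only [← ContinuousLinearMap.nonneg_iff_isPositive] at hp
    exact (Finset.sum_eq_zero_iff_of_nonneg (fun i _ => hp i)).1 hs i (Finset.mem_univ i)
  rw [← expand (basis_spec X) z]
  exact Finset.sum_eq_zero fun i _ => by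
    rw [← hb, hz i, ← mkL_apply, map_zero]

end Ten

/-- The relative tensor product `X ⊠_A Y` (composition of correspondences), with
`⟨x ⊠ y | x' ⊠ y'⟩ = ⟨y | ⟨x|x'⟩ y'⟩`. -/
noncomputable def tensor (X Y : Bim A) : Bim A where
  carrier := Ten X Y
  l := Ten.l
  r := Ten.r
  l_r a b z := by
    induction z using Ten.induction with
    | h0 => simp
    | h1 x y => simp
    | h2 z w hz hw => simp only [map_add, hz, hw]
  ip := Ten.ip
  ip_add := Ten.ip_add
  ip_r z w a := by
    induction w using Ten.induction with
    | h0 => simp [Ten.ip_zero]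
    | h2 w w' h h' => simp only [map_add, Ten.ip_add, h, h', add_mul]
    | h1 x' y' =>
      induction z using Ten.induction with
      | h0 => simp [Ten.ip_zero_left]
      | h2 w w' h h' => simp only [Ten.ip_add_left, h, h', add_mul]
      | h1 x y =>
        rw [Ten.r_mk, Ten.ip_mk, Ten.ip_mk, Y.l_r, Y.ip_r]
  star_ip := Ten.star_ip
  ip_pos z := by
    simp only [Ten.ip]
    rw [← ContinuousLinearMap.nonneg_iff_isPositive]
    rw [AddSubmonoidClass.coe_finsetSum]
    exact Finset.sum_nonneg fun i _ =>
      (ContinuousLinearMap.nonneg_iff_isPositive _).2 (Y.ip_pos _)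
  ip_def := Ten.eq_zero_of_ip
  ip_l a z w := by
    induction w using Ten.induction with
    | h0 => simp [Ten.ip_zero]
    | h2 w w' h h' => simp only [map_add, Ten.ip_add, h, h']
    | h1 x' y' =>
      induction z using Ten.induction with
      | h0 => simp [Ten.ip_zero_left]
      | h2 w w' h h' => simp only [map_add, Ten.ip_add_left, h, h']
      | h1 x y => rw [Ten.l_mk, Ten.l_mk, Ten.ip_mk, Ten.ip_mk, X.ip_l]
  exists_basis := by
    obtain ⟨n, b, hb⟩ := X.exists_basis
    obtain ⟨m, c, hc⟩ := Y.exists_basis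
    refine ⟨n * m, fun k => Ten.mk (b (finProdFinEquiv.symm k).1) (c (finProdFinEquiv.symm k).2), ?_⟩
    intro z
    rw [finProdFinEquiv.symm.sum_comp (fun p : Fin n × Fin m =>
      Ten.r (MulOpposite.op (Ten.ip (Ten.mk (b p.1) (c p.2)) z)) (Ten.mk (b p.1) (c p.2))),
      Fintype.sum_prod_type]
    induction z using Ten.induction with
    | h0 => simp [Ten.ip_zero]
    | h2 w w' h h' =>
      simp only [Ten.ip_add, MulOpposite.op_add, map_add, LinearMap.add_apply,
        Finset.sum_add_distrib, h, h']
    | h1 x y =>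
      simp only [Ten.ip_mk, Ten.r_mk, ← Ten.mk_sum, hc]
      simp only [← Ten.ra_mk, ← Ten.sum_mk]
      exact congrArg (fun t => Ten.mk t y) (hb x)
  l_normal z w a ha := by
    induction w using Ten.induction with
    | h0 => intro ξ η; simp [Ten.ip_zero]
    | h2 w w' h h' =>
      intro ξ η
      simpa [Ten.ip_add, inner_add_right] using (h ξ η).add (h' ξ η)
    | h1 x' y' =>
      induction z using Ten.induction with
      | h0 => intro ξ η; simp [Ten.ip_zero_left]
      | h2 w w' h h' =>
        intro ξ η
        simpa [Ten.ip_add_left, inner_add_right] using (h ξ η).add (h' ξ η)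
      | h1 x y =>
        simp only [Ten.l_mk, Ten.ip_mk]
        exact Y.l_normal _ _ _ (X.l_normal _ _ _ ha)

/-- The identity bimodule `A` with `⟨a|b⟩ = a* b`. -/
noncomputable def unit (A : IIOneFactor H) : Bim A where
  carrier := A.El
  l := Algebra.lmul ℂ A.El
  r := AlgHom.ofLinearMap
    { toFun := fun a => LinearMap.mulRight ℂ a.unop
      map_add' := fun a b => by ext1 x; simp [mul_add]
      map_smul' := fun c a => by ext1 x; simp }
    (by ext1 x; simp) (fun a b => by ext1 x; simp [mul_assoc])
  l_r a b x := by simp [mul_assoc]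
  ip x y := star x * y
  ip_add x y z := mul_add _ _ _
  ip_r x y a := by simp [mul_assoc]
  star_ip x y := by simp
  ip_pos x := by
    exact ContinuousLinearMap.isPositive_adjoint_comp_self (x : H →L[ℂ] H)
  ip_def x hx := A.tr_faithful x (by rw [hx, map_zero])
  ip_l a x y := by simp [mul_assoc]
  exists_basis := ⟨1, fun _ => 1, fun x => by simp⟩
  l_normal x y a ha := by
    intro ξ η
    have := ha ((x : H →L[ℂ] H) ξ) ((y : H →L[ℂ] H) η)
    simpa [ContinuousLinearMap.star_eq_adjoint, ContinuousLinearMap.adjoint_inner_right] using this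

/-- The simple tensor `x ⊠ y`. -/
noncomputable def tm (x : X) (y : Y) : tensor X Y := Ten.mk x y

lemma add_tm (x x' : X) (y : Y) : tm (x + x') y = tm x y + tm x' y := Ten.add_mk x x' y

lemma tm_add (x : X) (y y' : Y) : tm x (y + y') = tm x y + tm x y' := Ten.mk_add x y y'

lemma smul_tm (c : ℂ) (x : X) (y : Y) : tm (c • x) y = c • tm x y := Ten.smul_mk c x y

lemma tm_smul (c : ℂ) (x : X) (y : Y) : tm x (c • y) = c • tm x y := Ten.mk_smul c x y

lemma ra_tm (x : X) (a : A.El) (y : Y) : tm (X.ra x a) y = tm x (Y.l a y) := Ten.ra_mk x a y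

lemma zero_tm (y : Y) : tm (0 : X) y = 0 := by
  have := smul_tm (0 : ℂ) (0 : X) y
  simpa using this

lemma tm_zero (x : X) : tm x (0 : Y) = 0 := by
  have := tm_smul (0 : ℂ) x (0 : Y)
  simpa using this

/-- `x ⊠ y` as a bilinear map. -/
noncomputable def tmL : X →ₗ[ℂ] Y →ₗ[ℂ] tensor X Y := LinearMap.mk₂ ℂ tm add_tm smul_tm tm_add tm_smul

@[simp] lemma tmL_apply (x : X) (y : Y) : tmL x y = tm x y := rfl

lemma sum_tm {ι : Type*} (s : Finset ι) (f : ι → X) (y : Y) :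
    tm (∑ i ∈ s, f i) y = ∑ i ∈ s, tm (f i) y := Ten.sum_mk s f y

lemma tm_sum {ι : Type*} (s : Finset ι) (x : X) (f : ι → Y) :
    tm x (∑ i ∈ s, f i) = ∑ i ∈ s, tm x (f i) := Ten.mk_sum s x f

lemma tensor_l (a : A.El) (x : X) (y : Y) : (tensor X Y).l a (tm x y) = tm (X.l a x) y :=
  Ten.l_mk a x y

lemma tensor_ra (a : A.El) (x : X) (y : Y) : (tensor X Y).ra (tm x y) a = tm x (Y.ra y a) :=
  Ten.r_mk _ x y

lemma tensor_ip (x x' : X) (y y' : Y) :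
    (tensor X Y).ip (tm x y) (tm x' y') = Y.ip y (Y.l (X.ip x x') y') := Ten.ip_mk x x' y y'

@[elab_as_elim]
lemma tensor_induction {p : tensor X Y → Prop} (z : tensor X Y) (h0 : p 0)
    (h1 : ∀ x y, p (tm x y)) (h2 : ∀ z w, p z → p w → p (z + w)) : p z :=
  Ten.induction (p := p) z h0 h1 h2

/-- The universal property of `X ⊠_A Y`. -/
noncomputable def lift {V : Type*} [AddCommGroup V] [Module ℂ V] (f : X →ₗ[ℂ] Y →ₗ[ℂ] V)
    (hf : ∀ x a y, f (X.ra x a) y = f x (Y.l a y)) : tensor X Y →ₗ[ℂ] V := Ten.lift f hf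

@[simp] lemma lift_tm {V : Type*} [AddCommGroup V] [Module ℂ V] (f : X →ₗ[ℂ] Y →ₗ[ℂ] V) (hf)
    (x : X) (y : Y) : lift f hf (tm x y) = f x y := Ten.lift_mk f hf x y

/-- The map `x† ⊠ 1 : z ⊠ y ↦ ⟨x|z⟩ y`. -/
noncomputable def contract (x : X) : tensor X Y →ₗ[ℂ] Y := Ten.contract x

@[simp] lemma contract_tm (x z : X) (y : Y) : contract x (tm z y) = Y.l (X.ip x z) y :=
  Ten.contract_mk x z y

/-- The underlying elements of the identity bimodule. -/
noncomputable def toUnit : A.El →ₗ[ℂ] unit A where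
  toFun a := a
  map_add' _ _ := rfl
  map_smul' _ _ := rfl

/-- The underlying elements of the identity bimodule. -/
noncomputable def ofUnit : unit A →ₗ[ℂ] A.El where
  toFun a := a
  map_add' _ _ := rfl
  map_smul' _ _ := rfl

@[simp] lemma ofUnit_toUnit (a : A.El) : ofUnit (toUnit a) = a := rfl

@[simp] lemma toUnit_ofUnit (a : unit A) : toUnit (ofUnit a) = a := rfl

lemma unit_l (a : A.El) (x : unit A) : (unit A).l a x = toUnit (a * ofUnit x) := rfl

lemma unit_ra (x : unit A) (a : A.El) : (unit A).ra x a = toUnit (ofUnit x * a) := rfl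

lemma unit_ip (x y : unit A) : (unit A).ip x y = star (ofUnit x) * ofUnit y := rfl

end Tensor

/-! ### The monoidal structure -/

section Monoidal

variable {X Y Z W : Bim A}

/-- Two linear maps out of `X ⊠ Y` agree if they agree on simple tensors. -/
lemma lin_ext {V : Type*} [AddCommGroup V] [Module ℂ V] {f g : tensor X Y →ₗ[ℂ] V}
    (h : ∀ x y, f (tm x y) = g (tm x y)) : f = g := by
  refine LinearMap.ext fun z => ?_
  induction z using tensor_induction with
  | h0 => simp
  | h1 x y => exact h x y
  | h2 z w hz hw => simp [hz, hw]

/-- Inner product preservation can be checked on a set of vectors that spans. -/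
lemma tensor_ip_ext (f : tensor X Y →ₗ[ℂ] Z)
    (h : ∀ x y x' y', Z.ip (f (tm x y)) (f (tm x' y')) = (tensor X Y).ip (tm x y) (tm x' y'))
    (t s : tensor X Y) : Z.ip (f t) (f s) = (tensor X Y).ip t s := by
  induction t using tensor_induction with
  | h0 => rw [map_zero, ← Z.star_ip, Z.ip_zero, ← (tensor X Y).star_ip, Bim.ip_zero]
  | h2 t t' ht ht' => rw [map_add, Bim.ip_add_left, Bim.ip_add_left, ht, ht']
  | h1 x y =>
    induction s using tensor_induction with
    | h0 => rw [map_zero, Z.ip_zero, Bim.ip_zero]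
    | h2 t t' ht ht' => rw [map_add, Bim.ip_add, Bim.ip_add, ht, ht']
    | h1 x' y' => exact h x y x' y'

/-- Left linearity can be checked on simple tensors. -/
lemma tensor_l_ext (f : tensor X Y →ₗ[ℂ] Z) (a : A.El)
    (h : ∀ x y, f (tm (X.l a x) y) = Z.l a (f (tm x y))) (t : tensor X Y) :
    f ((tensor X Y).l a t) = Z.l a (f t) := by
  induction t using tensor_induction with
  | h0 => simp
  | h1 x y => rw [tensor_l, h]
  | h2 t s ht hs => rw [map_add, map_add, ht, hs, map_add, map_add]

/-- Right linearity can be checked on simple tensors. -/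
lemma tensor_ra_ext (f : tensor X Y →ₗ[ℂ] Z) (a : A.El)
    (h : ∀ x y, f (tm x (Y.ra y a)) = Z.ra (f (tm x y)) a) (t : tensor X Y) :
    f ((tensor X Y).ra t a) = Z.ra (f t) a := by
  induction t using tensor_induction with
  | h0 => simp [ra]
  | h1 x y => rw [tensor_ra, h]
  | h2 t s ht hs => rw [ra_add, map_add, ht, hs, map_add, ra_add]

/-- Tensor product of linear maps. -/
noncomputable def lmap (f : X ⟶ Z) (g : Y ⟶ W) : tensor X Y →ₗ[ℂ] tensor Z W :=
  lift (LinearMap.compl₁₂ tmL (map f) (map g)) (fun x a y => by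
    simp only [LinearMap.compl₁₂_apply, tmL_apply, map_ra, map_l, ra_tm])

lemma lmap_tm (f : X ⟶ Z) (g : Y ⟶ W) (x : X) (y : Y) :
    lmap f g (tm x y) = tm (map f x) (map g y) := lift_tm _ _ _ _

/-- Tensor product of morphisms. -/
noncomputable def tensorMap (f : X ⟶ Z) (g : Y ⟶ W) : tensor X Y ⟶ tensor Z W where
  toFun := lmap f g
  adj := lmap (dagger f) (dagger g)
  map_l a z := tensor_l_ext _ a (fun x y => by simp only [lmap_tm, map_l, tensor_l]) z
  map_ra z a := tensor_ra_ext _ a (fun x y => by simp only [lmap_tm, map_ra, tensor_ra]) z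
  adj_spec z w := by
    induction z using tensor_induction with
    | h0 =>
      rw [map_zero, ← Bim.star_ip, Bim.ip_zero, ← (tensor X Y).star_ip, Bim.ip_zero]
    | h2 z z' h h' => simp only [map_add, Bim.ip_add_left, h, h']
    | h1 x y =>
      induction w using tensor_induction with
      | h0 => simp [Bim.ip_zero]
      | h2 z z' h h' => simp only [map_add, Bim.ip_add, h, h']
      | h1 x' y' => rw [lmap_tm, lmap_tm, tensor_ip, tensor_ip, ip_map, ip_map, map_l]

@[simp] lemma tensorMap_tm (f : X ⟶ Z) (g : Y ⟶ W) (x : X) (y : Y) :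
    map (tensorMap f g) (tm x y) = tm (map f x) (map g y) := lmap_tm _ _ _ _

/-- Morphisms out of a tensor product agree if they agree on simple tensors. -/
lemma tensor_ext {f g : tensor X Y ⟶ Z} (h : ∀ x y, map f (tm x y) = map g (tm x y)) : f = g :=
  hom_ext fun z => LinearMap.congr_fun (lin_ext h) z

lemma lin_ext₃ {V : Type*} [AddCommGroup V] [Module ℂ V] {f g : tensor (tensor X Y) Z →ₗ[ℂ] V}
    (h : ∀ x y z, f (tm (tm x y) z) = g (tm (tm x y) z)) : f = g := by
  refine lin_ext fun t z => ?_
  have key : f ∘ₗ tmL.flip z = g ∘ₗ tmL.flip z := lin_ext fun x y => h x y z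
  exact LinearMap.congr_fun key t

lemma lin_ext₃' {V : Type*} [AddCommGroup V] [Module ℂ V] {f g : tensor X (tensor Y Z) →ₗ[ℂ] V}
    (h : ∀ x y z, f (tm x (tm y z)) = g (tm x (tm y z))) : f = g := by
  refine lin_ext fun x t => ?_
  have key : f ∘ₗ tmL x = g ∘ₗ tmL x := lin_ext fun y z => h x y z
  exact LinearMap.congr_fun key t

lemma tensor_ext₃ {f g : tensor (tensor X Y) Z ⟶ W}
    (h : ∀ x y z, map f (tm (tm x y) z) = map g (tm (tm x y) z)) : f = g :=
  hom_ext fun z => LinearMap.congr_fun (lin_ext₃ h) z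

lemma tensor_ext₃' {f g : tensor X (tensor Y Z) ⟶ W}
    (h : ∀ x y z, map f (tm x (tm y z)) = map g (tm x (tm y z))) : f = g :=
  hom_ext fun z => LinearMap.congr_fun (lin_ext₃' h) z

/-- The associator as a linear map. -/
noncomputable def assocFun : tensor (tensor X Y) Z →ₗ[ℂ] tensor X (tensor Y Z) :=
  lift
    (lift (LinearMap.mk₂ ℂ (fun (x : X) (y : Y) => (tmL x) ∘ₗ (tmL (Y := Z) y))
      (fun x x' y => LinearMap.ext fun z => by simp [add_tm])
      (fun c x y => LinearMap.ext fun z => by simp [smul_tm])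
      (fun x y y' => LinearMap.ext fun z => by simp [tm_add, add_tm])
      (fun c x y => LinearMap.ext fun z => by simp [tm_smul, smul_tm]))
      (fun x a y => LinearMap.ext fun z => by simp [ra_tm, tensor_l]))
    (fun t a z => by
      induction t using tensor_induction with
      | h0 => simp [ra]
      | h2 t s ht hs => simp only [map_add, ra_add, LinearMap.add_apply, ht, hs]
      | h1 x y => simp [tensor_ra, ra_tm])

lemma assocFun_tm (x : X) (y : Y) (z : Z) : assocFun (tm (tm x y) z) = tm x (tm y z) := by
  simp [assocFun]

/-- The inverse associator as a linear map. -/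
noncomputable def assocInv : tensor X (tensor Y Z) →ₗ[ℂ] tensor (tensor X Y) Z :=
  lift
    (LinearMap.flip (lift (LinearMap.mk₂ ℂ
      (fun (y : Y) (z : Z) => (tmL.flip z) ∘ₗ ((tmL (X := X)).flip y))
      (fun y y' z => LinearMap.ext fun x => by simp [tm_add, add_tm])
      (fun c y z => LinearMap.ext fun x => by simp [tm_smul, smul_tm])
      (fun y z z' => LinearMap.ext fun x => by simp [tm_add])
      (fun c y z => LinearMap.ext fun x => by simp [tm_smul]))
      (fun y a z => LinearMap.ext fun x => by simp [← ra_tm, tensor_ra])))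
    (fun x a t => by
      induction t using tensor_induction with
      | h0 => simp
      | h2 t s ht hs => simp only [map_add, LinearMap.add_apply, ht, hs]
      | h1 y z => simp [tensor_l, ra_tm])

lemma assocInv_tm (x : X) (y : Y) (z : Z) : assocInv (tm x (tm y z)) = tm (tm x y) z := by
  simp [assocInv]

variable (X Y Z)

/-- The associator `(x ⊠ y) ⊠ z ↦ x ⊠ (y ⊠ z)`. -/
noncomputable def assoc : tensor (tensor X Y) Z ≅ tensor X (tensor Y Z) :=
  unitaryIso assocFun assocInv
    (LinearMap.congr_fun (f := assocFun ∘ₗ assocInv) (g := LinearMap.id)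
      (lin_ext₃' fun x y z => by simp [assocFun_tm, assocInv_tm]))
    (LinearMap.congr_fun (f := assocInv ∘ₗ assocFun) (g := LinearMap.id)
      (lin_ext₃ fun x y z => by simp [assocFun_tm, assocInv_tm]))
    (fun a => LinearMap.congr_fun (f := assocFun ∘ₗ (tensor (tensor X Y) Z).l a)
      (g := (tensor X (tensor Y Z)).l a ∘ₗ assocFun)
      (lin_ext₃ fun x y z => by simp [assocFun_tm, tensor_l]))
    (fun t a => LinearMap.congr_fun
      (f := assocFun ∘ₗ (tensor (tensor X Y) Z).r (MulOpposite.op a))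
      (g := (tensor X (tensor Y Z)).r (MulOpposite.op a) ∘ₗ assocFun)
      (lin_ext₃ fun x y z => by
        change assocFun ((tensor (tensor X Y) Z).ra (tm (tm x y) z) a) =
          (tensor X (tensor Y Z)).ra (assocFun (tm (tm x y) z)) a
        rw [tensor_ra, assocFun_tm, assocFun_tm, tensor_ra, tensor_ra]) t)
    (tensor_ip_ext assocFun fun t z t' z' => by
      induction t using tensor_induction with
      | h0 =>
        rw [zero_tm, map_zero, ← Bim.star_ip, Bim.ip_zero, ← (tensor (tensor X Y) Z).star_ip,
          Bim.ip_zero]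
      | h2 t s ht hs => rw [add_tm, map_add, Bim.ip_add_left, ht, hs, Bim.ip_add_left]
      | h1 x y =>
        induction t' using tensor_induction with
        | h0 => rw [zero_tm, map_zero, Bim.ip_zero, Bim.ip_zero]
        | h2 t s ht hs => rw [add_tm, map_add, Bim.ip_add, ht, hs, Bim.ip_add]
        | h1 x' y' =>
          rw [assocFun_tm, assocFun_tm, tensor_ip, tensor_ip, tensor_l, tensor_ip, tensor_ip])

/-- The left action as a bilinear map. -/
noncomputable def lL : A.El →ₗ[ℂ] X →ₗ[ℂ] X := X.l.toLinearMap

@[simp] lemma lL_apply (x : X) (a : A.El) : lL X a x = X.l a x := rfl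

/-- The right action as a bilinear map. -/
noncomputable def raL : X →ₗ[ℂ] A.El →ₗ[ℂ] X :=
  LinearMap.mk₂ ℂ X.ra X.ra_add (fun c x a => map_smul _ _ _)
    (fun x a b => by simp [ra]) (fun c x a => by simp [ra, MulOpposite.op_smul])

@[simp] lemma raL_apply (x : X) (a : A.El) : raL X x a = X.ra x a := rfl

/-- The left unitor as a linear map. -/
noncomputable def leftFun : tensor (unit A) X →ₗ[ℂ] X :=
  lift (lL X ∘ₗ ofUnit) (fun a b x => X.l_mul (ofUnit a) b x)

@[simp] lemma leftFun_tm (a : unit A) (x : X) : leftFun X (tm a x) = X.l (ofUnit a) x :=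
  lift_tm _ _ _ _

/-- The right unitor as a linear map. -/
noncomputable def rightFun : tensor X (unit A) →ₗ[ℂ] X :=
  lift (LinearMap.compl₂ (raL X) ofUnit) (fun x a b => (X.ra_mul x a (ofUnit b)).symm)

@[simp] lemma rightFun_tm (x : X) (a : unit A) : rightFun X (tm x a) = X.ra x (ofUnit a) :=
  lift_tm _ _ _ _

lemma tm_one_l (a : A.El) (x : X) : tm (toUnit 1) (X.l a x) = tm (toUnit a) x := by
  rw [← ra_tm, unit_ra, ofUnit_toUnit, one_mul]

lemma tm_ra_one (x : X) (a : A.El) : tm (X.ra x a) (toUnit 1) = tm x (toUnit a) := by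
  rw [ra_tm, unit_l, ofUnit_toUnit, mul_one]

/-- The left unitor `a ⊠ x ↦ a x`. -/
noncomputable def leftU : tensor (unit A) X ≅ X :=
  unitaryIso (leftFun X) (tmL (toUnit 1))
    (fun x => by rw [tmL_apply, leftFun_tm, ofUnit_toUnit, X.l_one])
    (LinearMap.congr_fun (g := LinearMap.id)
      (f := tmL (toUnit 1) ∘ₗ leftFun X) (lin_ext fun a x => by
        rw [LinearMap.comp_apply, leftFun_tm, tmL_apply, tm_one_l, toUnit_ofUnit]; rfl))
    (fun a => tensor_l_ext _ a fun b x => by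
      rw [leftFun_tm, leftFun_tm, unit_l, ofUnit_toUnit, X.l_mul])
    (fun t a => tensor_ra_ext _ a (fun b x => by rw [leftFun_tm, leftFun_tm, l_ra]) t)
    (tensor_ip_ext _ fun a x b y => by
      rw [leftFun_tm, leftFun_tm, tensor_ip, X.ip_l, unit_ip, X.l_mul])

/-- The right unitor `x ⊠ a ↦ x a`. -/
noncomputable def rightU : tensor X (unit A) ≅ X :=
  unitaryIso (rightFun X) (tmL.flip (toUnit 1))
    (fun x => by rw [LinearMap.flip_apply, tmL_apply, rightFun_tm, ofUnit_toUnit, X.ra_one])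
    (LinearMap.congr_fun (g := LinearMap.id)
      (f := tmL.flip (toUnit 1) ∘ₗ rightFun X) (lin_ext fun x a => by
        rw [LinearMap.comp_apply, rightFun_tm, LinearMap.flip_apply, tmL_apply, tm_ra_one,
          toUnit_ofUnit]; rfl))
    (fun a => tensor_l_ext _ a fun x b => by rw [rightFun_tm, rightFun_tm, l_ra])
    (fun t a => tensor_ra_ext _ a (fun x b => by
      rw [rightFun_tm, rightFun_tm, unit_ra, ofUnit_toUnit, X.ra_mul]) t)
    (tensor_ip_ext _ fun x a y b => by
      rw [rightFun_tm, rightFun_tm, tensor_ip, X.ip_ra, X.ip_ra_left, unit_ip, unit_l,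
        ofUnit_toUnit, mul_assoc])

variable {X Y Z}

@[simp] lemma assoc_tm (x : X) (y : Y) (z : Z) :
    map (assoc X Y Z).hom (tm (tm x y) z) = tm x (tm y z) := assocFun_tm x y z

@[simp] lemma assoc_inv_tm (x : X) (y : Y) (z : Z) :
    map (assoc X Y Z).inv (tm x (tm y z)) = tm (tm x y) z := assocInv_tm x y z

@[simp] lemma leftU_tm (a : unit A) (x : X) : map (leftU X).hom (tm a x) = X.l (ofUnit a) x :=
  leftFun_tm X a x

@[simp] lemma rightU_tm (x : X) (a : unit A) : map (rightU X).hom (tm x a) = X.ra x (ofUnit a) :=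
  rightFun_tm X x a

noncomputable instance : MonoidalCategoryStruct (Bim A) where
  tensorObj := tensor
  whiskerLeft X _ _ g := tensorMap (𝟙 X) g
  whiskerRight f Y := tensorMap f (𝟙 Y)
  tensorHom := tensorMap
  tensorUnit := unit A
  associator := assoc
  leftUnitor := leftU
  rightUnitor := rightU

/-- `Bim_fgp(A)` is a monoidal category under the relative tensor product. -/
noncomputable instance : MonoidalCategory (Bim A) := MonoidalCategory.ofTensorHom
  (id_tensorHom_id := fun X Y => tensor_ext fun x y => tensorMap_tm (𝟙 X) (𝟙 Y) x y)
  (id_tensorHom := fun _ _ _ _ => rfl)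
  (tensorHom_id := fun _ _ => rfl)
  (tensorHom_comp_tensorHom := fun f₁ f₂ g₁ g₂ =>
    show tensorMap f₁ f₂ ≫ tensorMap g₁ g₂ = tensorMap (f₁ ≫ g₁) (f₂ ≫ g₂) from
      tensor_ext fun x y => by simp)
  (associator_naturality := fun {X₁ X₂ X₃ Y₁ Y₂ Y₃} f₁ f₂ f₃ =>
    show tensorMap (tensorMap f₁ f₂) f₃ ≫ (assoc Y₁ Y₂ Y₃).hom =
      (assoc X₁ X₂ X₃).hom ≫ tensorMap f₁ (tensorMap f₂ f₃) from
      tensor_ext₃ fun x y z => by simp)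
  (leftUnitor_naturality := fun {X Y} f =>
    show tensorMap (𝟙 (unit A)) f ≫ (leftU Y).hom = (leftU X).hom ≫ f from
      tensor_ext fun a x => by simp [map_l])
  (rightUnitor_naturality := fun {X Y} f =>
    show tensorMap f (𝟙 (unit A)) ≫ (rightU Y).hom = (rightU X).hom ≫ f from
      tensor_ext fun x a => by simp [map_ra])
  (pentagon := fun W X Y Z =>
    show tensorMap (assoc W X Y).hom (𝟙 Z) ≫ (assoc W (tensor X Y) Z).hom ≫
        tensorMap (𝟙 W) (assoc X Y Z).hom =
      (assoc (tensor W X) Y Z).hom ≫ (assoc W X (tensor Y Z)).hom from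
    tensor_ext fun t z => by
      have key := lin_ext₃ (X := W) (Y := X) (Z := Y)
        (f := map (tensorMap (assoc W X Y).hom (𝟙 Z) ≫ (assoc W (tensor X Y) Z).hom ≫
          tensorMap (𝟙 W) (assoc X Y Z).hom) ∘ₗ tmL.flip z)
        (g := map ((assoc (tensor W X) Y Z).hom ≫ (assoc W X (tensor Y Z)).hom) ∘ₗ tmL.flip z)
        (fun w x y => by simp)
      exact LinearMap.congr_fun key t)
  (triangle := fun X Y =>
    show (assoc X (unit A) Y).hom ≫ tensorMap (𝟙 X) (leftU Y).hom =
      tensorMap (rightU X).hom (𝟙 Y) from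
      tensor_ext₃ fun x a y => by simp [ra_tm])

end Monoidal

/-! ### Adjoints and the monoidal structure -/

section DaggerLemmas

variable {X Y Z W : Bim A}

@[simp] lemma dagger_id : dagger (𝟙 X) = 𝟙 X := rfl

@[simp] lemma dagger_comp (f : X ⟶ Y) (g : Y ⟶ Z) : dagger (f ≫ g) = dagger g ≫ dagger f := rfl

@[simp] lemma dagger_dagger (f : X ⟶ Y) : dagger (dagger f) = f := rfl

@[simp] lemma dagger_tensorHom (f : X ⟶ Z) (g : Y ⟶ W) :
    dagger (f ⊗ₘ g) = dagger f ⊗ₘ dagger g := rfl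

@[simp] lemma dagger_whiskerLeft (f : Y ⟶ Z) : dagger (X ◁ f) = X ◁ dagger f := rfl

@[simp] lemma dagger_whiskerRight (f : Y ⟶ Z) : dagger (f ▷ X) = dagger f ▷ X := rfl

@[simp] lemma dagger_assoc : dagger (α_ X Y Z).hom = (α_ X Y Z).inv := rfl

@[simp] lemma dagger_assoc_inv : dagger (α_ X Y Z).inv = (α_ X Y Z).hom := rfl

@[simp] lemma dagger_rightUnitor : dagger (ρ_ X).hom = (ρ_ X).inv := rfl

@[simp] lemma dagger_leftUnitor : dagger (λ_ X).hom = (λ_ X).inv := rfl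

@[simp] lemma whiskerLeft_tm (f : Y ⟶ Z) (x : X) (y : Y) :
    map (X ◁ f) (tm x y) = tm x (map f y) := tensorMap_tm (𝟙 X) f x y

@[simp] lemma whiskerRight_tm (f : X ⟶ Z) (x : X) (y : Y) :
    map (f ▷ Y) (tm x y) = tm (map f x) y := tensorMap_tm f (𝟙 Y) x y

@[simp] lemma associator_tm (x : X) (y : Y) (z : Z) :
    map (α_ X Y Z).hom (tm (tm x y) z) = tm x (tm y z) := assocFun_tm x y z

@[simp] lemma associator_inv_tm (x : X) (y : Y) (z : Z) :
    map (α_ X Y Z).inv (tm x (tm y z)) = tm (tm x y) z := assocInv_tm x y z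

@[simp] lemma leftUnitor_tm (a : unit A) (x : X) :
    map (λ_ X).hom (tm a x) = X.l (ofUnit a) x := leftFun_tm X a x

@[simp] lemma rightUnitor_tm (x : X) (a : unit A) :
    map (ρ_ X).hom (tm x a) = X.ra x (ofUnit a) := rightFun_tm X x a

end DaggerLemmas

/-! ### Approximately inner and centrally trivial bimodules -/

section Chi

/-- The `2`-norm `‖x‖₂ = tr(⟨x|x⟩)^{1/2}` on a bimodule. -/
noncomputable def norm2 (X : Bim A) (x : X) : ℝ := Real.sqrt (A.tr (X.ip x x)).re

/-- Central sequences of `A`: bounded sequences `(a_n)` with `‖a_n b - b a_n‖₂ → 0` for all `b`. -/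
def IsCentralSeq (a : ℕ → A.El) : Prop :=
  (∃ C : ℝ, ∀ n, ‖(a n : H →L[ℂ] H)‖ ≤ C) ∧
    ∀ b : A.El, Tendsto (fun n => A.norm2 (a n * b - b * a n)) atTop (𝓝 0)

/-- `X` is centrally trivial: `‖a_n x - x a_n‖₂ → 0` for all central sequences and all `x`. -/
def CentrallyTrivial (X : Bim A) : Prop :=
  ∀ a : ℕ → A.El, IsCentralSeq a →
    ∀ x : X, Tendsto (fun n => X.norm2 (X.l (a n) x - X.ra x (a n))) atTop (𝓝 0)

/-- An approximately inner basis of `X`: a sequence of uniformly bounded finite families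
`{b_i^{(n)}}` of uniformly bounded length (the same length `m`, after adding zeros) with
`‖x - ∑ b_i^{(n)} ⟨b_i^{(n)}|x⟩‖₂ → 0` for all `x` and `‖a b_i^{(n)} - b_i^{(n)} a‖₂ → 0`
for all `a`. -/
structure IsAIBasis (X : Bim A) {m : ℕ} (b : ℕ → Fin m → X) : Prop where
  bounded : ∃ C : ℝ, ∀ n i, ‖(X.ip (b n i) (b n i) : H →L[ℂ] H)‖ ≤ C
  approx : ∀ x : X,
    Tendsto (fun n => X.norm2 (x - ∑ i, X.ra (b n i) (X.ip (b n i) x))) atTop (𝓝 0)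
  inner : ∀ (a : A.El) (i : Fin m),
    Tendsto (fun n => X.norm2 (X.l a (b n i) - X.ra (b n i) a)) atTop (𝓝 0)

/-- `X` is approximately inner. -/
def ApproxInner (X : Bim A) : Prop := ∃ (m : ℕ) (b : ℕ → Fin m → X), IsAIBasis X b

variable (A) in
/-- The objects of `χ̃(A)`: the dualizable bimodules that are approximately inner and centrally
trivial together with their dual. -/
def chi : ObjectProperty (Bim A) := fun X =>
  ApproxInner X ∧ CentrallyTrivial X ∧ ∃ X' : Bim A, ApproxInner X' ∧ CentrallyTrivial X' ∧
    Nonempty (ExactPairing X X') ∧ Nonempty (ExactPairing X' X)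

variable (A) in
/-- The category `χ̃(A)`, a full subcategory of `Bim_fgp(A)`. -/
abbrev Chi : Type (u + 1) := (chi A).FullSubcategory

/-- `u : X ⊠ Y → Y ⊠ X` is the limit of `∑_{i,j} |c_j ⊠ b_i^{(n)}⟩⟨b_i^{(n)} ⊠ c_j|` in the strong
topology given by `‖·‖₂`, for every approximately inner basis `b` of `X` and every basis `c`
of `Y`. -/
def IsBraiding (X Y : Bim A) (v : X ⊗ Y ⟶ Y ⊗ X) : Prop :=
  ∀ (m k : ℕ) (b : ℕ → Fin m → X) (c : Fin k → Y), IsAIBasis X b → Y.IsBasis c →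
    ∀ z : (tensor X Y : Bim A), Tendsto (fun n => (tensor Y X).norm2
      (map v z - ∑ i, ∑ j, (tensor Y X).ra (tm (c j) (b n i))
        ((tensor X Y).ip (tm (b n i) (c j)) z))) atTop (𝓝 0)

open Classical in
/-- The braiding `u_{X,Y}`.  (It is unique when `X` is approximately inner, and the value `0` is
used only where it does not exist.) -/
noncomputable def braid (X Y : Bim A) : X ⊗ Y ⟶ Y ⊗ X :=
  if h : ∃ v, IsBraiding X Y v then h.choose else (0 : tensor X Y ⟶ tensor Y X)

end Chi

/-! ### Q-systems -/

section QSystems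

variable (A) in
/-- A (unitary) Q-system in `Bim_fgp(A)`: a unital associative algebra whose multiplication is a
coisometry and satisfies the Frobenius relations. -/
structure QSystem where
  X : Bim A
  m : X ⊗ X ⟶ X
  i : 𝟙_ (Bim A) ⟶ X
  assoc : m ▷ X ≫ m = (α_ X X X).hom ≫ X ◁ m ≫ m
  unit_left : i ▷ X ≫ m = (λ_ X).hom
  unit_right : X ◁ i ≫ m = (ρ_ X).hom
  frobenius_right : m ≫ dagger m = X ◁ dagger m ≫ (α_ X X X).inv ≫ m ▷ X
  frobenius_left : m ≫ dagger m = dagger m ▷ X ≫ (α_ X X X).hom ≫ X ◁ m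
  separable : dagger m ≫ m = 𝟙 X

/-- Commutativity with respect to the braiding of `χ̃(A)`. -/
def QSystem.IsCommutative (Q : QSystem A) : Prop :=
  braid Q.X Q.X ≫ Q.m = Q.m ∧ dagger (braid Q.X Q.X) ≫ Q.m = Q.m

/-- Local right `Q`-modules in `χ̃(A)`. -/
structure LocMod (Q : QSystem A) where
  X : Bim A
  mem : chi A X
  act : X ⊗ Q.X ⟶ X
  act_assoc : act ▷ Q.X ≫ act = (α_ X Q.X Q.X).hom ≫ X ◁ Q.m ≫ act
  act_unit : X ◁ Q.i ≫ act = (ρ_ X).hom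
  frobenius : act ≫ dagger act = X ◁ dagger Q.m ≫ (α_ X Q.X Q.X).inv ≫ act ▷ Q.X
  separable : dagger act ≫ act = 𝟙 X
  isLocal : braid Q.X X ≫ act = dagger (braid X Q.X) ≫ act

namespace LocMod

variable {Q : QSystem A}

/-- The left action `Q ⊠ X → X` of a local module. -/
noncomputable def leftAct (X : LocMod Q) : Q.X ⊗ X.X ⟶ X.X := braid Q.X X.X ≫ X.act

/-- Module maps. -/
@[ext]
structure Hom (X Y : LocMod Q) where
  hom : X.X ⟶ Y.X
  comm : X.act ≫ hom = hom ▷ Q.X ≫ Y.act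

noncomputable instance : Category (LocMod Q) where
  Hom := Hom
  id X := ⟨𝟙 _, by simp⟩
  comp f g := ⟨f.hom ≫ g.hom, by
    rw [← Category.assoc, f.comm, Category.assoc, g.comm, comp_whiskerRight, Category.assoc]⟩

/-- The action is determined by its adjoint. -/
lemma act_eq (X : LocMod Q) :
    X.act = dagger X.act ▷ Q.X ≫ (α_ _ _ _).hom ≫ X.X ◁ (Q.m ≫ dagger Q.i) ≫ (ρ_ _).hom := by
  have h1 := congrArg dagger X.frobenius
  have h2 := congrArg dagger X.act_unit
  simp only [dagger_comp, dagger_dagger, dagger_whiskerLeft, dagger_whiskerRight,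
    dagger_assoc_inv, dagger_rightUnitor, Category.assoc] at h1 h2
  have h3 : (dagger X.act ≫ X.X ◁ dagger Q.i) ≫ (ρ_ X.X).hom = 𝟙 _ := by
    rw [h2, Iso.inv_hom_id]
  rw [MonoidalCategory.whiskerLeft_comp, Category.assoc]
  rw [← reassoc_of% h1, ← Category.assoc (dagger X.act), h3, Category.comp_id]

/-- The adjoint of a module map is a module map. -/
noncomputable def daggerHom {X Y : LocMod Q} (f : X ⟶ Y) : Y ⟶ X where
  hom := dagger (Hom.hom f)
  comm := by
    have h1 := congrArg dagger (Hom.comm f)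
    simp only [dagger_comp, dagger_whiskerRight] at h1
    rw [Y.act_eq, X.act_eq]
    simp only [Category.assoc]
    rw [← rightUnitor_naturality, whisker_exchange_assoc, ← associator_naturality_left_assoc,
      ← comp_whiskerRight_assoc, ← comp_whiskerRight_assoc, h1]

/-- The functor to `χ̃(A)` that forgets the action. -/
noncomputable def forget (Q : QSystem A) : LocMod Q ⥤ Chi A where
  obj X := ⟨X.X, X.mem⟩
  map f := ObjectProperty.homMk (Hom.hom f)

end LocMod

end QSystems

end Bim

end Bimodules

/-! ## Finite index subfactors and their Q-systems -/

section FiniteIndexSubfactors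

variable {H : Type u} [NormedAddCommGroup H] [InnerProductSpace ℂ H] [CompleteSpace H]
  {M : IIOneFactor H}

/-- A trace preserving normal conditional expectation `E : M → N`.  (There is exactly one.) -/
structure CondExp (S : Subfactor M) where
  E : M.El →ₗ[ℂ] S.toFactor.El
  E_incl : ∀ a, E (S.incl a) = a
  E_mul_left : ∀ a x, E (S.incl a * x) = a * E x
  E_mul_right : ∀ x a, E (x * S.incl a) = E x * a
  E_star : ∀ x, E (star x) = star (E x)
  E_pos : ∀ x, ((E (star x * x) : S.toFactor.El) : H →L[ℂ] H).IsPositive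
  tr_E : ∀ x, S.toFactor.tr (E x) = M.tr x
  E_normal : ∀ a : ℕ → M.El, WeakNull a → WeakNull (fun n => E (a n))

/-- `N ⊆ M` has finite index, witnessed by a finite Pimsner-Popa basis `{c_j}` of `M` over `N`:
`x = ∑ c_j E(c_j* x)` for all `x ∈ M`. -/
structure FiniteIndex (S : Subfactor M) extends CondExp S where
  n : ℕ
  c : Fin n → M.El
  expand : ∀ x, ∑ j, c j * S.incl (E (star (c j) * x)) = x

namespace FiniteIndex

variable {S : Subfactor M} (I : FiniteIndex S)

lemma expand' (x : M.El) : ∑ j, S.incl (I.E (x * I.c j)) * star (I.c j) = x := by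
  have h := congrArg star (I.expand (star x))
  rw [star_star, star_sum] at h
  rw [← h]
  refine Finset.sum_congr rfl fun j _ => ?_
  rw [star_mul, ← map_star S.incl, ← I.E_star, star_mul, star_star, star_star, h]

/-- The index `[M : N]`, where `∑ c_j c_j* = [M : N] 1`. -/
noncomputable def index : ℝ := (M.tr (∑ j, I.c j * star (I.c j))).re

lemma sum_comm (y : M.El) :
    y * ∑ j, I.c j * star (I.c j) = (∑ j, I.c j * star (I.c j)) * y := by
  have h1 : ∀ j, y * I.c j = ∑ k, I.c k * S.incl (I.E (star (I.c k) * y * I.c j)) := fun j => by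
    conv_lhs => rw [← I.expand (y * I.c j)]
    simp only [mul_assoc]
  calc y * ∑ j, I.c j * star (I.c j)
      = ∑ j, (y * I.c j) * star (I.c j) := by simp only [Finset.mul_sum, mul_assoc]
    _ = ∑ j, ∑ k, I.c k * (S.incl (I.E (star (I.c k) * y * I.c j)) * star (I.c j)) := by
        refine Finset.sum_congr rfl fun j _ => ?_
        rw [h1, Finset.sum_mul]; simp only [mul_assoc]
    _ = ∑ k, I.c k * (star (I.c k) * y) := by
        rw [Finset.sum_comm]
        refine Finset.sum_congr rfl fun k _ => ?_
        rw [← Finset.mul_sum, I.expand']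
    _ = _ := by simp only [Finset.sum_mul, mul_assoc]

lemma sum_eq : ∑ j, I.c j * star (I.c j) = (I.index : ℂ) • (1 : M.El) := by
  obtain ⟨z, hz⟩ := M.center_trivial _ (∑ j, I.c j * star (I.c j) : M.El).2 (fun y hy => by
    have := congrArg (Subtype.val) (I.sum_comm ⟨y, hy⟩)
    exact this.symm)
  have hz' : ∑ j, I.c j * star (I.c j) = z • (1 : M.El) := Subtype.ext hz
  have h0 : 0 ≤ M.tr (∑ j, I.c j * star (I.c j)) := by
    rw [map_sum]
    exact Finset.sum_nonneg fun j _ => by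
      have := M.tr_nonneg (star (I.c j)); rwa [star_star] at this
  have h1 : M.tr (∑ j, I.c j * star (I.c j)) = z := by
    rw [hz', map_smul, M.tr_one, smul_eq_mul, mul_one]
  rw [h1] at h0
  have h2 : ((I.index : ℝ) : ℂ) = z := by
    rw [index, h1]
    exact (Complex.conj_eq_iff_re).1 (Complex.conj_eq_iff_im.2 (Complex.nonneg_iff.1 h0).2.symm)
  rw [hz', h2]

lemma index_pos : 0 < I.index := by
  have hn : ∀ j, 0 ≤ (M.tr (I.c j * star (I.c j))).re := fun j => by
    have := M.tr_nonneg (star (I.c j)); rw [star_star] at this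
    exact (Complex.nonneg_iff.1 this).1
  have h0 : I.index = ∑ j, (M.tr (I.c j * star (I.c j))).re := by
    rw [index, map_sum, Complex.re_sum]
  rcases (Finset.sum_nonneg (s := Finset.univ) fun j _ => hn j).lt_or_eq with h | h
  · rwa [h0]
  exfalso
  have hj : ∀ j, I.c j = 0 := fun j => by
    have h1 := (Finset.sum_eq_zero_iff_of_nonneg (fun j _ => hn j)).1 h.symm j (Finset.mem_univ j)
    have h2 := M.tr_nonneg (star (I.c j))
    rw [star_star] at h2
    have h3 : M.tr (I.c j * star (I.c j)) = 0 :=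
      Complex.ext h1 (Complex.nonneg_iff.1 h2).2.symm
    have h4 := M.tr_faithful (star (I.c j)) (by rw [star_star, h3])
    simpa using congrArg star h4
  have h5 := I.expand 1
  simp only [hj, zero_mul, Finset.sum_const_zero] at h5
  have h6 := M.tr_one
  rw [← h5, map_zero] at h6
  exact zero_ne_one h6

lemma index_ne : (I.index : ℂ) ≠ 0 := Complex.ofReal_ne_zero.2 I.index_pos.ne'

/-- The `N`-`N` bimodule `M` (that is, `L²M`), with `⟨x|y⟩ = [M : N] E(x* y)`.  The factor
`[M : N]` changes `L²M` only by a scalar unitary, and it makes the multiplication a coisometry. -/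
noncomputable def bim : Bim S.toFactor where
  carrier := M.El
  l := (Algebra.lmul ℂ M.El).comp S.incl.toAlgHom
  r := AlgHom.ofLinearMap
    { toFun := fun a => LinearMap.mulRight ℂ (S.incl a.unop)
      map_add' := fun a b => by ext1 x; simp [mul_add]
      map_smul' := fun c a => by ext1 x; simp }
    (by ext1 x; simp) (fun a b => by ext1 x; simp [mul_assoc])
  l_r a b x := by simp [mul_assoc]
  ip x y := (I.index : ℂ) • I.E (star x * y)
  ip_add x y z := by rw [mul_add, map_add, smul_add]
  ip_r x y a := by
    change (I.index : ℂ) • I.E (star x * (y * S.incl a)) = _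
    rw [← mul_assoc, I.E_mul_right, smul_mul_assoc]
  star_ip x y := by
    rw [star_smul, ← I.E_star, star_mul, star_star, Complex.star_def, Complex.conj_ofReal]
  ip_pos x := by
    have := (I.E_pos x).smul_of_nonneg (c := (I.index : ℂ))
      (Complex.zero_le_real.2 I.index_pos.le)
    exact this
  ip_def x hx := by
    have h1 : I.E (star x * x) = 0 := (smul_eq_zero.1 hx).resolve_left I.index_ne
    exact M.tr_faithful x (by rw [← I.tr_E, h1, map_zero])
  ip_l a x y := by
    change (I.index : ℂ) • I.E (star (S.incl a * x) * y) =
      (I.index : ℂ) • I.E (star x * (S.incl (star a) * y))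
    rw [star_mul, map_star, mul_assoc]
  exists_basis := ⟨I.n, fun j => ((Real.sqrt I.index : ℝ) : ℂ)⁻¹ • I.c j, fun x => by
    change ∑ j, (((Real.sqrt I.index : ℝ) : ℂ)⁻¹ • I.c j) *
      S.incl ((I.index : ℂ) • I.E (star (((Real.sqrt I.index : ℝ) : ℂ)⁻¹ • I.c j) * x)) = x
    conv_rhs => rw [← I.expand x]
    refine Finset.sum_congr rfl fun j _ => ?_
    have hs : ((Real.sqrt I.index : ℝ) : ℂ) * ((Real.sqrt I.index : ℝ) : ℂ) = (I.index : ℂ) := by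
      rw [← Complex.ofReal_mul, Real.mul_self_sqrt I.index_pos.le]
    have hs0 : ((Real.sqrt I.index : ℝ) : ℂ) ≠ 0 :=
      Complex.ofReal_ne_zero.2 (Real.sqrt_pos.2 I.index_pos).ne'
    rw [star_smul, smul_mul_assoc, smul_mul_assoc, map_smul, map_smul, map_smul, mul_smul_comm,
      mul_smul_comm, smul_smul, smul_smul, star_inv₀, Complex.star_def, Complex.conj_ofReal, ← hs]
    have : ((Real.sqrt I.index : ℝ) : ℂ)⁻¹ * (((Real.sqrt I.index : ℝ) : ℂ) *
      ((Real.sqrt I.index : ℝ) : ℂ)) * ((Real.sqrt I.index : ℝ) : ℂ)⁻¹ = 1 := by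
      field_simp
    rw [← mul_assoc] at this ⊢
    rw [this, one_smul]⟩
  l_normal x y a ha := by
    have h1 : WeakNull (M := M) (fun n => star x * (S.incl (a n) * y)) := fun ξ η => by
      have := ha ((x : H →L[ℂ] H) ξ) ((y : H →L[ℂ] H) η)
      refine this.congr fun n => ?_
      change _ = inner ℂ ξ (star (x : H →L[ℂ] H) ((a n : H →L[ℂ] H) ((y : H →L[ℂ] H) η)))
      rw [ContinuousLinearMap.star_eq_adjoint, ContinuousLinearMap.adjoint_inner_right]
    intro ξ η
    have h2 := (I.E_normal _ h1 ξ η).const_mul (I.index : ℂ)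
    rw [mul_zero] at h2
    refine h2.congr fun n => ?_
    rw [← inner_smul_right]
    rfl

/-- The elements of `M`, as vectors of the bimodule. -/
noncomputable def toBim : M.El ≃ₗ[ℂ] I.bim := LinearEquiv.refl ℂ M.El

/-- The vectors of the bimodule, as elements of `M`. -/
noncomputable def ofBim : I.bim ≃ₗ[ℂ] M.El := LinearEquiv.refl ℂ M.El

@[simp] lemma ofBim_toBim (x : M.El) : I.ofBim (I.toBim x) = x := rfl

@[simp] lemma toBim_ofBim (x : I.bim) : I.toBim (I.ofBim x) = x := rfl

lemma bim_l (a : S.toFactor.El) (x : I.bim) :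
    I.bim.l a x = I.toBim (S.incl a * I.ofBim x) := rfl

lemma bim_ra (x : I.bim) (a : S.toFactor.El) :
    I.bim.ra x a = I.toBim (I.ofBim x * S.incl a) := rfl

lemma bim_ip (x y : I.bim) :
    I.bim.ip x y = (I.index : ℂ) • I.E (star (I.ofBim x) * I.ofBim y) := rfl

open Bim

/-- Multiplication as a linear map. -/
noncomputable def mulFun : tensor I.bim I.bim →ₗ[ℂ] I.bim :=
  lift (LinearMap.compr₂ (LinearMap.compl₁₂ (LinearMap.mul ℂ M.El) I.ofBim.toLinearMap
    I.ofBim.toLinearMap) I.toBim.toLinearMap)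
    (fun x a y => mul_assoc (I.ofBim x) (S.incl a) (I.ofBim y))

lemma mulFun_tm (x y : I.bim) : I.mulFun (tm x y) = I.toBim (I.ofBim x * I.ofBim y) :=
  lift_tm _ _ _ _

/-- The adjoint of the multiplication, `z ↦ [M : N]⁻¹ ∑ z c_j ⊠ c_j*`. -/
noncomputable def comulFun : I.bim →ₗ[ℂ] tensor I.bim I.bim where
  toFun z := (I.index : ℂ)⁻¹ •
    ∑ j, tm (I.toBim (I.ofBim z * I.c j)) (I.toBim (star (I.c j)))
  map_add' z w := by
    simp only [map_add, add_mul, add_tm, Finset.sum_add_distrib, smul_add]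
  map_smul' a z := by
    simp only [map_smul, smul_mul_assoc, smul_tm, ← Finset.smul_sum, RingHom.id_apply]
    rw [smul_comm]

lemma comulFun_apply (z : I.bim) : I.comulFun z = (I.index : ℂ)⁻¹ •
    ∑ j, tm (I.toBim (I.ofBim z * I.c j)) (I.toBim (star (I.c j))) := rfl

/-- The multiplication `M ⊠_N M → M`. -/
noncomputable def mul : tensor I.bim I.bim ⟶ I.bim where
  toFun := I.mulFun
  adj := I.comulFun
  map_l a := tensor_l_ext _ a fun x y => by
    rw [mulFun_tm, mulFun_tm, bim_l, bim_l, ofBim_toBim, ofBim_toBim, mul_assoc]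
  map_ra t a := tensor_ra_ext _ a (fun x y => by
    rw [mulFun_tm, mulFun_tm, bim_ra, bim_ra, ofBim_toBim, ofBim_toBim, mul_assoc]) t
  adj_spec t z := by
    induction t using tensor_induction with
    | h0 =>
      rw [map_zero, ← Bim.star_ip, Bim.ip_zero, ← (tensor I.bim I.bim).star_ip, Bim.ip_zero]
    | h2 t s ht hs => rw [map_add, Bim.ip_add_left, Bim.ip_add_left, ht, hs]
    | h1 x y =>
      rw [mulFun_tm, comulFun_apply, Bim.ip_smul, Bim.ip_sum]
      simp only [tensor_ip, bim_ip, bim_l, ofBim_toBim]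
      have h : ∀ j, (I.index : ℂ) • I.E (star (I.ofBim y) *
          (S.incl ((I.index : ℂ) • I.E (star (I.ofBim x) * (I.ofBim z * I.c j))) *
            star (I.c j))) = (I.index : ℂ) • (I.index : ℂ) • I.E (star (I.ofBim y) *
          (S.incl (I.E (star (I.ofBim x) * I.ofBim z * I.c j)) * star (I.c j))) := fun j => by
        rw [map_smul, smul_mul_assoc, mul_smul_comm, map_smul, mul_assoc (star (I.ofBim x))]
      simp only [h, ← Finset.smul_sum, ← map_sum, ← Finset.mul_sum, I.expand']
      rw [inv_smul_smul₀ I.index_ne, star_mul, mul_assoc]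

@[simp] lemma mul_tm (x y : I.bim) : map I.mul (tm x y) = I.toBim (I.ofBim x * I.ofBim y) :=
  I.mulFun_tm x y

lemma dagger_mul (z : I.bim) : map (dagger I.mul) z = (I.index : ℂ)⁻¹ •
    ∑ j, tm (I.toBim (I.ofBim z * I.c j)) (I.toBim (star (I.c j))) := rfl

/-- The inclusion `N → M`. -/
noncomputable def one : unit S.toFactor ⟶ I.bim where
  toFun := I.toBim.toLinearMap ∘ₗ S.incl.toAlgHom.toLinearMap ∘ₗ ofUnit
  adj := toUnit ∘ₗ ((I.index : ℂ) • I.E) ∘ₗ I.ofBim.toLinearMap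
  map_l a x := map_mul S.incl a (ofUnit x)
  map_ra x a := map_mul S.incl (ofUnit x) a
  adj_spec x y := by
    change (I.index : ℂ) • I.E (star (S.incl (ofUnit x)) * I.ofBim y) =
      star (ofUnit x) * ((I.index : ℂ) • I.E (I.ofBim y))
    rw [← map_star, I.E_mul_left, mul_smul_comm]

@[simp] lemma one_apply (a : unit S.toFactor) : map I.one a = I.toBim (S.incl (ofUnit a)) := rfl

lemma comul_comm (y : M.El) :
    ∑ j, tm (I.toBim (y * I.c j)) (I.toBim (star (I.c j))) =
      ∑ j, tm (I.toBim (I.c j)) (I.toBim (star (I.c j) * y)) := by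
  have h1 : ∀ j, I.toBim (y * I.c j) =
      ∑ k, I.bim.ra (I.toBim (I.c k)) (I.E (star (I.c k) * y * I.c j)) := fun j => by
    simp only [bim_ra, ofBim_toBim, ← map_sum, mul_assoc]
    rw [I.expand]
  have h2 : ∀ k, I.toBim (star (I.c k) * y) =
      ∑ j, I.bim.l (I.E (star (I.c k) * y * I.c j)) (I.toBim (star (I.c j))) := fun k => by
    simp only [bim_l, ofBim_toBim, ← map_sum]
    rw [I.expand']
  simp only [h1, h2, sum_tm, tm_sum, ra_tm]
  exact Finset.sum_comm

/-- The Q-system `L²M` of a finite index subfactor `N ⊆ M`. -/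
noncomputable def qSystem : QSystem S.toFactor where
  X := I.bim
  m := I.mul
  i := I.one
  assoc := tensor_ext₃ fun x y z => by
    rw [Bim.map_comp, Bim.map_comp, Bim.map_comp, associator_tm, whiskerRight_tm, whiskerLeft_tm,
      mul_tm, mul_tm, mul_tm, mul_tm, ofBim_toBim, ofBim_toBim, mul_assoc]
  unit_left := tensor_ext fun a x => by
    rw [Bim.map_comp, whiskerRight_tm, leftUnitor_tm, mul_tm, one_apply, bim_l, ofBim_toBim]
  unit_right := tensor_ext fun x a => by
    rw [Bim.map_comp, whiskerLeft_tm, rightUnitor_tm, mul_tm, one_apply, bim_ra, ofBim_toBim]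
  frobenius_right := tensor_ext fun x y => by
    rw [Bim.map_comp, Bim.map_comp, Bim.map_comp, whiskerLeft_tm, mul_tm, dagger_mul, dagger_mul,
      tm_smul, tm_sum, map_smul, map_smul, map_sum, map_sum]
    refine congrArg _ (Finset.sum_congr rfl fun j _ => ?_)
    rw [associator_inv_tm, whiskerRight_tm, mul_tm, ofBim_toBim, ofBim_toBim, mul_assoc]
  frobenius_left := tensor_ext fun x y => by
    rw [Bim.map_comp, Bim.map_comp, Bim.map_comp, whiskerRight_tm, mul_tm, dagger_mul, dagger_mul,
      smul_tm, sum_tm, map_smul, map_smul, map_sum, map_sum]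
    congr 1
    have key := congrArg (fun t => map (I.mul ▷ I.bim) (map (α_ I.bim I.bim I.bim).inv (tm x t)))
      (I.comul_comm (I.ofBim y))
    simp only [tm_sum, map_sum, associator_inv_tm, whiskerRight_tm, mul_tm, ofBim_toBim] at key
    rw [ofBim_toBim]
    simp only [mul_assoc]
    rw [key]
    refine Finset.sum_congr rfl fun j _ => ?_
    rw [associator_tm, whiskerLeft_tm, mul_tm]
    simp
  separable := hom_ext fun z => by
    have h : ∀ j, map I.mul (tm (I.toBim (I.ofBim z * I.c j)) (I.toBim (star (I.c j)))) =
        I.toBim (I.ofBim z * (I.c j * star (I.c j))) := fun j => by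
      rw [mul_tm, ofBim_toBim, ofBim_toBim, mul_assoc]
    rw [Bim.map_comp, dagger_mul, map_smul, map_sum, Finset.sum_congr rfl fun j _ => h j,
      ← map_sum, ← Finset.mul_sum, I.sum_eq, mul_smul_comm, mul_one, map_smul,
      inv_smul_smul₀ I.index_ne]
    rfl

end FiniteIndex

end FiniteIndexSubfactors

/-! ## Unitary braided categories -/

section Dagger

universe v₁ u₁ v₂ u₂

/-- A dagger category. -/
class DaggerCategory (C : Type u₁) [Category.{v₁} C] where
  dag : ∀ {X Y : C}, (X ⟶ Y) → (Y ⟶ X)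
  dag_id : ∀ X : C, dag (𝟙 X) = 𝟙 X
  dag_comp : ∀ {X Y Z : C} (f : X ⟶ Y) (g : Y ⟶ Z), dag (f ≫ g) = dag g ≫ dag f
  dag_dag : ∀ {X Y : C} (f : X ⟶ Y), dag (dag f) = f

variable (C : Type u₁) [Category.{v₁} C] [DaggerCategory C]

variable {C} in
/-- Unitary morphisms. -/
def IsUnitaryHom {X Y : C} (f : X ⟶ Y) : Prop :=
  f ≫ DaggerCategory.dag f = 𝟙 X ∧ DaggerCategory.dag f ≫ f = 𝟙 Y

/-- The tensor product is a dagger functor, and all coherence isomorphisms and the braiding are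
unitary. -/
structure IsUnitaryBraided [MonoidalCategory C] [BraidedCategory C] : Prop where
  dag_tensorHom : ∀ {X Y Z W : C} (f : X ⟶ Y) (g : Z ⟶ W),
    DaggerCategory.dag (f ⊗ₘ g) = DaggerCategory.dag f ⊗ₘ DaggerCategory.dag g
  associator : ∀ X Y Z : C, IsUnitaryHom (α_ X Y Z).hom
  leftUnitor : ∀ X : C, IsUnitaryHom (λ_ X).hom
  rightUnitor : ∀ X : C, IsUnitaryHom (ρ_ X).hom
  braiding : ∀ X Y : C, IsUnitaryHom (β_ X Y).hom

variable {C} {D : Type u₂} [Category.{v₂} D] [DaggerCategory D]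
  [MonoidalCategory C] [MonoidalCategory D] [BraidedCategory C] [BraidedCategory D]

open Functor.LaxMonoidal in
/-- A braided functor is a braided unitary equivalence if it is an equivalence of categories that
preserves the dagger, and its tensorator and its unit morphism are unitary. -/
structure IsBraidedUnitaryEquivalence (F : C ⥤ D) [F.Braided] : Prop where
  isEquivalence : F.IsEquivalence
  map_dag : ∀ {X Y : C} (f : X ⟶ Y),
    F.map (DaggerCategory.dag f) = DaggerCategory.dag (F.map f)
  unitary_μ : ∀ X Y : C, IsUnitaryHom (μ F X Y)
  unitary_ε : IsUnitaryHom (ε F)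

end Dagger

/-! ## The braided categories `χ̃(A)` and `χ̃(A)_Q^loc` -/

section Main

variable {H : Type u} [NormedAddCommGroup H] [InnerProductSpace ℂ H] [CompleteSpace H]
  {A : IIOneFactor H}

open Bim Functor.LaxMonoidal

noncomputable instance : DaggerCategory (Chi A) where
  dag f := ObjectProperty.homMk (dagger f.hom)
  dag_id _ := rfl
  dag_comp _ _ := rfl
  dag_dag _ := rfl

noncomputable instance (Q : QSystem A) : DaggerCategory (LocMod Q) where
  dag f := LocMod.daggerHom f
  dag_id _ := rfl
  dag_comp _ _ := rfl
  dag_dag _ := rfl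

variable (A) in
/-- The statement that `χ̃(A)` is closed under `⊠` and is a unitary braided category with the
braiding `u_{X,Y}`.  All structure is determined: the only datum is the braiding, and it is given
by the limit formula. -/
class ChiBraiding where
  [mon : (chi A).IsMonoidal]
  [br : BraidedCategory (Chi A)]
  isBraiding : ∀ X Y : Chi A, IsBraiding X.obj Y.obj (braid X.obj Y.obj)
  hom_eq : ∀ X Y : Chi A, (β_ X Y).hom.hom = braid X.obj Y.obj
  unitary : IsUnitaryBraided (Chi A)

attribute [instance] ChiBraiding.mon

attribute [reducible, instance] ChiBraiding.br

/-- The relative tensor product `⊗_Q` and the braiding of the category of local `Q`-modules.  The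
lax structure `π = μ` of the forgetful functor consists of the quotient maps
`π : X ⊠ Y → X ⊗_Q Y`, which are coisometries onto the image of the projection
`(ρ_X ⊠ 1)(1 ⊠ λ_Y†)`; the unit object is `Q`, and the action, the coherence isomorphisms and the
braiding are those induced along `π`.  This determines the structure up to unique unitary
isomorphism. -/
class LocalTensor [ChiBraiding A] (Q : QSystem A) where
  [mon : MonoidalCategory (LocMod Q)]
  [br : BraidedCategory (LocMod Q)]
  unitary : IsUnitaryBraided (LocMod Q)
  /-- The coherence isomorphisms and the braiding are induced by those of `χ̃(A)`. -/
  [lax : (LocMod.forget Q).LaxBraided]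
  coisometry : ∀ X Y : LocMod Q,
    dagger (μ (LocMod.forget Q) X Y).hom ≫ (μ (LocMod.forget Q) X Y).hom = 𝟙 (X ⊗ Y).X
  projection : ∀ X Y : LocMod Q,
    (μ (LocMod.forget Q) X Y).hom ≫ dagger (μ (LocMod.forget Q) X Y).hom =
      X.X ◁ dagger Y.leftAct ≫ (α_ X.X Q.X Y.X).inv ≫ X.act ▷ Y.X
  action : ∀ X Y : LocMod Q,
    (μ (LocMod.forget Q) X Y).hom ▷ Q.X ≫ (X ⊗ Y).act =
      (α_ X.X Y.X Q.X).hom ≫ X.X ◁ Y.act ≫ (μ (LocMod.forget Q) X Y).hom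
  /-- The unit object is `Q`, with the right action and the unit map of `Q`. -/
  unitEquiv : (𝟙_ (LocMod Q)).X ⟶ Q.X
  unit_unitary : unitEquiv ≫ dagger unitEquiv = 𝟙 _ ∧ dagger unitEquiv ≫ unitEquiv = 𝟙 _
  unit_action : (𝟙_ (LocMod Q)).act ≫ unitEquiv = unitEquiv ▷ Q.X ≫ Q.m
  unit_map : (ε (LocMod.forget Q)).hom ≫ unitEquiv = Q.i

attribute [reducible, instance] LocalTensor.mon LocalTensor.br LocalTensor.lax

/-- The functor `F : χ̃(N)_Q^loc → χ̃(M)` is realization, `X ↦ |X|`: up to the natural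
identification `θ`, the space `|X|` is `X` itself, with the right and the left action of
`M = |Q|` given by the right and the left action of `Q`, with the `M`-valued inner product
`⟨x₁|x₂⟩_M = (x₁† ⊠ 1) ρ†(x₂)`, and with the tensorator `|x| ⊠ |y| ↦ |π(x ⊠ y)|`. -/
structure IsRealization {M : IIOneFactor H} {S : Subfactor M} (I : FiniteIndex S)
    [ChiBraiding S.toFactor] [ChiBraiding M] [LocalTensor I.qSystem]
    (F : LocMod I.qSystem ⥤ Chi M) [F.Braided]
    (θ : ∀ X : LocMod I.qSystem, X.X ≃ₗ[ℂ] (F.obj X).obj) : Prop where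
  natural : ∀ {X Y : LocMod I.qSystem} (f : X ⟶ Y) (x : X.X),
    θ Y (map (LocMod.Hom.hom f) x) = map (F.map f).hom (θ X x)
  right : ∀ (X : LocMod I.qSystem) (x : X.X) (q : M.El),
    θ X (map X.act (tm x (I.toBim q))) = (F.obj X).obj.ra (θ X x) q
  left : ∀ (X : LocMod I.qSystem) (q : M.El) (x : X.X),
    θ X (map X.leftAct (tm (I.toBim q) x)) = (F.obj X).obj.l q (θ X x)
  inner : ∀ (X : LocMod I.qSystem) (x y : X.X),
    (F.obj X).obj.ip (θ X x) (θ X y) = I.ofBim (contract x (map (dagger X.act) y))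
  tensorator : ∀ (X Y : LocMod I.qSystem) (x : X.X) (y : Y.X),
    map (μ F X Y).hom (tm (θ X x) (θ Y y)) =
      θ (X ⊗ Y) (map (μ (LocMod.forget I.qSystem) X Y).hom (tm x y))
  unitor : map (ε F).hom (toUnit 1) =
    θ (𝟙_ (LocMod I.qSystem)) (map (ε (LocMod.forget I.qSystem)).hom (toUnit 1))

end Main

end LocalExt

open LocalExt LocalExt.Bim

/-! Realization and its inverse leave the underlying space alone. A local module X and an M-bimodule
Z are turned into one another by trading the N-valued inner product for the M-valued one, with
⟨x|y⟩_N = [M : N] E(⟨x|y⟩_M). Once both constructions are known to land in the right categories,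
full faithfulness, essential surjectivity and unitarity are formal. The content is that the left
action of a local module is a normal *-action commuting with the right one, and that approximate
innerness, central triviality and dualizability pass in both directions.

The tool is an asymptotic description of the braiding. Call a bounded sequence of vectors central if
it commutes with A up to ‖·‖₂-null sequences. For X approximately inner and Y centrally trivial,
u_{X,Y} is the right linear map with u(x_n ⊠ y) - y ⊠ x_n → 0 for all central (x_n) and all y
(`exists_br`, `br_braid`). An approximately inner basis consists of central sequences, so right
linear maps on X ⊠ Y may be compared on such x_n ⊠ y (`IsAIBasis.ext`). Naturality, unitarity and
the hexagons follow by flipping tensors.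

In these terms, commutativity of Q makes every bounded sequence of M that asymptotically commutes
with N asymptotically commute with M (`Comm.isCentralSeq`), and central triviality of Q makes
central sequences of N central in M. For a local module, λ = ρ u_{Q,X} gives q_n x - x q_n → 0 for
central sequences (q_n) of M (`Comm.lam_br`), and λ = ρ u_{X,Q}† gives q x_n - x_n q → 0 for
N-central (x_n) and every q ∈ M (`Comm.lam_br'`). Through the first relation the algebra of λ
reduces to that of ρ (`Comm.lam_rho`, `Comm.lam_mul`, `Comm.ip_lam`), and |X| is centrally trivial.
Through the second an approximately inner basis of X stays one for |X|. Conversely, for Z ∈ χ̃(M)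
the products b_i q_j of approximately inner bases of Z and of Q form an M-central approximately
inner basis of the restriction (`Comm.exists_isAIBasis_res`), and this makes the restriction local.

All of this needs null times bounded to be null on both sides. On the left, ‖a x‖₂ ≤ D ‖x‖ ‖a‖₂
holds because a ↦ ∑ tr⟨b_i|a b_i⟩ is a normal trace, hence a multiple of tr by averaging over
unitaries (`IIOneFactor.tracial_eq`, `exists_norm2_l_bound`).

For dualizability, the dual Y of X in χ̃(N) inherits a right action of M that need not respect the
inner product of Y. The module embeds into the free module Y ⊠ Q, and pulling back that inner
product repairs the defect. Finite dimensionality of End(Y) turns the embedding into one with an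
orthogonal range projection (`exists_projection`). The repaired dual is local, and the pairing lifts
to an M-valued one (`Comm.exists_exactPairing`). One-sided duals suffice because the ambient
category is braided.

Finally X ⊗_Q Y is taken to be the restriction of |X| ⊠_M |Y|, with all structure transported along
realization. The map π is the quotient X ⊠_N Y → X ⊠_M Y, whose adjoint is computed with a
Pimsner-Popa basis (`dagger_quot`). The braidings over N and M match under π because N-central
sequences of a local module are M-central (`braid_quot`). -/

namespace LocalExt

/-! ## Square roots, traces and norms in a II₁ factor -/

section Factor

variable {H : Type u} [NormedAddCommGroup H] [InnerProductSpace ℂ H] [CompleteSpace H]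

namespace IIOneFactor

variable (A : IIOneFactor H)

/-- An operator that commutes with the commutant of `A` belongs to `A`. -/
lemma mem_of_commute {T : H →L[ℂ] H}
    (h : ∀ y : H →L[ℂ] H, (∀ g ∈ A.alg, g * y = y * g) → T * y = y * T) : T ∈ A.alg := by
  rw [← VonNeumannAlgebra.commutant_commutant A.alg, VonNeumannAlgebra.mem_commutant_iff]
  intro g hg
  rw [VonNeumannAlgebra.mem_commutant_iff] at hg
  exact (h g hg).symm

/-- Positive elements of `A` have a square root in their bicommutant. -/
lemma exists_sqrt_commute (a : A.El) (ha : (a : H →L[ℂ] H).IsPositive) :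
    ∃ c : A.El, star c = c ∧ c * c = a ∧ ∀ y : A.El, a * y = y * a → c * y = y * c := by
  have h0 : 0 ≤ (a : H →L[ℂ] H) := (ContinuousLinearMap.nonneg_iff_isPositive _).2 ha
  have hcomm : ∀ y : H →L[ℂ] H, (a : H →L[ℂ] H) * y = y * a →
      CFC.sqrt (a : H →L[ℂ] H) * y = y * CFC.sqrt (a : H →L[ℂ] H) := fun y hy => by
    have h1 : Commute (a : H →L[ℂ] H) y := hy
    exact h1.cfcₙ_nnreal _
  have hm : CFC.sqrt (a : H →L[ℂ] H) ∈ A.alg :=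
    A.mem_of_commute fun y hy => hcomm y (hy _ a.2)
  refine ⟨⟨_, hm⟩, Subtype.ext ?_, Subtype.ext ?_, fun y hy => Subtype.ext ?_⟩
  · exact (CFC.sqrt_nonneg (a : H →L[ℂ] H)).isSelfAdjoint
  · exact CFC.sqrt_mul_sqrt_self (a : H →L[ℂ] H) h0
  · exact hcomm y (congrArg Subtype.val hy)

/-- Positive elements of `A` have a square root in `A`. -/
lemma exists_sqrt (a : A.El) (ha : (a : H →L[ℂ] H).IsPositive) :
    ∃ c : A.El, star c = c ∧ c * c = a := by
  obtain ⟨c, h1, h2, -⟩ := A.exists_sqrt_commute a ha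
  exact ⟨c, h1, h2⟩

lemma tr_pos (a : A.El) (ha : (a : H →L[ℂ] H).IsPositive) : 0 ≤ A.tr a := by
  obtain ⟨c, hc, rfl⟩ := A.exists_sqrt a ha
  have := A.tr_nonneg c
  rwa [hc] at this

/-- Polarization: `tr (star y * y)` is real for y = x, 1 + x and 1 + ix, and comparing imaginary
parts gives the imaginary and the real part of the identity. -/
lemma tr_star (x : A.El) : A.tr (star x) = starRingEnd ℂ (A.tr x) := by
  have h := fun y : A.El => (Complex.nonneg_iff.1 (A.tr_nonneg y)).2
  have h1 := h (1 + x)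
  have h2 := h (1 + Complex.I • x)
  have h3 := h x
  have e1 : star (1 + x) * (1 + x) = 1 + x + star x + star x * x := by
    rw [star_add, star_one]; noncomm_ring
  have e2 : star (1 + Complex.I • x) * (1 + Complex.I • x) =
      1 + Complex.I • x - Complex.I • star x + star x * x := by
    rw [star_add, star_one, star_smul, Complex.star_def, Complex.conj_I, add_mul, mul_add, mul_add,
      smul_mul_smul_comm]
    simp
    abel
  rw [e1] at h1
  rw [e2] at h2
  simp only [map_add, map_sub, map_smul, A.tr_one, smul_eq_mul, Complex.add_im, Complex.sub_im,
    Complex.one_im, Complex.mul_im, Complex.I_re, Complex.I_im, ← h3] at h1 h2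
  apply Complex.ext
  · simp only [Complex.conj_re]; linarith
  · simp only [Complex.conj_im]; linarith

/-- `‖a‖² - a* a` is of the form `c* c` with `c ∈ A`. -/
lemma exists_defect (a : A.El) {K : ℝ} (h : ‖(a : H →L[ℂ] H)‖ ≤ K) :
    ∃ c : A.El, star c * c = ((K ^ 2 : ℝ) : ℂ) • (1 : A.El) - star a * a := by
  have hK : 0 ≤ K := (norm_nonneg _).trans h
  have hp : ((((K ^ 2 : ℝ) : ℂ) • (1 : A.El) - star a * a : A.El) : H →L[ℂ] H).IsPositive := by
    rw [ContinuousLinearMap.isPositive_iff_complex]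
    intro x
    have e : inner ℂ (((((K ^ 2 : ℝ) : ℂ) • (1 : A.El) - star a * a : A.El) : H →L[ℂ] H) x) x =
        (((K ^ 2 * ‖x‖ ^ 2 - ‖(a : H →L[ℂ] H) x‖ ^ 2 : ℝ)) : ℂ) := by
      change inner ℂ (((K ^ 2 : ℝ) : ℂ) • x - (star (a : H →L[ℂ] H)) ((a : H →L[ℂ] H) x)) x = _
      rw [inner_sub_left, inner_smul_left, ContinuousLinearMap.star_eq_adjoint,
        ContinuousLinearMap.adjoint_inner_left, inner_self_eq_norm_sq_to_K,
        inner_self_eq_norm_sq_to_K, Complex.conj_ofReal]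
      push_cast
      rfl
    rw [e]
    refine ⟨by rw [RCLike.re_eq_complex_re, Complex.ofReal_re], ?_⟩
    have h1 : ‖(a : H →L[ℂ] H) x‖ ≤ K * ‖x‖ := ((a : H →L[ℂ] H).le_opNorm x).trans (by gcongr)
    have h2 : ‖(a : H →L[ℂ] H) x‖ ^ 2 ≤ (K * ‖x‖) ^ 2 := by gcongr
    rw [mul_pow] at h2
    rw [RCLike.re_eq_complex_re, Complex.ofReal_re]
    exact sub_nonneg.2 h2
  obtain ⟨c, hc, h2⟩ := A.exists_sqrt _ hp
  exact ⟨c, by rw [hc, h2]⟩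

end IIOneFactor

end Factor

/-! ### The Hilbert norm ‖·‖₂ of a bimodule and its module estimates -/

namespace Bim

variable {H : Type u} [NormedAddCommGroup H] [InnerProductSpace ℂ H] [CompleteSpace H]
  {A : IIOneFactor H}

/-- The pre-Hilbert space structure `tr ⟨x|y⟩` on a bimodule. -/
@[reducible] noncomputable def trCore (X : Bim A) : InnerProductSpace.Core ℂ X where
  inner x y := A.tr (X.ip x y)
  conj_inner_symm x y := by rw [← A.tr_star, X.star_ip]
  re_inner_nonneg x := (Complex.nonneg_iff.1 (A.tr_pos _ (X.ip_pos x))).1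
  add_left x y z := by rw [X.ip_add_left, map_add]
  smul_left x y r := by rw [X.ip_smul_left, map_smul, smul_eq_mul]
  definite x h := by
    obtain ⟨c, hc, h2⟩ := A.exists_sqrt _ (X.ip_pos x)
    apply X.ip_def
    rw [← h2, A.tr_faithful c (by rw [hc, h2]; exact h), mul_zero]

variable (X : Bim A)

lemma norm2_nonneg (x : X) : 0 ≤ X.norm2 x := Real.sqrt_nonneg _

lemma norm2_add_le (x y : X) : X.norm2 (x + y) ≤ X.norm2 x + X.norm2 y :=
  letI := X.trCore.toNormedAddCommGroup
  norm_add_le x y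

lemma norm2_sub_le (x y : X) : X.norm2 (x - y) ≤ X.norm2 x + X.norm2 y :=
  letI := X.trCore.toNormedAddCommGroup
  norm_sub_le x y

lemma norm2_sub_rev (x y : X) : X.norm2 (x - y) = X.norm2 (y - x) :=
  letI := X.trCore.toNormedAddCommGroup
  norm_sub_rev x y

lemma norm2_neg (x : X) : X.norm2 (-x) = X.norm2 x :=
  letI := X.trCore.toNormedAddCommGroup
  norm_neg x

lemma norm2_zero : X.norm2 0 = 0 :=
  letI := X.trCore.toNormedAddCommGroup
  norm_zero (E := X)

lemma eq_zero_of_norm2 {x : X} (h : X.norm2 x = 0) : x = 0 :=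
  letI := X.trCore.toNormedAddCommGroup
  norm_eq_zero.1 h

lemma norm2_sum_le {ι : Type*} (s : Finset ι) (f : ι → X) :
    X.norm2 (∑ i ∈ s, f i) ≤ ∑ i ∈ s, X.norm2 (f i) :=
  letI := X.trCore.toNormedAddCommGroup
  norm_sum_le s f

lemma norm2_smul (c : ℂ) (x : X) : X.norm2 (c • x) = ‖c‖ * X.norm2 x :=
  letI := X.trCore.toNormedAddCommGroup
  letI := InnerProductSpace.ofCore X.trCore.toCore
  norm_smul c x

lemma norm_tr_ip_le (x y : X) : ‖A.tr (X.ip x y)‖ ≤ X.norm2 x * X.norm2 y :=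
  letI := X.trCore.toNormedAddCommGroup
  letI := InnerProductSpace.ofCore X.trCore.toCore
  norm_inner_le_norm (𝕜 := ℂ) x y

lemma tr_ip_self (x : X) : A.tr (X.ip x x) = ((X.norm2 x ^ 2 : ℝ) : ℂ) := by
  have h := A.tr_pos _ (X.ip_pos x)
  rw [norm2, Real.sq_sqrt (Complex.nonneg_iff.1 h).1]
  exact Complex.ext rfl (Complex.nonneg_iff.1 h).2.symm

lemma parallelogram (x y : X) :
    X.norm2 (x + y) ^ 2 + X.norm2 (x - y) ^ 2 = 2 * (X.norm2 x ^ 2 + X.norm2 y ^ 2) :=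
  letI := X.trCore.toNormedAddCommGroup
  letI := InnerProductSpace.ofCore X.trCore.toCore
  parallelogram_law_with_norm ℂ x y

lemma norm2_sq_le_of_re {x : X} {K : ℝ} (h : (A.tr (X.ip x x)).re ≤ K ^ 2) (hK : 0 ≤ K) :
    X.norm2 x ≤ K := Real.sqrt_le_iff.2 ⟨hK, h⟩

/-- The left action is contractive for `‖·‖₂`. -/
lemma norm2_l_le (a : A.El) {K : ℝ} (h : ‖(a : H →L[ℂ] H)‖ ≤ K) (x : X) :
    X.norm2 (X.l a x) ≤ K * X.norm2 x := by
  have hK : 0 ≤ K := (norm_nonneg _).trans h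
  obtain ⟨c, hc⟩ := A.exists_defect a h
  refine X.norm2_sq_le_of_re ?_ (mul_nonneg hK (X.norm2_nonneg x))
  -- As c* c = K² - a* a, the vector c x measures the defect K²⟨x|x⟩ - ⟨ax|ax⟩; nonnegativity of its
  -- trace is the estimate.
  have h1 : X.ip (X.l c x) (X.l c x) =
      ((K ^ 2 : ℝ) : ℂ) • X.ip x x - X.ip (X.l a x) (X.l a x) := by
    rw [X.ip_l, ← X.l_mul, hc, map_sub, LinearMap.sub_apply, X.ip_sub, map_smul,
      LinearMap.smul_apply, X.ip_smul, X.l_one, X.l_mul, ← X.ip_l]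
  have h2 := (Complex.nonneg_iff.1 (A.tr_pos _ (X.ip_pos (X.l c x)))).1
  rw [h1, map_sub, map_smul, X.tr_ip_self x, smul_eq_mul, ← Complex.ofReal_mul, Complex.sub_re,
    Complex.ofReal_re] at h2
  rw [mul_pow]
  linarith

/-- The supremum norm `‖x‖ = ‖⟨x|x⟩‖^{1/2}` on a bimodule. -/
noncomputable def nrm (x : X) : ℝ := Real.sqrt ‖(X.ip x x : H →L[ℂ] H)‖

lemma nrm_nonneg (x : X) : 0 ≤ X.nrm x := Real.sqrt_nonneg _

lemma nrm_sq (x : X) : X.nrm x ^ 2 = ‖(X.ip x x : H →L[ℂ] H)‖ := Real.sq_sqrt (norm_nonneg _)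

/-- Replacing x by ⟨x|x⟩^{1/2} reduces the claim to A itself, where traciality turns right
multiplication by a into left multiplication by a*. -/
lemma norm2_ra_le (x : X) (a : A.El) {K : ℝ} (h : ‖(a : H →L[ℂ] H)‖ ≤ K) :
    X.norm2 (X.ra x a) ≤ K * X.norm2 x := by
  have hK : 0 ≤ K := (norm_nonneg _).trans h
  obtain ⟨c, hc, h2⟩ := A.exists_sqrt _ (X.ip_pos x)
  have e1 : A.tr (X.ip (X.ra x a) (X.ra x a)) =
      A.tr ((unit A).ip ((unit A).l (star a) (toUnit c)) ((unit A).l (star a) (toUnit c))) := by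
    rw [X.ip_ra, X.ip_ra_left, ← h2, unit_l, unit_ip]
    simp only [ofUnit_toUnit, star_mul, star_star, hc]
    rw [A.tr_mul_comm (c * a)]
    simp only [mul_assoc]
  have e2 : A.tr (X.ip x x) = A.tr ((unit A).ip (toUnit c) (toUnit c)) := by
    rw [unit_ip, ← h2]; simp [hc]
  have e3 : X.norm2 (X.ra x a) = (unit A).norm2 ((unit A).l (star a) (toUnit c)) := by
    rw [norm2, norm2, e1]
  have e4 : X.norm2 x = (unit A).norm2 (toUnit c) := by rw [norm2, norm2, e2]
  rw [e3, e4]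
  refine norm2_l_le (unit A) _ ?_ _
  change ‖star (a : H →L[ℂ] H)‖ ≤ K
  rwa [norm_star]

/-- `‖x a‖₂ ≤ ‖x‖ ‖a‖₂`. -/
lemma norm2_ra_le' (x : X) (a : A.El) :
    X.norm2 (X.ra x a) ≤ X.nrm x * (unit A).norm2 (toUnit a) := by
  obtain ⟨c, hc, h2⟩ := A.exists_sqrt _ (X.ip_pos x)
  have e3 : X.norm2 (X.ra x a) = (unit A).norm2 ((unit A).l c (toUnit a)) := by
    rw [norm2, norm2, X.ip_ra, X.ip_ra_left, ← h2, unit_l, unit_ip]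
    simp only [ofUnit_toUnit, star_mul, hc, mul_assoc]
  rw [e3]
  refine norm2_l_le _ _ ?_ _
  rw [nrm, ← h2]
  apply Real.le_sqrt_of_sq_le
  have : ‖(c : H →L[ℂ] H) * (c : H →L[ℂ] H)‖ = ‖(c : H →L[ℂ] H)‖ ^ 2 := by
    conv_lhs => enter [1, 1]; rw [show (c : H →L[ℂ] H) = star (c : H →L[ℂ] H) from
      (congrArg Subtype.val hc).symm]
    rw [CStarRing.norm_star_mul_self, pow_two]
  exact this.ge

lemma norm2_ip_rev (x y : X) :
    (unit A).norm2 (toUnit (X.ip x y)) = (unit A).norm2 (toUnit (X.ip y x)) := by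
  rw [norm2, norm2, unit_ip, unit_ip]
  simp only [ofUnit_toUnit, X.star_ip]
  rw [A.tr_mul_comm]

/-- `‖⟨x|y⟩‖₂ ≤ ‖x‖ ‖y‖₂`. -/
lemma norm2_ip_le (x y : X) : (unit A).norm2 (toUnit (X.ip x y)) ≤ X.nrm x * X.norm2 y := by
  set t := (unit A).norm2 (toUnit (X.ip x y)) with ht
  -- Duality: t² = tr⟨y | x⟨x|y⟩⟩, so Cauchy-Schwarz and `norm2_ra_le'` give a bound linear in t,
  -- and one factor t cancels.
  have h1 : t ^ 2 ≤ X.norm2 y * (X.nrm x * t) := by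
    have e : A.tr (X.ip y (X.ra x (X.ip x y))) = ((t ^ 2 : ℝ) : ℂ) := by
      rw [ht, ← tr_ip_self, unit_ip, X.ip_ra]; simp [X.star_ip]
    have h2 := X.norm_tr_ip_le y (X.ra x (X.ip x y))
    rw [e, Complex.norm_real, Real.norm_of_nonneg (sq_nonneg _)] at h2
    exact h2.trans (mul_le_mul_of_nonneg_left (X.norm2_ra_le' x _) (X.norm2_nonneg y))
  have h0 : 0 ≤ t := norm2_nonneg _ _
  rcases h0.eq_or_lt with h | h
  · rw [← h]; exact mul_nonneg (X.nrm_nonneg x) (X.norm2_nonneg y)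
  · nlinarith

lemma norm2_ip_le' (x y : X) : (unit A).norm2 (toUnit (X.ip x y)) ≤ X.norm2 x * X.nrm y := by
  rw [norm2_ip_rev, mul_comm]; exact X.norm2_ip_le y x

end Bim
end LocalExt

namespace LocalExt

/-! ### Weak limits of bounded sequences, and ‖·‖₂-completeness of balls -/

section WeakLimits

variable {H : Type u} [NormedAddCommGroup H] [InnerProductSpace ℂ H] [CompleteSpace H]

/-- Bounded sequences of operators converge weakly along ultrafilters. -/
lemma exists_weak_limit (T : ℕ → H →L[ℂ] H) {C : ℝ} (hC : ∀ n, ‖T n‖ ≤ C) (f : Ultrafilter ℕ) :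
    ∃ S : H →L[ℂ] H, ‖S‖ ≤ C ∧ ∀ ξ η : H, Tendsto (fun n => inner ℂ ξ (T n η)) f
      (𝓝 (inner ℂ ξ (S η))) := by
  have hC0 : 0 ≤ C := (norm_nonneg _).trans (hC 0)
  have hb : ∀ ξ η n, ‖inner ℂ (T n ξ) η‖ ≤ C * ‖ξ‖ * ‖η‖ := fun ξ η n =>
    (norm_inner_le_norm _ _).trans (mul_le_mul_of_nonneg_right
      (((T n).le_opNorm ξ).trans (mul_le_mul_of_nonneg_right (hC n) (norm_nonneg _)))
      (norm_nonneg _))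
  have hlim : ∀ ξ η, ∃ c : ℂ, ‖c‖ ≤ C * ‖ξ‖ * ‖η‖ ∧
      Tendsto (fun n => inner ℂ (T n ξ) η) f (𝓝 c) := fun ξ η => by
    obtain ⟨c, hc, h⟩ := (isCompact_closedBall (0 : ℂ) (C * ‖ξ‖ * ‖η‖)).ultrafilter_le_nhds
      (f.map fun n => inner ℂ (T n ξ) η) (by
        rw [le_principal_iff]
        rw [Ultrafilter.coe_map]
        exact Filter.mem_map.2 (Filter.univ_mem' fun n => by simpa using hb ξ η n))
    exact ⟨c, by simpa using hc, h⟩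
  choose c hc ht using hlim
  have huniq : ∀ {g : ℕ → ℂ} {a b : ℂ}, Tendsto g f (𝓝 a) → Tendsto g f (𝓝 b) → a = b :=
    fun h1 h2 => tendsto_nhds_unique h1 h2
  -- Limits along an ultrafilter exist for all pairs of vectors at once and are unique. Hence the
  -- limit form is sesquilinear and bounded by C, and S is the operator representing it.
  let B : H →ₗ⋆[ℂ] H →ₗ[ℂ] ℂ := LinearMap.mk₂'ₛₗ _ _ c
    (fun x y z => huniq (ht _ _) (by simpa [inner_add_left] using (ht x z).add (ht y z)))
    (fun a x z => huniq (ht _ _)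
      (by simpa [inner_smul_left, mul_comm] using (ht x z).const_mul (starRingEnd ℂ a)))
    (fun x y z => huniq (ht _ _) (by simpa [inner_add_right] using (ht x y).add (ht x z)))
    (fun a x z => huniq (ht _ _) (by simpa [inner_smul_right] using (ht x z).const_mul _))
  let B' := B.mkContinuous₂ C hc
  refine ⟨InnerProductSpace.continuousLinearMapOfBilin B', ?_, fun ξ η => ?_⟩
  · refine ContinuousLinearMap.opNorm_le_bound _ hC0 fun ξ => ?_
    set S := InnerProductSpace.continuousLinearMapOfBilin B' with hS
    have h1 : inner ℂ (S ξ) (S ξ) = c ξ (S ξ) :=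
      InnerProductSpace.continuousLinearMapOfBilin_apply B' ξ (S ξ)
    have h2 := hc ξ (S ξ)
    rw [← h1, inner_self_eq_norm_sq_to_K, norm_pow] at h2
    simp only [Complex.coe_algebraMap, Complex.norm_real, norm_norm] at h2
    rcases (norm_nonneg (S ξ)).eq_or_lt with h | h
    · rw [← h]; positivity
    · nlinarith
  · have h1 := (ht η ξ).star
    have h2 : star (c η ξ) = inner ℂ ξ (InnerProductSpace.continuousLinearMapOfBilin B' η) := by
      rw [show c η ξ = inner ℂ (InnerProductSpace.continuousLinearMapOfBilin B' η) ξ from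
        (InnerProductSpace.continuousLinearMapOfBilin_apply B' η ξ).symm]
      exact inner_conj_symm _ _
    rw [h2] at h1
    refine h1.congr fun n => ?_
    exact inner_conj_symm _ _

namespace IIOneFactor

variable (A : IIOneFactor H)

/-- The unit ball of `A` is weakly closed. -/
lemma exists_weak_limit (a : ℕ → A.El) {C : ℝ} (hC : ∀ n, ‖(a n : H →L[ℂ] H)‖ ≤ C)
    (f : Ultrafilter ℕ) :
    ∃ s : A.El, ‖(s : H →L[ℂ] H)‖ ≤ C ∧ ∀ ξ η : H,
      Tendsto (fun n => inner ℂ ξ ((a n : H →L[ℂ] H) η)) f (𝓝 (inner ℂ ξ ((s : H →L[ℂ] H) η))) := by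
  obtain ⟨S, hS, h⟩ := LocalExt.exists_weak_limit (fun n => (a n : H →L[ℂ] H)) hC f
  have hm : S ∈ A.alg := A.mem_of_commute fun y hy => by
    ext η
    refine ext_inner_left ℂ fun ξ => ?_
    have h1 := h ξ (y η)
    have h2 := h (ContinuousLinearMap.adjoint y ξ) η
    simp only [ContinuousLinearMap.adjoint_inner_left] at h2
    refine tendsto_nhds_unique h1 (h2.congr fun n => ?_)
    have := congrArg (fun t : H →L[ℂ] H => t η) (hy _ (a n).2)
    exact congrArg (inner ℂ ξ) this.symm
  exact ⟨⟨S, hm⟩, hS, h⟩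

/-- Weak continuity of the trace on bounded sets. -/
lemma tendsto_tr {f : Filter ℕ} (a : ℕ → A.El) {C : ℝ} (hC : ∀ n, ‖(a n : H →L[ℂ] H)‖ ≤ C)
    {s : A.El} (h : ∀ ξ η : H,
      Tendsto (fun n => inner ℂ ξ ((a n : H →L[ℂ] H) η)) f (𝓝 (inner ℂ ξ ((s : H →L[ℂ] H) η)))) :
    Tendsto (fun n => A.tr (a n)) f (𝓝 (A.tr s)) := by
  obtain ⟨ξ, η, h1, h2, h3⟩ := A.tr_normal
  simp only [fun x => (h3 x).tsum_eq.symm]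
  refine tendsto_tsum_of_dominated_convergence (bound := fun k => C * (‖ξ k‖ ^ 2 + ‖η k‖ ^ 2))
    ((h1.add h2).mul_left C) (fun k => h _ _) (Eventually.of_forall fun n k => ?_)
  have hC0 : 0 ≤ C := (norm_nonneg _).trans (hC 0)
  calc _ ≤ ‖ξ k‖ * ‖(a n : H →L[ℂ] H) (η k)‖ := norm_inner_le_norm _ _
    _ ≤ ‖ξ k‖ * (C * ‖η k‖) := by
        gcongr
        exact ((a n : H →L[ℂ] H).le_opNorm _).trans (by gcongr; exact hC n)
    _ ≤ _ := by
        nlinarith [mul_nonneg hC0 (sq_nonneg (‖ξ k‖ - ‖η k‖)), mul_nonneg hC0 (sq_nonneg ‖ξ k‖),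
          mul_nonneg hC0 (sq_nonneg ‖η k‖)]

lemma norm_mul_coe_le (a b : A.El) :
    ‖((a * b : A.El) : H →L[ℂ] H)‖ ≤ ‖(a : H →L[ℂ] H)‖ * ‖(b : H →L[ℂ] H)‖ := norm_mul_le _ _

lemma norm_star_coe (a : A.El) : ‖((star a : A.El) : H →L[ℂ] H)‖ = ‖(a : H →L[ℂ] H)‖ :=
  norm_star (a : H →L[ℂ] H)

lemma norm2_nonneg (a : A.El) : 0 ≤ A.norm2 a := Real.sqrt_nonneg _

lemma norm2_add_le (a b : A.El) : A.norm2 (a + b) ≤ A.norm2 a + A.norm2 b :=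
  Bim.norm2_add_le (unit A) (toUnit a) (toUnit b)

lemma norm2_sub_le (a b : A.El) : A.norm2 (a - b) ≤ A.norm2 a + A.norm2 b :=
  Bim.norm2_sub_le (unit A) (toUnit a) (toUnit b)

/-- Left multiplication preserves weak convergence. -/
lemma tendsto_weak_mul_left {f : Filter ℕ} {a : ℕ → A.El} {s : A.El} (b : A.El) (h : ∀ ξ η : H,
      Tendsto (fun n => inner ℂ ξ ((a n : H →L[ℂ] H) η)) f (𝓝 (inner ℂ ξ ((s : H →L[ℂ] H) η))))
    (ξ η : H) : Tendsto (fun n => inner ℂ ξ (((b * a n : A.El) : H →L[ℂ] H) η)) f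
      (𝓝 (inner ℂ ξ (((b * s : A.El) : H →L[ℂ] H) η))) := by
  have := h (ContinuousLinearMap.adjoint (b : H →L[ℂ] H) ξ) η
  simp only [ContinuousLinearMap.adjoint_inner_left] at this
  exact this

/-- Bounded sequences that tend to `0` in `‖·‖₂` tend to `0` weakly. -/
lemma weakNull_of_norm2 (a : ℕ → A.El) {C : ℝ} (hC : ∀ n, ‖(a n : H →L[ℂ] H)‖ ≤ C)
    (h : Tendsto (fun n => A.norm2 (a n)) atTop (𝓝 0)) : WeakNull a := by
  intro ξ η
  rw [tendsto_iff_ultrafilter]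
  intro f hf
  obtain ⟨s, hs, hlim⟩ := A.exists_weak_limit a hC f
  -- For a weak limit s, tr(s* s) = lim tr(s* a_n), and Cauchy-Schwarz sends the right side to 0;
  -- faithfulness gives s = 0.
  have h1 := A.tendsto_tr (fun n => star s * a n) (C := ‖((star s : A.El) : H →L[ℂ] H)‖ * C)
    (fun n => (A.norm_mul_coe_le _ _).trans
      (mul_le_mul_of_nonneg_left (hC n) (norm_nonneg _)))
    (A.tendsto_weak_mul_left (star s) hlim)
  have h2 : Tendsto (fun n => A.tr (star s * a n)) atTop (𝓝 0) := by
    refine squeeze_zero_norm (fun n => norm_tr_ip_le (unit A) (toUnit s) (toUnit (a n))) ?_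
    have := h.const_mul ((unit A).norm2 (toUnit s))
    rw [mul_zero] at this
    exact this
  have h3 := A.tr_faithful s (tendsto_nhds_unique h1 (h2.mono_left hf))
  have h4 := hlim ξ η
  rw [h3] at h4
  simpa using h4

lemma tendsto_tr_of_weakNull (a : ℕ → A.El) {C : ℝ} (hC : ∀ n, ‖(a n : H →L[ℂ] H)‖ ≤ C)
    (h : WeakNull a) : Tendsto (fun n => A.tr (a n)) atTop (𝓝 0) := by
  have := A.tendsto_tr a hC (s := 0) (f := atTop) (fun ξ η => by simpa using h ξ η)
  simpa using this

/-- Balls of `A` are complete for `‖·‖₂`. -/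
lemma exists_norm2_limit (a : ℕ → A.El) {C : ℝ} (hC : ∀ n, ‖(a n : H →L[ℂ] H)‖ ≤ C)
    (h : ∀ ε > 0, ∃ N, ∀ m ≥ N, ∀ n ≥ N, A.norm2 (a m - a n) ≤ ε) :
    ∃ s : A.El, ‖(s : H →L[ℂ] H)‖ ≤ C ∧
      Tendsto (fun n => A.norm2 (a n - s)) atTop (𝓝 0) := by
  obtain ⟨s, hs, hlim⟩ := A.exists_weak_limit a hC (hyperfilter ℕ)
  refine ⟨s, hs, ?_⟩
  have hle : (hyperfilter ℕ : Filter ℕ) ≤ atTop := by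
    rw [← Nat.cofinite_eq_atTop]; exact hyperfilter_le_cofinite
  have key : ∀ ε > 0, ∃ N, ∀ n ≥ N, A.norm2 (a n - s) ≤ ε := fun ε hε => by
    obtain ⟨N, hN⟩ := h ε hε
    refine ⟨N, fun n hn => ?_⟩
    -- With n fixed, ‖d‖₂² = lim_m tr(d* (a_m - a_n)) ≤ ‖d‖₂ ε, so the weak limit is also the
    -- ‖·‖₂-limit.
    set d := s - a n with hd
    have hdl : ∀ ξ η : H, Tendsto (fun m => inner ℂ ξ (((a m - a n : A.El) : H →L[ℂ] H) η))
        (hyperfilter ℕ) (𝓝 (inner ℂ ξ ((d : H →L[ℂ] H) η))) := fun ξ η => by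
      have := (hlim ξ η).sub_const (inner ℂ ξ ((a n : H →L[ℂ] H) η))
      simpa [hd, inner_sub_right] using this
    have h1 := A.tendsto_tr (fun m => star d * (a m - a n))
      (C := ‖((star d : A.El) : H →L[ℂ] H)‖ * (C + C))
      (fun m => (A.norm_mul_coe_le _ _).trans (mul_le_mul_of_nonneg_left
        ((norm_sub_le (a m : H →L[ℂ] H) _).trans (add_le_add (hC m) (hC n))) (norm_nonneg _)))
      (A.tendsto_weak_mul_left (star d) hdl)
    have h2 : ‖A.tr (star d * d)‖ ≤ A.norm2 d * ε := by
      refine le_of_tendsto h1.norm ?_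
      have : ∀ᶠ m in (hyperfilter ℕ : Filter ℕ), N ≤ m := hle (eventually_ge_atTop N)
      filter_upwards [this] with m hm
      exact (norm_tr_ip_le (unit A) (toUnit d) (toUnit (a m - a n))).trans
        (mul_le_mul_of_nonneg_left (hN m hm n hn) (A.norm2_nonneg _))
    have h3 : A.tr (star d * d) = ((A.norm2 d ^ 2 : ℝ) : ℂ) := tr_ip_self (unit A) (toUnit d)
    rw [h3, Complex.norm_real, Real.norm_of_nonneg (sq_nonneg _)] at h2
    have h4 : A.norm2 (a n - s) = A.norm2 d := norm2_sub_rev (unit A) (toUnit (a n)) (toUnit s)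
    rw [h4]
    have h0 : 0 ≤ A.norm2 d := A.norm2_nonneg d
    rcases h0.eq_or_lt with h5 | h5
    · rw [← h5]; exact hε.le
    · nlinarith
  rw [Metric.tendsto_atTop]
  intro ε hε
  obtain ⟨N, hN⟩ := key (ε / 2) (by positivity)
  refine ⟨N, fun n hn => ?_⟩
  rw [Real.dist_0_eq_abs, abs_of_nonneg (A.norm2_nonneg _)]
  exact (hN n hn).trans_lt (by linarith)

/-! ### Uniqueness of the trace -/

/-- An element that commutes with all unitaries of `A` is central. -/
lemma comm_of_unitary {k : A.El} (h : ∀ v : A.El, star v * v = 1 → v * star v = 1 → v * k = k * v)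
    (y : A.El) : y * k = k * y := by
  -- A selfadjoint contraction y is the real part of the unitary y + i(1 - y²)^{1/2}; the root lies
  -- in the bicommutant of 1 - y², hence commutes with y.
  have hsa : ∀ y : A.El, star y = y → ‖(y : H →L[ℂ] H)‖ ≤ 1 → y * k = k * y := fun y hy hn => by
    obtain ⟨c, hc⟩ := A.exists_defect y hn
    obtain ⟨d, hd, hdd, hcomm⟩ := A.exists_sqrt_commute (star c * c)
      (ContinuousLinearMap.isPositive_adjoint_comp_self (c : H →L[ℂ] H))
    have hc' : star c * c = 1 - y * y := by rw [hc, hy]; simp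
    rw [hc'] at hdd hcomm
    have hdy : d * y = y * d := hcomm y (by noncomm_ring)
    set v := y + Complex.I • d with hv
    have hsv : star v = y - Complex.I • d := by
      rw [hv, star_add, star_smul, hy, hd, Complex.star_def, Complex.conj_I, neg_smul,
        sub_eq_add_neg]
    have e1 : star v * v = 1 := by
      rw [hsv, hv, sub_mul, mul_add, mul_add, smul_mul_smul_comm, Complex.I_mul_I, hdd,
        smul_mul_assoc, mul_smul_comm, hdy, neg_one_smul]
      abel
    have e2 : v * star v = 1 := by
      rw [hsv, hv, add_mul, mul_sub, mul_sub, smul_mul_smul_comm, Complex.I_mul_I, hdd,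
        smul_mul_assoc, mul_smul_comm, hdy, neg_one_smul]
      abel
    have h1 := h v e1 e2
    have h2 := h (star v) (by rw [star_star, e2]) (by rw [star_star, e1])
    have e3 : y = (2 : ℂ)⁻¹ • (v + star v) := by
      rw [hsv, hv, add_add_sub_cancel, ← two_smul ℂ y, inv_smul_smul₀ two_ne_zero]
    rw [e3, smul_mul_assoc, mul_smul_comm, add_mul, mul_add, h1, h2]
  have hsa' : ∀ y : A.El, star y = y → y * k = k * y := fun y hy => by
    -- The summand 1 keeps the scaling factor nonzero.
    set r : ℝ := ‖(y : H →L[ℂ] H)‖ + 1 with hr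
    have hr0 : 0 < r := by positivity
    have h1 := hsa (((r⁻¹ : ℝ) : ℂ) • y) (by
      rw [star_smul, hy, Complex.star_def, Complex.conj_ofReal]) (by
      change ‖((r⁻¹ : ℝ) : ℂ) • (y : H →L[ℂ] H)‖ ≤ 1
      rw [norm_smul, Complex.norm_real, Real.norm_of_nonneg (by positivity), inv_mul_le_one₀ hr0]
      linarith)
    rw [smul_mul_assoc, mul_smul_comm] at h1
    have hne : (((r⁻¹ : ℝ) : ℂ)) ≠ 0 := Complex.ofReal_ne_zero.2 (by positivity)
    exact smul_right_injective _ hne h1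
  have h1 := hsa' (y + star y) (by rw [star_add, star_star, add_comm])
  have h2 := hsa' (Complex.I • (y - star y)) (by
    rw [star_smul, star_sub, star_star, Complex.star_def, Complex.conj_I, neg_smul, ← smul_neg,
      neg_sub])
  rw [smul_mul_assoc, mul_smul_comm] at h2
  have h3 := smul_right_injective _ Complex.I_ne_zero h2
  have e : y = (2 : ℂ)⁻¹ • ((y + star y) + (y - star y)) := by
    rw [add_add_sub_cancel, ← two_smul ℂ y, inv_smul_smul₀ two_ne_zero]
  rw [e, smul_mul_assoc, mul_smul_comm, add_mul, mul_add, h1, h3]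

/-- The averages of the conjugates of `x` by unitaries. -/
inductive Average (x : A.El) : A.El → Prop
  | base : Average x x
  | mid {a b : A.El} : Average x a → Average x b → Average x ((2 : ℂ)⁻¹ • (a + b))
  | conj {a : A.El} (v : A.El) : star v * v = 1 → v * star v = 1 → Average x a →
      Average x (v * a * star v)

variable {A}

lemma norm_le_one_of_unitary {v : A.El} (h : star v * v = 1) : ‖(v : H →L[ℂ] H)‖ ≤ 1 := by
  have h1 : star (v : H →L[ℂ] H) * v = 1 := congrArg Subtype.val h
  have h2 := CStarRing.norm_star_mul_self (x := (v : H →L[ℂ] H))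
  rw [h1] at h2
  have h3 : ‖(1 : H →L[ℂ] H)‖ ≤ 1 := ContinuousLinearMap.norm_id_le
  nlinarith [norm_nonneg (v : H →L[ℂ] H)]

lemma Average.norm_le {x k : A.El} (h : A.Average x k) :
    ‖(k : H →L[ℂ] H)‖ ≤ ‖(x : H →L[ℂ] H)‖ := by
  induction h with
  | base => exact le_rfl
  | @mid a b _ _ ha hb =>
    change ‖(2 : ℂ)⁻¹ • ((a : H →L[ℂ] H) + b)‖ ≤ _
    rw [norm_smul, norm_inv, Complex.norm_ofNat]
    have := norm_add_le (a : H →L[ℂ] H) b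
    linarith
  | @conj a v h1 h2 _ ha =>
    refine (A.norm_mul_coe_le _ _).trans ?_
    rw [A.norm_star_coe]
    have h3 := norm_le_one_of_unitary h1
    calc _ ≤ (1 * ‖(x : H →L[ℂ] H)‖) * 1 := by
          gcongr
          exact (A.norm_mul_coe_le _ _).trans (by gcongr)
      _ = _ := by ring

lemma Average.apply_eq {x k : A.El} (h : A.Average x k) (φ : A.El →ₗ[ℂ] ℂ)
    (hφ : ∀ a b, φ (a * b) = φ (b * a)) : φ k = φ x := by
  induction h with
  | base => rfl
  | mid _ _ ha hb => rw [map_smul, map_add, ha, hb, ← two_smul ℂ, inv_smul_smul₀ two_ne_zero]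
  | conj v h1 h2 _ ha => rw [hφ, ← mul_assoc, h1, one_mul, ha]

variable (A)

/-- Averages of conjugates of `x` approximate the scalar `tr x`. -/
lemma exists_average (x : A.El) : ∃ k : ℕ → A.El, (∀ n, A.Average x (k n)) ∧
    Tendsto (fun n => A.norm2 (k n - A.tr x • 1)) atTop (𝓝 0) := by
  -- Minimize ‖·‖₂ over the averages. Midpoints are averages, so by the parallelogram law
  -- near-minimizers are close to one another, a minimizing sequence is Cauchy, and it converges in
  -- A because averages are bounded by ‖x‖. The limit commutes with all unitaries, hence is scalar,
  -- and the scalar is tr x since averaging preserves the trace.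
  set S : Set ℝ := {t | ∃ k, A.Average x k ∧ t = A.norm2 k} with hS
  have hne : S.Nonempty := ⟨_, x, .base, rfl⟩
  have hbdd : BddBelow S := ⟨0, by rintro _ ⟨k, -, rfl⟩; exact Real.sqrt_nonneg _⟩
  set d := sInf S with hd
  have hd0 : 0 ≤ d := le_csInf hne (by rintro _ ⟨k, -, rfl⟩; exact Real.sqrt_nonneg _)
  have hclose : ∀ (ε : ℝ) (k k' : A.El), A.Average x k → A.Average x k' →
      A.norm2 k ≤ d + ε → A.norm2 k' ≤ d + ε → A.norm2 (k - k') ^ 2 ≤ 4 * (ε * (2 * d + ε)) := by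
    intro ε k k' hk hk' h1 h2
    have h3 : d ≤ A.norm2 ((2 : ℂ)⁻¹ • (k + k')) := csInf_le hbdd ⟨_, hk.mid hk', rfl⟩
    have h4 : A.norm2 ((2 : ℂ)⁻¹ • (k + k')) = 2⁻¹ * A.norm2 (k + k') := by
      have := norm2_smul (unit A) ((2 : ℂ)⁻¹) (toUnit (k + k'))
      rw [norm_inv, Complex.norm_ofNat] at this
      exact this
    have h5 : A.norm2 (k + k') ^ 2 + A.norm2 (k - k') ^ 2 = 2 * (A.norm2 k ^ 2 + A.norm2 k' ^ 2) :=
      parallelogram (unit A) (toUnit k) (toUnit k')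
    have h6 : 0 ≤ A.norm2 k := Real.sqrt_nonneg _
    have h7 : 0 ≤ A.norm2 k' := Real.sqrt_nonneg _
    have h8 : A.norm2 k ^ 2 ≤ (d + ε) ^ 2 := pow_le_pow_left₀ h6 h1 2
    have h9 : A.norm2 k' ^ 2 ≤ (d + ε) ^ 2 := pow_le_pow_left₀ h7 h2 2
    have h10 : (2 * d) ^ 2 ≤ A.norm2 (k + k') ^ 2 := by
      apply pow_le_pow_left₀ (by positivity); linarith
    nlinarith
  have hex : ∀ n : ℕ, ∃ k, A.Average x k ∧ A.norm2 k ≤ d + 1 / ((n : ℝ) + 1) := fun n => by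
    obtain ⟨_, ⟨k, hk, rfl⟩, h⟩ := exists_lt_of_csInf_lt hne
      (lt_add_of_pos_right (sInf S) (Nat.one_div_pos_of_nat (α := ℝ) (n := n)))
    exact ⟨k, hk, h.le⟩
  choose k hk hkd using hex
  have hlim0 : Tendsto (fun n : ℕ => 4 * ((1 / ((n : ℝ) + 1)) * (2 * d + 1 / ((n : ℝ) + 1))))
      atTop (𝓝 0) := by
    have h1 := tendsto_one_div_add_atTop_nhds_zero_nat (𝕜 := ℝ)
    have := ((h1.mul (h1.const_add (2 * d))).const_mul 4)
    simpa using this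
  have hsmall : ∀ ε > 0, ∃ N : ℕ, ∀ n ≥ N, ∀ l l' : A.El, A.Average x l → A.Average x l' →
      A.norm2 l ≤ d + 1 / ((n : ℝ) + 1) → A.norm2 l' ≤ d + 1 / ((n : ℝ) + 1) →
      A.norm2 (l - l') ≤ ε := fun ε hε => by
    obtain ⟨N, hN⟩ := (hlim0.eventually (gt_mem_nhds (show (0 : ℝ) < ε ^ 2 by positivity))).exists_forall_of_atTop
    exact ⟨N, fun n hn l l' h1 h2 h3 h4 =>
      abs_le_of_sq_le_sq' ((hclose _ l l' h1 h2 h3 h4).trans (hN n hn).le) hε.le |>.2⟩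
  obtain ⟨s, -, hs⟩ := A.exists_norm2_limit k (fun n => (hk n).norm_le) (fun ε hε => by
    obtain ⟨N, hN⟩ := hsmall ε hε
    have hmono : ∀ m ≥ N, A.norm2 (k m) ≤ d + 1 / ((N : ℝ) + 1) := fun m hm =>
      (hkd m).trans (by gcongr)
    exact ⟨N, fun m hm n hn => hN N le_rfl _ _ (hk m) (hk n) (hmono m hm) (hmono n hn)⟩)
  have hcomm : ∀ v : A.El, star v * v = 1 → v * star v = 1 → v * s = s * v := fun v h1 h2 => by
    have hconj : ∀ a : A.El, A.norm2 (v * a * star v) ≤ A.norm2 a := fun a => by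
      have e1 := norm2_ra_le (unit A) (toUnit (v * a)) (star v) (K := 1)
        (by rw [A.norm_star_coe]; exact norm_le_one_of_unitary h1)
      have e2 := norm2_l_le (unit A) v (K := 1) (norm_le_one_of_unitary h1) (toUnit a)
      rw [one_mul] at e1 e2
      exact e1.trans e2
    -- Conjugation by v does not increase ‖·‖₂, so v k_n v* is again near-minimizing and therefore
    -- close to k_n.
    have hz : A.norm2 (s - v * s * star v) = 0 := by
      refine le_antisymm (le_of_forall_pos_le_add fun ε hε => ?_) (Real.sqrt_nonneg _)
      obtain ⟨N, hN⟩ := hsmall (ε / 3) (by positivity)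
      obtain ⟨N', hN'⟩ := (hs.eventually (gt_mem_nhds (show (0 : ℝ) < ε / 3 by positivity))).exists_forall_of_atTop
      set n := max N N' with hn
      have a1 := hN n (le_max_left _ _) (k n) (v * k n * star v) (hk n) ((hk n).conj v h1 h2)
        (hkd n) ((hconj _).trans (hkd n))
      have a2 := hN' n (le_max_right _ _)
      have a3 := (hconj (k n - s)).trans a2.le
      have e : s - v * s * star v =
          (k n - v * k n * star v) + v * (k n - s) * star v - (k n - s) := by noncomm_ring
      have t1 := A.norm2_sub_le ((k n - v * k n * star v) + v * (k n - s) * star v) (k n - s)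
      have t2 := A.norm2_add_le (k n - v * k n * star v) (v * (k n - s) * star v)
      rw [e]
      linarith
    have h3 : s = v * s * star v := sub_eq_zero.1 (eq_zero_of_norm2 (unit A) hz)
    conv_rhs => rw [h3]
    rw [mul_assoc, h1, mul_one]
  obtain ⟨c, hc⟩ := A.center_trivial s s.2 fun y hy =>
    (congrArg Subtype.val (A.comm_of_unitary hcomm ⟨y, hy⟩)).symm
  have hc' : s = c • 1 := Subtype.ext hc
  have htr : A.tr x = c := by
    have h1 : Tendsto (fun n => A.tr (k n - s)) atTop (𝓝 0) := by
      have := hs.const_mul ((unit A).norm2 (toUnit 1))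
      rw [mul_zero] at this
      refine squeeze_zero_norm (fun n => ?_) this
      have := norm_tr_ip_le (unit A) (toUnit 1) (toUnit (k n - s))
      rw [unit_ip, ofUnit_toUnit, ofUnit_toUnit, star_one, one_mul] at this
      exact this
    have h2 : ∀ n, A.tr (k n - s) = A.tr x - c := fun n => by
      rw [map_sub, (hk n).apply_eq A.tr A.tr_mul_comm, hc', map_smul, A.tr_one, smul_eq_mul,
        mul_one]
    simp only [h2] at h1
    exact sub_eq_zero.1 (tendsto_nhds_unique tendsto_const_nhds h1)
  refine ⟨k, hk, ?_⟩
  rw [htr, ← hc']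
  exact hs

/-- A tracial functional that is continuous on bounded sets is a multiple of the trace. -/
lemma tracial_eq (φ : A.El →ₗ[ℂ] ℂ) (hφ : ∀ a b, φ (a * b) = φ (b * a))
    (hcont : ∀ (a : ℕ → A.El) (C : ℝ), (∀ n, ‖(a n : H →L[ℂ] H)‖ ≤ C) →
      Tendsto (fun n => A.norm2 (a n)) atTop (𝓝 0) → Tendsto (fun n => φ (a n)) atTop (𝓝 0))
    (x : A.El) : φ x = φ 1 * A.tr x := by
  obtain ⟨k, hk, hlim⟩ := A.exists_average x
  -- φ takes the value φ x on every average of x, while the averages tend to the scalar tr x.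
  have h1 := hcont (fun n => k n - A.tr x • 1)
    (‖(x : H →L[ℂ] H)‖ + ‖((A.tr x • 1 : A.El) : H →L[ℂ] H)‖)
    (fun n => (norm_sub_le (k n : H →L[ℂ] H) _).trans (add_le_add (hk n).norm_le le_rfl)) hlim
  have h2 : ∀ n, φ (k n - A.tr x • 1) = φ x - φ 1 * A.tr x := fun n => by
    rw [map_sub, (hk n).apply_eq φ hφ, map_smul, smul_eq_mul, mul_comm]
  simp only [h2] at h1
  exact sub_eq_zero.1 (tendsto_nhds_unique tendsto_const_nhds h1)

end IIOneFactor
end WeakLimits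
end LocalExt

namespace LocalExt

namespace Bim

variable {H : Type u} [NormedAddCommGroup H] [InnerProductSpace ℂ H] [CompleteSpace H]
  {A : IIOneFactor H}

/-! ## The supremum norm of a bimodule -/

section SupNorm

variable (X : Bim A)

lemma ip_sub_left (x y z : X) : X.ip (x - y) z = X.ip x z - X.ip y z := by
  rw [← X.star_ip, X.ip_sub, star_sub, X.star_ip, X.star_ip]

/-- The absolute value `⟨x|x⟩^{1/2}` of a vector. -/
lemma exists_abs (x : X) : ∃ c : A.El, star c = c ∧ c * c = X.ip x x ∧
    ‖(c : H →L[ℂ] H)‖ = X.nrm x ∧ A.norm2 c = X.norm2 x := by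
  obtain ⟨c, hc, h2⟩ := A.exists_sqrt _ (X.ip_pos x)
  refine ⟨c, hc, h2, ?_, ?_⟩
  · have h3 := CStarRing.norm_star_mul_self (x := (c : H →L[ℂ] H))
    rw [show star (c : H →L[ℂ] H) = c from congrArg Subtype.val hc] at h3
    rw [nrm, ← h2]
    change _ = √‖(c : H →L[ℂ] H) * c‖
    rw [h3, Real.sqrt_mul_self (norm_nonneg _)]
  · rw [IIOneFactor.norm2, norm2, hc, h2]

/-- Comparison of norms from a decomposition `K² ⟨y|y⟩ - ⟨x|x⟩ = ⟨z|z⟩`. -/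
lemma nrm_le_of_defect {Y Z : Bim A} {x : X} {y : Y} {z : Z} {K : ℝ} (hK : 0 ≤ K)
    (h : Z.ip z z = ((K ^ 2 : ℝ) : ℂ) • Y.ip y y - X.ip x x) : X.nrm x ≤ K * Y.nrm y := by
  have h0 : 0 ≤ (X.ip x x : H →L[ℂ] H) := (ContinuousLinearMap.nonneg_iff_isPositive _).2 (X.ip_pos x)
  have h1 : (X.ip x x : H →L[ℂ] H) ≤ ((K ^ 2 : ℝ) : ℂ) • (Y.ip y y : H →L[ℂ] H) := by
    rw [← sub_nonneg]
    have := (ContinuousLinearMap.nonneg_iff_isPositive _).2 (Z.ip_pos z)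
    rw [h] at this
    exact this
  have h2 := CStarAlgebra.norm_le_norm_of_nonneg_of_le h0 h1
  rw [norm_smul, Complex.norm_real, Real.norm_of_nonneg (sq_nonneg K), ← nrm_sq, ← nrm_sq,
    ← mul_pow] at h2
  exact (abs_le_of_sq_le_sq' h2 (mul_nonneg hK (Y.nrm_nonneg y))).2

lemma eq_zero_of_nrm {x : X} (h : X.nrm x = 0) : x = 0 := by
  apply X.ip_def
  have := X.nrm_sq x
  rw [h] at this
  apply Subtype.ext
  have h2 : ‖(X.ip x x : H →L[ℂ] H)‖ = 0 := by rw [← this]; norm_num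
  exact norm_eq_zero.1 h2

lemma nrm_l_le (a : A.El) {K : ℝ} (h : ‖(a : H →L[ℂ] H)‖ ≤ K) (x : X) :
    X.nrm (X.l a x) ≤ K * X.nrm x := by
  obtain ⟨c, hc⟩ := A.exists_defect a h
  refine nrm_le_of_defect X (z := X.l c x) ((norm_nonneg _).trans h) ?_
  rw [X.ip_l, ← X.l_mul, hc, map_sub, LinearMap.sub_apply, X.ip_sub, map_smul,
    LinearMap.smul_apply, X.ip_smul, X.l_one, X.l_mul, ← X.ip_l]

lemma nrm_toUnit (a : A.El) : (unit A).nrm (toUnit a) = ‖(a : H →L[ℂ] H)‖ := by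
  rw [nrm, unit_ip]
  change √‖star (a : H →L[ℂ] H) * a‖ = _
  rw [CStarRing.norm_star_mul_self, Real.sqrt_mul_self (norm_nonneg _)]

lemma nrm_ra_le (x : X) (a : A.El) : X.nrm (X.ra x a) ≤ X.nrm x * ‖(a : H →L[ℂ] H)‖ := by
  obtain ⟨c, hc, h2, h3, -⟩ := X.exists_abs x
  have e : X.nrm (X.ra x a) = (unit A).nrm (toUnit (c * a)) := by
    rw [nrm, nrm, X.ip_ra, X.ip_ra_left, ← h2, unit_ip]
    simp only [ofUnit_toUnit, star_mul, hc, mul_assoc]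
  rw [e, nrm_toUnit, ← h3]
  exact A.norm_mul_coe_le _ _

/-- Cauchy-Schwarz for the operator norm: with K = ‖x‖ and a = ⟨x|y⟩, expand ⟨w|w⟩ ≥ 0 for w = x a -
K² y and use ⟨x|x⟩ ≤ K². What remains is K² a* a ≤ K⁴ ⟨y|y⟩. -/
lemma norm_ip_le (x y : X) : ‖(X.ip x y : H →L[ℂ] H)‖ ≤ X.nrm x * X.nrm y := by
  set a := X.ip x y with ha
  set K := X.nrm x with hK
  rcases (X.nrm_nonneg x).eq_or_lt with h0 | h0
  · have hx : x = 0 := X.eq_zero_of_nrm h0.symm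
    have : a = 0 := by rw [ha, hx, ← X.star_ip, X.ip_zero, star_zero]
    rw [this]
    simp only [ZeroMemClass.coe_zero, norm_zero]
    exact mul_nonneg (X.nrm_nonneg x) (X.nrm_nonneg y)
  obtain ⟨c, hc, h2, h3, -⟩ := X.exists_abs x
  obtain ⟨d, hd⟩ := A.exists_defect c h3.le
  rw [hc, h2] at hd
  rw [← nrm_toUnit]
  set w := X.ra x a - ((K ^ 2 : ℝ) : ℂ) • y with hw
  have e1 : X.ip w w = star a * X.ip x x * a - (2 : ℂ) • ((K ^ 2 : ℝ) : ℂ) • (star a * a) +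
      ((K ^ 2 : ℝ) : ℂ) • ((K ^ 2 : ℝ) : ℂ) • X.ip y y := by
    have hya : X.ip y x = star a := by rw [ha, X.star_ip]
    rw [hw, X.ip_sub, X.ip_sub_left, X.ip_sub_left]
    simp only [X.ip_smul, X.ip_smul_left, X.ip_ra, X.ip_ra_left, Complex.conj_ofReal, hya, ← ha,
      two_smul, mul_assoc]
    abel
  have e2 : star a * X.ip x x * a = ((K ^ 2 : ℝ) : ℂ) • (star a * a) -
      star (d * a) * (d * a) := by
    have : X.ip x x = ((K ^ 2 : ℝ) : ℂ) • 1 - star d * d := by rw [hd]; abel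
    rw [this, star_mul]
    simp only [mul_sub, sub_mul, mul_smul_comm, smul_mul_assoc, mul_one, mul_assoc]
  have e3 : (X.ip w w : H →L[ℂ] H) + (star (d * a) * (d * a) : A.El) +
      ((K ^ 2 : ℝ) : ℂ) • (star a * a : A.El) =
      ((K ^ 2 : ℝ) : ℂ) • ((K ^ 2 : ℝ) : ℂ) • (X.ip y y : H →L[ℂ] H) := by
    have : X.ip w w + star (d * a) * (d * a) + ((K ^ 2 : ℝ) : ℂ) • (star a * a) =
      ((K ^ 2 : ℝ) : ℂ) • ((K ^ 2 : ℝ) : ℂ) • X.ip y y := by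
      rw [e1, e2, two_smul]; abel
    exact congrArg Subtype.val this
  have p1 : 0 ≤ (X.ip w w : H →L[ℂ] H) :=
    (ContinuousLinearMap.nonneg_iff_isPositive _).2 (X.ip_pos w)
  have p2 : 0 ≤ ((star (d * a) * (d * a) : A.El) : H →L[ℂ] H) :=
    (ContinuousLinearMap.nonneg_iff_isPositive _).2
      (ContinuousLinearMap.isPositive_adjoint_comp_self ((d * a : A.El) : H →L[ℂ] H))
  have p3 : 0 ≤ ((star a * a : A.El) : H →L[ℂ] H) :=
    (ContinuousLinearMap.nonneg_iff_isPositive _).2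
      (ContinuousLinearMap.isPositive_adjoint_comp_self (a : H →L[ℂ] H))
  have p4 : 0 ≤ ((K ^ 2 : ℝ) : ℂ) • ((star a * a : A.El) : H →L[ℂ] H) :=
    smul_nonneg (by exact_mod_cast sq_nonneg K) p3
  have h5 : ((K ^ 2 : ℝ) : ℂ) • ((star a * a : A.El) : H →L[ℂ] H) ≤
      ((K ^ 2 : ℝ) : ℂ) • ((K ^ 2 : ℝ) : ℂ) • (X.ip y y : H →L[ℂ] H) := by
    rw [← e3]; exact le_add_of_nonneg_left (add_nonneg p1 p2)
  have h6 := CStarAlgebra.norm_le_norm_of_nonneg_of_le p4 h5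
  rw [norm_smul, norm_smul, norm_smul, Complex.norm_real, Real.norm_of_nonneg (sq_nonneg K)] at h6
  have hK2 : 0 < K ^ 2 := by positivity
  have h7 := le_of_mul_le_mul_left h6 hK2
  rw [← nrm_sq, ← mul_pow] at h7
  have h8 : ‖((star a * a : A.El) : H →L[ℂ] H)‖ = (unit A).nrm (toUnit a) ^ 2 := by
    rw [nrm_sq]; rfl
  rw [h8] at h7
  exact (abs_le_of_sq_le_sq' h7 (mul_nonneg (X.nrm_nonneg x) (X.nrm_nonneg y))).2

lemma nrm_add_le (x y : X) : X.nrm (x + y) ≤ X.nrm x + X.nrm y := by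
  refine Real.sqrt_le_iff.2 ⟨add_nonneg (X.nrm_nonneg x) (X.nrm_nonneg y), ?_⟩
  rw [X.ip_add, X.ip_add_left, X.ip_add_left]
  have h1 := X.norm_ip_le x x
  have h2 := X.norm_ip_le x y
  have h3 := X.norm_ip_le y x
  have h4 := X.norm_ip_le y y
  have t1 := norm_add_le ((X.ip x x : H →L[ℂ] H) + X.ip y x) ((X.ip x y : H →L[ℂ] H) + X.ip y y)
  have t2 := norm_add_le (X.ip x x : H →L[ℂ] H) (X.ip y x)
  have t3 := norm_add_le (X.ip x y : H →L[ℂ] H) (X.ip y y)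
  refine (t1.trans (add_le_add t2 t3)).trans ?_
  nlinarith

lemma nrm_zero : X.nrm 0 = 0 := by rw [nrm, X.ip_zero]; simp

lemma nrm_sum_le {ι : Type*} (s : Finset ι) (f : ι → X) :
    X.nrm (∑ i ∈ s, f i) ≤ ∑ i ∈ s, X.nrm (f i) :=
  Finset.le_sum_of_subadditive (fun x => X.nrm x) (X.nrm_zero).le X.nrm_add_le s f

variable {X} {Y : Bim A}

/-- Only ⟨x|x⟩ enters the length of x ⊠ y, so x may be replaced by its absolute value acting on y.
Estimates for tensors become estimates for the left action. -/
lemma tm_abs (x : X) (y : Y) {c : A.El} (hc : star c = c) (h2 : c * c = X.ip x x) :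
    (tensor X Y).ip (tm x y) (tm x y) = Y.ip (Y.l c y) (Y.l c y) := by
  rw [tensor_ip, ← h2, Y.ip_l, hc, Y.l_mul]

lemma nrm_tm_le (x : X) (y : Y) : (tensor X Y).nrm (tm x y) ≤ X.nrm x * Y.nrm y := by
  obtain ⟨c, hc, h2, h3, -⟩ := X.exists_abs x
  rw [nrm, tm_abs x y hc h2]
  exact Y.nrm_l_le c h3.le y

lemma norm2_tm_le (x : X) (y : Y) : (tensor X Y).norm2 (tm x y) ≤ X.nrm x * Y.norm2 y := by
  obtain ⟨c, hc, h2, h3, -⟩ := X.exists_abs x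
  rw [norm2, tm_abs x y hc h2]
  exact Y.norm2_l_le c h3.le y

variable (X) in
/-- Left multiplication on a vector is bounded for `‖·‖₂`, as the trace of `A` is unique. -/
lemma exists_norm2_l_bound : ∃ D : ℝ, 0 ≤ D ∧ ∀ (a : A.El) (x : X),
    X.norm2 (X.l a x) ≤ D * X.nrm x * A.norm2 a := by
  obtain ⟨n, b, hb⟩ := X.exists_basis
  -- The trace of left multiplication by a, viewed as a matrix over A in the basis b. It is tracial,
  -- and continuous on balls since the left action is normal, so it is a multiple of tr. Since φ(a*
  -- a) = ∑ ‖a b_i‖₂², this bounds each ‖a b_i‖₂ by a multiple of ‖a‖₂.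
  let φ : A.El →ₗ[ℂ] ℂ := ∑ i, A.tr ∘ₗ X.ipL (b i) ∘ₗ (lL X).flip (b i)
  have hφ : ∀ a, φ a = ∑ i, A.tr (X.ip (b i) (X.l a (b i))) := fun a => by
    simp [φ, LinearMap.sum_apply]
  have htr : ∀ a c, φ (a * c) = φ (c * a) := fun a c => by
    have h : ∀ a c, φ (a * c) =
        ∑ i, ∑ k, A.tr (X.ip (b i) (X.l a (b k)) * X.ip (b k) (X.l c (b i))) := fun a c => by
      rw [hφ]
      refine Finset.sum_congr rfl fun i _ => ?_
      rw [X.l_mul]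
      conv_lhs => rw [← hb (X.l c (b i))]
      rw [map_sum, X.ip_sum, map_sum]
      refine Finset.sum_congr rfl fun k _ => ?_
      rw [X.l_r, X.ip_r]
    rw [h, h, Finset.sum_comm]
    simp only [fun i k => A.tr_mul_comm (X.ip (b i) (X.l a (b k)))]
  have hcont : ∀ (a : ℕ → A.El) (C : ℝ), (∀ n, ‖(a n : H →L[ℂ] H)‖ ≤ C) →
      Tendsto (fun n => A.norm2 (a n)) atTop (𝓝 0) →
      Tendsto (fun n => φ (a n)) atTop (𝓝 0) := fun a C hC ha => by
    simp only [hφ]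
    rw [show (0 : ℂ) = ∑ i : Fin n, 0 by simp]
    refine tendsto_finsetSum _ fun i _ => ?_
    refine A.tendsto_tr_of_weakNull _ (C := X.nrm (b i) * (C * X.nrm (b i))) (fun n => ?_)
      (X.l_normal _ _ _ (A.weakNull_of_norm2 a hC ha))
    exact (X.norm_ip_le _ _).trans
      (mul_le_mul_of_nonneg_left (X.nrm_l_le _ (hC n) _) (X.nrm_nonneg _))
  have hφt := A.tracial_eq φ htr hcont
  set d : ℝ := (φ 1).re with hd
  have hre : ∀ a : A.El, (φ (star a * a)).re = ∑ i, X.norm2 (X.l a (b i)) ^ 2 := fun a => by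
    rw [hφ, Complex.re_sum]
    refine Finset.sum_congr rfl fun i _ => ?_
    rw [X.l_mul, ← star_star a, ← X.ip_l, star_star, tr_ip_self, Complex.ofReal_re]
  have hd0 : 0 ≤ d := by
    have := hre 1
    rw [star_one, one_mul] at this
    rw [hd, this]
    positivity
  have hb2 : ∀ a i, X.norm2 (X.l a (b i)) ≤ √d * A.norm2 a := fun a i => by
    rw [← Real.sqrt_sq (A.norm2_nonneg a), ← Real.sqrt_mul hd0]
    apply Real.le_sqrt_of_sq_le
    have h1 := hre a
    have h2 : A.tr (star a * a) = ((A.norm2 a ^ 2 : ℝ) : ℂ) := tr_ip_self (unit A) (toUnit a)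
    rw [hφt, h2, mul_comm, Complex.re_ofReal_mul, ← hd] at h1
    rw [mul_comm, h1]
    exact Finset.single_le_sum (f := fun i => X.norm2 (X.l a (b i)) ^ 2)
      (fun i _ => sq_nonneg _) (Finset.mem_univ i)
  refine ⟨∑ i, √d * X.nrm (b i), Finset.sum_nonneg fun i _ =>
    mul_nonneg (Real.sqrt_nonneg _) (X.nrm_nonneg _), fun a x => ?_⟩
  -- Expanding x in b spreads the bound from the basis to all vectors, at the price of ‖⟨b_i|x⟩‖ ≤
  -- ‖b_i‖ ‖x‖.
  have hx : X.l a x = ∑ i, X.ra (X.l a (b i)) (X.ip (b i) x) := by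
    conv_lhs => rw [← hb x]
    rw [map_sum]
    exact Finset.sum_congr rfl fun i _ => X.l_r _ _ _
  rw [hx, Finset.sum_mul, Finset.sum_mul]
  refine (X.norm2_sum_le _ _).trans (Finset.sum_le_sum fun i _ => ?_)
  calc _ ≤ (X.nrm (b i) * X.nrm x) * X.norm2 (X.l a (b i)) :=
        X.norm2_ra_le _ _ (X.norm_ip_le _ _)
    _ ≤ (X.nrm (b i) * X.nrm x) * (√d * A.norm2 a) :=
        mul_le_mul_of_nonneg_left (hb2 a i) (mul_nonneg (X.nrm_nonneg _) (X.nrm_nonneg _))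
    _ = _ := by ring

variable (Y) in
-- With c = ⟨x|x⟩^{1/2} one has ‖c‖₂ = ‖x‖₂, so the bound on c y applies. The constant depends on Y
-- alone.
lemma exists_norm2_tm_bound : ∃ D : ℝ, 0 ≤ D ∧ ∀ (X : Bim A) (x : X) (y : Y),
    (tensor X Y).norm2 (tm x y) ≤ D * Y.nrm y * X.norm2 x := by
  obtain ⟨D, hD, h⟩ := Y.exists_norm2_l_bound
  refine ⟨D, hD, fun X x y => ?_⟩
  obtain ⟨c, hc, h2, -, h3⟩ := X.exists_abs x
  rw [norm2, tm_abs x y hc h2, ← h3]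
  exact h c y

end SupNorm

/-! ## Right linear maps -/

section RightLinear

variable {X Y Z : Bim A}

/-- Right `A`-linear maps. -/
def RLin (T : X →ₗ[ℂ] Y) : Prop := ∀ x a, T (X.ra x a) = Y.ra (T x) a

lemma RLin.map (f : X ⟶ Y) : RLin (Bim.map f) := Bim.map_ra f

lemma RLin.comp {T : Y →ₗ[ℂ] Z} {S : X →ₗ[ℂ] Y} (hT : RLin T) (hS : RLin S) : RLin (T ∘ₗ S) :=
  fun x a => by rw [LinearMap.comp_apply, hS, hT, LinearMap.comp_apply]

lemma ra_sub (X : Bim A) (x y : X) (a : A.El) : X.ra (x - y) a = X.ra x a - X.ra y a :=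
  _root_.map_sub _ _ _

lemma ra_zero (X : Bim A) (a : A.El) : X.ra 0 a = 0 := _root_.map_zero _

lemma zero_ra (X : Bim A) (x : X) : X.ra x 0 = 0 := by simp [ra]

lemma ra_add' (X : Bim A) (x : X) (a b : A.El) : X.ra x (a + b) = X.ra x a + X.ra x b :=
  map_add (raL X x) a b

lemma ra_sub' (X : Bim A) (x : X) (a b : A.El) : X.ra x (a - b) = X.ra x a - X.ra x b :=
  map_sub (raL X x) a b

lemma ra_sum (X : Bim A) {ι : Type*} (s : Finset ι) (f : ι → X) (a : A.El) :
    X.ra (∑ i ∈ s, f i) a = ∑ i ∈ s, X.ra (f i) a := map_sum _ _ _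

lemma ra_sum' (X : Bim A) {ι : Type*} (s : Finset ι) (x : X) (f : ι → A.El) :
    X.ra x (∑ i ∈ s, f i) = ∑ i ∈ s, X.ra x (f i) := map_sum (raL X x) f s

lemma smul_ra (X : Bim A) (c : ℂ) (x : X) (a : A.El) : X.ra (c • x) a = c • X.ra x a :=
  map_smul _ _ _

lemma ra_smul (X : Bim A) (c : ℂ) (x : X) (a : A.El) : X.ra x (c • a) = c • X.ra x a :=
  map_smul (raL X x) c a

lemma RLin.sub {T S : X →ₗ[ℂ] Y} (hT : RLin T) (hS : RLin S) : RLin (T - S) := fun x a => by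
  rw [LinearMap.sub_apply, hT, hS, LinearMap.sub_apply, ra_sub]

lemma rLin_l (X : Bim A) (a : A.El) : RLin (X.l a) := fun x b => X.l_ra a b x

lemma rLin_ipL (X : Bim A) (x : X) : RLin (Y := unit A) (toUnit ∘ₗ X.ipL x) :=
  fun y a => congrArg toUnit (X.ip_ra x y a)

lemma RLin.apply_basis {T : X →ₗ[ℂ] Y} (hT : RLin T) {n : ℕ} {b : Fin n → X} (hb : X.IsBasis b)
    (x : X) : T x = ∑ i, Y.ra (T (b i)) (X.ip (b i) x) := by
  conv_lhs => rw [← hb x]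
  rw [map_sum]
  exact Finset.sum_congr rfl fun i _ => hT _ _

/-- Right linear maps are bounded. -/
lemma RLin.exists_bound {T : X →ₗ[ℂ] Y} (hT : RLin T) : ∃ C : ℝ, 0 ≤ C ∧
    (∀ x, Y.norm2 (T x) ≤ C * X.norm2 x) ∧ ∀ x, Y.nrm (T x) ≤ C * X.nrm x := by
  obtain ⟨n, b, hb⟩ := X.exists_basis
  refine ⟨∑ i, Y.nrm (T (b i)) * X.nrm (b i), Finset.sum_nonneg fun i _ =>
    mul_nonneg (Y.nrm_nonneg _) (X.nrm_nonneg _), fun x => ?_, fun x => ?_⟩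
  · rw [hT.apply_basis hb, Finset.sum_mul]
    refine (Y.norm2_sum_le _ _).trans (Finset.sum_le_sum fun i _ => ?_)
    refine (Y.norm2_ra_le' _ _).trans ?_
    rw [mul_assoc]
    exact mul_le_mul_of_nonneg_left (X.norm2_ip_le _ _) (Y.nrm_nonneg _)
  · rw [hT.apply_basis hb, Finset.sum_mul]
    refine (Y.nrm_sum_le _ _).trans (Finset.sum_le_sum fun i _ => ?_)
    refine (Y.nrm_ra_le _ _).trans ?_
    rw [mul_assoc]
    exact mul_le_mul_of_nonneg_left (X.norm_ip_le _ _) (Y.nrm_nonneg _)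

/-- Bimodule maps are adjointable. -/
noncomputable def mkHom (T : X →ₗ[ℂ] Y) (hl : ∀ a x, T (X.l a x) = Y.l a (T x)) (hr : RLin T) :
    X ⟶ Y where
  toFun := T
  -- The adjoint is y ↦ ∑ b_i ⟨T b_i|y⟩ for a finite basis b of X.
  adj := ∑ i, (raL X (X.exists_basis.choose_spec.choose i)) ∘ₗ
    Y.ipL (T (X.exists_basis.choose_spec.choose i))
  map_l := hl
  map_ra := hr
  adj_spec x y := by
    rw [hr.apply_basis (Ten.basis_spec X) x, Y.ip_sum_left, LinearMap.sum_apply, X.ip_sum]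
    refine Finset.sum_congr rfl fun i _ => ?_
    rw [Y.ip_ra_left, LinearMap.comp_apply, raL_apply, X.ip_ra, X.star_ip]
    rfl

@[simp] lemma map_mkHom (T : X →ₗ[ℂ] Y) (hl) (hr) (x : X) : map (mkHom T hl hr) x = T x := rfl

end RightLinear

/-! ## Null sequences and bounded sequences -/

section Null

variable {X Y Z : Bim A}

/-- Convergence to `0` in `‖·‖₂`. -/
def Null (X : Bim A) (z : ℕ → X) : Prop := Tendsto (fun n => X.norm2 (z n)) atTop (𝓝 0)

/-- Boundedness in the supremum norm. -/
def Bdd (X : Bim A) (z : ℕ → X) : Prop := ∃ C : ℝ, 0 ≤ C ∧ ∀ n, X.nrm (z n) ≤ C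

lemma Null.of_le {z : ℕ → X} (hz : Null X z) {w : ℕ → Y} {C : ℝ}
    (h : ∀ n, Y.norm2 (w n) ≤ C * X.norm2 (z n)) : Null Y w := by
  have := Tendsto.const_mul C hz
  rw [mul_zero] at this
  exact squeeze_zero (fun n => Y.norm2_nonneg _) h this

lemma Null.add {z w : ℕ → X} (hz : Null X z) (hw : Null X w) : Null X (fun n => z n + w n) := by
  have := Tendsto.add hz hw
  rw [add_zero] at this
  exact squeeze_zero (fun n => X.norm2_nonneg _) (fun n => X.norm2_add_le _ _) this

lemma Null.neg {z : ℕ → X} (hz : Null X z) : Null X (fun n => -z n) := by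
  simpa only [Null, norm2_neg] using hz

lemma Null.sub {z w : ℕ → X} (hz : Null X z) (hw : Null X w) : Null X (fun n => z n - w n) := by
  simpa only [sub_eq_add_neg] using hz.add hw.neg

lemma null_zero (X : Bim A) : Null X (fun _ => 0) := by
  simp only [Null, norm2_zero]; exact tendsto_const_nhds

lemma Null.sum {ι : Type*} (s : Finset ι) {z : ι → ℕ → X} (hz : ∀ i ∈ s, Null X (z i)) :
    Null X (fun n => ∑ i ∈ s, z i n) := by
  classical
  induction s using Finset.induction_on with
  | empty => simpa using null_zero X
  | insert i s hi ih =>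
    simp only [Finset.sum_insert hi]
    exact (hz i (Finset.mem_insert_self _ _)).add
      (ih fun j hj => hz j (Finset.mem_insert_of_mem hj))

lemma Null.comp {z : ℕ → X} (hz : Null X z) {σ : ℕ → ℕ} (hσ : Tendsto σ atTop atTop) :
    Null X (fun n => z (σ n)) :=
  (show Tendsto (fun n => X.norm2 (z n)) atTop (𝓝 0) from hz).comp hσ

lemma Null.eq_zero {x : X} (h : Null X (fun _ => x)) : x = 0 :=
  X.eq_zero_of_norm2 (tendsto_nhds_unique tendsto_const_nhds h)

lemma Null.map {z : ℕ → X} (hz : Null X z) {T : X →ₗ[ℂ] Y} (hT : RLin T) :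
    Null Y (fun n => T (z n)) := by
  obtain ⟨C, -, hC, -⟩ := hT.exists_bound
  exact hz.of_le fun n => hC _

lemma Null.smul {z : ℕ → X} (hz : Null X z) (c : ℂ) : Null X (fun n => c • z n) :=
  hz.of_le fun n => (X.norm2_smul c (z n)).le

lemma bdd_const (x : X) : Bdd X (fun _ => x) := ⟨_, X.nrm_nonneg x, fun _ => le_rfl⟩

lemma Bdd.add {z w : ℕ → X} (hz : Bdd X z) (hw : Bdd X w) : Bdd X (fun n => z n + w n) := by
  obtain ⟨C, hC0, hC⟩ := hz
  obtain ⟨D, hD0, hD⟩ := hw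
  exact ⟨C + D, add_nonneg hC0 hD0, fun n => (X.nrm_add_le _ _).trans (add_le_add (hC n) (hD n))⟩

lemma Bdd.comp {z : ℕ → X} (hz : Bdd X z) (σ : ℕ → ℕ) : Bdd X (fun n => z (σ n)) := by
  obtain ⟨C, hC0, hC⟩ := hz
  exact ⟨C, hC0, fun n => hC _⟩

lemma Bdd.map {z : ℕ → X} (hz : Bdd X z) {T : X →ₗ[ℂ] Y} (hT : RLin T) :
    Bdd Y (fun n => T (z n)) := by
  obtain ⟨C, hC0, -, hC⟩ := hT.exists_bound
  obtain ⟨D, hD0, hD⟩ := hz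
  exact ⟨C * D, mul_nonneg hC0 hD0, fun n => (hC _).trans (mul_le_mul_of_nonneg_left (hD n) hC0)⟩

lemma Bdd.tm {x : ℕ → X} {y : ℕ → Y} (hx : Bdd X x) (hy : Bdd Y y) :
    Bdd (tensor X Y) (fun n => tm (x n) (y n)) := by
  obtain ⟨C, hC0, hC⟩ := hx
  obtain ⟨D, hD0, hD⟩ := hy
  exact ⟨C * D, mul_nonneg hC0 hD0, fun n => (nrm_tm_le _ _).trans
    (mul_le_mul (hC n) (hD n) (Y.nrm_nonneg _) hC0)⟩

/-- Bounded sequences in `A`. -/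
def BddA (a : ℕ → A.El) : Prop := ∃ C : ℝ, ∀ n, ‖(a n : H →L[ℂ] H)‖ ≤ C

/-- Sequences in `A` that tend to `0` in `‖·‖₂`. -/
def NullA (a : ℕ → A.El) : Prop := Tendsto (fun n => A.norm2 (a n)) atTop (𝓝 0)

lemma nullA_iff {a : ℕ → A.El} : NullA a ↔ Null (unit A) (fun n => toUnit (a n)) := Iff.rfl

lemma bddA_iff {a : ℕ → A.El} : BddA a ↔ Bdd (unit A) (fun n => toUnit (a n)) := by
  simp only [BddA, Bdd, nrm_toUnit]
  exact ⟨fun ⟨C, hC⟩ => ⟨C, (norm_nonneg _).trans (hC 0), hC⟩, fun ⟨C, _, hC⟩ => ⟨C, hC⟩⟩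

lemma Bdd.ip {x y : ℕ → X} (hx : Bdd X x) (hy : Bdd X y) : BddA fun n => X.ip (x n) (y n) := by
  obtain ⟨C, hC0, hC⟩ := hx
  obtain ⟨D, hD0, hD⟩ := hy
  exact ⟨C * D, fun n => (X.norm_ip_le _ _).trans
    (mul_le_mul (hC n) (hD n) (X.nrm_nonneg _) hC0)⟩

lemma Bdd.ra {a : ℕ → A.El} {x : ℕ → X} (hx : Bdd X x) (ha : BddA a) :
    Bdd X fun n => X.ra (x n) (a n) := by
  obtain ⟨C, hC⟩ := ha
  obtain ⟨D, hD0, hD⟩ := hx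
  have hC0 := (norm_nonneg _).trans (hC 0)
  exact ⟨D * C, mul_nonneg hD0 hC0, fun n =>
    (X.nrm_ra_le _ _).trans (mul_le_mul (hD n) (hC n) (norm_nonneg _) hD0)⟩

lemma Null.tm_left {x : ℕ → X} {y : ℕ → Y} (hx : Bdd X x) (hy : Null Y y) :
    Null (tensor X Y) (fun n => tm (x n) (y n)) := by
  obtain ⟨C, hC0, hC⟩ := hx
  exact hy.of_le fun n => (norm2_tm_le _ _).trans
    (mul_le_mul_of_nonneg_right (hC n) (Y.norm2_nonneg _))

/-- Unlike `Null.tm_left`, this rests on uniqueness of the trace, through `exists_norm2_tm_bound`: a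
null left factor acts on y like a ‖·‖₂-null sequence of A. -/
lemma Null.tm_right {x : ℕ → X} {y : ℕ → Y} (hx : Null X x) (hy : Bdd Y y) :
    Null (tensor X Y) (fun n => tm (x n) (y n)) := by
  obtain ⟨C, hC0, hC⟩ := hy
  obtain ⟨D, hD0, hD⟩ := Y.exists_norm2_tm_bound
  exact hx.of_le fun n => (hD _ _ _).trans
    (mul_le_mul_of_nonneg_right (mul_le_mul_of_nonneg_left (hC n) hD0) (X.norm2_nonneg _))

lemma Null.ip_left {x y : ℕ → X} (hx : Bdd X x) (hy : Null X y) :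
    NullA (fun n => X.ip (x n) (y n)) := by
  obtain ⟨C, hC0, hC⟩ := hx
  exact hy.of_le (Y := unit A) fun n => (X.norm2_ip_le _ _).trans
    (mul_le_mul_of_nonneg_right (hC n) (X.norm2_nonneg _))

lemma Null.ip_right {x y : ℕ → X} (hx : Null X x) (hy : Bdd X y) :
    NullA (fun n => X.ip (x n) (y n)) := by
  obtain ⟨C, hC0, hC⟩ := hy
  refine hx.of_le (Y := unit A) (C := C) fun n => (X.norm2_ip_le' _ _).trans ?_
  rw [mul_comm]
  exact mul_le_mul_of_nonneg_right (hC n) (X.norm2_nonneg _)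

lemma Null.ra {x : ℕ → X} {a : ℕ → A.El} (hx : Null X x) (ha : BddA a) :
    Null X (fun n => X.ra (x n) (a n)) := by
  obtain ⟨C, hC⟩ := ha
  exact hx.of_le fun n => X.norm2_ra_le _ _ (hC n)

lemma Null.l {x : ℕ → X} {a : ℕ → A.El} (ha : BddA a) (hx : Null X x) :
    Null X (fun n => X.l (a n) (x n)) := by
  obtain ⟨C, hC⟩ := ha
  exact hx.of_le fun n => X.norm2_l_le _ (hC n) _

lemma NullA.ra {x : ℕ → X} {a : ℕ → A.El} (hx : Bdd X x) (ha : NullA a) :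
    Null X (fun n => X.ra (x n) (a n)) := by
  obtain ⟨C, hC0, hC⟩ := hx
  exact Null.of_le (X := unit A) ha fun n => (X.norm2_ra_le' _ _).trans
    (mul_le_mul_of_nonneg_right (hC n) (Bim.norm2_nonneg _ _))

/-- The coefficients are null only in ‖·‖₂, so the contraction estimate for the left action is of no
help; the bound from the trace of left multiplication is what applies. -/
lemma NullA.l {x : ℕ → X} {a : ℕ → A.El} (ha : NullA a) (hx : Bdd X x) :
    Null X (fun n => X.l (a n) (x n)) := by
  obtain ⟨C, hC0, hC⟩ := hx
  obtain ⟨D, hD0, hD⟩ := X.exists_norm2_l_bound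
  exact Null.of_le (X := unit A) ha fun n => (hD _ _).trans
    (mul_le_mul_of_nonneg_right (mul_le_mul_of_nonneg_left (hC n) hD0) (A.norm2_nonneg _))

lemma NullA.add {a b : ℕ → A.El} (ha : NullA a) (hb : NullA b) : NullA (fun n => a n + b n) :=
  Null.add (X := unit A) ha hb

lemma NullA.neg {a : ℕ → A.El} (ha : NullA a) : NullA (fun n => -a n) :=
  Null.neg (X := unit A) ha

lemma NullA.sub {a b : ℕ → A.El} (ha : NullA a) (hb : NullA b) : NullA (fun n => a n - b n) :=
  Null.sub (X := unit A) ha hb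

lemma NullA.mul_right {a b : ℕ → A.El} (ha : NullA a) (hb : BddA b) : NullA (fun n => a n * b n) :=
  Null.ra (X := unit A) ha hb

lemma NullA.mul_left {a b : ℕ → A.El} (ha : BddA a) (hb : NullA b) : NullA (fun n => a n * b n) :=
  Null.l (X := unit A) ha hb

lemma bddA_const (a : A.El) : BddA fun _ => a := ⟨_, fun _ => le_rfl⟩

lemma BddA.mul {a b : ℕ → A.El} (ha : BddA a) (hb : BddA b) : BddA (fun n => a n * b n) := by
  obtain ⟨C, hC⟩ := ha
  obtain ⟨D, hD⟩ := hb
  exact ⟨C * D, fun n => (A.norm_mul_coe_le _ _).trans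
    (mul_le_mul (hC n) (hD n) (norm_nonneg _) ((norm_nonneg _).trans (hC n)))⟩

end Null

end Bim
end LocalExt

namespace LocalExt

namespace Bim

variable {H : Type u} [NormedAddCommGroup H] [InnerProductSpace ℂ H] [CompleteSpace H]
  {A : IIOneFactor H}

/-! ## Central sequences of vectors -/

section Central

variable {X Y Z W : Bim A}

lemma null_congr {z w : ℕ → X} (hz : Null X z) (h : ∀ n, z n = w n) : Null X w := by
  rwa [show w = z from funext fun n => (h n).symm]

/-- The relation `z_n - w_n → 0` is transitive. -/
lemma Null.trans {x y z : ℕ → X} (h : Null X fun n => x n - y n) (h' : Null X fun n => y n - z n) :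
    Null X fun n => x n - z n :=
  null_congr (h.add h') fun _ => sub_add_sub_cancel _ _ _

lemma Null.symm {x y : ℕ → X} (h : Null X fun n => x n - y n) : Null X fun n => y n - x n :=
  null_congr h.neg fun _ => neg_sub _ _

lemma null_of_eq {x y : ℕ → X} (h : ∀ n, x n = y n) : Null X fun n => x n - y n :=
  null_congr (null_zero X) fun n => by rw [h, sub_self]

/-- Diagonal choice of a sequence of indices. -/
lemma exists_fast {p : ℕ → ℕ → ℝ} (hp : ∀ n, Tendsto (p n) atTop (𝓝 0)) :
    ∃ τ : ℕ → ℕ, Tendsto τ atTop atTop ∧ Tendsto (fun n => p n (τ n)) atTop (𝓝 0) := by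
  have h : ∀ n : ℕ, ∃ t, n ≤ t ∧ |p n t| < 1 / ((n : ℝ) + 1) := fun n => by
    have h1 := (Metric.tendsto_atTop.1 (hp n)) (1 / ((n : ℝ) + 1)) Nat.one_div_pos_of_nat
    obtain ⟨N, hN⟩ := h1
    refine ⟨max n N, le_max_left _ _, ?_⟩
    simpa [Real.dist_eq] using hN _ (le_max_right n N)
  choose τ h1 h2 using h
  refine ⟨τ, tendsto_atTop_mono h1 tendsto_id, ?_⟩
  exact squeeze_zero_norm (fun n => (h2 n).le) tendsto_one_div_add_atTop_nhds_zero_nat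

/-- Bounded sequences of vectors that asymptotically commute with `A`. -/
structure CentralVec (X : Bim A) (x : ℕ → X) : Prop where
  bdd : Bdd X x
  comm : ∀ a, Null X (fun n => X.l a (x n) - X.ra (x n) a)

lemma CentralVec.comp {x : ℕ → X} (hx : CentralVec X x) {σ : ℕ → ℕ} (hσ : Tendsto σ atTop atTop) :
    CentralVec X (fun n => x (σ n)) :=
  ⟨hx.bdd.comp σ, fun a => (hx.comm a).comp hσ⟩

lemma CentralVec.map {x : ℕ → X} (hx : CentralVec X x) (f : X ⟶ Y) :
    CentralVec Y (fun n => map f (x n)) :=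
  ⟨hx.bdd.map (RLin.map f), fun a => null_congr ((hx.comm a).map (RLin.map f)) fun n => by
    rw [map_sub, map_l, map_ra]⟩

lemma CentralVec.tm {x : ℕ → X} {y : ℕ → Y} (hx : CentralVec X x) (hy : CentralVec Y y) :
    CentralVec (tensor X Y) (fun n => tm (x n) (y n)) :=
  ⟨hx.bdd.tm hy.bdd, fun a => null_congr
    (((hx.comm a).tm_right hy.bdd).add (Null.tm_left hx.bdd (hy.comm a))) fun n => by
      simp only [← tmL_apply, map_sub, LinearMap.sub_apply]
      simp only [tmL_apply, tensor_l, tensor_ra, ra_tm]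
      abel⟩

/-- The inner product of central sequences of vectors is a central sequence. -/
lemma CentralVec.ip {x y : ℕ → X} (hx : CentralVec X x) (hy : CentralVec X y) :
    IsCentralSeq (fun n => X.ip (x n) (y n)) := by
  refine ⟨hx.bdd.ip hy.bdd, fun b => ?_⟩
  have h1 := Null.ip_right (hx.comm (star b)) hy.bdd
  have h2 := Null.ip_left hx.bdd (hy.comm b)
  refine null_congr (X := unit A) (NullA.sub h1 h2) fun n => ?_
  change X.ip (X.l (star b) (x n) - X.ra (x n) (star b)) (y n) -
    X.ip (x n) (X.l b (y n) - X.ra (y n) b) = X.ip (x n) (y n) * b - b * X.ip (x n) (y n)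
  rw [X.ip_sub_left, X.ip_sub, X.ip_ra, X.ip_ra_left, X.ip_l, star_star]
  abel

lemma IsAIBasis.central {m : ℕ} {b : ℕ → Fin m → X} (hb : IsAIBasis X b) (i : Fin m) :
    CentralVec X (fun n => b n i) := by
  refine ⟨?_, fun a => hb.inner a i⟩
  obtain ⟨C, hC⟩ := hb.bounded
  exact ⟨√C, Real.sqrt_nonneg _, fun n => Real.sqrt_le_sqrt (hC n i)⟩

lemma isAIBasis_of_central {m : ℕ} {b : ℕ → Fin m → X} (hb : ∀ i, CentralVec X (fun n => b n i))
    (h : ∀ x, Null X (fun n => x - ∑ i, X.ra (b n i) (X.ip (b n i) x))) : IsAIBasis X b := by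
  refine ⟨?_, h, fun a i => (hb i).comm a⟩
  choose C hC0 hC using fun i => (hb i).bdd
  refine ⟨∑ i, C i ^ 2, fun n i => ?_⟩
  rw [← nrm_sq]
  exact (pow_le_pow_left₀ (X.nrm_nonneg _) (hC i n) 2).trans
    (Finset.single_le_sum (f := fun i => C i ^ 2) (fun i _ => sq_nonneg _) (Finset.mem_univ i))

lemma IsAIBasis.comp {m : ℕ} {b : ℕ → Fin m → X} (hb : IsAIBasis X b) {σ : ℕ → ℕ}
    (hσ : Tendsto σ atTop atTop) : IsAIBasis X (fun n => b (σ n)) :=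
  isAIBasis_of_central (fun i => (hb.central i).comp hσ)
    fun x => Null.comp (X := X) (hb.approx x) hσ

lemma Bdd.sum {ι : Type*} (s : Finset ι) {z : ι → ℕ → X} (hz : ∀ i ∈ s, Bdd X (z i)) :
    Bdd X (fun n => ∑ i ∈ s, z i n) := by
  classical
  induction s using Finset.induction_on with
  | empty => simpa using bdd_const (0 : X)
  | insert i s hi ih =>
    simp only [Finset.sum_insert hi]
    exact (hz i (Finset.mem_insert_self _ _)).add
      (ih fun j hj => hz j (Finset.mem_insert_of_mem hj))

/-- A sequence of uniformly bounded right linear maps. -/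
structure UBdd (T : ℕ → X →ₗ[ℂ] Y) : Prop where
  rlin : ∀ n, RLin (T n)
  bound : ∃ K : ℝ, ∀ n z, Y.norm2 (T n z) ≤ K * X.norm2 z

lemma UBdd.null {T : ℕ → X →ₗ[ℂ] Y} (hT : UBdd T) {z : ℕ → X} (hz : Null X z) :
    Null Y fun n => T n (z n) := by
  obtain ⟨K, hK⟩ := hT.bound
  exact hz.of_le fun n => hK n _

lemma RLin.ubdd {T : X →ₗ[ℂ] Y} (hT : RLin T) : UBdd fun _ => T := by
  obtain ⟨C, -, hC, -⟩ := hT.exists_bound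
  exact ⟨fun _ => hT, C, fun _ => hC⟩

/-- Expansion of `T (x ⊠ y)` in a basis of `Y`. -/
lemma RLin.tm_basis {T : tensor X Y →ₗ[ℂ] Z} (hT : RLin T) {k : ℕ} {c : Fin k → Y}
    (hc : Y.IsBasis c) {m : ℕ} (b : Fin m → X) (x : X) (y : Y) :
    T (tm (∑ i, X.ra (b i) (X.ip (b i) x)) y) =
      ∑ i, ∑ j, Z.ra (T (tm (b i) (c j))) ((tensor X Y).ip (tm (b i) (c j)) (tm x y)) := by
  rw [sum_tm, map_sum]
  refine Finset.sum_congr rfl fun i _ => ?_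
  rw [ra_tm]
  conv_lhs => rw [← hc (Y.l (X.ip (b i) x) y)]
  rw [tm_sum, map_sum]
  refine Finset.sum_congr rfl fun j _ => ?_
  rw [← tensor_ra, hT, tensor_ip]

/-- Expansion of right linear maps along an approximately inner basis. -/
lemma IsAIBasis.expand {m k : ℕ} {b : ℕ → Fin m → X} (hb : IsAIBasis X b) {c : Fin k → Y}
    (hc : Y.IsBasis c) {T : ℕ → tensor X Y →ₗ[ℂ] Z} (hT : UBdd T) {w : ℕ → Fin m → Fin k → Z}
    (h : ∀ i j, Null Z fun n => T n (tm (b n i) (c j)) - w n i j) (z : tensor X Y) :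
    Null Z fun n => T n z -
      ∑ i, ∑ j, Z.ra (w n i j) ((tensor X Y).ip (tm (b n i) (c j)) z) := by
  induction z using tensor_induction with
  | h0 => simpa [Bim.ip_zero, zero_ra] using null_zero Z
  | h2 z z' hz hz' =>
    refine null_congr (hz.add hz') fun n => ?_
    simp only [map_add, Bim.ip_add, ra_add', Finset.sum_add_distrib]
    abel
  | h1 x y =>
    -- There are two errors: replacing x by its expansion in `b n`, controlled by uniform
    -- boundedness of T, and replacing the values of T on b_i ⊠ c_j by w.
    have h1 : Null Z fun n => T n (tm (x - ∑ i, X.ra (b n i) (X.ip (b n i) x)) y) :=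
      hT.null (Null.tm_right (hb.approx x) (bdd_const y))
    have h2 : Null Z fun n => ∑ i, ∑ j, Z.ra (T n (tm (b n i) (c j)) - w n i j)
        ((tensor X Y).ip (tm (b n i) (c j)) (tm x y)) :=
      Null.sum _ fun i _ => Null.sum _ fun j _ =>
        (h i j).ra (((hb.central i).bdd.tm (bdd_const (c j))).ip (bdd_const _))
    refine null_congr (h1.add h2) fun n => ?_
    simp only [ra_sub, Finset.sum_sub_distrib]
    rw [← (hT.rlin n).tm_basis hc, ← tmL_apply, map_sub, LinearMap.sub_apply, map_sub]
    simp only [tmL_apply]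
    abel

lemma exists_isBasis (X : Bim A) : ∃ (n : ℕ) (b : Fin n → X), X.IsBasis b := X.exists_basis

/-- A right linear map that is asymptotically zero on an approximately inner basis vanishes. -/
lemma IsAIBasis.eq_zero {m : ℕ} {b : ℕ → Fin m → X} (hb : IsAIBasis X b)
    {T : tensor X Y →ₗ[ℂ] Z} (hT : RLin T) (h : ∀ i y, Null Z fun n => T (tm (b n i) y)) :
    T = 0 := by
  obtain ⟨k, c, hc⟩ := exists_isBasis Y
  refine LinearMap.ext fun z => Null.eq_zero (X := Z) ?_
  refine null_congr (hb.expand hc hT.ubdd (w := fun _ _ _ => 0) (fun i j => ?_) z) fun n => ?_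
  · simpa using h i (c j)
  · simp [ra_zero]

/-- With the approximately inner basis in the last factor the coefficients already stand on the
right, so right linearity of T applies without a basis of Y. -/
lemma IsAIBasis.eq_zero_right {m : ℕ} {b : ℕ → Fin m → X} (hb : IsAIBasis X b)
    {T : tensor Y X →ₗ[ℂ] Z} (hT : RLin T) (h : ∀ i y, Null Z fun n => T (tm y (b n i))) :
    T = 0 := by
  refine lin_ext fun y x => Null.eq_zero (X := Z) ?_
  have h1 : Null Z fun n => T (tm y (x - ∑ i, X.ra (b n i) (X.ip (b n i) x))) :=
    (Null.tm_left (bdd_const y) (hb.approx x)).map hT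
  have h2 : Null Z fun n => ∑ i, Z.ra (T (tm y (b n i))) (X.ip (b n i) x) :=
    Null.sum _ fun i _ => (h i y).ra ((hb.central i).bdd.ip (bdd_const x))
  refine null_congr (h1.add h2) fun n => ?_
  rw [← tmL_apply, map_sub, map_sub, map_sum, map_sum]
  simp only [tmL_apply, ← tensor_ra, hT _ _, sub_add_cancel]

/-- The device behind most of the braiding identities below: an equation between right linear maps
becomes an asymptotic one, in which the central sequence can be flipped past other vectors. -/
lemma IsAIBasis.ext {m : ℕ} {b : ℕ → Fin m → X} (hb : IsAIBasis X b)
    {T S : tensor X Y →ₗ[ℂ] Z} (hT : RLin T) (hS : RLin S)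
    (h : ∀ x, CentralVec X x → ∀ y, Null Z fun n => T (tm (x n) y) - S (tm (x n) y)) : T = S :=
  sub_eq_zero.1 (hb.eq_zero (hT.sub hS) fun i y => h _ (hb.central i) y)

lemma IsAIBasis.ext_right {m : ℕ} {b : ℕ → Fin m → X} (hb : IsAIBasis X b)
    {T S : tensor Y X →ₗ[ℂ] Z} (hT : RLin T) (hS : RLin S)
    (h : ∀ x, CentralVec X x → ∀ y, Null Z fun n => T (tm y (x n)) - S (tm y (x n))) : T = S :=
  sub_eq_zero.1 (hb.eq_zero_right (hT.sub hS) fun i y => h _ (hb.central i) y)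

/-- Bounded Cauchy sequences for `‖·‖₂` converge. -/
lemma exists_limit {f : ℕ → X} (hf : Bdd X f)
    (h : ∀ ε > 0, ∃ N, ∀ m ≥ N, ∀ n ≥ N, X.norm2 (f m - f n) ≤ ε) :
    ∃ s, Null X fun n => f n - s := by
  obtain ⟨k, b, hb⟩ := exists_isBasis X
  have key : ∀ i, ∃ s : A.El, NullA fun n => X.ip (b i) (f n) - s := fun i => by
    obtain ⟨C, hC⟩ := (bdd_const (b i)).ip hf
    obtain ⟨s, -, hs⟩ := A.exists_norm2_limit (fun n => X.ip (b i) (f n)) hC fun ε hε => by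
      -- The coefficients ⟨b_i|f_n⟩ are Cauchy in A since ‖⟨b_i|z⟩‖₂ ≤ ‖b_i‖ ‖z‖₂; the summand 1
      -- avoids division by zero.
      obtain ⟨N, hN⟩ := h (ε / (X.nrm (b i) + 1)) (div_pos hε (by linarith [X.nrm_nonneg (b i)]))
      refine ⟨N, fun m hm n hn => ?_⟩
      rw [← X.ip_sub]
      refine (X.norm2_ip_le (b i) _).trans ?_
      have h1 := hN m hm n hn
      have h2 := X.nrm_nonneg (b i)
      rw [le_div_iff₀ (by linarith)] at h1
      nlinarith [X.norm2_nonneg (f m - f n)]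
    exact ⟨s, hs⟩
  choose s hs using key
  refine ⟨∑ i, X.ra (b i) (s i), ?_⟩
  refine null_congr (Null.sum Finset.univ fun i _ => NullA.ra (bdd_const (b i)) (hs i)) fun n => ?_
  simp only [ra_sub', Finset.sum_sub_distrib]
  rw [hb (f n)]

/-- A Cauchy criterion by subsequences. -/
lemma cauchy_of_seq {f : ℕ → X}
    (h : ∀ σ σ' : ℕ → ℕ, Tendsto σ atTop atTop → Tendsto σ' atTop atTop →
      Null X fun n => f (σ n) - f (σ' n)) :
    ∀ ε > 0, ∃ N, ∀ m ≥ N, ∀ n ≥ N, X.norm2 (f m - f n) ≤ ε := by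
  intro ε hε
  by_contra! hc
  choose σ hσ σ' hσ' hlt using hc
  have h1 := h σ σ' (tendsto_atTop_mono hσ tendsto_id) (tendsto_atTop_mono hσ' tendsto_id)
  exact absurd (ge_of_tendsto' h1 fun n => (hlt n).le) (not_le.2 hε)

end Central

/-! ## The braiding -/

section Braiding

variable {X Y Z W : Bim A}

/-- The characteristic property of the braiding. -/
def Br (v : tensor X Y →ₗ[ℂ] tensor Y X) : Prop :=
  ∀ x, CentralVec X x → ∀ y, Null (tensor Y X) fun n => v (tm (x n) y) - tm y (x n)

/-- The map `∑ |c_j ⊠ b_i⟩⟨b_i ⊠ c_j|`. -/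
noncomputable def flipSum {m k : ℕ} (b : Fin m → X) (c : Fin k → Y) :
    tensor X Y →ₗ[ℂ] tensor Y X :=
  ∑ i, ∑ j, raL (tensor Y X) (tm (c j) (b i)) ∘ₗ (tensor X Y).ipL (tm (b i) (c j))

lemma flipSum_apply {m k : ℕ} (b : Fin m → X) (c : Fin k → Y) (z : tensor X Y) :
    flipSum b c z = ∑ i, ∑ j, (tensor Y X).ra (tm (c j) (b i))
        ((tensor X Y).ip (tm (b i) (c j)) z) := by
  simp [flipSum, LinearMap.sum_apply]

lemma rLin_flipSum {m k : ℕ} (b : Fin m → X) (c : Fin k → Y) : RLin (flipSum b c) := fun z a => by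
  simp only [flipSum_apply, Bim.ip_ra, Bim.ra_mul, Bim.ra_sum]

lemma ubdd_flipSum {m k : ℕ} {b : ℕ → Fin m → X} (hb : IsAIBasis X b) (c : Fin k → Y) :
    UBdd fun n => flipSum (b n) c := by
  refine ⟨fun n => rLin_flipSum _ _, ?_⟩
  choose C hC0 hC using fun i => (hb.central i).bdd
  refine ⟨∑ i, ∑ j, (Y.nrm (c j) * C i) * (C i * Y.nrm (c j)), fun n z => ?_⟩
  rw [flipSum_apply, Finset.sum_mul]
  refine (Bim.norm2_sum_le _ _ _).trans (Finset.sum_le_sum fun i _ => ?_)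
  rw [Finset.sum_mul]
  refine (Bim.norm2_sum_le _ _ _).trans (Finset.sum_le_sum fun j _ => ?_)
  refine (Bim.norm2_ra_le' _ _ _).trans ?_
  rw [mul_assoc]
  have hY := Y.nrm_nonneg (c j)
  refine mul_le_mul ((nrm_tm_le _ _).trans (mul_le_mul_of_nonneg_left (hC i n) hY))
    ((Bim.norm2_ip_le _ _ _).trans (mul_le_mul_of_nonneg_right ((nrm_tm_le _ _).trans
      (mul_le_mul_of_nonneg_right (hC i n) hY)) (Bim.norm2_nonneg _ _))) (Bim.norm2_nonneg _ _)
    (mul_nonneg hY (hC0 i))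

/-- The coefficients ⟨b_i|x_n⟩ form a central sequence, so they move past y by central triviality
(h1). Then b_i moves past ⟨c_j|y⟩ (h2), the c_j sum to y, and what is left is y ⊠ ∑ b_i⟨b_i|x_n⟩
(h3). The hypothesis hP is separate because the n-th family must expand a vector that itself varies
with n. -/
lemma flipSum_central {m k : ℕ} {b : ℕ → Fin m → X} (hb : IsAIBasis X b) {c : Fin k → Y}
    (hc : Y.IsBasis c) (hY : CentrallyTrivial Y) {x : ℕ → X} (hx : CentralVec X x)
    (hP : Null X fun n => x n - ∑ i, X.ra (b n i) (X.ip (b n i) (x n))) (y : Y) :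
    Null (tensor Y X) fun n => flipSum (b n) c (tm (x n) y) - tm y (x n) := by
  have h1 : Null (tensor Y X) fun n => ∑ i, ∑ j, (tensor Y X).ra (tm (c j) (b n i))
      (Y.ip (c j) (Y.l (X.ip (b n i) (x n)) y - Y.ra y (X.ip (b n i) (x n)))) :=
    Null.sum _ fun i _ => Null.sum _ fun j _ =>
      NullA.ra ((bdd_const (c j)).tm (hb.central i).bdd)
        (Null.ip_left (bdd_const (c j)) (hY _ ((hb.central i).ip hx) y))
  have h2 : Null (tensor Y X) fun n => ∑ i, ∑ j, (tensor Y X).ra (tm (c j)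
      (X.l (Y.ip (c j) y) (b n i) - X.ra (b n i) (Y.ip (c j) y))) (X.ip (b n i) (x n)) :=
    Null.sum _ fun i _ => Null.sum _ fun j _ =>
      (Null.tm_left (bdd_const (c j)) ((hb.central i).comm _)).ra ((hb.central i).bdd.ip hx.bdd)
  have h3 : Null (tensor Y X) fun n => tm y (x n - ∑ i, X.ra (b n i) (X.ip (b n i) (x n))) :=
    Null.tm_left (bdd_const y) hP
  refine null_congr ((h1.sub h2).sub h3) fun n => ?_
  have e : tm y (∑ i, X.ra (b n i) (X.ip (b n i) (x n))) = ∑ i, ∑ j, (tensor Y X).ra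
      (tm (c j) (X.l (Y.ip (c j) y) (b n i))) (X.ip (b n i) (x n)) := by
    rw [tm_sum]
    refine Finset.sum_congr rfl fun i _ => ?_
    conv_lhs => rw [← hc y]
    rw [sum_tm]
    refine Finset.sum_congr rfl fun j _ => ?_
    rw [ra_tm, tensor_ra, l_ra]
  rw [flipSum_apply]
  rw [← tmL_apply y (x n - _), map_sub, tmL_apply, tmL_apply, e]
  simp only [tensor_ip]
  simp only [Y.ip_sub, Y.ip_ra, ra_sub', Finset.sum_sub_distrib, ← tmL_apply, map_sub,
    ra_sub]
  simp only [tmL_apply, tensor_ra, X.ra_mul]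
  abel

/-- Existence of the braiding. -/
lemma exists_br {m k : ℕ} {b : ℕ → Fin m → X} (hb : IsAIBasis X b) {c : Fin k → Y}
    (hc : Y.IsBasis c) (hY : CentrallyTrivial Y) :
    ∃ v : tensor X Y →ₗ[ℂ] tensor Y X, RLin v ∧ Br v := by
  have hlim : ∀ z, ∃ s, Null (tensor Y X) fun n => flipSum (b n) c z - s := fun z => by
    refine exists_limit ?_ (cauchy_of_seq fun σ σ' hσ hσ' => ?_)
    · simp only [flipSum_apply]
      exact Bdd.sum _ fun i _ => Bdd.sum _ fun j _ =>
        ((bdd_const (c j)).tm (hb.central i).bdd).ra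
          (((hb.central i).bdd.tm (bdd_const (c j))).ip (bdd_const z))
    -- Let τ be so fast that the family at τ n expands the vectors of the families at σ n and σ' n.
    -- Then the flip sum at τ n nearly flips b_i^{(σ n)} ⊠ c_j, so expanding z along b^{(σ n)} shows
    -- it close to the flip sum at σ n; the same holds for σ'.
    · obtain ⟨τ, hτ, hp⟩ := exists_fast (p := fun n t =>
        ∑ i, X.norm2 (b (σ n) i - ∑ l, X.ra (b t l) (X.ip (b t l) (b (σ n) i))) +
        ∑ i, X.norm2 (b (σ' n) i - ∑ l, X.ra (b t l) (X.ip (b t l) (b (σ' n) i))))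
        (fun n => by
          rw [← add_zero (0 : ℝ)]
          refine Tendsto.add ?_ ?_ <;>
          · rw [show (0 : ℝ) = ∑ i : Fin m, (0 : ℝ) by simp]
            exact tendsto_finsetSum _ fun i _ => hb.approx _)
      have step : ∀ ρ : ℕ → ℕ, Tendsto ρ atTop atTop → (∀ i, Null X fun n => b (ρ n) i -
          ∑ l, X.ra (b (τ n) l) (X.ip (b (τ n) l) (b (ρ n) i))) →
          Null (tensor Y X) fun n => flipSum (b (τ n)) c z - flipSum (b (ρ n)) c z :=
        fun ρ hρ hn => by
          simp only [flipSum_apply (b (ρ _))]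
          exact (hb.comp hρ).expand hc (ubdd_flipSum (hb.comp hτ) c) (fun i j =>
            flipSum_central (hb.comp hτ) hc hY ((hb.central i).comp hρ) (hn i) (c j)) z
      have hs : ∀ (g : ℕ → ℝ) (f : Fin m → ℕ → X) (h0 : ∀ n, 0 ≤ g n)
          (h : Tendsto (fun n => ∑ i, X.norm2 (f i n) + g n) atTop (𝓝 0)) (i : Fin m),
          Null X (f i) := fun g f h0 h i =>
        squeeze_zero (fun n => X.norm2_nonneg _) (fun n =>
          (Finset.single_le_sum (f := fun i => X.norm2 (f i n))
            (fun i _ => X.norm2_nonneg _) (Finset.mem_univ i)).trans (le_add_of_nonneg_right (h0 n))) h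
      have h1 := step σ hσ (hs _ _ (fun n => Finset.sum_nonneg fun i _ => X.norm2_nonneg _) hp)
      simp only [add_comm (∑ i, X.norm2 (b (σ _) i - _))] at hp
      have h2 := step σ' hσ' (hs _ _ (fun n => Finset.sum_nonneg fun i _ => X.norm2_nonneg _) hp)
      exact h1.symm.trans h2
  choose V hV using hlim
  have huniq : ∀ z s, (Null (tensor Y X) fun n => flipSum (b n) c z - s) → V z = s :=
    fun z s hs => sub_eq_zero.1 (Null.eq_zero (X := tensor Y X) ((hV z).symm.trans hs))
  let v : tensor X Y →ₗ[ℂ] tensor Y X :=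
    { toFun := V
      map_add' := fun z w => huniq _ _ <| null_congr ((hV z).add (hV w)) fun n => by
        rw [map_add]; abel
      map_smul' := fun t z => huniq _ _ <| null_congr ((hV z).smul t) fun n => by
        rw [map_smul, smul_sub]; rfl }
  have hv : ∀ z, v z = V z := fun _ => rfl
  refine ⟨v, fun z a => huniq _ _ <| null_congr ((hV z).ra (bddA_const a)) fun n => ?_, ?_⟩
  · rw [rLin_flipSum, ra_sub]; rfl
  intro x hx y
  -- The index must be large enough both to expand x_n and to bring the flip sum near its limit at
  -- x_n ⊠ y.
  obtain ⟨τ, hτ, hp⟩ := exists_fast (p := fun n t =>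
    X.norm2 (x n - ∑ i, X.ra (b t i) (X.ip (b t i) (x n))) +
      (tensor Y X).norm2 (flipSum (b t) c (tm (x n) y) - V (tm (x n) y))) (fun n => by
        rw [← add_zero (0 : ℝ)]
        exact (hb.approx _).add (hV _))
  have h1 : Null X fun n => x n - ∑ i, X.ra (b (τ n) i) (X.ip (b (τ n) i) (x n)) :=
    squeeze_zero (fun n => Bim.norm2_nonneg _ _)
      (fun n => le_add_of_nonneg_right (Bim.norm2_nonneg _ _)) hp
  have h2 : Null (tensor Y X) fun n => flipSum (b (τ n)) c (tm (x n) y) - v (tm (x n) y) :=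
    squeeze_zero (fun n => Bim.norm2_nonneg _ _)
      (fun n => le_add_of_nonneg_left (Bim.norm2_nonneg _ _)) hp
  exact h2.symm.trans (flipSum_central (hb.comp hτ) hc hY hx h1 y)

/-- The limit formula only makes right linearity evident. On a central sequence, a x_n may be
replaced by x_n a, and x_n a ⊠ y = x_n ⊠ a y flips to a y ⊠ x_n. -/
lemma Br.left_linear {v : tensor X Y →ₗ[ℂ] tensor Y X} (hv : Br v) (hr : RLin v)
    (hX : ApproxInner X) (a : A.El) (z : tensor X Y) :
    v ((tensor X Y).l a z) = (tensor Y X).l a (v z) := by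
  obtain ⟨m, b, hb⟩ := hX
  have : v ∘ₗ (tensor X Y).l a = (tensor Y X).l a ∘ₗ v := by
    refine hb.ext (hr.comp (rLin_l _ a)) ((rLin_l _ a).comp hr) fun x hx y => ?_
    have h1 : Null (tensor Y X) fun n => v (tm (X.l a (x n) - X.ra (x n) a) y) :=
      ((hx.comm a).tm_right (bdd_const y)).map hr
    have h2 := hv x hx (Y.l a y)
    have h3 := (hv x hx y).map (rLin_l (tensor Y X) a)
    refine null_congr ((h1.add h2).sub h3) fun n => ?_
    rw [← tmL_apply, map_sub, LinearMap.sub_apply, map_sub, map_sub]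
    simp only [tmL_apply, LinearMap.comp_apply, tensor_l, ra_tm]
    abel
  exact LinearMap.congr_fun this z

lemma Br.isBraiding {v : X ⊗ Y ⟶ Y ⊗ X} (hv : Br (map v)) : IsBraiding X Y v := by
  intro m k b c hb hc z
  exact hb.expand hc (RLin.map v).ubdd (fun i j => hv _ (hb.central i) (c j)) z

/-- The braiding exists if `X` is approximately inner and `Y` is centrally trivial. -/
lemma br_braid (hX : ApproxInner X) (hY : CentrallyTrivial Y) : Br (map (braid X Y)) := by
  obtain ⟨m, b, hb⟩ := hX
  obtain ⟨k, c, hc⟩ := exists_isBasis Y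
  obtain ⟨v, hr, hv⟩ := exists_br hb hc hY
  let w : X ⊗ Y ⟶ Y ⊗ X := mkHom v (hv.left_linear hr ⟨m, b, hb⟩) hr
  have hw : IsBraiding X Y w := Br.isBraiding (v := w) hv
  have h : ∃ v, IsBraiding X Y v := ⟨w, hw⟩
  -- The chosen braiding and w are limits of the same sums for b and c, so they coincide.
  have e : braid X Y = w := by
    rw [braid, dif_pos h]
    refine hom_ext fun z => sub_eq_zero.1 (Null.eq_zero (X := tensor Y X) ?_)
    exact Null.trans (h.choose_spec m k b c hb hc z) (Null.symm (hw m k b c hb hc z))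
  rw [e]
  exact hv

end Braiding

end Bim
end LocalExt

namespace LocalExt

namespace Bim

variable {H : Type u} [NormedAddCommGroup H] [InnerProductSpace ℂ H] [CompleteSpace H]
  {A : IIOneFactor H}

/-! ### Unitarity, naturality and hexagons of the braiding -/

section Braiding

variable {X Y Z W X' Y' : Bim A}

lemma nullA_congr {a b : ℕ → A.El} (ha : NullA a) (h : ∀ n, a n = b n) : NullA b := by
  rwa [show b = a from funext fun n => (h n).symm]

lemma NullA.sum {ι : Type*} (s : Finset ι) {a : ι → ℕ → A.El} (ha : ∀ i ∈ s, NullA (a i)) :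
    NullA (fun n => ∑ i ∈ s, a i n) := Null.sum (X := unit A) s ha

lemma sub_tm (x x' : X) (y : Y) : tm (x - x') y = tm x y - tm x' y := by
  rw [← tmL_apply, map_sub]; rfl

lemma tm_sub (x : X) (y y' : Y) : tm x (y - y') = tm x y - tm x y' := by
  rw [← tmL_apply, map_sub]; rfl

lemma Br.eq_braid (hX : ApproxInner X) (hY : CentrallyTrivial Y) {v : X ⊗ Y ⟶ Y ⊗ X}
    (hv : Br (map v)) : v = braid X Y := by
  have hb := br_braid hX hY
  obtain ⟨m, b, hbas⟩ := hX
  exact hom_ext fun z => LinearMap.congr_fun (hbas.ext (RLin.map v) (RLin.map _)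
    fun x hx y => (hv x hx y).trans (hb x hx y).symm) z

/-- The braiding preserves inner products asymptotically. Those of b_i ⊠ c_j and b_i' ⊠ c_j' agree
with those of the flipped tensors for three reasons: b_i' commutes past ⟨c_j|c_j'⟩ (h3), the central
sequence ⟨b_i|b_i'⟩ moves past c_j' by central triviality (h4), and it commutes with ⟨c_j|c_j'⟩
(h5). -/
lemma Br.comp_dagger (hX : ApproxInner X) (hY : CentrallyTrivial Y) {v : X ⊗ Y ⟶ Y ⊗ X}
    (hv : Br (map v)) : v ≫ dagger v = 𝟙 _ := by
  obtain ⟨m, b, hb⟩ := hX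
  obtain ⟨k, c, hc⟩ := exists_isBasis Y
  set T : tensor X Y →ₗ[ℂ] tensor X Y := map (v ≫ dagger v) - LinearMap.id with hT
  have hTr : RLin T := (RLin.map _).sub fun _ _ => rfl
  have hTip : ∀ z w, (tensor X Y).ip z (T w) =
      (tensor Y X).ip (map v z) (map v w) - (tensor X Y).ip z w := fun z w =>
    ((tensor X Y).ip_sub _ _ _).trans (congrArg (· - _) (ip_map v z (map v w)).symm)
  have key : ∀ i j i' j', NullA fun n =>
      (tensor X Y).ip (tm (b n i) (c j)) (T (tm (b n i') (c j'))) := fun i j i' j' => by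
    have hi := hb.central i
    have hi' := hb.central i'
    have h1 := Null.ip_left (X := tensor Y X) ((hi.bdd.tm (bdd_const (c j))).map (RLin.map v))
      (hv _ hi' (c j'))
    have h2 := Null.ip_right (hv _ hi (c j)) ((bdd_const (c j')).tm hi'.bdd)
    have h3 := Null.ip_left hi.bdd (hi'.comm (Y.ip (c j) (c j')))
    have h4 := Null.ip_left (bdd_const (c j)) (hY _ (hi.ip hi') (c j'))
    have h5 : NullA fun n => X.ip (b n i) (b n i') * Y.ip (c j) (c j') -
      Y.ip (c j) (c j') * X.ip (b n i) (b n i') := (hi.ip hi').2 (Y.ip (c j) (c j'))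
    refine nullA_congr ((((NullA.add h1 h2).add h3).sub h4).add h5) fun n => ?_
    rw [hTip]
    simp only [Bim.ip_sub, Bim.ip_sub_left, Bim.ip_ra, tensor_ip]
    abel
  -- From matrix entries to T: expanding z shows that the coefficients of T z along b_i ⊠ c_j are
  -- null, and expanding T z then gives T z = 0.
  have h0 : ∀ z, T z = 0 := fun z => by
    have h1 : ∀ i j, NullA fun n => (tensor X Y).ip (tm (b n i) (c j)) (T z) := fun i j => by
      have h2 := Null.ip_left ((hb.central i).bdd.tm (bdd_const (c j)))
        (hb.expand hc hTr.ubdd (w := fun n i j => T (tm (b n i) (c j)))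
          (fun i j => null_of_eq fun n => rfl) z)
      have h3 : NullA fun n => ∑ i', ∑ j', (tensor X Y).ip (tm (b n i) (c j))
          (T (tm (b n i') (c j'))) * (tensor X Y).ip (tm (b n i') (c j')) z :=
        NullA.sum _ fun i' _ => NullA.sum _ fun j' _ => (key i j i' j').mul_right
          (((hb.central i').bdd.tm (bdd_const (c j'))).ip (bdd_const z))
      refine nullA_congr (h2.add h3) fun n => ?_
      simp only [Bim.ip_sub, Bim.ip_sum, Bim.ip_ra, sub_add_cancel]
    have h4 := hb.expand hc (RLin.ubdd (T := LinearMap.id (M := tensor X Y)) fun _ _ => rfl)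
      (w := fun n i j => tm (b n i) (c j)) (fun i j => null_of_eq fun n => rfl) (T z)
    have h5 : Null (tensor X Y) fun n => ∑ i, ∑ j, (tensor X Y).ra (tm (b n i) (c j))
        ((tensor X Y).ip (tm (b n i) (c j)) (T z)) :=
      Null.sum _ fun i _ => Null.sum _ fun j _ =>
        NullA.ra ((hb.central i).bdd.tm (bdd_const (c j))) (h1 i j)
    exact Null.eq_zero (X := tensor X Y) (null_congr (h4.add h5) fun n => sub_add_cancel _ _)
  exact hom_ext fun z => sub_eq_zero.1 (h0 z)

lemma Br.dagger (hX : ApproxInner X) (hY : CentrallyTrivial Y) {v : X ⊗ Y ⟶ Y ⊗ X}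
    (hv : Br (map v)) {x : ℕ → X} (hx : CentralVec X x) (y : Y) :
    Null (tensor X Y) fun n => map (dagger v) (tm y (x n)) - tm (x n) y := by
  refine null_congr ((hv x hx y).symm.map (RLin.map (Bim.dagger v))) fun n => ?_
  have := congrArg (fun f => Bim.map f (tm (x n) y)) (hv.comp_dagger hX hY)
  simp only [map_comp] at this
  rw [map_sub, this]
  rfl

/-- Here the test vectors are y ⊠ x_n with the central sequence in the second factor; v† takes them
to x_n ⊠ y, and v takes these back. -/
lemma Br.dagger_comp (hX : ApproxInner X) (hY : CentrallyTrivial Y) {v : X ⊗ Y ⟶ Y ⊗ X}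
    (hv : Br (map v)) : Bim.dagger v ≫ v = 𝟙 _ := by
  have hd := fun x (hx : CentralVec X x) y => hv.dagger hX hY hx y
  obtain ⟨m, b, hb⟩ := hX
  refine hom_ext fun z => LinearMap.congr_fun (hb.ext_right (RLin.map _) (RLin.map _)
    fun x hx y => ?_) z
  refine null_congr (((hd x hx y).map (RLin.map v)).add (hv x hx y)) fun n => ?_
  rw [map_sub]
  simp only [map_comp]
  abel

/-- The braiding as an isomorphism. -/
noncomputable def braidIso (hX : ApproxInner X) (hY : CentrallyTrivial Y) : X ⊗ Y ≅ Y ⊗ X where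
  hom := braid X Y
  inv := Bim.dagger (braid X Y)
  hom_inv_id := (br_braid hX hY).comp_dagger hX hY
  inv_hom_id := (br_braid hX hY).dagger_comp hX hY

lemma braid_naturality (hX : ApproxInner X) (hX' : ApproxInner X') (hY : CentrallyTrivial Y)
    (hY' : CentrallyTrivial Y') (f : X ⟶ X') (g : Y ⟶ Y') :
    (f ⊗ₘ g) ≫ braid X' Y' = braid X Y ≫ (g ⊗ₘ f) := by
  have h1 := br_braid hX hY
  have h2 := br_braid hX' hY'
  obtain ⟨m, b, hb⟩ := hX
  refine hom_ext fun z => LinearMap.congr_fun (hb.ext (RLin.map _) (RLin.map _)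
    fun x hx y => ?_) z
  refine null_congr ((h2 _ (hx.map f) (map g y)).sub
    ((h1 x hx y).map (RLin.map (tensorMap g f)))) fun n => ?_
  rw [map_sub, tensorMap_tm, map_comp, map_comp]
  change _ = map (braid X' Y') (map (tensorMap f g) (tm (x n) y)) -
    map (tensorMap g f) (map (braid X Y) (tm (x n) y))
  rw [tensorMap_tm]
  abel

/-- The right hand side of the first hexagon identity. -/
lemma braid_tensor_right (hX : ApproxInner X) (hY : CentrallyTrivial Y) (hZ : CentrallyTrivial Z)
    (hYZ : CentrallyTrivial (Y ⊗ Z)) : braid X (Y ⊗ Z) =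
      (α_ X Y Z).inv ≫ braid X Y ▷ Z ≫ (α_ Y X Z).hom ≫ Y ◁ braid X Z ≫ (α_ Y Z X).inv := by
  have h1 := br_braid hX hY
  have h2 := br_braid hX hZ
  refine (Br.eq_braid hX hYZ fun x hx t => ?_).symm
  induction t using tensor_induction with
  | h0 => simpa [tm_zero, zero_tm] using null_zero _
  | h2 t s ht hs =>
    refine null_congr (ht.add hs) fun n => ?_
    simp only [tm_add, add_tm, map_add]
    abel
  | h1 y z =>
    have e1 := ((h1 x hx y).tm_right (bdd_const z)).map
      (RLin.map ((α_ Y X Z).hom ≫ Y ◁ braid X Z ≫ (α_ Y Z X).inv))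
    have e2 := (Null.tm_left (bdd_const y) (h2 x hx z)).map (RLin.map (α_ Y Z X).inv)
    refine null_congr (e1.add e2) fun n => ?_
    have E1 : map ((α_ X Y Z).inv ≫ braid X Y ▷ Z ≫ (α_ Y X Z).hom ≫ Y ◁ braid X Z ≫
        (α_ Y Z X).inv) (tm (x n) (tm y z)) = map ((α_ Y X Z).hom ≫ Y ◁ braid X Z ≫
        (α_ Y Z X).inv) (tm (map (braid X Y) (tm (x n) y)) z) := by
      rw [map_comp, map_comp (braid X Y ▷ Z), associator_inv_tm, whiskerRight_tm]
    have E2 : map ((α_ Y X Z).hom ≫ Y ◁ braid X Z ≫ (α_ Y Z X).inv) (tm (tm y (x n)) z) =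
        map (α_ Y Z X).inv (tm y (map (braid X Z) (tm (x n) z))) := by
      rw [map_comp, map_comp, associator_tm, whiskerLeft_tm]
    have E3 : map (α_ Y Z X).inv (tm y (tm z (x n))) = tm (tm y z) (x n) :=
      associator_inv_tm _ _ _
    rw [sub_tm, tm_sub, map_sub, map_sub]
    exact (congrArg₂ (· + ·) (congrArg (_ - ·) E2) (congrArg (_ - ·) E3)).trans
      ((sub_add_sub_cancel _ _ _).trans (congrArg (· - _) E1.symm))

/-- Right linear identities on `X ⊠ Y` may be checked on tensors of basis elements. -/
lemma null_of_basis {p q : ℕ} {e : Fin p → X} {f : Fin q → Y} (he : X.IsBasis e)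
    (hf : Y.IsBasis f) {T : ℕ → tensor X Y →ₗ[ℂ] Z} (hT : ∀ n, RLin (T n))
    (h : ∀ s t, Null Z fun n => T n (tm (e s) (f t))) (z : tensor X Y) :
    Null Z fun n => T n z := by
  induction z using tensor_induction with
  | h0 => simpa using null_zero Z
  | h2 z w hz hw => exact null_congr (hz.add hw) fun n => (map_add _ _ _).symm
  | h1 x y =>
    refine null_congr (Null.sum Finset.univ fun s _ => Null.sum Finset.univ fun t _ =>
      (h s t).ra (bddA_const ((tensor X Y).ip (tm (e s) (f t)) (tm x y)))) fun n => ?_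
    rw [← (hT n).tm_basis hf, he]

/-- The product of two approximately inner bases, along a subsequence of the second one. -/
lemma IsAIBasis.tensor {m k : ℕ} {b : ℕ → Fin m → X} (hb : IsAIBasis X b) {c : ℕ → Fin k → Y}
    (hc : IsAIBasis Y c) : ∃ τ : ℕ → ℕ, Tendsto τ atTop atTop ∧
      IsAIBasis (tensor X Y) fun n (l : Fin (m * k)) =>
        tm (b n (finProdFinEquiv.symm l).1) (c (τ n) (finProdFinEquiv.symm l).2) := by
  obtain ⟨p, e, he⟩ := exists_isBasis X
  obtain ⟨q, f, hf⟩ := exists_isBasis Y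
  -- Expanding e_s ⊠ f_u first in b leaves the vectors ⟨b_i|e_s⟩ f_u to be expanded in c. They vary
  -- with n but are finitely many for each n, so a fast index for c handles them.
  obtain ⟨τ, hτ, hp⟩ := exists_fast (p := fun n t => ∑ i, ∑ s, ∑ u, Y.norm2
    (Y.l (X.ip (b n i) (e s)) (f u) -
      ∑ j, Y.ra (c t j) (Y.ip (c t j) (Y.l (X.ip (b n i) (e s)) (f u))))) (fun n => by
      rw [show (0 : ℝ) = ∑ i : Fin m, ∑ s : Fin p, ∑ u : Fin q, (0 : ℝ) by simp]
      exact tendsto_finsetSum _ fun i _ => tendsto_finsetSum _ fun s _ =>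
        tendsto_finsetSum _ fun u _ => hc.approx (Y.l (X.ip (b n i) (e s)) (f u)))
  have hn : ∀ i s u, Null Y fun n => Y.l (X.ip (b n i) (e s)) (f u) -
      ∑ j, Y.ra (c (τ n) j) (Y.ip (c (τ n) j) (Y.l (X.ip (b n i) (e s)) (f u))) := fun i s u => by
    refine squeeze_zero (fun n => Y.norm2_nonneg _) (fun n => ?_) hp
    have h0 := fun z : Y => Y.norm2_nonneg z
    refine le_trans ?_ (Finset.single_le_sum (fun i _ => Finset.sum_nonneg fun s _ =>
      Finset.sum_nonneg fun u _ => h0 _) (Finset.mem_univ i))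
    refine le_trans ?_ (Finset.single_le_sum (fun s _ =>
      Finset.sum_nonneg fun u _ => h0 _) (Finset.mem_univ s))
    exact Finset.single_le_sum (f := fun u => Y.norm2 (Y.l (X.ip (b n i) (e s)) (f u) -
      ∑ j, Y.ra (c (τ n) j) (Y.ip (c (τ n) j) (Y.l (X.ip (b n i) (e s)) (f u)))))
      (fun u _ => h0 _) (Finset.mem_univ u)
  refine ⟨τ, hτ, isAIBasis_of_central
    (fun l => (hb.central _).tm ((hc.central _).comp hτ)) ?_⟩
  let T : ℕ → Bim.tensor X Y →ₗ[ℂ] Bim.tensor X Y := fun n => LinearMap.id -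
    ∑ i, ∑ j, raL (Bim.tensor X Y) (tm (b n i) (c (τ n) j)) ∘ₗ
      (Bim.tensor X Y).ipL (tm (b n i) (c (τ n) j))
  have hTa : ∀ n z, T n z = z - ∑ i, ∑ j, (Bim.tensor X Y).ra (tm (b n i) (c (τ n) j))
      ((Bim.tensor X Y).ip (tm (b n i) (c (τ n) j)) z) := fun n z => by
    simp [T, LinearMap.sum_apply]
  have hTr : ∀ n, RLin (T n) := fun n z a => by
    simp only [hTa, Bim.ip_ra, Bim.ra_mul, ra_sub, Bim.ra_sum]
  refine fun z => null_congr (null_of_basis he hf hTr (fun s u => ?_) z) fun n => ?_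
  · have h1 : Null (Bim.tensor X Y) fun n =>
        tm (e s - ∑ i, X.ra (b n i) (X.ip (b n i) (e s))) (f u) :=
      Null.tm_right (hb.approx (e s)) (bdd_const (f u))
    have h2 := Null.sum Finset.univ fun i _ => Null.tm_left (hb.central i).bdd (hn i s u)
    refine null_congr (h1.add h2) fun n => ?_
    rw [hTa]
    simp only [← tmL_apply, map_sub, LinearMap.sub_apply, map_sum, LinearMap.sum_apply,
      Finset.sum_sub_distrib]
    simp only [tmL_apply, tensor_ip, tensor_ra, ra_tm]
    abel
  · rw [hTa, finProdFinEquiv.symm.sum_comp (fun p : Fin m × Fin k =>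
      (Bim.tensor X Y).ra (tm (b n p.1) (c (τ n) p.2))
        ((Bim.tensor X Y).ip (tm (b n p.1) (c (τ n) p.2)) z)), Fintype.sum_prod_type]

lemma ApproxInner.tensor (hX : ApproxInner X) (hY : ApproxInner Y) : ApproxInner (X ⊗ Y) := by
  obtain ⟨m, b, hb⟩ := hX
  obtain ⟨k, c, hc⟩ := hY
  obtain ⟨τ, -, h⟩ := hb.tensor hc
  exact ⟨_, _, h⟩

lemma CentrallyTrivial.tensor (hX : CentrallyTrivial X) (hY : CentrallyTrivial Y) :
    CentrallyTrivial (X ⊗ Y) := by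
  intro a ha t
  change Null (Bim.tensor X Y) fun n => _
  induction t using tensor_induction with
  | h0 => simpa [ra_zero] using null_zero _
  | h2 t s ht hs =>
    refine null_congr (ht.add hs) fun n => ?_
    simp only [map_add, ra_add]
    abel
  | h1 x y =>
    refine null_congr ((Null.tm_right (hX a ha x) (bdd_const y)).add
      (Null.tm_left (bdd_const x) (hY a ha y))) fun n => ?_
    simp only [← tmL_apply, map_sub, LinearMap.sub_apply]
    simp only [tmL_apply, ra_tm]
    change _ = (Bim.tensor X Y).l (a n) (tm x y) - (Bim.tensor X Y).ra (tm x y) (a n)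
    rw [tensor_l, tensor_ra]
    abel

lemma approxInner_unit : ApproxInner (𝟙_ (Bim A)) := by
  refine ⟨1, fun _ _ => toUnit (1 : A.El), isAIBasis_of_central (fun i => ⟨bdd_const _, fun a =>
    null_of_eq fun n => ?_⟩) fun x => null_of_eq fun n => ?_⟩
  · change toUnit (a * 1) = toUnit (1 * a)
    rw [mul_one, one_mul]
  · rw [Fin.sum_univ_one]
    change ofUnit x = (1 : A.El) * (star (1 : A.El) * ofUnit x)
    rw [star_one, one_mul, one_mul]

lemma centrallyTrivial_unit : CentrallyTrivial (𝟙_ (Bim A)) := fun _ ha x =>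
  ha.2 (ofUnit x)

/-- The right hand side of the second hexagon identity. -/
lemma braid_tensor_left (hX : ApproxInner X) (hY : ApproxInner Y) (hZ : CentrallyTrivial Z) :
    braid (X ⊗ Y) Z =
      (α_ X Y Z).hom ≫ X ◁ braid Y Z ≫ (α_ X Z Y).inv ≫ braid X Z ▷ Y ≫ (α_ Z X Y).hom := by
  have h1 := br_braid hX hZ
  have h2 := br_braid hY hZ
  have h3 := br_braid (hX.tensor hY) hZ
  obtain ⟨m, b, hb⟩ := hX
  obtain ⟨k, c, hc⟩ := hY
  obtain ⟨τ, hτ, h⟩ := hb.tensor hc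
  -- The right hand side can be evaluated on x_n ⊠ y_n with both factors central, so the test runs
  -- over the product basis and not over arbitrary central sequences of X ⊠ Y.
  refine hom_ext fun z => LinearMap.congr_fun (sub_eq_zero.1 (h.eq_zero ((RLin.map _).sub
    (RLin.map _)) fun l z => ?_)) z
  have hb' := hb.central (finProdFinEquiv.symm l).1
  have hc' := (hc.central (finProdFinEquiv.symm l).2).comp hτ
  have e2 := (Null.tm_left hb'.bdd (h2 _ hc' z)).map
    (RLin.map ((α_ X Z Y).inv ≫ braid X Z ▷ Y ≫ (α_ Z X Y).hom))
  have e3 := ((h1 _ hb' z).tm_right hc'.bdd).map (RLin.map (α_ Z X Y).hom)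
  refine null_congr ((h3 _ (h.central l) z).sub (e2.add e3)) fun n => ?_
  set x := b n (finProdFinEquiv.symm l).1
  set y := c (τ n) (finProdFinEquiv.symm l).2
  have E1 : map ((α_ X Y Z).hom ≫ X ◁ braid Y Z ≫ (α_ X Z Y).inv ≫ braid X Z ▷ Y ≫
      (α_ Z X Y).hom) (tm (tm x y) z) = map ((α_ X Z Y).inv ≫ braid X Z ▷ Y ≫
      (α_ Z X Y).hom) (tm x (map (braid Y Z) (tm y z))) := by
    rw [map_comp, map_comp (X ◁ braid Y Z), associator_tm, whiskerLeft_tm]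
  have E2 : map ((α_ X Z Y).inv ≫ braid X Z ▷ Y ≫ (α_ Z X Y).hom) (tm x (tm z y)) =
      map (α_ Z X Y).hom (tm (map (braid X Z) (tm x z)) y) := by
    rw [map_comp, map_comp, associator_inv_tm, whiskerRight_tm]
  have E3 : map (α_ Z X Y).hom (tm (tm z x) y) = tm z (tm x y) := associator_tm _ _ _
  rw [sub_tm, tm_sub, map_sub, map_sub]
  refine (congrArg (_ - ·) ((congrArg₂ (· + ·) (congrArg (_ - ·) E2) (congrArg (_ - ·) E3)).trans
    ((sub_add_sub_cancel _ _ _).trans (congrArg (· - _) E1.symm)))).trans ?_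
  exact sub_sub_sub_cancel_right _ _ _

end Braiding

/-! ## The braided category `χ̃(A)` -/

section ChiCategory

variable (A) in
/-- The approximately inner and centrally trivial bimodules. -/
def chiZero : ObjectProperty (Bim A) := fun X => ApproxInner X ∧ CentrallyTrivial X

instance : (chiZero A).IsMonoidal where
  prop_unit := ⟨approxInner_unit, centrallyTrivial_unit⟩
  prop_tensor _ _ h h' := ⟨h.1.tensor h'.1, h.2.tensor h'.2⟩

/-- `χ̃(A)` is closed under the tensor product. -/
lemma isMonoidal_chi : (chi A).IsMonoidal where
  prop_unit := ⟨approxInner_unit, centrallyTrivial_unit, 𝟙_ _, approxInner_unit,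
    centrallyTrivial_unit, ⟨inferInstance⟩, ⟨inferInstance⟩⟩
  prop_tensor X Y := by
    rintro ⟨h1, h2, X', h3, h4, ⟨p⟩, ⟨p'⟩⟩ ⟨k1, k2, Y', k3, k4, ⟨q⟩, ⟨q'⟩⟩
    exact ⟨h1.tensor k1, h2.tensor k2, Y' ⊗ X', k3.tensor h3, k4.tensor h4,
      ⟨inferInstance⟩, ⟨inferInstance⟩⟩

/-- The braiding of a full subcategory of approximately inner and centrally trivial bimodules. -/
@[reducible] noncomputable def braidedOfLE (P : ObjectProperty (Bim A)) [P.IsMonoidal]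
    (hP : P ≤ chiZero A) : BraidedCategory P.FullSubcategory where
  braiding X Y := P.isoMk (braidIso (hP _ X.property).1 (hP _ Y.property).2)
  braiding_naturality_right X Y Z f := by
    ext
    have := braid_naturality (hP _ X.property).1 (hP _ X.property).1 (hP _ Y.property).2
      (hP _ Z.property).2 (𝟙 X.obj) f.hom
    rw [id_tensorHom, tensorHom_id] at this
    exact this
  braiding_naturality_left {X Y} f Z := by
    ext
    have := braid_naturality (hP _ X.property).1 (hP _ Y.property).1 (hP _ Z.property).2
      (hP _ Z.property).2 f.hom (𝟙 Z.obj)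
    rw [id_tensorHom, tensorHom_id] at this
    exact this
  hexagon_forward X Y Z := by
    ext
    have := braid_tensor_right (hP _ X.property).1 (hP _ Y.property).2 (hP _ Z.property).2
      ((hP _ Y.property).2.tensor (hP _ Z.property).2)
    change (α_ X.obj Y.obj Z.obj).hom ≫ braid X.obj (Y.obj ⊗ Z.obj) ≫
        (α_ Y.obj Z.obj X.obj).hom = _
    rw [this]
    simp only [Category.assoc, Iso.hom_inv_id_assoc, Iso.inv_hom_id, Category.comp_id]
    rfl
  hexagon_reverse X Y Z := by
    ext
    have := braid_tensor_left (hP _ X.property).1 (hP _ Y.property).1 (hP _ Z.property).2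
    change (α_ X.obj Y.obj Z.obj).inv ≫ braid (X.obj ⊗ Y.obj) Z.obj ≫
        (α_ Z.obj X.obj Y.obj).inv = _
    rw [this]
    simp only [Category.assoc, Iso.inv_hom_id_assoc, Iso.hom_inv_id, Category.comp_id]
    rfl

variable (A) in
lemma chi_le_chiZero : chi A ≤ chiZero A := fun _ h => ⟨h.1, h.2.1⟩

variable (A) in
/-- `χ̃(A)` is a unitary braided category. -/
@[reducible] noncomputable def chiBraiding : ChiBraiding A where
  mon := isMonoidal_chi
  br :=
    have := isMonoidal_chi (A := A)
    braidedOfLE (chi A) (chi_le_chiZero A)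
  isBraiding X Y := (br_braid X.property.1 Y.property.2.1).isBraiding
  hom_eq _ _ := rfl
  unitary := by
    have := isMonoidal_chi (A := A)
    let _ := braidedOfLE (chi A) (chi_le_chiZero A)
    refine ⟨fun f g => rfl, fun X Y Z => ⟨?_, ?_⟩, fun X => ⟨?_, ?_⟩, fun X => ⟨?_, ?_⟩,
      fun X Y => ⟨?_, ?_⟩⟩
    · exact (α_ X Y Z).hom_inv_id
    · exact (α_ X Y Z).inv_hom_id
    · exact (λ_ X).hom_inv_id
    · exact (λ_ X).inv_hom_id
    · exact (ρ_ X).hom_inv_id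
    · exact (ρ_ X).inv_hom_id
    · exact (β_ X Y).hom_inv_id
    · exact (β_ X Y).inv_hom_id

/-- A one-sided dual suffices. -/
lemma chi_of_exactPairing {X X' : Bim A} (hX : chiZero A X) (hX' : chiZero A X')
    (h : Nonempty (ExactPairing X X')) : chi A X := by
  obtain ⟨p⟩ := h
  -- Membership in `chiZero` does not mention duals and already gives a braided category, in which a
  -- left dual can be swapped into a right dual.
  let := braidedOfLE (chiZero A) le_rfl
  let Y : (chiZero A).FullSubcategory := ⟨X, hX⟩
  let Y' : (chiZero A).FullSubcategory := ⟨X', hX'⟩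
  let : ExactPairing ((chiZero A).ι.obj Y) ((chiZero A).ι.obj Y') := p
  let := ExactPairing.ofFullyFaithful (chiZero A).ι Y Y'
  let q := BraidedCategory.exactPairing_swap Y Y'
  let : ExactPairing X' X :=
    { coevaluation' := q.coevaluation'.hom
      evaluation' := q.evaluation'.hom
      coevaluation_evaluation' := congrArg (fun f => f.hom) q.coevaluation_evaluation'
      evaluation_coevaluation' := congrArg (fun f => f.hom) q.evaluation_coevaluation' }
  exact ⟨hX.1, hX.2, X', hX'.1, hX'.2, ⟨p⟩, ⟨this⟩⟩

end ChiCategory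

end Bim
end LocalExt

namespace LocalExt

variable {H : Type u} [NormedAddCommGroup H] [InnerProductSpace ℂ H] [CompleteSpace H]

namespace Bim

variable {M : IIOneFactor H}

lemma IsCentralSeq.star {q : ℕ → M.El} (hq : IsCentralSeq q) : IsCentralSeq fun n => star (q n) := by
  refine ⟨?_, fun b => ?_⟩
  · obtain ⟨C, hC⟩ := hq.1
    exact ⟨C, fun n => (M.norm_star_coe _).le.trans (hC n)⟩
  · refine (hq.2 (Star.star b)).congr fun n => ?_
    have e : Star.star (q n) * b - b * Star.star (q n) =
        -Star.star (q n * Star.star b - Star.star b * q n) := by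
      rw [star_sub, star_mul, star_mul, star_star]; abel
    rw [e]
    have h1 : ∀ x : M.El, M.norm2 (-Star.star x) = M.norm2 x := fun x => by
      rw [IIOneFactor.norm2, IIOneFactor.norm2, star_neg, star_star, neg_mul_neg, M.tr_mul_comm]
    rw [h1]

lemma IsCentralSeq.comp {q : ℕ → M.El} (hq : IsCentralSeq q) {σ : ℕ → ℕ}
    (hσ : Tendsto σ atTop atTop) : IsCentralSeq fun n => q (σ n) := by
  obtain ⟨⟨C, hC⟩, h⟩ := hq
  exact ⟨⟨C, fun n => hC _⟩, fun b => (h b).comp hσ⟩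

lemma IsCentralSeq.mul {q r : ℕ → M.El} (hq : IsCentralSeq q) (hr : IsCentralSeq r) :
    IsCentralSeq fun n => q n * r n := by
  refine ⟨BddA.mul hq.1 hr.1, fun b => ?_⟩
  have h1 : NullA fun n => q n * (r n * b - b * r n) := NullA.mul_left hq.1 (hr.2 b)
  have h2 : NullA fun n => (q n * b - b * q n) * r n := NullA.mul_right (hq.2 b) hr.1
  refine nullA_congr (h1.add h2) fun n => ?_
  simp only [mul_sub, sub_mul, mul_assoc]
  abel

/-- Multiplication of a central sequence of vectors by a central sequence of `M`. -/
lemma CentralVec.ra {Z : Bim M} {z : ℕ → Z} {q : ℕ → M.El} (hz : CentralVec Z z)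
    (hq : IsCentralSeq q) : CentralVec Z fun n => Z.ra (z n) (q n) := by
  refine ⟨hz.bdd.ra hq.1, fun a => ?_⟩
  have h1 := (hz.comm a).ra hq.1
  have h2 := NullA.ra hz.bdd (hq.2 a)
  refine null_congr (h1.sub h2) fun n => ?_
  simp only [ra_sub, ra_sub', ← Z.ra_mul, Z.l_ra]
  abel

/-- It suffices to test an approximately inner basis on a basis. -/
lemma isAIBasis_of_basis {X : Bim M} {m p : ℕ} {b : ℕ → Fin m → X} {e : Fin p → X}
    (he : X.IsBasis e) (hb : ∀ i, CentralVec X (fun n => b n i))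
    (h : ∀ s, Null X (fun n => e s - ∑ i, X.ra (b n i) (X.ip (b n i) (e s)))) :
    IsAIBasis X b := by
  refine isAIBasis_of_central hb fun x => ?_
  let T : ℕ → X →ₗ[ℂ] X := fun n => LinearMap.id - ∑ i, raL X (b n i) ∘ₗ X.ipL (b n i)
  have hTa : ∀ n z, T n z = z - ∑ i, X.ra (b n i) (X.ip (b n i) z) := fun n z => by
    simp [T, LinearMap.sum_apply]
  have hTr : ∀ n, RLin (T n) := fun n z a => by
    simp only [hTa, Bim.ip_ra, Bim.ra_mul, ra_sub, Bim.ra_sum]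
  refine null_congr (Null.sum Finset.univ fun s _ =>
    (null_congr (h s) fun n => (hTa n (e s)).symm).ra (bddA_const (X.ip (e s) x))) fun n => ?_
  rw [← (hTr n).apply_basis he x, hTa]

end Bim

/-! ## Restriction of bimodules to a subfactor -/

namespace FiniteIndex

variable {M : IIOneFactor H} {S : Subfactor M} (I : FiniteIndex S)

lemma E_positive (x : M.El) (hx : (x : H →L[ℂ] H).IsPositive) :
    ((I.E x : S.toFactor.El) : H →L[ℂ] H).IsPositive := by
  obtain ⟨c, hc, h2⟩ := M.exists_sqrt x hx
  have := I.E_pos c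
  rwa [hc, h2] at this

/-- Take r = (x - y)*; then tr E(x r - y r) is the trace of (x - y)(x - y)*. This reduces M-valued
identities to N-valued ones. -/
lemma ext_E {x y : M.El} (h : ∀ r, I.E (x * r) = I.E (y * r)) : x = y := by
  rw [← sub_eq_zero, ← star_eq_zero]
  refine M.tr_faithful _ ?_
  rw [star_star, ← I.tr_E, sub_mul, map_sub, h, sub_self, map_zero]

/-- Restriction of an `M`-`M` bimodule to `N`, with `⟨x|y⟩_N = [M : N] E(⟨x|y⟩_M)`. -/
noncomputable abbrev res (Z : Bim M) : Bim S.toFactor where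
  carrier := Z.carrier
  l := Z.l.comp S.incl.toAlgHom
  r := Z.r.comp (AlgHom.op S.incl.toAlgHom)
  l_r _ _ _ := Z.l_r _ _ _
  ip x y := (I.index : ℂ) • I.E (Z.ip x y)
  ip_add x y z := by rw [Z.ip_add, map_add, smul_add]
  ip_r x y a := by
    change (I.index : ℂ) • I.E (Z.ip x (Z.r (MulOpposite.op (S.incl a)) y)) = _
    rw [Z.ip_r, I.E_mul_right, smul_mul_assoc]
  star_ip x y := by
    rw [star_smul, ← I.E_star, Z.star_ip, Complex.star_def, Complex.conj_ofReal]
  ip_pos x := by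
    have := (I.E_positive _ (Z.ip_pos x)).smul_of_nonneg (c := (I.index : ℂ))
      (Complex.zero_le_real.2 I.index_pos.le)
    exact this
  ip_def x hx := by
    have h1 : I.E (Z.ip x x) = 0 := (smul_eq_zero.1 hx).resolve_left I.index_ne
    apply Z.eq_zero_of_norm2
    rw [norm2, ← I.tr_E, h1, map_zero, Complex.zero_re, Real.sqrt_zero]
  ip_l a x y := by
    change (I.index : ℂ) • I.E (Z.ip (Z.l (S.incl a) x) y) =
      (I.index : ℂ) • I.E (Z.ip x (Z.l (S.incl (star a)) y))
    rw [Z.ip_l, map_star S.incl]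
  exists_basis := by
    obtain ⟨n, b, hb⟩ := Z.exists_basis
    obtain ⟨m, c, hc⟩ := I.bim.exists_basis
    -- The products of an M-basis of Z with an N-basis of L²M form an N-basis of Z.
    refine ⟨n * m, fun k => Z.ra (b (finProdFinEquiv.symm k).1) (I.ofBim
      (c (finProdFinEquiv.symm k).2)), fun x => ?_⟩
    refine (finProdFinEquiv.symm.sum_comp (fun p : Fin n × Fin m =>
      Z.ra (Z.ra (b p.1) (I.ofBim (c p.2)))
        (S.incl ((I.index : ℂ) • I.E (Z.ip (Z.ra (b p.1) (I.ofBim (c p.2))) x))))).trans ?_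
    rw [Fintype.sum_prod_type]
    conv_rhs => rw [← hb x]
    refine Finset.sum_congr rfl fun i _ => ?_
    have h := hc (I.toBim (Z.ip (b i) x))
    have h' : ∑ j, I.ofBim (c j) * S.incl ((I.index : ℂ) • I.E (star (I.ofBim (c j)) *
      Z.ip (b i) x)) = Z.ip (b i) x := h
    simp only [Z.ip_ra_left, ← Z.ra_mul, ← Z.ra_sum', h']
    rfl
  l_normal x y a ha := by
    have h1 : WeakNull (M := M) (fun n => Z.ip x (Z.l (S.incl (a n)) y)) := Z.l_normal x y _ ha
    intro ξ η
    have h2 := (I.E_normal _ h1 ξ η).const_mul (I.index : ℂ)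
    rw [mul_zero] at h2
    refine h2.congr fun n => ?_
    rw [← inner_smul_right]
    rfl

section Res

variable {Z W : Bim M}

lemma res_ra (x : Z) (a : S.toFactor.El) : (I.res Z).ra x a = Z.ra x (S.incl a) := rfl

lemma res_ip (x y : Z) : (I.res Z).ip x y = (I.index : ℂ) • I.E (Z.ip x y) := rfl

lemma res_norm2 (z : Z) : (I.res Z).norm2 z = √I.index * Z.norm2 z := by
  rw [norm2, res_ip, map_smul, I.tr_E, smul_eq_mul, Complex.re_ofReal_mul,
    Real.sqrt_mul I.index_pos.le, ← norm2]

lemma null_res {z : ℕ → Z} : Null (I.res Z) z ↔ Null Z z := by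
  have h0 : 0 < √I.index := Real.sqrt_pos.2 I.index_pos
  have e : ∀ n, Z.norm2 (z n) = (√I.index)⁻¹ * (I.res Z).norm2 (z n) := fun n => by
    rw [res_norm2 I (z n), inv_mul_cancel_left₀ h0.ne']
  constructor
  · intro h
    have := Tendsto.const_mul (√I.index)⁻¹ h
    rw [mul_zero] at this
    exact this.congr fun n => (e n).symm
  · intro h
    have := Tendsto.const_mul √I.index h
    rw [mul_zero] at this
    exact this.congr fun n => (I.res_norm2 _).symm

/-- Boundedness over M follows from boundedness over N by expanding in a finite N-basis; the
converse holds because E is positive and unital. -/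
lemma bdd_res {z : ℕ → Z} : Bdd (I.res Z) z ↔ Bdd Z z := by
  constructor
  · rintro ⟨C, hC0, hC⟩
    obtain ⟨n, b, hb⟩ := exists_isBasis (I.res Z)
    refine ⟨∑ i, Z.nrm (b i) * ((I.res Z).nrm (b i) * C), Finset.sum_nonneg fun i _ =>
      mul_nonneg (Z.nrm_nonneg _) (mul_nonneg (Bim.nrm_nonneg _ _) hC0), fun k => ?_⟩
    rw [← hb (z k)]
    refine (Z.nrm_sum_le _ _).trans (Finset.sum_le_sum fun i _ => ?_)
    refine (Z.nrm_ra_le _ _).trans (mul_le_mul_of_nonneg_left ?_ (Z.nrm_nonneg _))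
    exact ((I.res Z).norm_ip_le _ _).trans
      (mul_le_mul_of_nonneg_left (hC k) (Bim.nrm_nonneg _ _))
  · rintro ⟨C, hC0, hC⟩
    refine ⟨√I.index * C, mul_nonneg (Real.sqrt_nonneg _) hC0, fun k => ?_⟩
    obtain ⟨c, hc, h2, h3, -⟩ := Z.exists_abs (z k)
    obtain ⟨d, hd⟩ := M.exists_defect c (h3.le.trans (hC k))
    -- With d* d = C² - ⟨z|z⟩_M, the defect [M : N] C² - ⟨z|z⟩_N is the inner square of d in L²M.
    have h := nrm_le_of_defect (I.res Z) (Y := unit S.toFactor) (Z := I.bim) (x := z k)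
      (y := toUnit 1) (z := I.toBim d) (K := √I.index * C)
      (mul_nonneg (Real.sqrt_nonneg _) hC0) (by
        rw [bim_ip, ofBim_toBim, hd, hc, h2, res_ip, unit_ip, map_sub, map_smul, smul_sub,
          smul_smul, mul_pow, Real.sq_sqrt I.index_pos.le, Complex.ofReal_mul]
        have e : I.E 1 = 1 := by rw [← map_one S.incl, I.E_incl]
        simp [e])
    rwa [nrm_toUnit, OneMemClass.coe_one, (show ‖(1 : H →L[ℂ] H)‖ = 1 from by
      have : Nontrivial (H →L[ℂ] H) := ⟨1, 0, fun h => by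
        have h1 := M.tr_one
        rw [show (1 : M.El) = 0 from Subtype.ext h, map_zero] at h1
        exact zero_ne_one h1⟩
      exact norm_one), mul_one] at h

/-- L²M is by definition the restriction of the unit bimodule of M. -/
lemma null_bim {x : ℕ → M.El} : Null I.bim (fun n => I.toBim (x n)) ↔ NullA x :=
  I.null_res (Z := unit M)

lemma bdd_bim {x : ℕ → M.El} : Bdd I.bim (fun n => I.toBim (x n)) ↔ BddA x :=
  (I.bdd_res (Z := unit M)).trans bddA_iff.symm

lemma nullA_E {x : ℕ → M.El} (hx : NullA x) : NullA fun n => I.E (x n) := by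
  have h := Null.smul (X := unit S.toFactor)
    (Null.ip_left (bdd_const (I.toBim 1)) (I.null_bim.2 hx)) (I.index : ℂ)⁻¹
  refine nullA_congr h fun n => ?_
  rw [bim_ip, ofBim_toBim, ofBim_toBim, star_one, one_mul]
  exact inv_smul_smul₀ I.index_ne _

end Res

/-- The standing assumption: `L²M` is a commutative Q-system in `χ̃(N)`. -/
structure Comm : Prop where
  mem : chi S.toFactor I.bim
  comm : I.qSystem.IsCommutative

variable {I}

/-- The relation m u = m is evaluated at q_n ⊠ y, where u is asymptotically the flip. This is where
commutativity of Q becomes a statement about sequences in M. -/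
lemma Comm.br_mul (h : I.Comm) {q : ℕ → I.bim} (hq : CentralVec I.bim q) (y : I.bim) :
    Null I.bim fun n => map I.mul (tm (q n) y) - map I.mul (tm y (q n)) := by
  have h1 := (br_braid h.mem.1 h.mem.2.1 q hq y).map (RLin.map I.mul)
  have h2 : braid I.bim I.bim ≫ I.mul = I.mul := h.comm.1
  refine null_congr h1 fun n => ?_
  have h3 := congrArg (fun f => map f (tm (q n) y)) h2
  rw [map_sub]
  exact congrArg (· - _) h3

/-- Sequences in `M` that are central for `N` are central for `M`. -/
lemma Comm.isCentralSeq (h : I.Comm) {q : ℕ → M.El}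
    (hq : CentralVec I.bim fun n => I.toBim (q n)) : IsCentralSeq q := by
  refine ⟨I.bdd_bim.1 hq.bdd, fun b => ?_⟩
  refine I.null_bim.1 (null_congr (h.br_mul hq (I.toBim b)) fun n => ?_)
  rw [mul_tm, mul_tm]
  rfl

lemma centralVec_bim {q : ℕ → M.El} (hq : IsCentralSeq q) :
    CentralVec I.bim fun n => I.toBim (q n) := by
  refine ⟨I.bdd_bim.2 hq.1, fun a => ?_⟩
  exact null_congr (I.null_bim.2 (NullA.neg (hq.2 (S.incl a)))) fun n =>
    congrArg I.toBim (neg_sub _ _)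

/-- Central sequences of `N` are central for `M`. -/
lemma Comm.isCentralSeq_incl (h : I.Comm) {a : ℕ → S.toFactor.El} (ha : IsCentralSeq a) :
    IsCentralSeq fun n => S.incl (a n) :=
  ⟨ha.1, fun b => I.null_bim.1 (h.mem.2.1 a ha (I.toBim b))⟩

lemma centralVec_res {Z : Bim M} {z : ℕ → Z} (hz : CentralVec Z z) : CentralVec (I.res Z) z :=
  ⟨I.bdd_res.2 hz.bdd, fun a => I.null_res.2 (hz.comm (S.incl a))⟩

/-- The restriction has an approximately inner basis of vectors that are central for `M`. -/
lemma Comm.exists_isAIBasis_res (h : I.Comm) {Z : Bim M} (hZ : ApproxInner Z) :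
    ∃ (m : ℕ) (b : ℕ → Fin m → Z), IsAIBasis (I.res Z) b ∧ ∀ i, CentralVec Z fun n => b n i := by
  obtain ⟨m, b, hb⟩ := hZ
  obtain ⟨k, q, hq⟩ := h.mem.1
  obtain ⟨p, e, he⟩ := exists_isBasis (I.res Z)
  have hqc : ∀ j, IsCentralSeq fun n => I.ofBim (q n j) := fun j =>
    h.isCentralSeq (q := fun n => I.ofBim (q n j)) (hq.central j)
  -- The new basis is b_i q_j, with q an approximately inner basis of L²M. Its members are M-central
  -- because the q_j are central sequences of M. The index τ is fast enough for q to expand the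
  -- finitely many ⟨b_i|e_s⟩ ∈ M belonging to each n.
  let w : ℕ → Fin m → Fin p → I.bim := fun n i s => I.toBim (Z.ip (b n i) (e s))
  obtain ⟨τ, hτ, hp⟩ := exists_fast (p := fun n t => ∑ i, ∑ s, I.bim.norm2
    (w n i s - ∑ j, I.bim.ra (q t j) (I.bim.ip (q t j) (w n i s)))) (fun n => by
      rw [show (0 : ℝ) = ∑ i : Fin m, ∑ s : Fin p, (0 : ℝ) by simp]
      exact tendsto_finsetSum _ fun i _ => tendsto_finsetSum _ fun s _ => hq.approx (w n i s))
  have hn : ∀ i s, NullA fun n => I.ofBim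
      (w n i s - ∑ j, I.bim.ra (q (τ n) j) (I.bim.ip (q (τ n) j) (w n i s))) := fun i s => by
    refine I.null_bim.1 (squeeze_zero (fun n => I.bim.norm2_nonneg _) (fun n => ?_) hp)
    have h0 := fun z : I.bim => I.bim.norm2_nonneg z
    refine le_trans ?_ (Finset.single_le_sum (fun i _ => Finset.sum_nonneg fun s _ => h0 _)
      (Finset.mem_univ i))
    exact Finset.single_le_sum (f := fun s => I.bim.norm2 (w n i s -
      ∑ j, I.bim.ra (q (τ n) j) (I.bim.ip (q (τ n) j) (w n i s))))
      (fun s _ => h0 _) (Finset.mem_univ s)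
  refine ⟨m * k, fun n l => Z.ra (b n (finProdFinEquiv.symm l).1)
    (I.ofBim (q (τ n) (finProdFinEquiv.symm l).2)), isAIBasis_of_basis he (fun l =>
      centralVec_res ((hb.central _).ra ((hqc _).comp hτ))) fun s => ?_,
    fun l => (hb.central _).ra ((hqc _).comp hτ)⟩
  have h1 : Null Z fun n => e s - ∑ i, Z.ra (b n i) (Z.ip (b n i) (e s)) := hb.approx (e s)
  have h2 := Null.sum Finset.univ fun i _ => NullA.ra (hb.central i).bdd (hn i s)
  refine I.null_res.2 (null_congr (h1.add h2) fun n => ?_)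
  have e2 : ∀ i, Z.ra (b n i) (I.ofBim
      (w n i s - ∑ j, I.bim.ra (q (τ n) j) (I.bim.ip (q (τ n) j) (w n i s)))) =
      Z.ra (b n i) (Z.ip (b n i) (e s)) - ∑ j, (I.res Z).ra (Z.ra (b n i) (I.ofBim (q (τ n) j)))
        ((I.res Z).ip (Z.ra (b n i) (I.ofBim (q (τ n) j))) (e s)) := fun i => by
    rw [map_sub, ra_sub', map_sum, Z.ra_sum']
    refine congrArg (_ - ·) (Finset.sum_congr rfl fun j _ => ?_)
    rw [bim_ra, bim_ip, ofBim_toBim, Z.ra_mul, res_ra, res_ip, Z.ip_ra_left]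
    rfl
  rw [Finset.sum_congr rfl fun i _ => e2 i, Finset.sum_sub_distrib, sub_add_sub_cancel]
  refine congrArg (e s - ·) (Eq.trans ?_ (finProdFinEquiv.symm.sum_comp (fun p : Fin m × Fin k =>
    (I.res Z).ra (Z.ra (b n p.1) (I.ofBim (q (τ n) p.2)))
      ((I.res Z).ip (Z.ra (b n p.1) (I.ofBim (q (τ n) p.2))) (e s)))).symm)
  rw [Fintype.sum_prod_type]

lemma Comm.approxInner_res (h : I.Comm) {Z : Bim M} (hZ : ApproxInner Z) :
    ApproxInner (I.res Z) := by
  obtain ⟨m, b, hb, -⟩ := h.exists_isAIBasis_res hZ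
  exact ⟨m, b, hb⟩

lemma Comm.centrallyTrivial_res (h : I.Comm) {Z : Bim M} (hZ : CentrallyTrivial Z) :
    CentrallyTrivial (I.res Z) := fun _ ha x =>
  I.null_res.2 (hZ _ (h.isCentralSeq_incl ha) x)

end FiniteIndex

/-! ## Dual bimodules -/

namespace Bim

variable {A : IIOneFactor H}

/-- A dual `Y` of `X`, written with an `A`-valued pairing and a finite dual basis. -/
structure DualData (X Y : Bim A) where
  B : Y →ₗ[ℂ] X →ₗ[ℂ] A.El
  l_B : ∀ a ξ x, B (Y.l a ξ) x = a * B ξ x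
  B_ra : ∀ ξ x a, B ξ (X.ra x a) = B ξ x * a
  bal : ∀ ξ a x, B (Y.ra ξ a) x = B ξ (X.l a x)
  n : ℕ
  e : Fin n → X
  f : Fin n → Y
  expand : ∀ x, ∑ k, X.ra (e k) (B (f k) x) = x
  expand' : ∀ ξ, ∑ k, Y.l (B ξ (e k)) (f k) = ξ

/-- Every vector of `X ⊠ Y` is a finite sum of simple tensors. -/
lemma exists_sum_tm {X Y : Bim A} (t : tensor X Y) :
    ∃ (n : ℕ) (e : Fin n → X) (f : Fin n → Y), t = ∑ k, tm (e k) (f k) := by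
  obtain ⟨n, b, hb⟩ := exists_isBasis X
  exact ⟨n, b, fun k => contract (b k) t, (Ten.expand hb t).symm⟩

/-- Write the coevaluation of 1 as ∑ e_k ⊠ f_k; the two zigzag identities, evaluated at ξ and at x,
are the two expansions. -/
lemma exists_dualData {X Y : Bim A} (p : ExactPairing X Y) : Nonempty (DualData X Y) := by
  obtain ⟨n, e, f, hef⟩ := exists_sum_tm (map p.coevaluation' (toUnit 1) : tensor X Y)
  let B : Y →ₗ[ℂ] X →ₗ[ℂ] A.El :=
    LinearMap.compr₂ tmL (ofUnit ∘ₗ (map p.evaluation' : tensor Y X →ₗ[ℂ] unit A))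
  have hB : ∀ ξ x, toUnit (B ξ x) = map p.evaluation' (tm ξ x) := fun _ _ => rfl
  refine ⟨⟨B, fun a ξ x => ?_, fun ξ x a => ?_, fun ξ a x => ?_, n, e, f, fun x => ?_,
    fun ξ => ?_⟩⟩
  · change map p.evaluation' (tm (Y.l a ξ) x) = (unit A).l a (map p.evaluation' (tm ξ x))
    rw [← map_l]
    exact congrArg _ (tensor_l a ξ x).symm
  · change map p.evaluation' (tm ξ (X.ra x a)) = (unit A).ra (map p.evaluation' (tm ξ x)) a
    rw [← map_ra]
    exact congrArg _ (tensor_ra a ξ x).symm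
  · change map p.evaluation' (tm (Y.ra ξ a) x) = map p.evaluation' (tm ξ (X.l a x))
    rw [ra_tm]
  · have h1 := congrArg (fun g => map (g ≫ (ρ_ X).hom) (tm (toUnit 1) x))
      p.evaluation_coevaluation'
    simp only [map_comp, Category.assoc, Iso.inv_hom_id, map_id] at h1
    have h2 : map (p.coevaluation' ▷ X) (tm (toUnit 1) x) = ∑ k, tm (tm (e k) (f k)) x :=
      (whiskerRight_tm _ _ _).trans ((congrArg (fun t => tm t x) hef).trans (sum_tm _ _ _))
    rw [h2] at h1
    simp only [map_sum] at h1
    refine Eq.trans (Finset.sum_congr rfl fun k _ => ?_) (h1.trans ?_)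
    · rw [associator_tm, whiskerLeft_tm, rightUnitor_tm]
      rfl
    · exact (leftUnitor_tm _ _).trans (X.l_one x)
  · have h1 := congrArg (fun g => map (g ≫ (λ_ Y).hom) (tm ξ (toUnit 1)))
      p.coevaluation_evaluation'
    simp only [map_comp, Category.assoc, Iso.inv_hom_id, map_id] at h1
    have h2 : map (Y ◁ p.coevaluation') (tm ξ (toUnit 1)) = ∑ k, tm ξ (tm (e k) (f k)) :=
      (whiskerLeft_tm _ _ _).trans ((congrArg (fun t => tm ξ t) hef).trans (tm_sum _ _ _))
    rw [h2] at h1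
    simp only [map_sum] at h1
    refine Eq.trans (Finset.sum_congr rfl fun k _ => ?_) (h1.trans ?_)
    · rw [associator_inv_tm, whiskerRight_tm, leftUnitor_tm]
      rfl
    · exact (rightUnitor_tm _ _).trans (Y.ra_one ξ)

namespace DualData

variable {X Y : Bim A} (D : DualData X Y)

/-- The evaluation. -/
noncomputable def ev : tensor Y X ⟶ unit A :=
  mkHom (toUnit ∘ₗ lift D.B D.bal)
    (fun a => tensor_l_ext (Z := unit A) _ a fun ξ x => by
      simp only [LinearMap.comp_apply, lift_tm, D.l_B]; rfl)
    (fun t a => tensor_ra_ext (Z := unit A) _ a (fun ξ x => by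
      simp only [LinearMap.comp_apply, lift_tm, D.B_ra]; rfl) t)

lemma ev_tm (ξ : Y) (x : X) : map D.ev (tm ξ x) = toUnit (D.B ξ x) :=
  congrArg toUnit (lift_tm D.B D.bal ξ x)

/-- Expanding a e_k along e, or f_l a along f, gives the same double sum with entries B(f_l, a e_k).
It is needed for the coevaluation to be a bimodule map. -/
lemma central (a : A.El) :
    ∑ k, tm (X.l a (D.e k)) (D.f k) = ∑ k, tm (D.e k) (Y.ra (D.f k) a) := by
  have h1 : ∀ k, X.l a (D.e k) = ∑ l, X.ra (D.e l) (D.B (D.f l) (X.l a (D.e k))) := fun k =>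
    (D.expand _).symm
  have h2 : ∀ l, Y.ra (D.f l) a = ∑ k, Y.l (D.B (D.f l) (X.l a (D.e k))) (D.f k) := fun l => by
    conv_lhs => rw [← D.expand' (Y.ra (D.f l) a)]
    simp only [D.bal]
  simp_rw [h2, tm_sum, ← ra_tm]
  rw [Finset.sum_comm]
  refine Finset.sum_congr rfl fun k _ => ?_
  rw [← sum_tm, ← h1]

/-- The coevaluation. -/
noncomputable def coev : unit A ⟶ tensor X Y :=
  mkHom ((lL (tensor X Y)).flip (∑ k, tm (D.e k) (D.f k)) ∘ₗ ofUnit)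
    (fun a x => Bim.l_mul (tensor X Y) a (ofUnit x) (∑ k, tm (D.e k) (D.f k)))
    (fun x a => by
      change (tensor X Y).l (ofUnit x * a) (∑ k, tm (D.e k) (D.f k)) =
        (tensor X Y).ra ((tensor X Y).l (ofUnit x) (∑ k, tm (D.e k) (D.f k))) a
      rw [Bim.l_mul, ← Bim.l_ra, Bim.ra_sum, map_sum]
      simp only [tensor_l, tensor_ra]
      rw [D.central])

lemma coev_one : map D.coev (toUnit 1) = ∑ k, tm (D.e k) (D.f k) :=
  Bim.l_one (tensor X Y) _

/-- The duality as an exact pairing. -/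
@[reducible] noncomputable def exactPairing : ExactPairing X Y where
  coevaluation' := D.coev
  evaluation' := D.ev
  coevaluation_evaluation' := by
    have h : (Y ◁ D.coev ≫ (α_ Y X Y).inv ≫ D.ev ▷ Y) ≫ (λ_ Y).hom = (ρ_ Y).hom := by
      rw [← cancel_epi (ρ_ Y).inv, Iso.inv_hom_id]
      refine hom_ext fun ξ => ?_
      have h0 : map (ρ_ Y).inv ξ = tm ξ (toUnit 1) := rfl
      have h1 : map (Y ◁ D.coev) (tm ξ (toUnit 1)) = ∑ k, tm ξ (tm (D.e k) (D.f k)) :=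
        (whiskerLeft_tm _ _ _).trans ((congrArg (fun t => tm ξ t) D.coev_one).trans
          (tm_sum _ _ _))
      simp only [map_comp]
      rw [h0, h1]
      simp only [map_sum]
      refine Eq.trans (Finset.sum_congr rfl fun k _ => ?_) (D.expand' ξ)
      rw [associator_inv_tm, whiskerRight_tm, ev_tm]
      exact leftUnitor_tm _ _
    rw [← cancel_mono (λ_ Y).hom, h, Category.assoc, Iso.inv_hom_id, Category.comp_id]
  evaluation_coevaluation' := by
    have h : (D.coev ▷ X ≫ (α_ X Y X).hom ≫ X ◁ D.ev) ≫ (ρ_ X).hom = (λ_ X).hom := by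
      rw [← cancel_epi (λ_ X).inv, Iso.inv_hom_id]
      refine hom_ext fun x => ?_
      have h0 : map (λ_ X).inv x = tm (toUnit 1) x := rfl
      have h1 : map (D.coev ▷ X) (tm (toUnit 1) x) = ∑ k, tm (tm (D.e k) (D.f k)) x :=
        (whiskerRight_tm _ _ _).trans ((congrArg (fun t => tm t x) D.coev_one).trans
          (sum_tm _ _ _))
      simp only [map_comp]
      rw [h0, h1]
      simp only [map_sum]
      refine Eq.trans (Finset.sum_congr rfl fun k _ => ?_) (D.expand x)
      rw [associator_tm, whiskerLeft_tm, ev_tm]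
      exact rightUnitor_tm _ _
    rw [← cancel_mono (ρ_ X).hom, h, Category.assoc, Iso.inv_hom_id, Category.comp_id]

lemma ext {ξ η : Y} (h : ∀ x, D.B ξ x = D.B η x) : ξ = η := by
  rw [← D.expand' ξ, ← D.expand' η]
  simp only [h]

/-- The vector that represents a right linear functional. -/
lemma exists_rep (φ : X →ₗ[ℂ] A.El) (hφ : ∀ x a, φ (X.ra x a) = φ x * a) :
    ∃ ξ : Y, ∀ x, D.B ξ x = φ x := by
  refine ⟨∑ k, Y.l (φ (D.e k)) (D.f k), fun x => ?_⟩
  conv_rhs => rw [← D.expand x]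
  simp only [map_sum, LinearMap.sum_apply, D.l_B, hφ]

lemma null_of_B {ξ : ℕ → Y} (h : ∀ x, NullA fun n => D.B (ξ n) x) : Null Y ξ :=
  null_congr (Null.sum Finset.univ fun k _ => (h (D.e k)).l (bdd_const (D.f k)))
    fun n => D.expand' (ξ n)

end DualData

end Bim

namespace FiniteIndex

variable {M : IIOneFactor H} {S : Subfactor M} (I : FiniteIndex S)

/-- Restriction of a duality to `N`. -/
noncomputable def dualRes {Z W : Bim M} (D : DualData Z W) : DualData (I.res Z) (I.res W) where
  B := LinearMap.compr₂ D.B I.E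
  l_B a ξ x := by
    change I.E (D.B (W.l (S.incl a) ξ) x) = a * I.E (D.B ξ x)
    rw [D.l_B, I.E_mul_left]
  B_ra ξ x a := by
    change I.E (D.B ξ (Z.ra x (S.incl a))) = I.E (D.B ξ x) * a
    rw [D.B_ra, I.E_mul_right]
  bal ξ a x := congrArg I.E (D.bal ξ (S.incl a) x)
  n := D.n * I.n
  -- A Pimsner-Popa basis enters the dual basis because x = ∑ c_j E(c_j* x) recovers the M-valued
  -- pairing from its image under E.
  e k := Z.ra (D.e (finProdFinEquiv.symm k).1) (I.c (finProdFinEquiv.symm k).2)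
  f k := W.l (star (I.c (finProdFinEquiv.symm k).2)) (D.f (finProdFinEquiv.symm k).1)
  expand x := by
    refine (finProdFinEquiv.symm.sum_comp (fun p : Fin D.n × Fin I.n =>
      Z.ra (Z.ra (D.e p.1) (I.c p.2))
        (S.incl (I.E (D.B (W.l (star (I.c p.2)) (D.f p.1)) x))))).trans ?_
    rw [Fintype.sum_prod_type]
    simp only [D.l_B, ← Z.ra_mul, ← Z.ra_sum', I.expand, D.expand]
  expand' ξ := by
    refine (finProdFinEquiv.symm.sum_comp (fun p : Fin D.n × Fin I.n =>
      W.l (S.incl (I.E (D.B ξ (Z.ra (D.e p.1) (I.c p.2)))))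
        (W.l (star (I.c p.2)) (D.f p.1)))).trans ?_
    rw [Fintype.sum_prod_type]
    simp only [D.B_ra, ← W.l_mul]
    simp only [← LinearMap.sum_apply, ← map_sum, I.expand']
    simp only [D.expand']

variable {I}

/-- Restriction preserves approximate innerness and central triviality for Z and for its dual, and
one restricted pairing is enough by `chi_of_exactPairing`. -/
lemma Comm.chi_res (h : I.Comm) {Z : Bim M} (hZ : chi M Z) : chi S.toFactor (I.res Z) := by
  obtain ⟨h1, h2, W, h3, h4, ⟨p⟩, ⟨p'⟩⟩ := hZ
  obtain ⟨D⟩ := exists_dualData p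
  exact chi_of_exactPairing ⟨h.approxInner_res h1, h.centrallyTrivial_res h2⟩
    ⟨h.approxInner_res h3, h.centrallyTrivial_res h4⟩ ⟨(I.dualRes D).exactPairing⟩

end FiniteIndex
end LocalExt

namespace LocalExt

variable {H : Type u} [NormedAddCommGroup H] [InnerProductSpace ℂ H] [CompleteSpace H]

namespace FiniteIndex

variable {M : IIOneFactor H} {S : Subfactor M} (I : FiniteIndex S)

/-! ## Right actions of `M` on `N`-bimodules -/

/-- A unital associative right action of `L²M`. -/
structure RAct (X : Bim S.toFactor) where
  act : tensor X I.bim ⟶ X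
  act_act : ∀ x q r, map act (tm (map act (tm x (I.toBim q))) (I.toBim r)) =
    map act (tm x (I.toBim (q * r)))
  act_one : ∀ x, map act (tm x (I.toBim 1)) = x

variable {I}

namespace RAct

variable {X : Bim S.toFactor} (R : I.RAct X)

/-- The right action of `M`. -/
noncomputable def rho : X →ₗ[ℂ] M.El →ₗ[ℂ] X :=
  LinearMap.compr₂ (LinearMap.compl₂ tmL I.toBim.toLinearMap) (map R.act)

lemma rho_apply (x : X) (q : M.El) : R.rho x q = map R.act (tm x (I.toBim q)) := rfl

lemma rho_rho (x : X) (q r : M.El) : R.rho (R.rho x q) r = R.rho x (q * r) := R.act_act x q r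

lemma rho_one (x : X) : R.rho x 1 = x := R.act_one x

lemma rho_ra' (x : X) (q : M.El) (a : S.toFactor.El) :
    X.ra (R.rho x q) a = R.rho x (q * S.incl a) := by
  rw [rho_apply, ← map_ra, tensor_ra]
  rfl

lemma rho_incl (x : X) (a : S.toFactor.El) : R.rho x (S.incl a) = X.ra x a := by
  conv_rhs => rw [← R.rho_one x, rho_ra', one_mul]

lemma rho_ra (x : X) (a : S.toFactor.El) (q : M.El) :
    R.rho (X.ra x a) q = R.rho x (S.incl a * q) := by
  rw [← rho_incl, rho_rho]

lemma rho_l (a : S.toFactor.El) (x : X) (q : M.El) : R.rho (X.l a x) q = X.l a (R.rho x q) := by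
  rw [rho_apply, rho_apply, ← map_l, tensor_l]

lemma rho_mul_c (x : X) (q : M.El) (k : Fin I.n) : R.rho x (q * I.c k) =
    ∑ l, X.ra (R.rho x (I.c l)) (I.E (star (I.c l) * q * I.c k)) := by
  conv_lhs => rw [← I.expand (q * I.c k)]
  simp only [map_sum, rho_ra', mul_assoc]

/-- The `M`-valued inner product `[M : N]⁻¹ ∑ ⟨x|y c_j⟩ c_j*`. -/
noncomputable def ipM (x y : X) : M.El :=
  (I.index : ℂ)⁻¹ • ∑ j, S.incl (X.ip x (R.rho y (I.c j))) * star (I.c j)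

lemma ipM_add (x y z : X) : R.ipM x (y + z) = R.ipM x y + R.ipM x z := by
  simp only [ipM, map_add, LinearMap.add_apply, X.ip_add, add_mul, Finset.sum_add_distrib,
    smul_add]

/-- Expanding q c_j in the Pimsner-Popa basis moves the N-valued coefficients out of the inner
product, and `expand'` resums them to c_l* q. -/
lemma ipM_rho (x y : X) (q : M.El) : R.ipM x (R.rho y q) = R.ipM x y * q := by
  rw [ipM, ipM, smul_mul_assoc]
  congr 1
  simp only [rho_rho, rho_mul_c, X.ip_sum, X.ip_ra, map_sum, map_mul, Finset.sum_mul]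
  rw [Finset.sum_comm]
  refine Finset.sum_congr rfl fun l _ => ?_
  simp only [mul_assoc, ← Finset.mul_sum]
  have := I.expand' (star (I.c l) * q)
  simp only [mul_assoc] at this
  rw [this]

/-- The expansion 1 = ∑ c_j E(c_j*) puts y back together. With `ext_E` it makes the M-valued inner
product determined by the N-valued one and the action. -/
lemma E_ipM (x y : X) : (I.index : ℂ) • I.E (R.ipM x y) = X.ip x y := by
  rw [ipM, map_smul, smul_inv_smul₀ I.index_ne, map_sum]
  simp only [I.E_mul_left]
  conv_rhs => rw [← R.rho_one y, ← I.expand 1]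
  simp only [map_sum, ← rho_ra', X.ip_sum, X.ip_ra, mul_one]

lemma E_ipM_mul (x y : X) (r : M.El) :
    (I.index : ℂ) • I.E (R.ipM x y * r) = X.ip x (R.rho y r) := by
  rw [← ipM_rho, E_ipM]

lemma ipM_ext {x y x' y' : X} (h : ∀ r, X.ip x (R.rho y r) = X.ip x' (R.rho y' r)) :
    R.ipM x y = R.ipM x' y' :=
  I.ext_E fun r => smul_right_injective _ I.index_ne (by
    simp only [E_ipM_mul, h])

/-- A basis over `N` is a basis over `M`. -/
lemma sum_basis {n : ℕ} {b : Fin n → X} (hb : X.IsBasis b) (x : X) :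
    ∑ i, R.rho (b i) (R.ipM (b i) x) = x := by
  have h1 : ∀ i, R.rho (b i) (R.ipM (b i) x) = (I.index : ℂ)⁻¹ • ∑ j,
      R.rho (X.ra (b i) (X.ip (b i) (R.rho x (I.c j)))) (star (I.c j)) := fun i => by
    simp only [ipM, map_smul, map_sum, rho_ra]
  simp only [h1, ← Finset.smul_sum]
  rw [Finset.sum_comm]
  have h2 : ∀ j, ∑ i, R.rho (X.ra (b i) (X.ip (b i) (R.rho x (I.c j)))) (star (I.c j)) =
      R.rho x (I.c j * star (I.c j)) := fun j => by
    rw [← LinearMap.sum_apply, ← map_sum, hb, rho_rho]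
  simp only [h2]
  rw [← map_sum, I.sum_eq, map_smul, rho_one, inv_smul_smul₀ I.index_ne]

lemma tensor_ip_comul (x y : X) (q : M.El) :
    (tensor X I.bim).ip (tm x (I.toBim q)) ((I.index : ℂ)⁻¹ •
      ∑ j, tm (R.rho y (I.c j)) (I.toBim (star (I.c j)))) =
      (I.index : ℂ) • I.E (star q * R.ipM x y) := by
  rw [Bim.ip_smul, Bim.ip_sum]
  simp only [tensor_ip, bim_l, bim_ip, ofBim_toBim]
  rw [ipM, mul_smul_comm, map_smul, Finset.mul_sum, map_sum, Finset.smul_sum, Finset.smul_sum,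
    Finset.smul_sum]
  exact Finset.sum_congr rfl fun j _ => smul_comm _ _ _

/-- Compatibility of the action with the inner product. -/
def Unitary : Prop := ∀ x q y, X.ip (R.rho x q) y = (I.index : ℂ) • I.E (star q * R.ipM x y)

/-- The right hand side pairs with x ⊠ q to [M : N] E(q* ⟨x|y⟩_M) by `tensor_ip_comul`, so the
condition amounts to an explicit formula for the adjoint of the action. -/
lemma unitary_iff : R.Unitary ↔ ∀ y, map (dagger R.act) y =
    (I.index : ℂ)⁻¹ • ∑ j, tm (R.rho y (I.c j)) (I.toBim (star (I.c j))) := by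
  constructor
  · intro h y
    refine (tensor X I.bim).ext_ip fun t => ?_
    rw [← ip_map]
    induction t using tensor_induction with
    | h0 => rw [map_zero, ← Bim.star_ip, ← Bim.star_ip (tensor X I.bim), Bim.ip_zero, Bim.ip_zero]
    | h2 t s ht hs => rw [map_add, Bim.ip_add_left, Bim.ip_add_left, ht, hs]
    | h1 x q => exact (h x (I.ofBim q) y).trans (R.tensor_ip_comul x y (I.ofBim q)).symm
  · intro h x q y
    rw [← tensor_ip_comul, ← h, ← ip_map]
    rfl

variable {R}

/-- By `ext_E` it suffices to apply E(· r); then both sides are expressed by ⟨x r|y⟩, which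
compatibility computes. -/
lemma Unitary.star_ipM (h : R.Unitary) (x y : X) : star (R.ipM x y) = R.ipM y x := by
  refine I.ext_E fun r => smul_right_injective _ I.index_ne ?_
  change (I.index : ℂ) • I.E (star (R.ipM x y) * r) = (I.index : ℂ) • I.E (R.ipM y x * r)
  rw [E_ipM_mul, ← X.star_ip, h, star_smul, ← I.E_star, star_mul, star_star, Complex.star_def,
    Complex.conj_ofReal]

/-- For an N-basis b, `sum_basis` and hermitian symmetry write ⟨x|x⟩_M as ∑ ⟨b_i|x⟩_M* ⟨b_i|x⟩_M. -/
lemma Unitary.ipM_pos (h : R.Unitary) (x : X) : ((R.ipM x x : M.El) : H →L[ℂ] H).IsPositive := by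
  obtain ⟨n, b, hb⟩ := exists_isBasis X
  have h1 : R.ipM x x = ∑ i, star (R.ipM (b i) x) * R.ipM (b i) x := by
    let φ : X →+ M.El := ⟨⟨R.ipM x, by
      have := R.ipM_add x 0 0; simpa using this⟩, R.ipM_add x⟩
    change φ x = _
    conv_lhs => rw [← R.sum_basis hb x]
    rw [map_sum]
    refine Finset.sum_congr rfl fun i _ => ?_
    change R.ipM x _ = _
    rw [ipM_rho, h.star_ipM]
  rw [h1, ← ContinuousLinearMap.nonneg_iff_isPositive, AddSubmonoidClass.coe_finsetSum]
  exact Finset.sum_nonneg fun i _ => (ContinuousLinearMap.nonneg_iff_isPositive _).2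
    (ContinuousLinearMap.isPositive_adjoint_comp_self (R.ipM (b i) x : H →L[ℂ] H))

end RAct

/-! ## Local modules -/

section Loc

variable (X : LocMod I.qSystem)

/-- The action of a local module, as a morphism on `X ⊠ L²M`. -/
noncomputable def actB : X.X ⊗ I.bim ⟶ X.X := X.act

lemma actB_assoc : actB X ▷ I.bim ≫ actB X = (α_ X.X I.bim I.bim).hom ≫ X.X ◁ I.mul ≫ actB X :=
  X.act_assoc

lemma actB_unit : X.X ◁ I.one ≫ actB X = (ρ_ X.X).hom := X.act_unit

lemma actB_frobenius : actB X ≫ dagger (actB X) =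
    X.X ◁ dagger I.mul ≫ (α_ X.X I.bim I.bim).inv ≫ actB X ▷ I.bim := X.frobenius

/-- The right action of a local module. -/
noncomputable def ract : I.RAct X.X where
  act := actB X
  act_act x q r := by
    have h := congrArg (fun f => map f (tm (tm x (I.toBim q)) (I.toBim r))) (actB_assoc X)
    have e1 : map (actB X ▷ I.bim ≫ actB X) (tm (tm x (I.toBim q)) (I.toBim r)) =
      map (actB X) (tm (map (actB X) (tm x (I.toBim q))) (I.toBim r)) := by
      rw [map_comp, whiskerRight_tm]
    have e2 : map ((α_ X.X I.bim I.bim).hom ≫ X.X ◁ I.mul ≫ actB X)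
        (tm (tm x (I.toBim q)) (I.toBim r)) =
      map (actB X) (tm x (map I.mul (tm (I.toBim q) (I.toBim r)))) := by
      rw [map_comp, map_comp, associator_tm, whiskerLeft_tm]
    exact e1.symm.trans (h.trans (e2.trans
      (congrArg (fun t => map (actB X) (tm x t)) (I.mul_tm (I.toBim q) (I.toBim r)))))
  act_one x := by
    have h := congrArg (fun f => map f (tm x (toUnit 1))) (actB_unit X)
    have e1 : map (X.X ◁ I.one ≫ actB X) (tm x (toUnit 1)) =
        map (actB X) (tm x (map I.one (toUnit 1))) := by rw [map_comp, whiskerLeft_tm]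
    have e2 : map I.one (toUnit 1) = I.toBim 1 :=
      (I.one_apply _).trans (congrArg I.toBim (map_one S.incl))
    have e3 : map (ρ_ X.X).hom (tm x (toUnit 1)) = x := (rightUnitor_tm _ _).trans (X.X.ra_one x)
    exact (congrArg (fun t => map (actB X) (tm x t)) e2.symm).trans (e1.symm.trans (h.trans e3))

/-- Evaluate the Frobenius relation ρ†ρ = (ρ ⊠ 1)(1 ⊠ m†) at y ⊠ 1, where m†(1) = [M : N]⁻¹ ∑ c_j ⊠
c_j*. -/
lemma unitary_ract : (ract X).Unitary := by
  rw [RAct.unitary_iff]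
  intro y
  have h := congrArg (fun f => map f (tm y (I.toBim 1))) (actB_frobenius X)
  have e1 : map (actB X ≫ dagger (actB X)) (tm y (I.toBim 1)) = map (dagger (actB X)) y :=
    congrArg (map (dagger (actB X))) ((ract X).act_one y)
  have e2 : map (dagger I.mul) (I.toBim 1) = (I.index : ℂ)⁻¹ • ∑ j,
      tm (I.toBim (I.c j)) (I.toBim (star (I.c j))) := by
    refine (I.dagger_mul (I.toBim 1)).trans ?_
    simp only [ofBim_toBim, one_mul]
  have e3 : map (X.X ◁ dagger I.mul ≫ (α_ X.X I.bim I.bim).inv ≫ actB X ▷ I.bim)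
      (tm y (I.toBim 1)) = map ((α_ X.X I.bim I.bim).inv ≫ actB X ▷ I.bim)
        (tm y (map (dagger I.mul) (I.toBim 1))) := by
    rw [map_comp, whiskerLeft_tm]
  refine e1.symm.trans (h.trans (e3.trans ?_))
  rw [e2]
  have e4 : ∀ j, map ((α_ X.X I.bim I.bim).inv ≫ actB X ▷ I.bim)
      (tm y (tm (I.toBim (I.c j)) (I.toBim (star (I.c j))))) =
      tm ((ract X).rho y (I.c j)) (I.toBim (star (I.c j))) := fun j => by
    rw [map_comp, associator_inv_tm, whiskerRight_tm]
    rfl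
  have e5 : tm y ((I.index : ℂ)⁻¹ • ∑ j, tm (I.toBim (I.c j)) (I.toBim (star (I.c j)))) =
      (I.index : ℂ)⁻¹ • ∑ j, tm y (tm (I.toBim (I.c j)) (I.toBim (star (I.c j)))) := by
    rw [tm_smul, tm_sum]
  refine (congrArg _ e5).trans ?_
  refine (map_smul _ _ _).trans (congrArg _ ((map_sum _ _ _).trans ?_))
  exact Finset.sum_congr rfl fun j _ => e4 j

/-- The left action of a local module, as a morphism. -/
noncomputable def lact : tensor I.bim X.X ⟶ X.X := X.leftAct

/-- The left action of `M` on a local module. -/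
noncomputable def lam : M.El →ₗ[ℂ] X.X →ₗ[ℂ] X.X :=
  LinearMap.compr₂ (LinearMap.compl₁₂ tmL I.toBim.toLinearMap LinearMap.id) (map (lact X))

lemma lam_apply (q : M.El) (x : X.X) : lam X q x = map (lact X) (tm (I.toBim q) x) := rfl

/-- λ = ρ u with u asymptotically the flip on q_n ⊠ x. This gives central triviality of the
realization and is the means by which identities for λ are reduced to identities for ρ. -/
lemma Comm.lam_br (h : I.Comm) {q : ℕ → M.El} (hq : IsCentralSeq q) (x : X.X) :
    Null X.X fun n => lam X (q n) x - (ract X).rho x (q n) := by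
  refine null_congr ((br_braid h.mem.1 X.mem.2.1 _ (centralVec_bim hq) x).map
    (RLin.map (ract X).act)) fun n => ?_
  rw [map_sub]
  rfl

/-- Locality enters here: λ is also ρ u_{X,Q}†, and u† flips q ⊠ x_n back when x_n is N-central.
Hence vectors central for N are central for M. -/
lemma Comm.lam_br' (h : I.Comm) (q : M.El) {x : ℕ → X.X} (hx : CentralVec X.X x) :
    Null X.X fun n => lam X q (x n) - (ract X).rho (x n) q := by
  have h1 := ((br_braid X.mem.1 h.mem.2.1).dagger X.mem.1 h.mem.2.1 hx (I.toBim q)).map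
    (RLin.map (ract X).act)
  refine null_congr h1 fun n => ?_
  rw [map_sub]
  exact congrArg (· - _) (congrArg (fun f => map f (tm (I.toBim q) (x n))) X.isLocal.symm)

/-- The constant sequence 1 is central, and for a constant sequence the asymptotic relation is an
equality. -/
lemma Comm.lam_one (h : I.Comm) (x : X.X) : lam X 1 x = x := by
  have h1 := h.lam_br X (q := fun _ => 1) ⟨bddA_const 1, fun b => by
    have : NullA fun _ : ℕ => (0 : M.El) := null_zero (unit M)
    exact nullA_congr this fun n => by rw [mul_one, one_mul, sub_self]⟩ x
  have h2 := sub_eq_zero.1 (Null.eq_zero h1)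
  rw [h2, RAct.rho_one]

lemma lam_l (a : S.toFactor.El) (q : M.El) (x : X.X) :
    X.X.l a (lam X q x) = lam X (S.incl a * q) x := by
  rw [lam_apply, ← map_l, tensor_l]
  rfl

lemma lam_bal (q : M.El) (a : S.toFactor.El) (x : X.X) :
    lam X (q * S.incl a) x = lam X q (X.X.l a x) := by
  rw [lam_apply, lam_apply, ← ra_tm]
  rfl

lemma lam_ra (q : M.El) (x : X.X) (a : S.toFactor.El) :
    lam X q (X.X.ra x a) = X.X.ra (lam X q x) a := by
  rw [lam_apply, lam_apply, ← map_ra, tensor_ra]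

lemma Comm.lam_incl (h : I.Comm) (a : S.toFactor.El) (x : X.X) : lam X (S.incl a) x = X.X.l a x := by
  conv_rhs => rw [← h.lam_one X x, lam_l, mul_one]

/-- For central q_n both sides are asymptotically x q_n r, because r q_n and q_n r agree up to a
null sequence; testing on such q_n suffices. -/
lemma Comm.lam_rho (h : I.Comm) (q : M.El) (x : X.X) (r : M.El) :
    lam X q ((ract X).rho x r) = (ract X).rho (lam X q x) r := by
  obtain ⟨m, b, hb⟩ := h.mem.1
  have key : map (I.bim ◁ (ract X).act ≫ lact X) =
      map ((α_ I.bim X.X I.bim).inv ≫ lact X ▷ I.bim ≫ (ract X).act) := by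
    refine sub_eq_zero.1 (hb.eq_zero ((RLin.map _).sub (RLin.map _)) fun i t => ?_)
    have hq : IsCentralSeq fun n => I.ofBim (b n i) := h.isCentralSeq (hb.central i)
    induction t using tensor_induction with
    | h0 => simpa [tm_zero] using null_zero _
    | h2 t s ht hs =>
      refine null_congr (ht.add hs) fun n => ?_
      rw [tm_add, map_add]
    | h1 x r =>
      have h1 := h.lam_br X hq ((ract X).rho x (I.ofBim r))
      have h2 := ((h.lam_br X hq x).tm_right (bdd_const r)).map (RLin.map (ract X).act)
      have h3 := (Null.tm_left (bdd_const x) (I.null_bim.2 (hq.2 (I.ofBim r)))).map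
        (RLin.map (ract X).act)
      refine null_congr ((h1.sub h2).sub h3) fun n => ?_
      rw [sub_tm, map_sub, map_sub, tm_sub, map_sub, LinearMap.sub_apply]
      have e1 : map (I.bim ◁ (ract X).act ≫ lact X) (tm (b n i) (tm x r)) =
          lam X (I.ofBim (b n i)) ((ract X).rho x (I.ofBim r)) := by
        rw [map_comp, whiskerLeft_tm]; rfl
      have e2 : map ((α_ I.bim X.X I.bim).inv ≫ lact X ▷ I.bim ≫ (ract X).act)
          (tm (b n i) (tm x r)) = map (ract X).act (tm (lam X (I.ofBim (b n i)) x) r) := by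
        rw [map_comp, map_comp, associator_inv_tm, whiskerRight_tm]; rfl
      have e3 : map (ract X).act (tm ((ract X).rho x (I.ofBim (b n i))) r) =
          (ract X).rho x (I.ofBim (b n i) * I.ofBim r) := (ract X).rho_rho x _ (I.ofBim r)
      rw [RAct.rho_rho, e3]
      refine Eq.trans ?_ (congrArg₂ (· - ·) e1 e2).symm
      change _ - _ - _ - ((ract X).rho x (I.ofBim (b n i) * I.ofBim r) -
        (ract X).rho x (I.ofBim r * I.ofBim (b n i))) = _
      abel
  have h1 := LinearMap.congr_fun key (tm (I.toBim q) (tm x (I.toBim r)))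
  have e1 : map (I.bim ◁ (ract X).act ≫ lact X) (tm (I.toBim q) (tm x (I.toBim r))) =
      lam X q ((ract X).rho x r) := by
    rw [map_comp, whiskerLeft_tm]; rfl
  have e2 : map ((α_ I.bim X.X I.bim).inv ≫ lact X ▷ I.bim ≫ (ract X).act)
      (tm (I.toBim q) (tm x (I.toBim r))) = (ract X).rho (lam X q x) r := by
    rw [map_comp, map_comp, associator_inv_tm, whiskerRight_tm]; rfl
  exact e1.symm.trans (h1.trans e2)

/-- On a product of central sequences, q_n (r_n x) is asymptotically q_n (x r_n) = (q_n x) r_n by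
`Comm.lam_rho`, and this is asymptotically x q_n r_n, as is (q_n r_n) x. -/
lemma Comm.lam_mul (h : I.Comm) (q r : M.El) (x : X.X) :
    lam X (q * r) x = lam X q (lam X r x) := by
  obtain ⟨m, b, hb⟩ := h.mem.1
  obtain ⟨τ, hτ, hbb⟩ := hb.tensor hb
  have hE1 : ∀ (q r : I.bim) (x : X.X), map (I.mul ▷ X.X ≫ lact X) (tm (tm q r) x) =
      lam X (I.ofBim q * I.ofBim r) x := fun q r x => by
    rw [map_comp, whiskerRight_tm, mul_tm]; rfl
  have hE2 : ∀ (q r : I.bim) (x : X.X), map ((α_ I.bim I.bim X.X).hom ≫ I.bim ◁ lact X ≫ lact X)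
      (tm (tm q r) x) = lam X (I.ofBim q) (lam X (I.ofBim r) x) := fun q r x => by
    rw [map_comp, map_comp, associator_tm, whiskerLeft_tm]; rfl
  have key : map (I.mul ▷ X.X ≫ lact X) =
      map ((α_ I.bim I.bim X.X).hom ≫ I.bim ◁ lact X ≫ lact X) := by
    refine sub_eq_zero.1 (hbb.eq_zero ((RLin.map _).sub (RLin.map _)) fun i x => ?_)
    have hq : IsCentralSeq fun n => I.ofBim (b n (finProdFinEquiv.symm i).1) :=
      h.isCentralSeq (hb.central _)
    have hr : IsCentralSeq fun n => I.ofBim (b (τ n) (finProdFinEquiv.symm i).2) :=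
      (h.isCentralSeq (q := fun n => I.ofBim (b n (finProdFinEquiv.symm i).2))
        (hb.central _)).comp hτ
    have h1 := h.lam_br X (hq.mul hr) x
    have h2 := (Null.tm_left (hb.central (finProdFinEquiv.symm i).1).bdd
      (h.lam_br X hr x)).map (RLin.map (lact X))
    have h3 := ((h.lam_br X hq x).tm_right ((hb.central (finProdFinEquiv.symm i).2).comp hτ).bdd).map
      (RLin.map (ract X).act)
    refine null_congr ((h1.sub h2).sub h3) fun n => ?_
    refine Eq.trans ?_ (congrArg₂ (· - ·) (hE1 _ _ x) (hE2 _ _ x)).symm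
    rw [sub_tm, map_sub, tm_sub, map_sub]
    change _ - (lam X (I.ofBim _) (lam X (I.ofBim _) x) - lam X (I.ofBim _) ((ract X).rho x _)) -
      ((ract X).rho (lam X _ x) (I.ofBim _) - (ract X).rho ((ract X).rho x _) (I.ofBim _)) = _
    rw [h.lam_rho, RAct.rho_rho]
    abel
  exact (hE1 (I.toBim q) (I.toBim r) x).symm.trans
    ((LinearMap.congr_fun key _).trans (hE2 (I.toBim q) (I.toBim r) x))

lemma lam_smul_star (y : X.X) (c : ℂ) (q : M.El) :
    lam X (star (c • q)) y = starRingEnd ℂ c • lam X (star q) y := by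
  rw [star_smul, map_smul]; rfl

/-- The left action is a `*`-action for the `N`-valued inner product. -/
lemma Comm.ip_lam (h : I.Comm) (y : X.X) (q : M.El) (x : X.X) :
    X.X.ip y (lam X q x) = X.X.ip (lam X (star q) y) x := by
  obtain ⟨m, b, hb⟩ := h.mem.1
  let T : tensor I.bim X.X →ₗ[ℂ] unit S.toFactor := toUnit ∘ₗ X.X.ipL y ∘ₗ map (lact X)
  let f : I.bim →ₗ[ℂ] X.X →ₗ[ℂ] S.toFactor.El := LinearMap.mk₂ ℂ
    (fun q x => X.X.ip (lam X (star (I.ofBim q)) y) x)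
    (fun q q' x => by rw [map_add, star_add, map_add, LinearMap.add_apply, Bim.ip_add_left])
    (fun c q x => by rw [map_smul, lam_smul_star, Bim.ip_smul_left, Complex.conj_conj])
    (fun q x x' => Bim.ip_add _ _ _ _) (fun c q x => Bim.ip_smul _ _ _ _)
  have hf : ∀ q a x, f (I.bim.ra q a) x = f q (X.X.l a x) := fun q a x => by
    change X.X.ip (lam X (star (I.ofBim q * S.incl a)) y) x =
      X.X.ip (lam X (star (I.ofBim q)) y) (X.X.l a x)
    rw [star_mul, ← map_star S.incl, ← lam_l, X.X.ip_l, star_star]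
  let T' : tensor I.bim X.X →ₗ[ℂ] unit S.toFactor := toUnit ∘ₗ lift f hf
  have hT' : ∀ q x, T' (tm q x) = toUnit (X.X.ip (lam X (star (I.ofBim q)) y) x) :=
    fun q x => congrArg (toUnit (A := S.toFactor)) (lift_tm f hf q x)
  have hTr : RLin T := (rLin_ipL X.X y).comp (RLin.map (lact X))
  have hTr' : RLin T' := fun t a => tensor_ra_ext (Z := unit S.toFactor) T' a (fun q x => by
    rw [hT', hT', X.X.ip_ra]; rfl) t
  -- On central q_n both sides reduce to the right action. Compatibility with the inner product
  -- leaves E(⟨y|x⟩_M q_n) against E(q_n ⟨y|x⟩_M), and these agree asymptotically.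
  have key : T = T' := by
    refine hb.ext hTr hTr' fun q hq x => ?_
    have hq' : IsCentralSeq fun n => I.ofBim (q n) := h.isCentralSeq hq
    have h1 := Null.ip_left (bdd_const y) (h.lam_br X hq' x)
    have h2 := Null.ip_right (h.lam_br X hq'.star y) (bdd_const x)
    have h3 := Null.smul (X := unit S.toFactor) (I.nullA_E (hq'.2 ((ract X).ipM y x))) (I.index : ℂ)
    refine nullA_congr ((h1.sub h2).sub h3) fun n => ?_
    change _ - _ - (I.index : ℂ) • I.E (I.ofBim (q n) * (ract X).ipM y x -
      (ract X).ipM y x * I.ofBim (q n)) =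
      X.X.ip y (lam X (I.ofBim (q n)) x) - ofUnit (T' (tm (q n) x))
    rw [hT', ofUnit_toUnit, X.X.ip_sub, X.X.ip_sub_left, unitary_ract, star_star, map_sub,
      smul_sub, RAct.E_ipM_mul]
    abel
  have h1 := LinearMap.congr_fun key (tm (I.toBim q) x)
  rw [hT'] at h1
  exact h1

lemma Comm.ipM_lam (h : I.Comm) (y : X.X) (q : M.El) (x : X.X) :
    (ract X).ipM y (lam X q x) = (ract X).ipM (lam X (star q) y) x :=
  (ract X).ipM_ext fun r => by rw [← h.lam_rho, h.ip_lam]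

lemma weakNull_mul_right {a : ℕ → M.El} (ha : WeakNull a) (b : M.El) :
    WeakNull fun n => a n * b := fun ξ η => ha ξ ((b : H →L[ℂ] H) η)

lemma weakNull_mul_left {a : ℕ → M.El} (ha : WeakNull a) (b : M.El) :
    WeakNull fun n => star b * a n := fun ξ η => by
  refine (ha ((b : H →L[ℂ] H) ξ) η).congr fun n => ?_
  change _ = inner ℂ ξ (star (b : H →L[ℂ] H) ((a n : H →L[ℂ] H) η))
  rw [ContinuousLinearMap.star_eq_adjoint, ContinuousLinearMap.adjoint_inner_right]

lemma weakNull_sum {ι : Type*} {s : Finset ι} {a : ι → ℕ → M.El} (ha : ∀ i ∈ s, WeakNull (a i)) :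
    WeakNull fun n => ∑ i ∈ s, a i n := fun ξ η => by
  have := tendsto_finsetSum s fun i hi => ha i hi ξ η
  rw [Finset.sum_const_zero] at this
  refine this.congr fun n => ?_
  rw [← inner_sum, AddSubmonoidClass.coe_finsetSum, sum_apply]

lemma weakNull_smul {a : ℕ → M.El} (ha : WeakNull a) (c : ℂ) : WeakNull fun n => c • a n :=
  fun ξ η => by
    have := (ha ξ η).const_mul c
    rw [mul_zero] at this
    refine this.congr fun n => ?_
    rw [← inner_smul_right]
    rfl

/-- Write λ†(x) as a finite sum ∑ e_i ⊠ f_i. Then ⟨x|a y⟩ = ∑ ⟨f_i | [M : N] E(e_i* a) y⟩, and both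
E and the left action of N are normal. -/
lemma weakNull_lam (x y : X.X) {a : ℕ → M.El} (ha : WeakNull a) :
    WeakNull fun n => X.X.ip x (lam X (a n) y) := by
  obtain ⟨k, e, f, hef⟩ := exists_sum_tm (map (dagger (lact X)) x)
  have h1 : ∀ n, X.X.ip x (lam X (a n) y) =
      ∑ i, X.X.ip (f i) (X.X.l (I.bim.ip (e i) (I.toBim (a n))) y) := fun n => by
    rw [lam_apply, ← X.X.star_ip, ip_map, Bim.star_ip, hef, Bim.ip_sum_left]
    exact Finset.sum_congr rfl fun i _ => tensor_ip _ _ _ _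
  simp only [h1]
  refine weakNull_sum fun i _ => X.X.l_normal _ _ _ ?_
  exact weakNull_smul (I.E_normal _ (weakNull_mul_left ha (I.ofBim (e i)))) (I.index : ℂ)

/-- Realization `|X|` of a local module. -/
noncomputable abbrev realize (h : I.Comm) (X : LocMod I.qSystem) : Bim M where
  carrier := X.X.carrier
  l := AlgHom.ofLinearMap (lam X) (LinearMap.ext fun x => h.lam_one X x)
    (fun q r => LinearMap.ext fun x => h.lam_mul X q r x)
  r := AlgHom.ofLinearMap ((ract X).rho.flip ∘ₗ (MulOpposite.opLinearEquiv ℂ).symm.toLinearMap)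
    (LinearMap.ext fun x => (ract X).rho_one x)
    (fun q r => LinearMap.ext fun x => ((ract X).rho_rho x r.unop q.unop).symm)
  l_r q r x := h.lam_rho X q x r.unop
  ip := (ract X).ipM
  ip_add := (ract X).ipM_add
  ip_r x y a := (ract X).ipM_rho x y a
  star_ip := (unitary_ract X).star_ipM
  ip_pos := (unitary_ract X).ipM_pos
  ip_def x hx := X.X.ip_def x (by rw [← (ract X).E_ipM, hx, map_zero, smul_zero])
  ip_l q x y := by
    have := h.ipM_lam X x (star q) y
    rw [star_star] at this
    exact this.symm
  exists_basis := by
    obtain ⟨n, b, hb⟩ := exists_isBasis X.X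
    exact ⟨n, b, (ract X).sum_basis hb⟩
  l_normal x y a ha := by
    refine weakNull_smul (weakNull_sum fun j _ => weakNull_mul_right ?_ (star (I.c j))) _
    have := weakNull_lam X x ((ract X).rho y (I.c j)) ha
    simp only [h.lam_rho] at this
    exact this

end Loc

end FiniteIndex
end LocalExt

namespace LocalExt

variable {H : Type u} [NormedAddCommGroup H] [InnerProductSpace ℂ H] [CompleteSpace H]

namespace FiniteIndex

variable {M : IIOneFactor H} {S : Subfactor M} {I : FiniteIndex S}

/-! ## Realization of local modules -/

section Realize

variable (h : I.Comm) (X : LocMod I.qSystem)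

/-- Restricting the realization gives back the inner product of X, so null and bounded sequences of
X and of |X| are the same by the comparison for `res`. -/
lemma res_realize_ip (x y : X.X) : (I.res (realize h X)).ip x y = X.X.ip x y :=
  (ract X).E_ipM x y

lemma null_realize {z : ℕ → X.X} : Null (realize h X) z ↔ Null X.X z := by
  rw [← I.null_res]
  refine tendsto_congr fun n => ?_
  rw [norm2, norm2, res_realize_ip h X (z n) (z n)]

lemma bdd_realize {z : ℕ → X.X} : Bdd (realize h X) z ↔ Bdd X.X z := by
  rw [← I.bdd_res]
  refine exists_congr fun C => and_congr_right fun _ => forall_congr' fun n => ?_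
  rw [nrm, nrm, res_realize_ip h X (z n) (z n)]

lemma centralVec_realize {x : ℕ → X.X} (hx : CentralVec X.X x) : CentralVec (realize h X) x :=
  ⟨(bdd_realize h X).2 hx.bdd, fun q => (null_realize h X).2 (h.lam_br' X q hx)⟩

/-- An approximately inner basis of X serves unchanged. If P_n is its N-expansion, its M-expansion
of x is [M : N]⁻¹ ∑ P_n(x c_j) c_j*, which tends to [M : N]⁻¹ ∑ x c_j c_j* = x. -/
lemma approxInner_realize : ApproxInner (realize h X) := by
  obtain ⟨m, b, hb⟩ := X.mem.1
  refine ⟨m, b, isAIBasis_of_central (fun i => centralVec_realize h X (hb.central i)) fun x => ?_⟩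
  refine (null_realize h X).2 ?_
  let P : ℕ → X.X → X.X := fun n x => ∑ i, X.X.ra (b n i) (X.X.ip (b n i) x)
  have h0 : ∀ y, Null X.X fun n => y - P n y := hb.approx
  have h1 := Null.smul (Null.sum Finset.univ fun j _ => ((h0 ((ract X).rho x (I.c j))).tm_right
    (bdd_const (I.toBim (star (I.c j))))).map (RLin.map (ract X).act)) (I.index : ℂ)⁻¹
  refine null_congr h1 fun n => ?_
  have e1 : ∀ j, map (ract X).act (tm ((ract X).rho x (I.c j) - P n ((ract X).rho x (I.c j)))
      (I.toBim (star (I.c j)))) = (ract X).rho x (I.c j * star (I.c j)) -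
        (ract X).rho (P n ((ract X).rho x (I.c j))) (star (I.c j)) := fun j => by
    rw [← RAct.rho_apply, map_sub, LinearMap.sub_apply, RAct.rho_rho]
  have e2 : ∀ i, (ract X).rho (b n i) ((ract X).ipM (b n i) x) = (I.index : ℂ)⁻¹ • ∑ j,
      (ract X).rho (X.X.ra (b n i) (X.X.ip (b n i) ((ract X).rho x (I.c j)))) (star (I.c j)) :=
    fun i => by simp only [RAct.ipM, map_smul, map_sum, RAct.rho_ra]
  change _ = x - ∑ i, (ract X).rho (b n i) ((ract X).ipM (b n i) x)
  rw [Finset.sum_congr rfl fun j _ => e1 j, Finset.sum_congr rfl fun i _ => e2 i,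
    Finset.sum_sub_distrib, smul_sub, ← map_sum, I.sum_eq, map_smul, RAct.rho_one,
    inv_smul_smul₀ I.index_ne, ← Finset.smul_sum, Finset.sum_comm]
  simp only [P, map_sum, LinearMap.sum_apply]

lemma centrallyTrivial_realize : CentrallyTrivial (realize h X) := fun _ ha x =>
  (null_realize h X).2 (h.lam_br X ha x)

end Realize

/-! ## Local modules from actions of `M` -/

section OfAction

variable {X : Bim S.toFactor}

lemma RAct.act_assoc (R : I.RAct X) :
    R.act ▷ I.bim ≫ R.act = (α_ X I.bim I.bim).hom ≫ X ◁ I.mul ≫ R.act :=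
  tensor_ext₃ fun x q r => by
    have e1 : map (R.act ▷ I.bim ≫ R.act) (tm (tm x q) r) =
        R.rho (R.rho x (I.ofBim q)) (I.ofBim r) := by
      rw [map_comp, whiskerRight_tm]; rfl
    have e2 : map ((α_ X I.bim I.bim).hom ≫ X ◁ I.mul ≫ R.act) (tm (tm x q) r) =
        R.rho x (I.ofBim q * I.ofBim r) := by
      rw [map_comp, map_comp, associator_tm, whiskerLeft_tm, mul_tm]; rfl
    exact e1.trans ((R.rho_rho _ _ _).trans e2.symm)

lemma RAct.act_unit (R : I.RAct X) : X ◁ I.one ≫ R.act = (ρ_ X).hom :=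
  tensor_ext fun x a => by
    have e1 : map (X ◁ I.one ≫ R.act) (tm x a) = R.rho x (S.incl (ofUnit a)) := by
      rw [map_comp, whiskerLeft_tm]; rfl
    exact e1.trans ((R.rho_incl _ _).trans (rightUnitor_tm _ _).symm)

lemma RAct.Unitary.frobenius {R : I.RAct X} (hR : R.Unitary) : R.act ≫ dagger R.act =
    X ◁ dagger I.mul ≫ (α_ X I.bim I.bim).inv ≫ R.act ▷ I.bim :=
  tensor_ext fun x q => by
    have e1 : map (R.act ≫ dagger R.act) (tm x q) = (I.index : ℂ)⁻¹ • ∑ j,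
        tm (R.rho x (I.ofBim q * I.c j)) (I.toBim (star (I.c j))) := by
      rw [map_comp, R.unitary_iff.1 hR]
      refine congrArg _ (Finset.sum_congr rfl fun j _ => ?_)
      rw [← R.rho_rho]; rfl
    have e2 : map (X ◁ dagger I.mul ≫ (α_ X I.bim I.bim).inv ≫ R.act ▷ I.bim) (tm x q) =
        (I.index : ℂ)⁻¹ • ∑ j, tm (R.rho x (I.ofBim q * I.c j)) (I.toBim (star (I.c j))) := by
      rw [map_comp, map_comp, whiskerLeft_tm, dagger_mul, tm_smul, tm_sum, map_smul, map_smul,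
        map_sum, map_sum]
      refine congrArg _ (Finset.sum_congr rfl fun j _ => ?_)
      rw [associator_inv_tm, whiskerRight_tm]; rfl
    exact e1.trans e2.symm

lemma RAct.Unitary.separable {R : I.RAct X} (hR : R.Unitary) : dagger R.act ≫ R.act = 𝟙 X :=
  hom_ext fun x => by
    rw [map_comp, R.unitary_iff.1 hR, map_smul, map_sum]
    simp only [← RAct.rho_apply, RAct.rho_rho]
    rw [← map_sum, I.sum_eq, map_smul, RAct.rho_one, inv_smul_smul₀ I.index_ne, Bim.map_id]

/-- The local module of a unitary right action of `M`. -/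
noncomputable def locMod (hX : chi S.toFactor X) (R : I.RAct X) (hR : R.Unitary)
    (hl : braid I.bim X ≫ R.act = dagger (braid X I.bim) ≫ R.act) : LocMod I.qSystem where
  X := X
  mem := hX
  act := R.act
  act_assoc := R.act_assoc
  act_unit := R.act_unit
  frobenius := hR.frobenius
  separable := hR.separable
  isLocal := hl

lemma free_act_tm (x : X) (p : I.bim) (q : M.El) : map ((α_ X I.bim I.bim).hom ≫ X ◁ I.mul)
    (tm (tm x p) (I.toBim q)) = tm x (I.toBim (I.ofBim p * q)) := by
  rw [map_comp, associator_tm, whiskerLeft_tm, mul_tm]; rfl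

/-- The free right module `X ⊠ L²M`. -/
noncomputable def RAct.free (X : Bim S.toFactor) : I.RAct (tensor X I.bim) where
  act := (α_ X I.bim I.bim).hom ≫ X ◁ I.mul
  act_act t q r := by
    induction t using tensor_induction with
    | h0 => simp only [← tmL_apply, map_zero, LinearMap.zero_apply]
    | h2 t s ht hs => simp only [add_tm, map_add, ht, hs]
    | h1 x p => rw [free_act_tm, free_act_tm, free_act_tm, ofBim_toBim, mul_assoc]
  act_one t := by
    induction t using tensor_induction with
    | h0 => simp only [← tmL_apply, map_zero, LinearMap.zero_apply]
    | h2 t s ht hs => rw [add_tm, map_add, ht, hs]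
    | h1 x p => rw [free_act_tm, mul_one, toBim_ofBim]

lemma RAct.free_rho (x : X) (p q : M.El) :
    (RAct.free (I := I) X).rho (tm x (I.toBim p)) q = tm x (I.toBim (p * q)) := free_act_tm x (I.toBim p) q

lemma RAct.free_ipM (x y : X) (p q : M.El) :
    (RAct.free (I := I) X).ipM (tm x (I.toBim p)) (tm y (I.toBim q)) =
      star p * S.incl (X.ip x y) * q := by
  rw [RAct.ipM]
  simp only [RAct.free_rho, tensor_ip, bim_l, bim_ip, ofBim_toBim]
  have e : ∀ j, S.incl ((I.index : ℂ) • I.E (star p * (S.incl (X.ip x y) * (q * I.c j)))) *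
      star (I.c j) = (I.index : ℂ) • (S.incl (I.E (star p * S.incl (X.ip x y) * q * I.c j)) *
        star (I.c j)) := fun j => by
    rw [map_smul, smul_mul_assoc]
    simp only [mul_assoc]
  rw [Finset.sum_congr rfl fun j _ => e j, ← Finset.smul_sum, I.expand',
    inv_smul_smul₀ I.index_ne]

lemma RAct.ipM_add_left {X : Bim S.toFactor} (R : I.RAct X) (x y z : X) :
    R.ipM (x + y) z = R.ipM x z + R.ipM y z := by
  simp only [RAct.ipM, X.ip_add_left, map_add, add_mul, Finset.sum_add_distrib, smul_add]

/-- Free modules are the supply of compatible inner products: `exists_unitary` pulls this one back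
along an embedding. -/
lemma RAct.unitary_free (X : Bim S.toFactor) : (RAct.free (I := I) X).Unitary := by
  intro t q s
  induction t using tensor_induction with
  | h0 =>
    have h0 : (tensor X I.bim).ip 0 s = 0 := by rw [← Bim.star_ip, Bim.ip_zero, star_zero]
    have h1 : (RAct.free (I := I) X).ipM 0 s = 0 := by
      have := (RAct.free (I := I) X).ipM_add_left 0 0 s
      simpa using this
    rw [map_zero, LinearMap.zero_apply, h0, h1, mul_zero, map_zero, smul_zero]
  | h2 t t' ht ht' =>
    rw [map_add, LinearMap.add_apply, Bim.ip_add_left, ht, ht', RAct.ipM_add_left, mul_add,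
      map_add, smul_add]
  | h1 x p =>
    induction s using tensor_induction with
    | h0 =>
      have h1 : (RAct.free (I := I) X).ipM (tm x p) 0 = 0 := by
        have := (RAct.free (I := I) X).ipM_add (tm x p) 0 0
        simpa using this
      rw [Bim.ip_zero, h1, mul_zero, map_zero, smul_zero]
    | h2 s s' hs hs' => rw [Bim.ip_add, hs, hs', RAct.ipM_add, mul_add, map_add, smul_add]
    | h1 y r =>
      have e1 := RAct.free_rho (I := I) x (I.ofBim p) q
      have e2 := RAct.free_ipM (I := I) x y (I.ofBim p) (I.ofBim r)
      rw [toBim_ofBim] at e1 e2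
      rw [toBim_ofBim] at e2
      rw [e1, e2, tensor_ip, bim_ip, bim_l, ofBim_toBim, ofBim_toBim, star_mul]
      simp only [mul_assoc]

end OfAction

end FiniteIndex
end LocalExt

namespace LocalExt

variable {H : Type u} [NormedAddCommGroup H] [InnerProductSpace ℂ H] [CompleteSpace H]

namespace Bim

variable {A : IIOneFactor H} {X Y : Bim A}

/-! ## Central vectors and endomorphisms -/

/-- The vectors `x` with `a x = x a` for all `a`. -/
def centralVectors (X : Bim A) : Submodule ℂ X where
  carrier := {x | ∀ a, X.l a x = X.ra x a}
  add_mem' hx hy a := by rw [map_add, hx a, hy a, X.ra_add]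
  zero_mem' a := by rw [map_zero, ra_zero]
  smul_mem' c x hx a := by rw [map_smul, hx a, smul_ra]

/-- The inner product of two central vectors commutes with A, hence is scalar because A is a factor;
applying tr identifies the scalar. -/
lemma ip_centralVectors {x y : X} (hx : x ∈ centralVectors X) (hy : y ∈ centralVectors X) :
    X.ip x y = A.tr (X.ip x y) • 1 := by
  have h : ∀ a : A.El, X.ip x y * a = a * X.ip x y := fun a => by
    rw [← X.ip_ra, ← hy a]
    have := X.ip_l (star a) x y
    rw [star_star] at this
    rw [← this, hx (star a), X.ip_ra_left, star_star]
  obtain ⟨c, hc⟩ := A.center_trivial _ (X.ip x y).2 fun a ha => congrArg Subtype.val (h ⟨a, ha⟩)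
  have hc' : X.ip x y = c • (1 : A.El) := Subtype.ext hc
  rw [hc', map_smul, A.tr_one, smul_eq_mul, mul_one]

/-- Bessel's inequality bounds the number of orthonormal central vectors. -/
lemma card_le_of_central {p : ℕ} {b : Fin p → X} (hb : X.IsBasis b) {d : ℕ} {v : Fin d → X}
    (hv : ∀ i, v i ∈ centralVectors X)
    (ho : ∀ i j, A.tr (X.ip (v i) (v j)) = if i = j then 1 else 0) :
    (d : ℝ) ≤ ∑ k, (A.tr (X.ip (b k) (b k))).re := by
  have ho' : ∀ i j, X.ip (v i) (v j) = if i = j then 1 else 0 := fun i j => by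
    rw [ip_centralVectors (hv i) (hv j), ho]
    split_ifs <;> simp
  have h1 : ∀ x : X, (∑ i, A.tr (X.ip x (v i) * X.ip (v i) x)).re ≤ (A.tr (X.ip x x)).re := by
    intro x
    have h2 := A.tr_pos _ (X.ip_pos (x - ∑ i, X.ra (v i) (X.ip (v i) x)))
    have h3 : X.ip (x - ∑ i, X.ra (v i) (X.ip (v i) x)) (x - ∑ i, X.ra (v i) (X.ip (v i) x)) =
        X.ip x x - ∑ i, X.ip x (v i) * X.ip (v i) x := by
      have h4 : ∀ j, X.ip (v j) (x - ∑ i, X.ra (v i) (X.ip (v i) x)) = 0 := fun j => by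
        rw [X.ip_sub, X.ip_sum]
        simp only [X.ip_ra, ho', ite_mul, one_mul, zero_mul, Finset.sum_ite_eq, Finset.mem_univ,
          if_true, sub_self]
      rw [X.ip_sub_left, X.ip_sum_left]
      simp only [X.ip_ra_left, h4, mul_zero, Finset.sum_const_zero, sub_zero]
      rw [X.ip_sub, X.ip_sum]
      simp only [X.ip_ra]
    rw [h3, map_sub, map_sum] at h2
    have h5 := (Complex.le_def.1 h2).1
    rw [Complex.zero_re, Complex.sub_re] at h5
    linarith
  -- In the sum of Bessel's inequality over the basis b, each v_i contributes tr⟨v_i|v_i⟩ = 1.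
  have h2 : ∀ i, ∑ k, A.tr (X.ip (b k) (v i) * X.ip (v i) (b k)) = 1 := fun i => by
    have h3 : X.ip (v i) (v i) = ∑ k, X.ip (v i) (b k) * X.ip (b k) (v i) := by
      have h4 := congrArg (X.ip (v i)) (hb (v i))
      rw [X.ip_sum] at h4
      simp only [X.ip_ra] at h4
      exact h4.symm
    have h4 := ho i i
    rw [h3, map_sum, if_pos rfl] at h4
    rw [← h4]
    exact Finset.sum_congr rfl fun k _ => A.tr_mul_comm _ _
  calc (d : ℝ) = (∑ i : Fin d, ∑ k, A.tr (X.ip (b k) (v i) * X.ip (v i) (b k))).re := by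
        simp only [h2]; simp
    _ = ∑ k, (∑ i : Fin d, A.tr (X.ip (b k) (v i) * X.ip (v i) (b k))).re := by
        rw [Finset.sum_comm, Complex.re_sum]
    _ ≤ _ := Finset.sum_le_sum fun k _ => h1 _

/-- Orthonormalizing the span of an independent finite set for tr⟨·|·⟩ produces equally many
orthonormal central vectors, and Bessel's inequality bounds their number uniformly. -/
lemma finite_centralVectors (X : Bim A) : Module.Finite ℂ (centralVectors X) := by
  obtain ⟨p, b, hb⟩ := exists_isBasis X
  let _ : NormedAddCommGroup X := (trCore X).toNormedAddCommGroup
  let _ : InnerProductSpace ℂ X := InnerProductSpace.ofCore (trCore X).toCore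
  obtain ⟨D, hD⟩ := exists_nat_ge (∑ k, (A.tr (X.ip (b k) (b k))).re)
  have key : Module.rank ℂ (centralVectors X) ≤ D := by
    refine rank_le fun s hs => ?_
    let U : Submodule ℂ (centralVectors X) := Submodule.span ℂ (s : Set (centralVectors X))
    have hU : Module.finrank ℂ U = s.card := finrank_span_finset_eq_card hs
    have : FiniteDimensional ℂ U := FiniteDimensional.span_finset ℂ s
    let o := stdOrthonormalBasis ℂ U
    have h1 := card_le_of_central hb (v := fun i => ((o i : centralVectors X) : X))
      (fun i => (o i : centralVectors X).2) (fun i j => by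
        have := orthonormal_iff_ite.1 o.orthonormal i j
        exact this)
    rw [hU] at h1
    exact_mod_cast h1.trans hD
  exact Module.rank_lt_aleph0_iff.1 (key.trans_lt (Cardinal.natCast_lt_aleph0))

/-- The linear bimodule endomorphisms. -/
def bimEnd (Y : Bim A) : Submodule ℂ (Module.End ℂ Y) where
  carrier := {f | (∀ a y, f (Y.l a y) = Y.l a (f y)) ∧ RLin f}
  add_mem' hf hg := ⟨fun a y => by simp [hf.1, hg.1], fun y a => by
    simp [hf.2 y a, hg.2 y a, Y.ra_add]⟩
  zero_mem' := ⟨fun a y => by simp, fun y a => by simp [ra_zero]⟩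
  smul_mem' c f hf := ⟨fun a y => by simp [hf.1], fun y a => by simp [hf.2 y a, smul_ra]⟩

/-- f ↦ ∑ e_k ⊠ f(f_k) maps endomorphisms of Y to central vectors of X ⊠ Y, and evaluation against ξ
recovers f(ξ), so the map is injective. -/
lemma finite_bimEnd (D : DualData X Y) : Module.Finite ℂ (bimEnd Y) := by
  have := finite_centralVectors (tensor X Y)
  let Θ : bimEnd Y →ₗ[ℂ] centralVectors (tensor X Y) :=
    { toFun := fun f => ⟨∑ k, tm (D.e k) (f.1 (D.f k)), fun a => by
        have h := congrArg (map (X ◁ mkHom f.1 f.2.1 f.2.2)) (D.central a)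
        simp only [map_sum, whiskerLeft_tm, map_mkHom, f.2.2 _ _] at h
        rw [map_sum, ra_sum]
        simp only [tensor_l, tensor_ra]
        exact h⟩
      map_add' := fun f g => Subtype.ext (by
        simp [tm_add, Finset.sum_add_distrib])
      map_smul' := fun c f => Subtype.ext (by
        simp [tm_smul, Finset.smul_sum]) }
  refine Module.Finite.of_injective Θ fun f g hfg => Subtype.ext (LinearMap.ext fun ξ => ?_)
  have h1 : ∑ k, tm (D.e k) (f.1 (D.f k)) = ∑ k, tm (D.e k) (g.1 (D.f k)) :=
    congrArg Subtype.val hfg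
  have h2 : ∀ f' : bimEnd Y, f'.1 ξ = map ((α_ Y X Y).inv ≫ D.ev ▷ Y ≫ (λ_ Y).hom)
      (tm ξ (∑ k, tm (D.e k) (f'.1 (D.f k)))) := fun f' => by
    conv_lhs => rw [← D.expand' ξ]
    simp only [map_comp, tm_sum, map_sum]
    refine Finset.sum_congr rfl fun k _ => ?_
    rw [associator_inv_tm, whiskerRight_tm, D.ev_tm, f'.2.1]
    exact (leftUnitor_tm _ _).symm
  rw [h2, h2, h1]

/-- An injective endomorphism of a dualizable bimodule is invertible. -/
lemma exists_inverse (D : DualData X Y) (T : Y ⟶ Y) (hT : Function.Injective (map T)) :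
    ∃ g : Y ⟶ Y, g ≫ T = 𝟙 Y ∧ T ≫ g = 𝟙 Y := by
  have := finite_bimEnd D
  -- Composition with T is an injective operator on a finite dimensional space, hence surjective; a
  -- preimage of the identity is the inverse.
  let L : bimEnd Y →ₗ[ℂ] bimEnd Y :=
    { toFun := fun f => ⟨map T ∘ₗ f.1, fun a y => by
        rw [LinearMap.comp_apply, f.2.1, map_l]; rfl, (RLin.map T).comp f.2.2⟩
      map_add' := fun f g => Subtype.ext (LinearMap.comp_add _ _ _)
      map_smul' := fun c f => Subtype.ext (LinearMap.comp_smul _ _ _) }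
  have hL : Function.Injective L := fun f g hfg => Subtype.ext (LinearMap.ext fun y =>
    hT (LinearMap.congr_fun (congrArg Subtype.val hfg) y))
  obtain ⟨g, hg⟩ := (LinearMap.injective_iff_surjective.1 hL)
    ⟨LinearMap.id, fun _ _ => rfl, fun _ _ => rfl⟩
  have hg' : ∀ y, map T (g.1 y) = y := fun y => LinearMap.congr_fun (congrArg Subtype.val hg) y
  refine ⟨mkHom g.1 g.2.1 g.2.2, hom_ext fun y => ?_, hom_ext fun y => hT ?_⟩
  · rw [map_comp, map_mkHom, hg', Bim.map_id]
  · rw [map_comp, map_mkHom, hg', Bim.map_id]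

/-! ## Changing the inner product -/

variable {W : Bim A}

/-- The bimodule `Y` with the inner product pulled back along an embedding `Φ : Y → W`. -/
noncomputable abbrev pullback (Φ : Y ⟶ W) (P : W ⟶ Y) (h : Φ ≫ P = 𝟙 Y)
    (hP : dagger (P ≫ Φ) = P ≫ Φ) : Bim A where
  carrier := Y.carrier
  l := Y.l
  r := Y.r
  l_r := Y.l_r
  ip x y := W.ip (map Φ x) (map Φ y)
  ip_add x y z := by rw [map_add, W.ip_add]
  ip_r x y a := by
    have := map_ra Φ y a
    rw [ra] at this
    rw [this, W.ip_ra]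
  star_ip x y := W.star_ip _ _
  ip_pos x := W.ip_pos _
  ip_def x hx := by
    have h1 := congrArg (fun f => map f x) h
    rw [map_comp, W.ip_def _ hx, map_zero, Bim.map_id] at h1
    exact h1.symm
  ip_l a x y := by rw [map_l, map_l, W.ip_l]
  exists_basis := by
    obtain ⟨n, b, hb⟩ := exists_isBasis W
    refine ⟨n, fun i => map P (b i), fun x => ?_⟩
    have h1 : ∀ y, map P (map Φ y) = y := fun y => congrArg (fun f => map f y) h
    -- Selfadjointness of the idempotent ΦP moves it off b_i and onto Φ x, which it fixes. So P maps
    -- a basis of W to a basis.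
    have h2 : ∀ i, W.ip (map Φ (map P (b i))) (map Φ x) = W.ip (b i) (map Φ x) := fun i => by
      have := ip_map (P ≫ Φ) (b i) (map Φ x)
      rw [hP, map_comp, map_comp, h1] at this
      exact this
    have h3 := congrArg (map P) (hb (map Φ x))
    rw [h1, map_sum] at h3
    simp only [h2]
    exact (Finset.sum_congr rfl fun i _ => (map_ra P _ _).symm).trans h3
  l_normal x y a ha := by
    simp only [map_l]
    exact W.l_normal _ _ _ ha

section Pullback

variable {Φ : Y ⟶ W} {P : W ⟶ Y} {h : Φ ≫ P = 𝟙 Y} {hP : dagger (P ≫ Φ) = P ≫ Φ}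

/-- The isometric embedding of the pullback. -/
noncomputable def pullbackHom (Φ : Y ⟶ W) (P : W ⟶ Y) (h : Φ ≫ P = 𝟙 Y)
    (hP : dagger (P ≫ Φ) = P ≫ Φ) : pullback Φ P h hP ⟶ W where
  toFun := map (X := Y) Φ
  adj := map (Y := Y) P
  map_l a x := map_l Φ a x
  map_ra x a := map_ra Φ x a
  adj_spec x w := by
    have h1 : ∀ y, map P (map Φ y) = y := fun y => congrArg (fun f => map f y) h
    have h2 := ip_map (P ≫ Φ) (map (X := Y) Φ x) w
    rw [hP, map_comp, map_comp] at h2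
    exact (congrArg (fun y => W.ip (map Φ y) w) (h1 x)).symm.trans h2

lemma pullbackHom_isometry : pullbackHom Φ P h hP ≫ dagger (pullbackHom Φ P h hP) = 𝟙 _ :=
  hom_ext fun y => congrArg (fun f => map (X := Y) (Y := Y) f y) h

lemma ApproxInner.of_isometry {V : Bim A} {j : V ⟶ W} (hj : j ≫ dagger j = 𝟙 V)
    (hW : ApproxInner W) : ApproxInner V := by
  obtain ⟨m, b, hb⟩ := hW
  have h1 : ∀ y, map (dagger j) (map j y) = y := fun y => congrArg (fun f => map f y) hj
  refine ⟨m, fun n i => map (dagger j) (b n i), isAIBasis_of_central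
    (fun i => (hb.central i).map (dagger j)) fun x => ?_⟩
  have h2 : Null W fun n => map j x - ∑ i, W.ra (b n i) (W.ip (b n i) (map j x)) :=
    hb.approx (map j x)
  refine null_congr (h2.map (RLin.map (dagger j))) fun n => ?_
  rw [map_sub, h1, map_sum]
  refine congrArg (x - ·) (Finset.sum_congr rfl fun i _ => ?_)
  rw [map_ra, ip_map, dagger_dagger]

lemma CentrallyTrivial.of_isometry {V : Bim A} {j : V ⟶ W} (hj : j ≫ dagger j = 𝟙 V)
    (hW : CentrallyTrivial W) : CentrallyTrivial V := fun a ha x => by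
  have h1 : ∀ y, map (dagger j) (map j y) = y := fun y => congrArg (fun f => map f y) hj
  have h2 : Null W fun n => W.l (a n) (map j x) - W.ra (map j x) (a n) := hW a ha (map j x)
  refine null_congr (h2.map (RLin.map (dagger j))) fun n => ?_
  rw [map_sub, map_l, map_ra, h1]

end Pullback

/-- Dualities are transported along isomorphisms of the dual. -/
noncomputable def DualData.isoRight (D : DualData X Y) (u : W ≅ Y) : DualData X W where
  B := D.B ∘ₗ map u.hom
  l_B a ξ x := by rw [LinearMap.comp_apply, map_l, D.l_B]; rfl
  B_ra ξ x a := D.B_ra _ x a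
  bal ξ a x := by rw [LinearMap.comp_apply, map_ra, D.bal]; rfl
  n := D.n
  e := D.e
  f k := map u.inv (D.f k)
  expand x := by
    simp only [LinearMap.comp_apply, ← map_comp, u.inv_hom_id, Bim.map_id]
    exact D.expand x
  expand' ξ := by
    simp only [LinearMap.comp_apply, ← map_l, ← map_sum, D.expand']
    rw [← map_comp, u.hom_inv_id, Bim.map_id]

/-- Dualities are transported along isomorphisms of the first object. -/
noncomputable def DualData.isoLeft (D : DualData Y X) (u : W ≅ Y) : DualData W X where
  B := D.B.compl₂ (map u.hom)
  l_B a ξ x := D.l_B _ _ _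
  B_ra ξ x a := by rw [LinearMap.compl₂_apply, map_ra, D.B_ra]; rfl
  bal ξ a x := by rw [LinearMap.compl₂_apply, D.bal, ← map_l]; rfl
  n := D.n
  e k := map u.inv (D.e k)
  f := D.f
  expand x := by
    simp only [LinearMap.compl₂_apply, ← map_ra, ← map_sum, D.expand]
    rw [← map_comp, u.hom_inv_id, Bim.map_id]
  expand' ξ := by
    simp only [LinearMap.compl₂_apply, ← map_comp, u.inv_hom_id, Bim.map_id]
    exact D.expand' ξ

/-- The pullback is isomorphic to `Y`. -/
noncomputable def pullbackIso (Φ : Y ⟶ W) (P : W ⟶ Y) (h : Φ ≫ P = 𝟙 Y)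
    (hP : dagger (P ≫ Φ) = P ≫ Φ) : pullback Φ P h hP ≅ Y where
  hom := mkHom (X := pullback Φ P h hP) (Y := Y) LinearMap.id (fun _ _ => rfl) (fun _ _ => rfl)
  inv := mkHom (X := Y) (Y := pullback Φ P h hP) LinearMap.id (fun _ _ => rfl) (fun _ _ => rfl)
  hom_inv_id := hom_ext fun _ => rfl
  inv_hom_id := hom_ext fun _ => rfl

/-- An embedding with a left inverse has a left inverse for which the idempotent is a
projection. -/
lemma exists_projection (D : DualData X Y) (Φ : Y ⟶ W) (m : W ⟶ Y) (h : Φ ≫ m = 𝟙 Y) :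
    ∃ P : W ⟶ Y, Φ ≫ P = 𝟙 Y ∧ dagger (P ≫ Φ) = P ≫ Φ := by
  have h1 : ∀ y, map m (map Φ y) = y := fun y => congrArg (fun f => map f y) h
  -- Φ†Φ is injective because Φ has a left inverse, so it has an inverse g. Then P = gΦ† is a left
  -- inverse of Φ, and ΦP is the orthogonal projection onto the range of Φ.
  obtain ⟨g, hg, hg'⟩ := exists_inverse D (Φ ≫ dagger Φ) (by
    refine (injective_iff_map_eq_zero _).2 fun y hy => ?_
    have h2 : W.ip (map Φ y) (map Φ y) = 0 := by
      rw [ip_map]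
      exact (congrArg (Y.ip y) hy).trans (Y.ip_zero y)
    rw [← h1 y, W.ip_def _ h2, map_zero])
  have hs : dagger g = g := by
    have h2 := congrArg dagger hg
    simp only [dagger_comp, dagger_dagger, dagger_id] at h2
    calc dagger g = (g ≫ Φ ≫ dagger Φ) ≫ dagger g := by rw [hg, Category.id_comp]
      _ = g := by
        rw [Category.assoc, h2, Category.comp_id]
  refine ⟨dagger Φ ≫ g, by rw [← Category.assoc, hg'], ?_⟩
  simp only [dagger_comp, dagger_dagger, hs, Category.assoc]

end Bim
end LocalExt

namespace LocalExt

variable {H : Type u} [NormedAddCommGroup H] [InnerProductSpace ℂ H] [CompleteSpace H]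

namespace Bim

lemma DualData.null_B {A : IIOneFactor H} {X Y : Bim A} (D : DualData X Y) {ξ : ℕ → Y} {x : ℕ → X}
    (hξ : Bdd Y ξ) (hx : Null X x) : NullA fun n => D.B (ξ n) (x n) :=
  nullA_congr (nullA_iff.2 ((Null.tm_left hξ hx).map (RLin.map D.ev)))
    fun _ => congrArg ofUnit (D.ev_tm _ _)

end Bim

namespace FiniteIndex

variable {M : IIOneFactor H} {S : Subfactor M} {I : FiniteIndex S}

/-! ## Unitarizing an action -/

namespace RAct

variable {Y : Bim S.toFactor} (R : I.RAct Y)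

/-- The embedding `ξ ↦ [M : N]⁻¹ ∑ ξ c_j ⊠ c_j*` of a module into a free module. -/
noncomputable def emb : Y ⟶ tensor Y I.bim :=
  (ρ_ Y).inv ≫ Y ◁ (I.one ≫ dagger I.mul) ≫ (α_ Y I.bim I.bim).inv ≫ R.act ▷ I.bim

lemma emb_apply (ξ : Y) : map R.emb ξ =
    (I.index : ℂ)⁻¹ • ∑ j, tm (R.rho ξ (I.c j)) (I.toBim (star (I.c j))) := by
  have e1 : map (I.one ≫ dagger I.mul) (toUnit 1) = (I.index : ℂ)⁻¹ • ∑ j,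
      tm (I.toBim (I.c j)) (I.toBim (star (I.c j))) := by
    rw [map_comp, one_apply, dagger_mul]
    simp only [ofBim_toBim, ofUnit_toUnit, map_one, one_mul]
  have e0 : map (ρ_ Y).inv ξ = tm ξ (toUnit 1) := rfl
  rw [emb, map_comp, e0, map_comp, whiskerLeft_tm, e1, tm_smul, tm_sum, map_smul, map_sum]
  refine congrArg _ (Finset.sum_congr rfl fun j _ => ?_)
  rw [map_comp, associator_inv_tm, whiskerRight_tm]; rfl

/-- The relation ∑ q c_j ⊠ c_j* = ∑ c_j ⊠ c_j* q, with the first leg acting on ξ, makes the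
embedding linear over M. -/
lemma emb_rho (ξ : Y) (q : M.El) : map R.emb (R.rho ξ q) = (RAct.free Y).rho (map R.emb ξ) q := by
  have key := congrArg (fun t => map ((α_ Y I.bim I.bim).inv ≫ R.act ▷ I.bim) (tm ξ t))
    (I.comul_comm q)
  have e : ∀ p r : M.El, map ((α_ Y I.bim I.bim).inv ≫ R.act ▷ I.bim)
      (tm ξ (tm (I.toBim p) (I.toBim r))) = tm (R.rho ξ p) (I.toBim r) := fun p r => by
    rw [map_comp, associator_inv_tm, whiskerRight_tm]; rfl
  simp only [tm_sum, map_sum, e] at key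
  rw [emb_apply, emb_apply, map_smul, map_sum, LinearMap.smul_apply, LinearMap.sum_apply]
  simp only [free_rho, rho_rho, key]

lemma emb_act : R.emb ≫ R.act = 𝟙 Y := hom_ext fun ξ => by
  rw [map_comp, emb_apply, map_smul, map_sum]
  simp only [← rho_apply, rho_rho]
  rw [← map_sum, I.sum_eq, map_smul, rho_one, inv_smul_smul₀ I.index_ne, Bim.map_id]

/-- Transport of an action along an isomorphism. -/
noncomputable def iso {V : Bim S.toFactor} (u : V ≅ Y) : I.RAct V where
  act := u.hom ▷ I.bim ≫ R.act ≫ u.inv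
  act_act x q r := by
    have e : ∀ x q, map (u.hom ▷ I.bim ≫ R.act ≫ u.inv) (tm x (I.toBim q)) =
        map u.inv (map R.act (tm (map u.hom x) (I.toBim q))) := fun x q => by
      rw [map_comp, whiskerRight_tm, map_comp]
    have e' : ∀ y, map u.hom (map u.inv y) = y := fun y =>
      congrArg (fun f => map f y) u.inv_hom_id
    rw [e, e, e, e', R.act_act]
  act_one x := by
    rw [map_comp, whiskerRight_tm, map_comp, R.act_one, ← map_comp, u.hom_inv_id, Bim.map_id]

lemma iso_rho {V : Bim S.toFactor} (u : V ≅ Y) (x : V) (q : M.El) :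
    (R.iso u).rho x q = map u.inv (R.rho (map u.hom x) q) := by
  change map (u.hom ▷ I.bim ≫ R.act ≫ u.inv) (tm x (I.toBim q)) = _
  rw [map_comp, whiskerRight_tm]; rfl

/-- An action on a dualizable bimodule is unitary for some equivalent inner product. -/
lemma exists_unitary {X : Bim S.toFactor} (D : DualData X Y) (hY : chiZero S.toFactor Y)
    (hQ : chiZero S.toFactor I.bim) :
    ∃ (V : Bim S.toFactor) (u : V ≅ Y), chiZero S.toFactor V ∧ (R.iso u).Unitary := by
  -- The action is a left inverse of the embedding into Y ⊠ L²M. The new object keeps the actions of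
  -- Y and takes the inner product of the free module, which is compatible with M. As a summand of Y
  -- ⊠ L²M it stays approximately inner and centrally trivial.
  obtain ⟨P, hP, hP'⟩ := exists_projection D R.emb R.act R.emb_act
  refine ⟨pullback R.emb P hP hP', pullbackIso R.emb P hP hP',
    ⟨ApproxInner.of_isometry pullbackHom_isometry (ApproxInner.tensor hY.1 hQ.1),
      CentrallyTrivial.of_isometry pullbackHom_isometry (CentrallyTrivial.tensor hY.2 hQ.2)⟩, ?_⟩
  set u := pullbackIso R.emb P hP hP'
  have h1 : ∀ x q, map R.emb ((R.iso u).rho x q) = (RAct.free Y).rho (map R.emb x) q :=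
    fun x q => (congrArg (map R.emb) (R.iso_rho u x q)).trans (R.emb_rho x q)
  have h2 : ∀ x y, (R.iso u).ipM x y = (RAct.free Y).ipM (map R.emb x) (map R.emb y) :=
    fun x y => by
      rw [ipM, ipM]
      refine congrArg _ (Finset.sum_congr rfl fun j _ => ?_)
      rw [← h1]
  intro x q y
  rw [h2, ← unitary_free Y _ _ _, ← h1]

end RAct

/-! ## The dual of a local module -/

section Dual

variable (X : LocMod I.qSystem) {Y : Bim S.toFactor} (D : DualData X.X Y)

/-- The right action of `M` on the dual, `⟨ξ q, x⟩ = ⟨ξ, q x⟩`. -/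
noncomputable def dualActFun : Y →ₗ[ℂ] I.bim →ₗ[ℂ] Y := LinearMap.mk₂ ℂ
  (fun ξ q => ∑ k, Y.l (D.B ξ (lam X (I.ofBim q) (D.e k))) (D.f k))
  (fun ξ η q => by simp only [map_add, LinearMap.add_apply, Finset.sum_add_distrib])
  (fun c ξ q => by simp only [map_smul, LinearMap.smul_apply, Finset.smul_sum])
  (fun ξ q r => by simp only [map_add, LinearMap.add_apply, Finset.sum_add_distrib])
  (fun c ξ q => by simp only [map_smul, LinearMap.smul_apply, Finset.smul_sum])

lemma B_dualActFun (ξ : Y) (q : I.bim) (x : X.X) :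
    D.B (dualActFun X D ξ q) x = D.B ξ (lam X (I.ofBim q) x) := by
  conv_rhs => rw [← D.expand x]
  change D.B (∑ k, Y.l (D.B ξ (lam X (I.ofBim q) (D.e k))) (D.f k)) x = _
  simp only [map_sum, LinearMap.sum_apply, D.l_B, lam_ra, D.B_ra]

lemma dualActFun_ra (ξ : Y) (a : S.toFactor.El) (q : I.bim) :
    dualActFun X D (Y.ra ξ a) q = dualActFun X D ξ (I.bim.l a q) := D.ext fun x => by
  rw [B_dualActFun, B_dualActFun, D.bal, lam_l]; rfl

/-- The right action of `M` on the dual, as a morphism. -/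
noncomputable def dualHom : tensor Y I.bim ⟶ Y :=
  mkHom (lift (dualActFun X D) (dualActFun_ra X D))
    (fun a => tensor_l_ext _ a fun ξ q => D.ext fun x => by
      rw [lift_tm, lift_tm, D.l_B, B_dualActFun, B_dualActFun, D.l_B])
    (fun t a => tensor_ra_ext _ a (fun ξ q => D.ext fun x => by
      rw [lift_tm, lift_tm, D.bal, B_dualActFun, B_dualActFun, ← lam_bal]; rfl) t)

lemma B_dualHom (ξ : Y) (q : M.El) (x : X.X) :
    D.B (map (dualHom X D) (tm ξ (I.toBim q))) x = D.B ξ (lam X q x) := by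
  refine Eq.trans ?_ (B_dualActFun X D ξ (I.toBim q) x)
  exact congrArg (fun η => D.B η x) (lift_tm _ (dualActFun_ra X D) ξ (I.toBim q))

/-- The right action of `M` on the dual of a local module. -/
noncomputable def dualAct (h : I.Comm) : I.RAct Y where
  act := dualHom X D
  act_act ξ q r := D.ext fun x => by
    rw [B_dualHom, B_dualHom, B_dualHom, h.lam_mul]
  act_one ξ := D.ext fun x => by rw [B_dualHom, h.lam_one]

lemma B_dualAct (h : I.Comm) (ξ : Y) (q : M.El) (x : X.X) :
    D.B ((dualAct X D h).rho ξ q) x = D.B ξ (lam X q x) := B_dualHom X D ξ q x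

/-- The `M`-valued pairing. -/
noncomputable def pairM : Y →ₗ[ℂ] X.X →ₗ[ℂ] M.El := LinearMap.mk₂ ℂ
  -- There is no factor [M : N]⁻¹ here, in contrast to `ipM`: the pairing B is E of this one,
  -- without the index.
  (fun ξ x => ∑ j, S.incl (D.B ξ ((ract X).rho x (I.c j))) * star (I.c j))
  (fun ξ η q => by simp only [map_add, LinearMap.add_apply, add_mul, Finset.sum_add_distrib])
  (fun c ξ q => by
    simp only [map_smul, LinearMap.smul_apply, smul_mul_assoc, Finset.smul_sum])
  (fun ξ q r => by simp only [map_add, LinearMap.add_apply, add_mul, Finset.sum_add_distrib])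
  (fun c ξ q => by
    simp only [map_smul, LinearMap.smul_apply, smul_mul_assoc, Finset.smul_sum])

lemma pairM_apply (ξ : Y) (x : X.X) : pairM X D ξ x =
    ∑ j, S.incl (D.B ξ ((ract X).rho x (I.c j))) * star (I.c j) := rfl

lemma pairM_rho (ξ : Y) (x : X.X) (r : M.El) :
    pairM X D ξ ((ract X).rho x r) = pairM X D ξ x * r := by
  rw [pairM_apply, pairM_apply]
  simp only [RAct.rho_rho, RAct.rho_mul_c, map_sum, D.B_ra, map_mul, Finset.sum_mul]
  rw [Finset.sum_comm]
  refine Finset.sum_congr rfl fun l _ => ?_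
  simp only [mul_assoc, ← Finset.mul_sum]
  have := I.expand' (star (I.c l) * r)
  simp only [mul_assoc] at this
  rw [this]

lemma pairM_ra (ξ : Y) (x : X.X) (a : S.toFactor.El) :
    pairM X D ξ (X.X.ra x a) = pairM X D ξ x * S.incl a := by
  rw [← pairM_rho, RAct.rho_incl]

lemma E_pairM (ξ : Y) (x : X.X) : I.E (pairM X D ξ x) = D.B ξ x := by
  rw [pairM_apply, map_sum]
  simp only [I.E_mul_left]
  conv_rhs => rw [← (ract X).rho_one x, ← I.expand 1]
  simp only [map_sum, ← RAct.rho_ra', D.B_ra, mul_one]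

lemma E_pairM_mul (ξ : Y) (x : X.X) (r : M.El) :
    I.E (pairM X D ξ x * r) = D.B ξ ((ract X).rho x r) := by
  rw [← pairM_rho, E_pairM]

lemma l_pairM (a : S.toFactor.El) (ξ : Y) (x : X.X) :
    pairM X D (Y.l a ξ) x = S.incl a * pairM X D ξ x := by
  simp only [pairM_apply, D.l_B, map_mul, Finset.mul_sum, mul_assoc]

lemma pairM_bal (ξ : Y) (a : S.toFactor.El) (x : X.X) :
    pairM X D (Y.ra ξ a) x = pairM X D ξ (X.X.l a x) := by
  simp only [pairM_apply, D.bal, RAct.rho_l]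

/-- The `M`-valued pairing as a bimodule map. -/
noncomputable def pairHom : tensor Y X.X ⟶ I.bim :=
  mkHom (I.toBim.toLinearMap ∘ₗ lift (pairM X D) (pairM_bal X D))
    (fun a => tensor_l_ext _ a fun ξ x => by
      simp only [LinearMap.comp_apply, lift_tm, l_pairM]; rfl)
    (fun t a => tensor_ra_ext _ a (fun ξ x => by
      simp only [LinearMap.comp_apply, lift_tm, pairM_ra]; rfl) t)

lemma pairHom_tm (ξ : Y) (x : X.X) : map (pairHom X D) (tm ξ x) = I.toBim (pairM X D ξ x) :=
  congrArg I.toBim (lift_tm (pairM X D) (pairM_bal X D) ξ x)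

/-- The left action of `M` on the dual, `⟨q ξ, x⟩ = E(q ⟨ξ, x⟩_M)`. -/
noncomputable def dualLeftFun : I.bim →ₗ[ℂ] Y →ₗ[ℂ] Y := LinearMap.mk₂ ℂ
  (fun q ξ => ∑ k, Y.l (I.E (I.ofBim q * pairM X D ξ (D.e k))) (D.f k))
  (fun ξ η q => by
    simp only [map_add, LinearMap.add_apply, add_mul, Finset.sum_add_distrib])
  (fun c ξ q => by
    simp only [map_smul, LinearMap.smul_apply, smul_mul_assoc, Finset.smul_sum])
  (fun ξ q r => by
    simp only [map_add, LinearMap.add_apply, mul_add, Finset.sum_add_distrib])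
  (fun c ξ q => by
    simp only [map_smul, LinearMap.smul_apply, mul_smul_comm, Finset.smul_sum])

lemma B_dualLeftFun (q : I.bim) (ξ : Y) (x : X.X) :
    D.B (dualLeftFun X D q ξ) x = I.E (I.ofBim q * pairM X D ξ x) := by
  conv_rhs => rw [← D.expand x]
  change D.B (∑ k, Y.l (I.E (I.ofBim q * pairM X D ξ (D.e k))) (D.f k)) x = _
  simp only [map_sum, LinearMap.sum_apply, D.l_B, pairM_ra, Finset.mul_sum, ← mul_assoc,
    I.E_mul_right]

lemma dualLeftFun_ra (q : I.bim) (a : S.toFactor.El) (ξ : Y) :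
    dualLeftFun X D (I.bim.ra q a) ξ = dualLeftFun X D q (Y.l a ξ) := D.ext fun x => by
  rw [B_dualLeftFun, B_dualLeftFun, l_pairM, ← mul_assoc]; rfl

/-- The left action on the dual as a linear map on `L²M ⊠ Y`. -/
noncomputable def dualLeft : tensor I.bim Y →ₗ[ℂ] Y :=
  lift (dualLeftFun X D) (dualLeftFun_ra X D)

lemma B_dualLeft (q : I.bim) (ξ : Y) (x : X.X) :
    D.B (dualLeft X D (tm q ξ)) x = I.E (I.ofBim q * pairM X D ξ x) := by
  rw [dualLeft, lift_tm, B_dualLeftFun]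

lemma rLin_dualLeft : RLin (dualLeft X D) := fun t a => tensor_ra_ext _ a (fun q ξ =>
  D.ext fun x => by rw [B_dualLeft, D.bal, B_dualLeft, pairM_bal]) t

/-! ### Locality of the dual module -/

section Local

variable {X D} {R : I.RAct Y}

lemma null_pairM {ξ : ℕ → Y} {x : ℕ → X.X} (hξ : Bdd Y ξ) (hx : Null X.X x) :
    NullA fun n => pairM X D (ξ n) (x n) :=
  I.null_bim.1 (null_congr ((Null.tm_left hξ hx).map (RLin.map (pairHom X D)))
    fun _ => pairHom_tm X D _ _)

/-- The pairing is an N-bimodule map into L²M, so it sends central vectors to sequences that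
asymptotically commute with N; commutativity of Q upgrades this to M. -/
lemma Comm.isCentralSeq_pairM (h : I.Comm) {ξ : ℕ → Y} {x : ℕ → X.X} (hξ : CentralVec Y ξ)
    (hx : CentralVec X.X x) : IsCentralSeq fun n => pairM X D (ξ n) (x n) := by
  refine h.isCentralSeq ?_
  have h1 := (hξ.tm hx).map (pairHom X D)
  simp only [pairHom_tm] at h1
  exact h1

/-- For central q_n in M, ⟨ξ q_n, x⟩ = ⟨ξ, q_n x⟩ is asymptotically ⟨ξ, x q_n⟩ = E(⟨ξ, x⟩_M q_n),
and q_n may then be moved to the front. -/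
lemma Comm.braid_dual (h : I.Comm) (hR : ∀ ξ q x, D.B (R.rho ξ q) x = D.B ξ (lam X q x))
    (hY : chiZero S.toFactor Y) : map (braid I.bim Y ≫ R.act) = dualLeft X D := by
  obtain ⟨m, b, hb⟩ := h.mem.1
  refine hb.ext (RLin.map _) (rLin_dualLeft X D) fun q hq ξ => ?_
  have hq' : IsCentralSeq fun n => I.ofBim (q n) := h.isCentralSeq hq
  have h1 := (br_braid h.mem.1 hY.2 q hq ξ).map (RLin.map R.act)
  have h2 : Null Y fun n => R.rho ξ (I.ofBim (q n)) - dualLeft X D (tm (q n) ξ) := by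
    refine D.null_of_B fun x => ?_
    have h3 := D.null_B (bdd_const ξ) (h.lam_br X hq' x)
    have h4 := I.nullA_E (hq'.2 (pairM X D ξ x))
    refine nullA_congr (h3.sub h4) fun n => ?_
    rw [map_sub (D.B ξ), map_sub I.E, map_sub D.B, LinearMap.sub_apply, hR, B_dualLeft,
      E_pairM_mul]
    abel
  refine null_congr (h1.add h2) fun n => ?_
  rw [map_sub, map_comp]
  exact sub_add_sub_cancel _ _ _

/-- Expanding x in an approximately inner basis of X reduces to vectors e_n central for N. There q
e_n is asymptotically e_n q by locality, and ⟨ξ_n, e_n⟩_M is a central sequence of M, so it commutes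
with q asymptotically. -/
lemma Comm.null_dual (h : I.Comm) {ξ : ℕ → Y} (hξ : CentralVec Y ξ) (q : M.El) (x : X.X) :
    NullA fun n => D.B (ξ n) (lam X q x) - I.E (q * pairM X D (ξ n) x) := by
  obtain ⟨p, e, he⟩ := X.mem.1
  have hx : Null X.X fun n => x - ∑ i, X.X.ra (e n i) (X.X.ip (e n i) x) := he.approx x
  have h3 := D.null_B hξ.bdd (hx.map (T := lam X q) (lam_ra X _))
  have h4 := I.nullA_E (NullA.mul_left (bddA_const q) (null_pairM (D := D) hξ.bdd hx))
  have h5 : ∀ i, NullA fun n => D.B (ξ n) (lam X q (e n i)) -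
      I.E (q * pairM X D (ξ n) (e n i)) := fun i => by
    have h6 := D.null_B hξ.bdd (h.lam_br' X q (he.central i))
    have h7 := I.nullA_E ((h.isCentralSeq_pairM (D := D) hξ (he.central i)).2 q)
    refine nullA_congr (h6.add h7) fun n => ?_
    rw [map_sub (D.B (ξ n)), map_sub I.E, E_pairM_mul]
    abel
  have h9 := NullA.sum Finset.univ fun i _ =>
    NullA.mul_right (h5 i) (Bdd.ip (he.central i).bdd (bdd_const x))
  refine nullA_congr ((h3.sub h4).add h9) fun n => ?_
  have e1 : D.B (ξ n) (lam X q (∑ i, X.X.ra (e n i) (X.X.ip (e n i) x))) =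
      ∑ i, D.B (ξ n) (lam X q (e n i)) * X.X.ip (e n i) x := by
    simp only [map_sum, lam_ra, D.B_ra]
  have e2 : I.E (q * pairM X D (ξ n) (∑ i, X.X.ra (e n i) (X.X.ip (e n i) x))) =
      ∑ i, I.E (q * pairM X D (ξ n) (e n i)) * X.X.ip (e n i) x := by
    simp only [map_sum, pairM_ra, Finset.mul_sum, ← mul_assoc, I.E_mul_right]
  simp only [sub_mul, Finset.sum_sub_distrib]
  rw [map_sub (lam X q), map_sub (D.B (ξ n)), map_sub (pairM X D (ξ n)), mul_sub, map_sub I.E,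
    e1, e2]
  abel

/-- Together with `Comm.braid_dual` it shows that both braidings induce the same left action on the
dual, which is locality. -/
lemma Comm.dagger_braid_dual (h : I.Comm)
    (hR : ∀ ξ q x, D.B (R.rho ξ q) x = D.B ξ (lam X q x)) (hY : chiZero S.toFactor Y) :
    map (dagger (braid Y I.bim) ≫ R.act) = dualLeft X D := by
  obtain ⟨m, b, hb⟩ := hY.1
  refine hb.ext_right (RLin.map _) (rLin_dualLeft X D) fun ξ hξ q => ?_
  have h1 := ((br_braid hY.1 h.mem.2.1).dagger hY.1 h.mem.2.1 hξ q).map (RLin.map R.act)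
  have h2 : Null Y fun n => R.rho (ξ n) (I.ofBim q) - dualLeft X D (tm q (ξ n)) := by
    refine D.null_of_B fun x => nullA_congr (h.null_dual (D := D) hξ (I.ofBim q) x) fun n => ?_
    rw [map_sub D.B, LinearMap.sub_apply, hR, B_dualLeft]
  refine null_congr (h1.add h2) fun n => ?_
  rw [map_sub, map_comp]
  exact sub_add_sub_cancel _ _ _

end Local

end Dual

/-- A duality of local modules induces a duality of their realizations. -/
lemma Comm.exists_exactPairing (h : I.Comm) (X V : LocMod I.qSystem) (D : DualData X.X V.X)
    (hl : ∀ q ξ x, D.B (lam V q ξ) x = I.E (q * pairM X D ξ x))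
    (hr : ∀ ξ q x, D.B ((ract V).rho ξ q) x = D.B ξ (lam X q x)) :
    Nonempty (ExactPairing (realize h X) (realize h V)) := by
  have hext : ∀ {ξ η : V.X}, (∀ x, pairM X D ξ x = pairM X D η x) → ξ = η := fun hξ =>
    D.ext fun x => by rw [← E_pairM X D, hξ, E_pairM X D]
  have hpl : ∀ q ξ x, pairM X D (lam V q ξ) x = q * pairM X D ξ x := fun q ξ x =>
    I.ext_E fun r => by rw [E_pairM_mul, hl, pairM_rho, mul_assoc]
  obtain ⟨n, b, hb⟩ := exists_isBasis X.X
  -- The dual basis consists of the vectors representing [M : N]⁻¹⟨b_k|·⟩; their M-valued pairing is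
  -- ⟨b_k|·⟩_M, so `sum_basis` gives the expansion.
  have hrep : ∀ k, ∃ ξ : V.X, ∀ x, pairM X D ξ x = (ract X).ipM (b k) x := fun k => by
    obtain ⟨ξ, hξ⟩ := D.exists_rep ((I.index : ℂ)⁻¹ • X.X.ipL (b k)) fun x a => by
      rw [LinearMap.smul_apply, LinearMap.smul_apply, ipL_apply, ipL_apply, X.X.ip_ra,
        smul_mul_assoc]
    refine ⟨ξ, fun x => I.ext_E fun r => ?_⟩
    rw [E_pairM_mul, hξ, LinearMap.smul_apply, ipL_apply, ← (ract X).E_ipM_mul,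
      inv_smul_smul₀ I.index_ne]
  choose f hf using hrep
  refine ⟨DualData.exactPairing
    { B := pairM X D
      l_B := hpl
      B_ra := pairM_rho X D
      bal := fun ξ q x => I.ext_E fun r => by
        change I.E (pairM X D ((ract V).rho ξ q) x * r) = I.E (pairM X D ξ (lam X q x) * r)
        rw [E_pairM_mul, E_pairM_mul, hr, h.lam_rho]
      n := n
      e := b
      f := f
      expand := fun x => ?_
      expand' := fun ξ => hext fun x => ?_ }⟩
  · change ∑ k, (ract X).rho (b k) (pairM X D (f k) x) = x
    simp only [hf]
    exact (ract X).sum_basis hb x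
  · change pairM X D (∑ k, lam V (pairM X D ξ (b k)) (f k)) x = _
    conv_rhs => rw [← (ract X).sum_basis hb x]
    rw [map_sum, map_sum, LinearMap.sum_apply]
    exact Finset.sum_congr rfl fun k _ => by rw [hpl, hf, pairM_rho]

/-- Realization maps to `χ̃(M)`. -/
lemma Comm.chi_realize (h : I.Comm) (X : LocMod I.qSystem) : chi M (realize h X) := by
  obtain ⟨h1, h2, Y₀, h3, h4, ⟨p⟩, ⟨p'⟩⟩ := X.mem
  obtain ⟨D₀⟩ := exists_dualData p
  obtain ⟨D₀'⟩ := exists_dualData p'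
  -- The dual Y₀ carries the right action of M, but its inner product need not be compatible with
  -- it. Y is the same bimodule with a repaired inner product, and D, R are the transported pairing
  -- and action.
  obtain ⟨Y, u, hY, hu⟩ := (dualAct X D₀ h).exists_unitary D₀ ⟨h3, h4⟩ ⟨h.mem.1, h.mem.2.1⟩
  let D := D₀.isoRight u
  let R := (dualAct X D₀ h).iso u
  have hR : ∀ ξ q x, D.B (R.rho ξ q) x = D.B ξ (lam X q x) := fun ξ q x => by
    change D₀.B (map u.hom (((dualAct X D₀ h).iso u).rho ξ q)) x = D₀.B (map u.hom ξ) (lam X q x)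
    rw [RAct.iso_rho, ← map_comp, u.inv_hom_id, Bim.map_id, B_dualAct]
  have e1 : map (braid I.bim Y ≫ R.act) = dualLeft X D := h.braid_dual hR hY
  have e2 : map (dagger (braid Y I.bim) ≫ R.act) = dualLeft X D := h.dagger_braid_dual hR hY
  let V : LocMod I.qSystem := locMod
    (chi_of_exactPairing hY ⟨h1, h2⟩ ⟨(D₀'.isoLeft u).exactPairing⟩) R hu
    (hom_ext fun t => LinearMap.congr_fun (e1.trans e2.symm) t)
  exact chi_of_exactPairing ⟨approxInner_realize h X, centrallyTrivial_realize h X⟩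
    ⟨approxInner_realize h V, centrallyTrivial_realize h V⟩
    (h.exists_exactPairing X V D (fun q ξ x =>
      (congrArg (fun η => D.B η x) (LinearMap.congr_fun e1 (tm (I.toBim q) ξ))).trans
        (B_dualLeft X D _ _ _)) hR)

end FiniteIndex
end LocalExt

namespace LocalExt

/-! ## Lifting a braided structure along a fully faithful functor -/

section Lift

universe v₁ u₁ v₂ u₂

variable {C : Type u₁} [Category.{v₁} C] [MonoidalCategory C] {D : Type u₂} [Category.{v₂} D]
  (F : D ⥤ C) [F.Full] [F.Faithful] (G : C → D) (c : ∀ Z, F.obj (G Z) ≅ Z)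

/-- The tensor product `G(F X ⊗ F Y)`, for a choice `G` of preimages under `F`. -/
@[reducible] noncomputable def liftStruct : MonoidalCategoryStruct D where
  tensorObj X Y := G (F.obj X ⊗ F.obj Y)
  whiskerLeft X _ _ f := F.preimage ((c _).hom ≫ F.obj X ◁ F.map f ≫ (c _).inv)
  whiskerRight f Y := F.preimage ((c _).hom ≫ F.map f ▷ F.obj Y ≫ (c _).inv)
  tensorHom f g := F.preimage ((c _).hom ≫ (F.map f ⊗ₘ F.map g) ≫ (c _).inv)
  tensorUnit := G (𝟙_ C)
  associator X Y Z := F.preimageIso (((c _) ≪≫ ((c _) ⊗ᵢ .refl _)) ≪≫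
    α_ (F.obj X) (F.obj Y) (F.obj Z) ≪≫ ((.refl _ ⊗ᵢ (c _).symm) ≪≫ (c _).symm))
  leftUnitor X := F.preimageIso (((c _) ≪≫ ((c _) ⊗ᵢ .refl _)) ≪≫ λ_ (F.obj X))
  rightUnitor X := F.preimageIso (((c _) ≪≫ (.refl _ ⊗ᵢ (c _))) ≪≫ ρ_ (F.obj X))

/-- `F` preserves the lifted structure. -/
noncomputable def liftData :
    letI := liftStruct F G c
    Monoidal.InducingFunctorData F :=
  letI := liftStruct F G c
  { μIso := fun X Y => (c (F.obj X ⊗ F.obj Y)).symm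
    εIso := (c (𝟙_ C)).symm
    whiskerLeft_eq := fun _ _ _ _ => F.map_preimage _
    whiskerRight_eq := fun _ _ => F.map_preimage _
    tensorHom_eq := fun _ _ => F.map_preimage _
    associator_eq := fun _ _ _ => F.map_preimage _
    leftUnitor_eq := fun _ => F.map_preimage _
    rightUnitor_eq := fun _ => F.map_preimage _ }

/-- The lifted monoidal category. -/
@[reducible] noncomputable def liftMonoidal : MonoidalCategory D :=
  letI := liftStruct F G c
  Monoidal.induced F (liftData F G c)

/-- `F` is a monoidal functor on the lifted monoidal category. -/
@[reducible] noncomputable def liftFunctor :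
    letI := liftMonoidal F G c
    F.Monoidal :=
  letI := liftStruct F G c
  letI := liftMonoidal F G c
  (Monoidal.fromInducedCoreMonoidal F (liftData F G c)).toMonoidal

variable [BraidedCategory C]

/-- The lifted braiding. -/
@[reducible] noncomputable def liftBraided :
    letI := liftMonoidal F G c
    BraidedCategory D :=
  letI := liftMonoidal F G c
  letI := liftFunctor F G c
  BraidedCategory.ofFaithful F (fun X Y => F.preimageIso
    (c (F.obj X ⊗ F.obj Y) ≪≫ β_ (F.obj X) (F.obj Y) ≪≫ (c (F.obj Y ⊗ F.obj X)).symm))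
    (fun X Y => by
      change (c _).inv ≫ F.map (F.preimage _) = (β_ _ _).hom ≫ (c _).inv
      rw [F.map_preimage]
      simp)

/-- `F` is a braided functor on the lifted braided category. -/
@[reducible] noncomputable def liftFunctorBraided :
    letI := liftMonoidal F G c
    letI := liftBraided F G c
    F.Braided :=
  letI := liftMonoidal F G c
  letI := liftBraided F G c
  letI := liftFunctor F G c
  { braided := fun X Y => by
      change (c _).inv ≫ F.map (F.preimage _) = (β_ _ _).hom ≫ (c _).inv
      rw [F.map_preimage]
      simp }

end Lift

/-! ### Unitary morphisms, and unitarity of the lifted structure -/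

section Unitary

universe v₁ u₁ v₂ u₂

open DaggerCategory

variable {C : Type u₁} [Category.{v₁} C] [DaggerCategory C]

lemma IsUnitaryHom.comp {X Y Z : C} {f : X ⟶ Y} {g : Y ⟶ Z} (hf : IsUnitaryHom f)
    (hg : IsUnitaryHom g) : IsUnitaryHom (f ≫ g) := by
  constructor
  · rw [dag_comp, Category.assoc, ← Category.assoc g, hg.1, Category.id_comp, hf.1]
  · rw [dag_comp, Category.assoc, ← Category.assoc (dag f), hf.2, Category.id_comp, hg.2]

lemma IsUnitaryHom.dag_hom {X Y : C} {e : X ≅ Y} (h : IsUnitaryHom e.hom) : dag e.hom = e.inv := by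
  rw [← cancel_epi e.hom, h.1, e.hom_inv_id]

lemma IsUnitaryHom.inv {X Y : C} {e : X ≅ Y} (h : IsUnitaryHom e.hom) : IsUnitaryHom e.inv := by
  rw [← h.dag_hom]
  exact ⟨by rw [dag_dag]; exact h.2, by rw [dag_dag]; exact h.1⟩

lemma IsUnitaryHom.dag_inv {X Y : C} {e : X ≅ Y} (h : IsUnitaryHom e.hom) : dag e.inv = e.hom := by
  rw [← h.dag_hom, dag_dag]

lemma isUnitaryHom_id (X : C) : IsUnitaryHom (𝟙 X) := by
  constructor <;> rw [dag_id, Category.id_comp]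

lemma IsUnitaryHom.tensor [MonoidalCategory C] [BraidedCategory C] (hC : IsUnitaryBraided C)
    {X Y Z W : C} {f : X ⟶ Y} {g : Z ⟶ W} (hf : IsUnitaryHom f) (hg : IsUnitaryHom g) :
    IsUnitaryHom (f ⊗ₘ g) := by
  constructor
  · rw [hC.dag_tensorHom, MonoidalCategory.tensorHom_comp_tensorHom, hf.1, hg.1,
      MonoidalCategory.id_tensorHom_id]
  · rw [hC.dag_tensorHom, MonoidalCategory.tensorHom_comp_tensorHom, hf.2, hg.2,
      MonoidalCategory.id_tensorHom_id]

variable [MonoidalCategory C] [BraidedCategory C] {D : Type u₂} [Category.{v₂} D]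
  [DaggerCategory D] (F : D ⥤ C) [F.Full] [F.Faithful] (G : C → D) (c : ∀ Z, F.obj (G Z) ≅ Z)

/-- The lifted structure is unitary. -/
lemma lift_unitary (hC : IsUnitaryBraided C)
    (hF : ∀ {X Y : D} (f : X ⟶ Y), F.map (dag f) = dag (F.map f))
    (hc : ∀ Z, IsUnitaryHom (c Z).hom) :
    let _ := liftMonoidal F G c
    let _ := liftBraided F G c
    IsUnitaryBraided D := by
  let _ := liftMonoidal F G c
  let _ := liftBraided F G c
  -- A faithful functor that preserves the dagger reflects unitarity, and all lifted structure
  -- consists of preimages of unitaries.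
  have hu : ∀ {X Y : D} {f : X ⟶ Y}, IsUnitaryHom (F.map f) → IsUnitaryHom f := fun {X Y f} h =>
    ⟨F.map_injective (by rw [F.map_comp, hF, h.1, F.map_id]),
      F.map_injective (by rw [F.map_comp, hF, h.2, F.map_id])⟩
  have hp : ∀ {X Y : D} {f : F.obj X ⟶ F.obj Y}, IsUnitaryHom f → IsUnitaryHom (F.preimage f) :=
    fun h => hu (by rwa [F.map_preimage])
  refine ⟨fun {X Y Z W} f g => F.map_injective ?_, fun X Y Z => hp ?_, fun X => hp ?_,
    fun X => hp ?_, fun X Y => hp ?_⟩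
  · rw [hF]
    change dag (F.map (F.preimage _)) = F.map (F.preimage _)
    rw [F.map_preimage, F.map_preimage, dag_comp, dag_comp, (hc _).dag_hom, (hc _).dag_inv,
      hC.dag_tensorHom, hF, hF, Category.assoc]
  · exact ((hc _).comp (IsUnitaryHom.tensor hC (hc _) (isUnitaryHom_id _))).comp
      ((hC.associator _ _ _).comp
        ((IsUnitaryHom.tensor hC (isUnitaryHom_id _) (hc _).inv).comp (hc _).inv))
  · exact ((hc _).comp (IsUnitaryHom.tensor hC (hc _) (isUnitaryHom_id _))).comp
      (hC.leftUnitor _)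
  · exact ((hc _).comp (IsUnitaryHom.tensor hC (isUnitaryHom_id _) (hc _))).comp
      (hC.rightUnitor _)
  · exact (hc _).comp ((hC.braiding _ _).comp (hc _).inv)

end Unitary

end LocalExt

namespace LocalExt

variable {H : Type u} [NormedAddCommGroup H] [InnerProductSpace ℂ H] [CompleteSpace H]

namespace FiniteIndex

variable {M : IIOneFactor H} {S : Subfactor M} {I : FiniteIndex S}

/-! ## The local module of an `M`-bimodule -/

section Restrict

variable (I) in
/-- The right action of `M` on the restriction, as a bilinear map. -/
noncomputable def resFun (Z : Bim M) : I.res Z →ₗ[ℂ] I.bim →ₗ[ℂ] I.res Z := LinearMap.mk₂ ℂ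
  (fun z q => Z.ra z (I.ofBim q)) (fun _ _ _ => Z.ra_add _ _ _) (fun _ _ _ => smul_ra _ _ _ _)
  (fun _ _ _ => ra_add' _ _ _ _) (fun _ _ _ => ra_smul _ _ _ _)

lemma resFun_ra (Z : Bim M) (z : I.res Z) (a : S.toFactor.El) (q : I.bim) :
    I.resFun Z ((I.res Z).ra z a) q = I.resFun Z z (I.bim.l a q) :=
  (Z.ra_mul z (S.incl a) (I.ofBim q)).symm

variable (I) in
/-- The right action of `L²M` on the restriction of an `M`-bimodule. -/
noncomputable def resHom (Z : Bim M) : tensor (I.res Z) I.bim ⟶ I.res Z :=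
  mkHom (lift (I.resFun Z) (resFun_ra Z))
    (fun a => tensor_l_ext (Z := I.res Z) _ a fun z q => by
      rw [lift_tm, lift_tm]
      exact (Z.l_ra (S.incl a) (I.ofBim q) z).symm)
    (fun t a => tensor_ra_ext (Z := I.res Z) _ a (fun z q => by
      rw [lift_tm, lift_tm]
      exact Z.ra_mul z (I.ofBim q) (S.incl a)) t)

lemma resHom_tm (Z : Bim M) (z : Z) (q : M.El) :
    map (I.resHom Z) (tm (X := I.res Z) z (I.toBim q)) = Z.ra z q :=
  lift_tm (I.resFun Z) (resFun_ra Z) z (I.toBim q)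

variable (I) in
/-- The right action of `M` on the restriction of an `M`-bimodule. -/
noncomputable def resAct (Z : Bim M) : I.RAct (I.res Z) where
  act := I.resHom Z
  act_act z q r := by
    rw [resHom_tm, resHom_tm, resHom_tm, Z.ra_mul]
  act_one z := (resHom_tm Z z 1).trans (Z.ra_one z)

lemma resAct_rho (Z : Bim M) (z : Z) (q : M.El) : (I.resAct Z).rho z q = Z.ra z q :=
  resHom_tm Z z q

/-- The index in the restricted inner product cancels the one in `ipM`, and `expand'` resums E(⟨z|w⟩
c_j) c_j* to ⟨z|w⟩. Hence realization undoes restriction. -/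
lemma resAct_ipM (Z : Bim M) (z w : Z) : (I.resAct Z).ipM z w = Z.ip z w := by
  rw [RAct.ipM]
  have e : ∀ j, S.incl ((I.res Z).ip z ((I.resAct Z).rho w (I.c j))) * star (I.c j) =
      (I.index : ℂ) • (S.incl (I.E (Z.ip z w * I.c j)) * star (I.c j)) := fun j => by
    rw [resAct_rho, I.res_ip, Z.ip_ra, map_smul, smul_mul_assoc]
  rw [Finset.sum_congr rfl fun j _ => e j, ← Finset.smul_sum, I.expand',
    inv_smul_smul₀ I.index_ne]

lemma unitary_resAct (Z : Bim M) : (I.resAct Z).Unitary := fun z q w => by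
  rw [resAct_ipM, resAct_rho, I.res_ip, Z.ip_ra_left]

variable (I) in
/-- The left action of `L²M` on the restriction of an `M`-bimodule. -/
noncomputable def resLeft (Z : Bim M) : tensor I.bim (I.res Z) →ₗ[ℂ] I.res Z :=
  lift (Y := I.res Z) (lL Z ∘ₗ I.ofBim.toLinearMap) (fun q a z => Z.l_mul (I.ofBim q) (S.incl a) z)

lemma resLeft_tm (Z : Bim M) (q : M.El) (z : Z) :
    I.resLeft Z (tm (Y := I.res Z) (I.toBim q) z) = Z.l q z := lift_tm _ _ _ _

lemma rLin_resLeft (Z : Bim M) : RLin (I.resLeft Z) := fun t a =>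
  tensor_ra_ext (Z := I.res Z) _ a (fun q z => by
    refine (resLeft_tm Z (I.ofBim q) _).trans ?_
    refine Eq.trans ?_ (congrArg (fun w => (I.res Z).ra w a) (resLeft_tm Z (I.ofBim q) z)).symm
    exact Z.l_ra _ _ _) t

/-- It suffices to test on q_n ⊠ z with q_n central for M; the braiding produces z q_n, and central
triviality over M exchanges it with q_n z. -/
lemma Comm.braid_res (h : I.Comm) {Z : Bim M} (hZ : chi M Z) :
    map (braid I.bim (I.res Z) ≫ (I.resAct Z).act) = I.resLeft Z := by
  obtain ⟨m, b, hb⟩ := h.mem.1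
  refine hb.ext (RLin.map _) (rLin_resLeft Z) fun q hq z => ?_
  have hq' : IsCentralSeq fun n => I.ofBim (q n) := h.isCentralSeq hq
  have h1 := (br_braid h.mem.1 (h.chi_res hZ).2.1 q hq z).map (RLin.map (I.resAct Z).act)
  have h2 : Null Z fun n => Z.l (I.ofBim (q n)) z - Z.ra z (I.ofBim (q n)) := hZ.2.1 _ hq' z
  refine null_congr (h1.sub (I.null_res.2 h2)) fun n => ?_
  rw [map_sub, map_comp]
  have e1 : map (I.resAct Z).act (tm (X := I.res Z) z (q n)) = Z.ra z (I.ofBim (q n)) :=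
    resHom_tm Z z (I.ofBim (q n))
  have e2 : I.resLeft Z (tm (Y := I.res Z) (q n) z) = Z.l (I.ofBim (q n)) z :=
    resLeft_tm Z (I.ofBim (q n)) z
  rw [e1, e2]
  exact sub_sub_sub_cancel_right _ _ _

/-- Central vectors for N are not enough here. The special basis from `Comm.exists_isAIBasis_res`
consists of vectors central for M, which commute with every q ∈ M asymptotically. -/
lemma Comm.dagger_braid_res (h : I.Comm) {Z : Bim M} (hZ : chi M Z) :
    map (dagger (braid (I.res Z) I.bim) ≫ (I.resAct Z).act) = I.resLeft Z := by
  obtain ⟨m, b, hb, hbc⟩ := h.exists_isAIBasis_res hZ.1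
  refine sub_eq_zero.1 (hb.eq_zero_right ((RLin.map _).sub (rLin_resLeft Z)) fun i q => ?_)
  have hA := (h.chi_res hZ).1
  have h1 := ((br_braid hA h.mem.2.1).dagger hA h.mem.2.1 (hb.central i) q).map
    (RLin.map (I.resAct Z).act)
  have h2 := (hbc i).comm (I.ofBim q)
  refine null_congr (h1.sub (I.null_res.2 h2)) fun n => ?_
  rw [map_sub, LinearMap.sub_apply, map_comp]
  have e1 : map (I.resAct Z).act (tm (X := I.res Z) (b n i) q) = Z.ra (b n i) (I.ofBim q) :=
    resHom_tm Z (b n i) (I.ofBim q)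
  have e2 : I.resLeft Z (tm (Y := I.res Z) q (b n i)) = Z.l (I.ofBim q) (b n i) :=
    resLeft_tm Z (I.ofBim q) (b n i)
  rw [e1, e2]
  exact sub_sub_sub_cancel_right _ _ _

/-- The local module of an object of `χ̃(M)`. -/
noncomputable def Comm.resMod (h : I.Comm) (Z : Chi M) : LocMod I.qSystem :=
  locMod (h.chi_res Z.property) (I.resAct Z.obj) (unitary_resAct Z.obj)
    (hom_ext fun t => LinearMap.congr_fun
      ((h.braid_res Z.property).trans (h.dagger_braid_res Z.property).symm) t)

lemma Comm.resMod_rho (h : I.Comm) (Z : Chi M) (z : Z.obj) (q : M.El) :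
    (ract (h.resMod Z)).rho z q = Z.obj.ra z q := resHom_tm Z.obj z q

lemma Comm.resMod_lam (h : I.Comm) (Z : Chi M) (q : M.El) (z : Z.obj) :
    lam (h.resMod Z) q z = Z.obj.l q z :=
  (LinearMap.congr_fun (h.braid_res Z.property) (tm (Y := I.res Z.obj) (I.toBim q) z)).trans
    (resLeft_tm Z.obj q z)

lemma Comm.resMod_ipM (h : I.Comm) (Z : Chi M) (z w : Z.obj) :
    (ract (h.resMod Z)).ipM z w = Z.obj.ip z w := resAct_ipM Z.obj z w

/-- The realization of the local module of `Z` is `Z`. -/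
noncomputable def Comm.realizeIso (h : I.Comm) (Z : Chi M) :
    (⟨realize h (h.resMod Z), h.chi_realize _⟩ : Chi M) ≅ Z :=
  (chi M).isoMk (unitaryIso (X := realize h (h.resMod Z)) (Y := Z.obj)
    (LinearMap.id (R := ℂ) (M := Z.obj)) (LinearMap.id (R := ℂ) (M := Z.obj))
    (fun _ => rfl) (fun _ => rfl) (fun q z => h.resMod_lam Z q z) (fun z q => h.resMod_rho Z z q)
    (fun z w => (h.resMod_ipM Z z w).symm))

end Restrict

/-! ## Realization as a functor -/

section Functor

variable {X Y : LocMod I.qSystem}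

/-- The underlying morphism of a module map. -/
noncomputable def homB (f : X ⟶ Y) : X.X ⟶ Y.X := LocMod.Hom.hom f

lemma homB_rho (f : X ⟶ Y) (x : X.X) (q : M.El) :
    map (homB f) ((ract X).rho x q) = (ract Y).rho (map (homB f) x) q := by
  have h1 : (ract X).act ≫ homB f = homB f ▷ I.bim ≫ (ract Y).act := LocMod.Hom.comm f
  have h2 := congrArg (fun g => map g (tm x (I.toBim q))) h1
  have e : map (homB f ▷ I.bim ≫ (ract Y).act) (tm x (I.toBim q)) =
    (ract Y).rho (map (homB f) x) q := by rw [map_comp, whiskerRight_tm]; rfl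
  exact h2.trans e

lemma Comm.homB_lam (h : I.Comm) (f : X ⟶ Y) (q : M.El) (x : X.X) :
    map (homB f) (lam X q x) = lam Y q (map (homB f) x) := by
  have h1 : (ract X).act ≫ homB f = homB f ▷ I.bim ≫ (ract Y).act := LocMod.Hom.comm f
  have h2 := braid_naturality h.mem.1 h.mem.1 X.mem.2.1 Y.mem.2.1 (𝟙 I.bim) (homB f)
  have h3 : (braid I.bim X.X ≫ (ract X).act) ≫ homB f =
      I.bim ◁ homB f ≫ braid I.bim Y.X ≫ (ract Y).act := by
    rw [Category.assoc, h1, ← MonoidalCategory.id_tensorHom, ← Category.assoc (𝟙 _ ⊗ₘ _), h2,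
      Category.assoc, MonoidalCategory.tensorHom_id]
  have h4 := congrArg (fun g => map g (tm (I.toBim q) x)) h3
  have e : map (I.bim ◁ homB f ≫ braid I.bim Y.X ≫ (ract Y).act) (tm (I.toBim q) x) =
    lam Y q (map (homB f) x) := by rw [map_comp, whiskerLeft_tm]; rfl
  exact h4.trans e

/-- The adjoint of a module map is again a module map, so it passes the factors c_j in the
definition of the M-valued inner product. -/
lemma ipM_homB (f : X ⟶ Y) (x : X.X) (y : Y.X) :
    (ract Y).ipM (map (homB f) x) y = (ract X).ipM x (map (dagger (homB f)) y) := by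
  rw [RAct.ipM, RAct.ipM]
  refine congrArg _ (Finset.sum_congr rfl fun j _ => ?_)
  have e : map (dagger (homB f)) ((ract Y).rho y (I.c j)) =
    (ract X).rho (map (dagger (homB f)) y) (I.c j) := homB_rho (LocMod.daggerHom f) y (I.c j)
  rw [ip_map, e]

variable (h : I.Comm)

/-- The realization of a module map. -/
noncomputable def realizeHom (f : X ⟶ Y) : realize h X ⟶ realize h Y where
  toFun := map (X := X.X) (Y := Y.X) (homB f)
  adj := map (X := Y.X) (Y := X.X) (dagger (homB f))
  map_l q x := h.homB_lam f q x
  map_ra x q := homB_rho f x q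
  adj_spec x y := ipM_homB f x y

/-- A bimodule map of realizations, as a morphism of the underlying bimodules. -/
noncomputable def unrealizeHom (g : realize h X ⟶ realize h Y) : X.X ⟶ Y.X where
  toFun := map (X := realize h X) (Y := realize h Y) g
  adj := map (X := realize h Y) (Y := realize h X) (dagger g)
  map_l a x := by
    rw [← h.lam_incl X, ← h.lam_incl Y]
    exact map_l g (S.incl a) x
  map_ra x a := by
    rw [← (ract X).rho_incl, ← (ract Y).rho_incl]
    exact map_ra g x (S.incl a)
  adj_spec x y := by
    rw [← (ract X).E_ipM, ← (ract Y).E_ipM]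
    exact congrArg _ (congrArg I.E (ip_map g x y))

lemma unrealizeHom_comm (g : realize h X ⟶ realize h Y) :
    (ract X).act ≫ unrealizeHom h g = unrealizeHom h g ▷ I.bim ≫ (ract Y).act :=
  tensor_ext fun x q => by
    have e : map (unrealizeHom h g ▷ I.bim ≫ (ract Y).act) (tm x q) =
      (ract Y).rho (map (unrealizeHom h g) x) (I.ofBim q) := by
        rw [map_comp, whiskerRight_tm]; rfl
    exact Eq.trans (map_ra g x (I.ofBim q)) e.symm

/-- Realization of local modules. -/
noncomputable def Comm.realization : LocMod I.qSystem ⥤ Chi M where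
  obj X := ⟨realize h X, h.chi_realize X⟩
  map f := ObjectProperty.homMk (realizeHom h f)
  map_id _ := rfl
  map_comp _ _ := rfl

/-- Realization is fully faithful. -/
noncomputable def Comm.fullyFaithful : h.realization.FullyFaithful where
  preimage g := ⟨unrealizeHom h g.hom, unrealizeHom_comm h g.hom⟩
  map_preimage _ := rfl
  preimage_map _ := rfl

instance : h.realization.Full := h.fullyFaithful.full

instance : h.realization.Faithful := h.fullyFaithful.faithful

instance : h.realization.EssSurj := ⟨fun Z => ⟨h.resMod Z, ⟨h.realizeIso Z⟩⟩⟩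

/-- The inverse was constructed as the dagger, so the inverse laws are the unitarity relations. -/
lemma Comm.isUnitaryHom_realizeIso (Z : Chi M) : IsUnitaryHom (h.realizeIso Z).hom :=
  ⟨(h.realizeIso Z).hom_inv_id, (h.realizeIso Z).inv_hom_id⟩

end Functor

end FiniteIndex
end LocalExt

namespace LocalExt

variable {H : Type u} [NormedAddCommGroup H] [InnerProductSpace ℂ H] [CompleteSpace H]

namespace FiniteIndex

variable {M : IIOneFactor H} {S : Subfactor M} {I : FiniteIndex S}

/-! ## The quotient maps `X ⊠_N Y → X ⊠_M Y` -/

section Quot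

variable (h : I.Comm) (X Y : LocMod I.qSystem)

/-- The tensor product of the realizations. -/
noncomputable abbrev tensorM : Bim M := tensor (realize h X) (realize h Y)

/-- The simple tensor `x ⊠_M y`. -/
noncomputable def tmM (x : X.X) (y : Y.X) : tensorM h X Y :=
  tm (X := realize h X) (Y := realize h Y) x y

/-- The map `(x, y) ↦ x ⊠_M y`. -/
noncomputable def quotFun : X.X →ₗ[ℂ] Y.X →ₗ[ℂ] I.res (tensorM h X Y) := LinearMap.mk₂ ℂ
  (tmM h X Y) (fun _ _ _ => add_tm (X := realize h X) (Y := realize h Y) _ _ _)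
  (fun _ _ _ => smul_tm (X := realize h X) (Y := realize h Y) _ _ _)
  (fun _ _ _ => tm_add (X := realize h X) (Y := realize h Y) _ _ _)
  (fun _ _ _ => tm_smul (X := realize h X) (Y := realize h Y) _ _ _)

lemma tmM_rho (x : X.X) (q : M.El) (y : Y.X) :
    tmM h X Y ((ract X).rho x q) y = tmM h X Y x (lam Y q y) :=
  ra_tm (X := realize h X) (Y := realize h Y) x q y

lemma l_tmM (q : M.El) (x : X.X) (y : Y.X) :
    (tensorM h X Y).l q (tmM h X Y x y) = tmM h X Y (lam X q x) y :=
  tensor_l (X := realize h X) (Y := realize h Y) q x y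

lemma ra_tmM (x : X.X) (y : Y.X) (q : M.El) :
    (tensorM h X Y).ra (tmM h X Y x y) q = tmM h X Y x ((ract Y).rho y q) :=
  tensor_ra (X := realize h X) (Y := realize h Y) q x y

lemma ip_tmM (x x' : X.X) (y y' : Y.X) :
    (tensorM h X Y).ip (tmM h X Y x y) (tmM h X Y x' y') =
      (ract Y).ipM y (lam Y ((ract X).ipM x x') y') :=
  tensor_ip (X := realize h X) (Y := realize h Y) x x' y y'

lemma quotFun_ra (x : X.X) (a : S.toFactor.El) (y : Y.X) :
    quotFun h X Y (X.X.ra x a) y = quotFun h X Y x (Y.X.l a y) := by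
  change tmM h X Y _ _ = tmM h X Y _ _
  rw [← (ract X).rho_incl, tmM_rho, h.lam_incl]

/-- The quotient map `X ⊠_N Y → X ⊠_M Y`. -/
noncomputable def quot : tensor X.X Y.X ⟶ I.res (tensorM h X Y) :=
  mkHom (lift (quotFun h X Y) (quotFun_ra h X Y))
    (fun a => tensor_l_ext (Z := I.res (tensorM h X Y)) _ a fun x y => by
      rw [lift_tm, lift_tm, ← h.lam_incl X]
      exact (l_tmM h X Y (S.incl a) x y).symm)
    (fun t a => tensor_ra_ext (Z := I.res (tensorM h X Y)) _ a (fun x y => by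
      rw [lift_tm, lift_tm, ← (ract Y).rho_incl]
      exact (ra_tmM h X Y x y (S.incl a)).symm) t)

lemma quot_tm (x : X.X) (y : Y.X) : map (quot h X Y) (tm x y) = tmM h X Y x y :=
  lift_tm (quotFun h X Y) (quotFun_ra h X Y) x y

lemma tensorM_induction {p : tensorM h X Y → Prop} (z : tensorM h X Y) (h0 : p 0)
    (h1 : ∀ x y, p (tmM h X Y x y)) (h2 : ∀ z w, p z → p w → p (z + w)) : p z :=
  tensor_induction z h0 h1 h2

/-- Over N, x' ⊠_M y' and x ⊠_M y have inner product ⟨y' | ⟨x'|x⟩_M y⟩_N. Inserting the sum over c_j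
that defines ⟨x'|x⟩_M reads off the adjoint. -/
lemma dagger_quot (x : X.X) (y : Y.X) : map (dagger (quot h X Y)) (tmM h X Y x y) =
    (I.index : ℂ)⁻¹ • ∑ j, tm ((ract X).rho x (I.c j)) (lam Y (star (I.c j)) y) := by
  refine (tensor X.X Y.X).ext_ip fun t => ?_
  rw [← ip_map]
  induction t using tensor_induction with
  | h0 => rw [map_zero, ← Bim.star_ip, ← Bim.star_ip (tensor X.X Y.X), Bim.ip_zero, Bim.ip_zero]
  | h2 t s ht hs => rw [map_add, Bim.ip_add_left, Bim.ip_add_left, ht, hs]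
  | h1 x' y' =>
    have e1 : (I.res (tensorM h X Y)).ip (map (quot h X Y) (tm x' y')) (tmM h X Y x y) =
        Y.X.ip y' (lam Y ((ract X).ipM x' x) y) := by
      rw [quot_tm, I.res_ip, ip_tmM, RAct.E_ipM]
    rw [e1, Bim.ip_smul, Bim.ip_sum, RAct.ipM]
    simp only [map_smul, map_sum, LinearMap.smul_apply, LinearMap.sum_apply, Bim.ip_smul,
      Bim.ip_sum, tensor_ip]
    refine congrArg _ (Finset.sum_congr rfl fun j _ => ?_)
    rw [h.lam_mul, h.lam_incl]

/-- Over M the factor c_j* passes to the left tensor factor, and ∑ c_j c_j* = [M : N]. -/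
lemma quot_coisometry : dagger (quot h X Y) ≫ quot h X Y = 𝟙 _ := hom_ext fun z => by
  rw [map_comp, Bim.map_id]
  induction z using tensorM_induction with
  | h0 => rw [map_zero, map_zero]
  | h2 z w hz hw => rw [map_add, map_add, hz, hw]
  | h1 x y =>
    rw [dagger_quot, map_smul, map_sum]
    have e0 : ∀ j, map (quot h X Y) (tm ((ract X).rho x (I.c j)) (lam Y (star (I.c j)) y)) =
        tmM h X Y ((ract X).rho x (I.c j * star (I.c j))) y := fun j => by
      rw [quot_tm, ← tmM_rho, RAct.rho_rho]
    have e : ∑ j, tmM h X Y ((ract X).rho x (I.c j * star (I.c j))) y =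
        (I.index : ℂ) • tmM h X Y x y := by
      have := congrArg (fun q => quotFun h X Y ((ract X).rho x q) y) I.sum_eq
      simp only [map_sum, LinearMap.sum_apply, map_smul, LinearMap.smul_apply, RAct.rho_one] at this
      exact this
    rw [Finset.sum_congr rfl fun j _ => e0 j]
    exact (congrArg _ e).trans (inv_smul_smul₀ I.index_ne _)

/-- The *-property of λ moves q to q* y, and `expand'` writes q* = ∑ E(q* c_j) c_j*. -/
lemma Comm.dagger_lact (h : I.Comm) (y : Y.X) : map (dagger (lact Y)) y =
    (I.index : ℂ)⁻¹ • ∑ j, tm (I.toBim (I.c j)) (lam Y (star (I.c j)) y) := by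
  refine (tensor I.bim Y.X).ext_ip fun t => ?_
  rw [← ip_map]
  induction t using tensor_induction with
  | h0 => rw [map_zero, ← Bim.star_ip, ← Bim.star_ip (tensor I.bim Y.X), Bim.ip_zero, Bim.ip_zero]
  | h2 t s ht hs => rw [map_add, Bim.ip_add_left, Bim.ip_add_left, ht, hs]
  | h1 q y' =>
    have e1 : Y.X.ip (map (lact Y) (tm q y')) y = Y.X.ip y' (lam Y (star (I.ofBim q)) y) := by
      have := h.ip_lam Y y' (star (I.ofBim q)) y
      rw [star_star] at this
      exact this.symm
    rw [e1, Bim.ip_smul, Bim.ip_sum]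
    simp only [tensor_ip, bim_ip, ofBim_toBim]
    have e2 : ∀ j, Y.X.ip y' (Y.X.l ((I.index : ℂ) • I.E (star (I.ofBim q) * I.c j))
        (lam Y (star (I.c j)) y)) = (I.index : ℂ) • Y.X.ip y'
          (lam Y (S.incl (I.E (star (I.ofBim q) * I.c j)) * star (I.c j)) y) := fun j => by
      rw [map_smul, LinearMap.smul_apply, Bim.ip_smul, lam_l]
    rw [Finset.sum_congr rfl fun j _ => e2 j, ← Finset.smul_sum, ← Bim.ip_sum,
      ← LinearMap.sum_apply, ← map_sum, I.expand', inv_smul_smul₀ I.index_ne]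

lemma quot_projection : quot h X Y ≫ dagger (quot h X Y) =
    X.X ◁ dagger (lact Y) ≫ (α_ X.X I.bim Y.X).inv ≫ (ract X).act ▷ Y.X :=
  tensor_ext fun x y => by
    have e1 : map (quot h X Y ≫ dagger (quot h X Y)) (tm x y) = (I.index : ℂ)⁻¹ • ∑ j,
        tm ((ract X).rho x (I.c j)) (lam Y (star (I.c j)) y) := by
      rw [map_comp, quot_tm, dagger_quot]
    have e2 : map (X.X ◁ dagger (lact Y) ≫ (α_ X.X I.bim Y.X).inv ≫ (ract X).act ▷ Y.X) (tm x y) =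
        (I.index : ℂ)⁻¹ • ∑ j, tm ((ract X).rho x (I.c j)) (lam Y (star (I.c j)) y) := by
      rw [map_comp, map_comp, whiskerLeft_tm, h.dagger_lact, tm_smul, tm_sum, map_smul, map_smul,
        map_sum, map_sum]
      refine congrArg _ (Finset.sum_congr rfl fun j _ => ?_)
      rw [associator_inv_tm, whiskerRight_tm]; rfl
    exact e1.trans e2.symm

/-- The braiding of the realizations. -/
noncomputable def braidM : tensorM h X Y ⟶ tensorM h Y X := braid (realize h X) (realize h Y)

/-- The braidings over `N` and over `M` are compatible. -/
lemma braid_quot (z : tensor X.X Y.X) :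
    map (quot h Y X) (map (braid X.X Y.X) z) =
      map (braidM h X Y) (map (quot h X Y) z) := by
  obtain ⟨m, b, hb⟩ := X.mem.1
  let T : tensor X.X Y.X →ₗ[ℂ] I.res (tensorM h Y X) :=
    (map (braidM h X Y) : tensorM h X Y →ₗ[ℂ] tensorM h Y X) ∘ₗ
      (map (quot h X Y) : tensor X.X Y.X →ₗ[ℂ] tensorM h X Y)
  have hT : RLin T := fun t a => by
    change map (braidM h X Y) (map (quot h X Y) _) = _
    rw [map_ra]
    exact map_ra (braidM h X Y) _ (S.incl a)
  -- An N-central sequence of X is M-central because X is local, so both braidings are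
  -- asymptotically the flip on x_n ⊠ y, and the quotient maps intertwine the flips.
  have key : map (braid X.X Y.X ≫ quot h Y X) = T := by
    refine hb.ext (RLin.map _) hT fun x hx y => ?_
    have h1 := (br_braid X.mem.1 Y.mem.2.1 x hx y).map (RLin.map (quot h Y X))
    have h2 := br_braid (approxInner_realize h X) (centrallyTrivial_realize h Y) x
      (centralVec_realize h X hx) y
    refine null_congr (h1.sub (I.null_res.2 h2)) fun n => ?_
    have e : T (tm (x n) y) = map (braidM h X Y) (tmM h X Y (x n) y) :=
      congrArg (map (braidM h X Y)) (quot_tm h X Y _ _)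
    rw [map_sub, map_comp, e, quot_tm]
    exact sub_sub_sub_cancel_right _ _ _
  exact LinearMap.congr_fun key z

end Quot

end FiniteIndex
end LocalExt

namespace LocalExt

variable {H : Type u} [NormedAddCommGroup H] [InnerProductSpace ℂ H] [CompleteSpace H]

namespace FiniteIndex

variable {M : IIOneFactor H} {S : Subfactor M} {I : FiniteIndex S}

/-! ## The tensor product of local modules -/

section Structure

attribute [local instance] chiBraiding

/-- The tensor product of local modules. -/
@[reducible] noncomputable def Comm.monoidal (h : I.Comm) : MonoidalCategory (LocMod I.qSystem) :=
  -- X ⊗_Q Y is the restriction of |X| ⊠_M |Y|, and the coherence isomorphisms are those of χ̃(M)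
  -- transported along realization.
  liftMonoidal h.realization h.resMod h.realizeIso

/-- The braiding of local modules. -/
@[reducible] noncomputable def Comm.braided (h : I.Comm) :
    letI := h.monoidal
    BraidedCategory (LocMod I.qSystem) :=
  liftBraided h.realization h.resMod h.realizeIso

/-- Realization is a braided functor. -/
@[reducible] noncomputable def Comm.realizationBraided (h : I.Comm) :
    letI := h.monoidal
    letI := h.braided
    h.realization.Braided :=
  liftFunctorBraided h.realization h.resMod h.realizeIso

variable (h : I.Comm) (X Y Z : LocMod I.qSystem)

variable {X Y} in
lemma map_preimage (g : h.realization.obj X ⟶ h.realization.obj Y) (x : realize h X) :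
    map (homB (h.realization.preimage g)) x = map g.hom x :=
  congrArg (fun k : h.realization.obj X ⟶ h.realization.obj Y => map k.hom x)
    (h.realization.map_preimage g)

/-- Transported structure morphisms are preimages under realization, and the comparison isomorphisms
act as the identity on vectors, so on simple tensors over M the usual formulas hold. This and its
companions are the input for the lax structure. -/
lemma whiskerRight_tmM {X' : LocMod I.qSystem} (f : X ⟶ X') (x : X.X) (y : Y.X) :
    letI := h.monoidal
    map (homB (f ▷ Y)) (tmM h X Y x y) = tmM h X' Y (map (homB f) x) y :=
  (map_preimage h _ _).trans
    (whiskerRight_tm (X := realize h X) (Y := realize h Y) (realizeHom h f) x y)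

lemma whiskerLeft_tmM {Y' : LocMod I.qSystem} (f : Y ⟶ Y') (x : X.X) (y : Y.X) :
    letI := h.monoidal
    map (homB (X ◁ f)) (tmM h X Y x y) = tmM h X Y' x (map (homB f) y) :=
  (map_preimage h _ _).trans
    (whiskerLeft_tm (X := realize h X) (Y := realize h Y) (realizeHom h f) x y)

/-- The identification of the realization of `X ⊗_Q Y`. -/
noncomputable def compM : realize h (h.resMod (h.realization.obj X ⊗ h.realization.obj Y)) ≅
    tensorM h X Y :=
  (chi M).ι.mapIso (h.realizeIso (h.realization.obj X ⊗ h.realization.obj Y))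

lemma associator_tmM (x : X.X) (y : Y.X) (z : Z.X) :
    letI := h.monoidal
    map (homB (α_ X Y Z).hom) (tmM h (X ⊗ Y) Z (tmM h X Y x y) z) =
      tmM h X (Y ⊗ Z) x (tmM h Y Z y z) := by
  let _ := h.monoidal
  refine (map_preimage h _ _).trans ?_
  have e1 : map (Bim.tensorMap (compM h X Y).hom (𝟙 (realize h Z)))
      (tmM h (X ⊗ Y) Z (tmM h X Y x y) z) =
      tm (X := tensorM h X Y) (Y := realize h Z) (tmM h X Y x y) z := tensorMap_tm _ _ _ _
  have e2 := associator_tm (X := realize h X) (Y := realize h Y) (Z := realize h Z) x y z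
  have e3 : map (Bim.tensorMap (𝟙 (realize h X)) (compM h Y Z).inv)
      (tm (X := realize h X) (Y := tensorM h Y Z) x (tmM h Y Z y z)) =
      tmM h X (Y ⊗ Z) x (tmM h Y Z y z) := tensorMap_tm _ _ _ _
  exact (congrArg (fun t => map (Bim.tensorMap (𝟙 (realize h X)) (compM h Y Z).inv)
    (map (α_ (realize h X) (realize h Y) (realize h Z)).hom t)) e1).trans
    ((congrArg (map (Bim.tensorMap (𝟙 (realize h X)) (compM h Y Z).inv)) e2).trans e3)

lemma leftUnitor_tmM (q : M.El) (x : X.X) :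
    letI := h.monoidal
    map (homB (λ_ X).hom) (tmM h (𝟙_ _) X (toUnit q) x) = lam X q x := by
  let _ := h.monoidal
  refine (map_preimage h _ _).trans ?_
  have e1 : map (Bim.tensorMap ((chi M).ι.mapIso (h.realizeIso (𝟙_ (Chi M)))).hom
      (𝟙 (realize h X))) (tmM h (𝟙_ _) X (toUnit q) x) =
      tm (X := unit M) (Y := realize h X) (toUnit q) x := tensorMap_tm _ _ _ _
  refine Eq.trans ?_ (leftUnitor_tm (X := realize h X) (toUnit q) x)
  exact congrArg (map (λ_ (realize h X)).hom) e1

lemma rightUnitor_tmM (q : M.El) (x : X.X) :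
    letI := h.monoidal
    map (homB (ρ_ X).hom) (tmM h X (𝟙_ _) x (toUnit q)) = (ract X).rho x q := by
  let _ := h.monoidal
  refine (map_preimage h _ _).trans ?_
  have e1 : map (Bim.tensorMap (𝟙 (realize h X))
      ((chi M).ι.mapIso (h.realizeIso (𝟙_ (Chi M)))).hom) (tmM h X (𝟙_ _) x (toUnit q)) =
      tm (X := realize h X) (Y := unit M) x (toUnit q) := tensorMap_tm _ _ _ _
  refine Eq.trans ?_ (rightUnitor_tm (X := realize h X) x (toUnit q))
  exact congrArg (map (ρ_ (realize h X)).hom) e1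

lemma braiding_quot (t : tensor X.X Y.X) :
    letI := h.monoidal
    letI := h.braided
    map (homB (β_ X Y).hom) (map (quot h X Y) t) = map (quot h Y X) (map (braid X.X Y.X) t) := by
  refine Eq.trans ?_ (braid_quot h X Y t).symm
  exact map_preimage h _ _

/-- The inclusion `N → M`, as a map into the unit object. -/
noncomputable def unitMap : unit S.toFactor ⟶ I.res (unit M) := I.one

/-- The quotient maps, as a lax braided structure on the forgetful functor. -/
@[reducible] noncomputable def Comm.laxBraided :
    letI := h.monoidal
    letI := h.braided
    (LocMod.forget I.qSystem).LaxBraided :=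
  letI := h.monoidal
  letI := h.braided
  { ε := ObjectProperty.homMk I.one
    μ := fun X Y => ObjectProperty.homMk (quot h X Y)
    μ_natural_left := fun {X X'} f Y => ObjectProperty.hom_ext _ (tensor_ext fun (x : X.X) (y : Y.X) => by
      have e1 : map (homB f ▷ Y.X ≫ quot h X' Y) (tm x y) = tmM h X' Y (map (homB f) x) y := by
        rw [map_comp, whiskerRight_tm, quot_tm]
      have e2 := congrArg (map (homB (f ▷ Y))) (quot_tm h X Y x y)
      exact e1.trans (e2.trans (whiskerRight_tmM h X Y f x y)).symm)
    μ_natural_right := fun {Y Y'} X f => ObjectProperty.hom_ext _ (tensor_ext fun (x : X.X) (y : Y.X) => by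
      have e1 : map (X.X ◁ homB f ≫ quot h X Y') (tm x y) = tmM h X Y' x (map (homB f) y) := by
        rw [map_comp, whiskerLeft_tm, quot_tm]
      have e2 := congrArg (map (homB (X ◁ f))) (quot_tm h X Y x y)
      exact e1.trans (e2.trans (whiskerLeft_tmM h X Y f x y)).symm)
    associativity := fun X Y Z => ObjectProperty.hom_ext _ (tensor_ext₃
      fun (x : X.X) (y : Y.X) (z : Z.X) => by
      have e1 : map (quot h X Y ▷ Z.X) (tm (tm x y) z) =
          tm (X := (X ⊗ Y).X) (tmM h X Y x y) z := by
        rw [whiskerRight_tm, quot_tm]; rfl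
      have e2 := quot_tm h (X ⊗ Y) Z (tmM h X Y x y) z
      have e3 : map ((α_ X.X Y.X Z.X).hom ≫ X.X ◁ quot h Y Z) (tm (tm x y) z) =
          tm (Y := (Y ⊗ Z).X) x (tmM h Y Z y z) := by
        rw [map_comp, associator_tm, whiskerLeft_tm, quot_tm]; rfl
      have e4 := quot_tm h X (Y ⊗ Z) x (tmM h Y Z y z)
      have e5 := (congrArg (map (quot h (X ⊗ Y) Z)) e1).trans e2
      have e6 := (congrArg (map (quot h X (Y ⊗ Z))) e3).trans e4
      exact ((congrArg (map (homB (α_ X Y Z).hom)) e5).trans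
        (associator_tmM h X Y Z x y z)).trans e6.symm)
    left_unitality := fun X => ObjectProperty.hom_ext _ (tensor_ext fun a x => by
      have e1 : map (unitMap (I := I) ▷ X.X) (tm a x) =
          tm (X := (𝟙_ (LocMod I.qSystem)).X) (toUnit (S.incl (ofUnit a))) x :=
        whiskerRight_tm _ _ _
      have e2 := (congrArg (map (quot h (𝟙_ _) X)) e1).trans
        (quot_tm h (𝟙_ _) X (toUnit (S.incl (ofUnit a))) x)
      have e3 := (congrArg (map (homB (λ_ X).hom)) e2).trans (leftUnitor_tmM h X _ x)
      exact ((leftUnitor_tm a x).trans (h.lam_incl X (ofUnit a) x).symm).trans e3.symm)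
    right_unitality := fun X => ObjectProperty.hom_ext _ (tensor_ext fun x a => by
      have e1 : map (X.X ◁ unitMap (I := I)) (tm x a) =
          tm (Y := (𝟙_ (LocMod I.qSystem)).X) x (toUnit (S.incl (ofUnit a))) :=
        whiskerLeft_tm _ _ _
      have e2 := (congrArg (map (quot h X (𝟙_ _))) e1).trans
        (quot_tm h X (𝟙_ _) x (toUnit (S.incl (ofUnit a))))
      have e3 := (congrArg (map (homB (ρ_ X).hom)) e2).trans (rightUnitor_tmM h X _ x)
      exact ((rightUnitor_tm x a).trans ((ract X).rho_incl x (ofUnit a)).symm).trans e3.symm)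
    braided := fun X Y => ObjectProperty.hom_ext _ (hom_ext fun t => braiding_quot h X Y t) }

/-- The identification of the unit object with `Q`. -/
noncomputable def unitIdent : I.res (unit M) ≅ I.bim :=
  unitaryIso (X := I.res (unit M)) (Y := I.bim) (LinearMap.id (R := ℂ) (M := M.El))
    (LinearMap.id (R := ℂ) (M := M.El)) (fun _ => rfl) (fun _ => rfl) (fun _ _ => rfl)
    (fun _ _ => rfl) (fun _ _ => rfl)

lemma resHom_unitIdent : I.resHom (unit M) ≫ (unitIdent (I := I)).hom =
    (unitIdent (I := I)).hom ▷ I.bim ≫ I.mul :=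
  tensor_ext fun x q => by
    have e : map ((unitIdent (I := I)).hom ▷ I.bim ≫ I.mul) (tm x q) =
        map I.mul (tm (map (unitIdent (I := I)).hom x) q) := by
      rw [map_comp, whiskerRight_tm]
    exact (resHom_tm (unit M) x (I.ofBim q)).trans (e.trans (I.mul_tm _ _)).symm

lemma quot_action : quot h X Y ▷ I.bim ≫ I.resHom (tensorM h X Y) =
    (α_ X.X Y.X I.bim).hom ≫ X.X ◁ (ract Y).act ≫ quot h X Y :=
  tensor_ext₃ fun x y q => by
    have e1 : map (quot h X Y ▷ I.bim ≫ I.resHom (tensorM h X Y)) (tm (tm x y) q) =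
        map (I.resHom (tensorM h X Y)) (tm (X := I.res (tensorM h X Y)) (tmM h X Y x y) q) := by
      rw [map_comp, whiskerRight_tm, quot_tm]
    have e2 : map ((α_ X.X Y.X I.bim).hom ≫ X.X ◁ (ract Y).act ≫ quot h X Y) (tm (tm x y) q) =
        tmM h X Y x ((ract Y).rho y (I.ofBim q)) := by
      rw [map_comp, map_comp, associator_tm, whiskerLeft_tm, quot_tm]; rfl
    exact e1.trans ((resHom_tm (tensorM h X Y) _ (I.ofBim q)).trans
      ((ra_tmM h X Y x y (I.ofBim q)).trans e2.symm))

/-- The relative tensor product of local modules. -/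
@[reducible] noncomputable def Comm.localTensor : LocalTensor I.qSystem :=
  letI := h.monoidal
  letI := h.braided
  letI := h.laxBraided
  { unitary := lift_unitary h.realization h.resMod h.realizeIso (chiBraiding M).unitary
      (fun _ => rfl) h.isUnitaryHom_realizeIso
    coisometry := quot_coisometry h
    projection := quot_projection h
    action := quot_action h
    unitEquiv := (unitIdent (I := I)).hom
    unit_unitary := ⟨(unitIdent (I := I)).hom_inv_id, (unitIdent (I := I)).inv_hom_id⟩
    unit_action := resHom_unitIdent
    unit_map := rfl }

/-- Contracting the explicit formula for ρ†(y) with x gives the defining sum of the M-valued inner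
product. -/
lemma ipM_eq_contract (x y : X.X) :
    (ract X).ipM x y = I.ofBim (contract x (map (dagger (ract X).act) y)) := by
  rw [(RAct.unitary_iff _).1 (unitary_ract X), map_smul, map_sum]
  simp only [contract_tm, bim_l, ofBim_toBim, map_smul, map_sum]
  rfl

/-- Realization is a braided unitary equivalence. -/
lemma Comm.isBraidedUnitaryEquivalence :
    let _ := h.localTensor
    let _ := h.realizationBraided
    IsBraidedUnitaryEquivalence h.realization := by
  let _ := h.localTensor
  let _ := h.realizationBraided
  exact
    { isEquivalence := {}
      map_dag := fun _ => rfl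
      unitary_μ := fun _ _ => (h.isUnitaryHom_realizeIso _).inv
      unitary_ε := (h.isUnitaryHom_realizeIso _).inv }

lemma Comm.isRealization :
    let _ := h.localTensor
    let _ := h.realizationBraided
    IsRealization I h.realization fun X => LinearEquiv.refl ℂ X.X := by
  let _ := h.localTensor
  let _ := h.realizationBraided
  exact
    { natural := fun _ _ => rfl
      right := fun _ _ _ => rfl
      left := fun _ _ _ => rfl
      inner := ipM_eq_contract
      tensorator := fun X Y x y => (quot_tm h X Y x y).symm
      unitor := (congrArg toUnit (map_one S.incl)).symm }

end Structure

end FiniteIndex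
end LocalExt

theorem theoremB {H : Type u} [NormedAddCommGroup H] [InnerProductSpace ℂ H] [CompleteSpace H]
    [TopologicalSpace.SeparableSpace H] (M : IIOneFactor H) (N : Subfactor M)
    (I : FiniteIndex N) (hQ : chi N.toFactor I.qSystem.X) (hcomm : I.qSystem.IsCommutative) :
    ∃ (_ : ChiBraiding N.toFactor) (_ : ChiBraiding M) (_ : LocalTensor I.qSystem)
      (F : LocMod I.qSystem ⥤ Chi M) (_ : F.Braided)
      (θ : ∀ X : LocMod I.qSystem, X.X ≃ₗ[ℂ] (F.obj X).obj),
      IsBraidedUnitaryEquivalence F ∧ IsRealization I F θ := by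
  have h : I.Comm := ⟨hQ, hcomm⟩
  -- The space |X| is X itself, so θ is the identity.
  exact ⟨chiBraiding N.toFactor, chiBraiding M, h.localTensor, h.realization,
    h.realizationBraided, fun X => LinearEquiv.refl ℂ X.X, h.isBraidedUnitaryEquivalence,
    h.isRealization⟩
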